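/- A \emph{cograph} is a finite simple undirected graph that arises from one-vertex graphs by finitely many disjoint unions and complementations. For a graph $G=(V,E)$ let $d_G(u,v)\in\mathbb{N}\cup\{\infty\}$ be the length of a shortest path between $u$ and $v$, with $d_G(u,v)=\infty$ if there is none. A set $R\subseteq V$ is \emph{resolving} for $G$ if for any two distinct vertices $u,v\in V$ there is a vertex $w\in R$ with $d_G(u,w)\neq d_G(v,w)$. It is a \emph{fault-tolerant resolving set} if $R$ is resolving and $R\setminus\{r\}$ is resolving for every $r\in R$. For vertex weights $c:V\to\mathbb{R}_{\ge 0}$ the weight of $R$ is $\sum_{v\in R}c(v)$, and the \emph{weighted fault-tolerant metric dimension} of $(G,c)$ is the least weight of a fault-tolerant resolving set for $G$. \textbf{Theorem.} There is an algorithm that, given any cograph $G=(V,E)$ (not necessarily connected) by adjacency lists and any vertex weights $c:V\to\mathbb{R}_{\ge 0}$, computes a fault-tolerant resolving set for $G$ of minimum weight and the weighted fault-tolerant metric dimension of $(G,c)$ in time $O(|V|+|E|)$. Time is counted in elementary operations of a random access machine which at unit cost reads and writes registers and array cells, increments, decrements and compares natural numbers, and copies, adds and compares weights. -/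

import Mathlib

/-! ## Cographs -/

/-- Cographs: a one-vertex graph is a cograph, the disjoint union of two cographs is a cograph,
and the complement of a cograph is a cograph. The last constructor says that the names of the
vertices are irrelevant. -/
inductive IsCograph : {V : Type} → SimpleGraph V → Prop
  | single : IsCograph (⊥ : SimpleGraph Unit)
  | union {V₁ V₂ : Type} {G₁ : SimpleGraph V₁} {G₂ : SimpleGraph V₂} :
      IsCograph G₁ → IsCograph G₂ → IsCograph (G₁.sum G₂)
  | compl {V : Type} {G : SimpleGraph V} : IsCograph G → IsCograph Gᶜ
  | ofIso {V W : Type} {G : SimpleGraph V} {H : SimpleGraph W} (e : G ≃g H) :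
      IsCograph G → IsCograph H

/-! ## Fault-tolerant resolving sets -/

/-- `R` is a resolving set: any two distinct vertices have different distances to some vertex of
`R`. Distances are extended: they are infinite between different connected components. -/
def IsResolvingSet {V : Type} (G : SimpleGraph V) (R : Finset V) : Prop :=
  ∀ u v : V, u ≠ v → ∃ w ∈ R, G.edist u w ≠ G.edist v w

/-- A resolving set that stays a resolving set when any one of its vertices is removed. -/
def IsFaultTolerantResolvingSet {V : Type} [DecidableEq V] (G : SimpleGraph V)
    (R : Finset V) : Prop :=
  IsResolvingSet G R ∧ ∀ r ∈ R, IsResolvingSet G (R.erase r)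

/-- The weight of a vertex set. -/
noncomputable def setWeight {V : Type} (c : V → NNReal) (R : Finset V) : NNReal :=
  ∑ v ∈ R, c v

/-- `R` is a fault-tolerant resolving set and none has smaller weight. -/
def IsMinWeightFaultTolerantResolvingSet {V : Type} [DecidableEq V] (G : SimpleGraph V)
    (c : V → NNReal) (R : Finset V) : Prop :=
  IsFaultTolerantResolvingSet G R ∧
    ∀ R' : Finset V, IsFaultTolerantResolvingSet G R' → ¬ setWeight c R' < setWeight c R

/-- `k` is the weighted fault-tolerant metric dimension: the least weight of a fault-tolerant
resolving set. -/
def IsWeightedFaultTolerantMetricDim {V : Type} [DecidableEq V] (G : SimpleGraph V)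
    (c : V → NNReal) (k : NNReal) : Prop :=
  IsLeast {w | ∃ R : Finset V, IsFaultTolerantResolvingSet G R ∧ setWeight c R = w} k

/-! ## The machine model

A random access machine, programmed in a structured language. It has registers and arrays that hold
natural numbers, and registers and arrays that hold non-negative real weights. A program is a
finite piece of syntax, so it names finitely many registers and arrays. On natural numbers the
machine can only count up and down, compare, and use a number as an array index; hence no number
ever exceeds the largest one in the input and the program by more than the number of steps. On
weights it can only add, compare and copy. Every such operation costs one step. -/

namespace RAM

/-- The memory: natural-number registers and arrays, weight registers and arrays. -/
structure State where
  reg : ℕ → ℕ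
  arr : ℕ → ℕ → ℕ
  wreg : ℕ → NNReal
  warr : ℕ → ℕ → NNReal

/-- Expressions for natural numbers. -/
inductive NatExpr where
  | const (k : ℕ)
  | reg (x : ℕ)
  | read (a : ℕ) (i : NatExpr)
  | succ (e : NatExpr)
  | pred (e : NatExpr)

/-- The value of an expression. -/
def NatExpr.eval (s : State) : NatExpr → ℕ
  | .const k => k
  | .reg x => s.reg x
  | .read a i => s.arr a (i.eval s)
  | .succ e => e.eval s + 1
  | .pred e => e.eval s - 1

/-- The number of operations in an expression. -/
def NatExpr.cost : NatExpr → ℕ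
  | .const _ => 1
  | .reg _ => 1
  | .read _ i => i.cost + 1
  | .succ e => e.cost + 1
  | .pred e => e.cost + 1

/-- Expressions for weights. -/
inductive WeightExpr where
  | zero
  | reg (x : ℕ)
  | read (a : ℕ) (i : NatExpr)
  | add (p q : WeightExpr)

/-- The value of a weight expression. -/
noncomputable def WeightExpr.eval (s : State) : WeightExpr → NNReal
  | .zero => 0
  | .reg x => s.wreg x
  | .read a i => s.warr a (i.eval s)
  | .add p q => p.eval s + q.eval s

/-- The number of operations in a weight expression. -/
def WeightExpr.cost : WeightExpr → ℕ
  | .zero => 1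
  | .reg _ => 1
  | .read _ i => i.cost + 1
  | .add p q => p.cost + q.cost + 1

/-- Conditions for branching. -/
inductive Test where
  | eq (e f : NatExpr)
  | lt (e f : NatExpr)
  | wle (p q : WeightExpr)
  | not (b : Test)
  | and (b d : Test)

/-- The truth of a condition. -/
def Test.holds (s : State) : Test → Prop
  | .eq e f => e.eval s = f.eval s
  | .lt e f => e.eval s < f.eval s
  | .wle p q => p.eval s ≤ q.eval s
  | .not b => ¬ b.holds s
  | .and b d => b.holds s ∧ d.holds s

/-- The number of operations in a condition. -/
def Test.cost : Test → ℕ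
  | .eq e f => e.cost + f.cost + 1
  | .lt e f => e.cost + f.cost + 1
  | .wle p q => p.cost + q.cost + 1
  | .not b => b.cost + 1
  | .and b d => b.cost + d.cost + 1

/-- Programs. -/
inductive Program where
  | skip
  | setReg (x : ℕ) (e : NatExpr)
  | setArr (a : ℕ) (i e : NatExpr)
  | setWReg (x : ℕ) (p : WeightExpr)
  | setWArr (a : ℕ) (i : NatExpr) (p : WeightExpr)
  | seq (P Q : Program)
  | ite (b : Test) (P Q : Program)
  | loop (b : Test) (P : Program)

/-- Assignment to a natural-number register. -/
def State.setReg (s : State) (x v : ℕ) : State :=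
  { s with reg := Function.update s.reg x v }

/-- Assignment to an entry of a natural-number array. -/
def State.setArr (s : State) (a i v : ℕ) : State :=
  { s with arr := Function.update s.arr a (Function.update (s.arr a) i v) }

/-- Assignment to a weight register. -/
def State.setWReg (s : State) (x : ℕ) (w : NNReal) : State :=
  { s with wreg := Function.update s.wreg x w }

/-- Assignment to an entry of a weight array. -/
def State.setWArr (s : State) (a i : ℕ) (w : NNReal) : State :=
  { s with warr := Function.update s.warr a (Function.update (s.warr a) i w) }

/-- `Runs P s s' t`: the program `P`, started in state `s`, halts in state `s'` after exactly `t`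
steps. The language is deterministic. `loop b P` repeats `P` while `b` holds. -/
inductive Runs : Program → State → State → ℕ → Prop
  | skip (s : State) : Runs .skip s s 1
  | setReg (s : State) (x : ℕ) (e : NatExpr) :
      Runs (.setReg x e) s (s.setReg x (e.eval s)) (e.cost + 1)
  | setArr (s : State) (a : ℕ) (i e : NatExpr) :
      Runs (.setArr a i e) s (s.setArr a (i.eval s) (e.eval s)) (i.cost + e.cost + 1)
  | setWReg (s : State) (x : ℕ) (p : WeightExpr) :
      Runs (.setWReg x p) s (s.setWReg x (p.eval s)) (p.cost + 1)
  | setWArr (s : State) (a : ℕ) (i : NatExpr) (p : WeightExpr) :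
      Runs (.setWArr a i p) s (s.setWArr a (i.eval s) (p.eval s)) (i.cost + p.cost + 1)
  | seq {P Q : Program} {s s₁ s₂ : State} {t₁ t₂ : ℕ} :
      Runs P s s₁ t₁ → Runs Q s₁ s₂ t₂ → Runs (.seq P Q) s s₂ (t₁ + t₂)
  | iteTrue {b : Test} {P Q : Program} {s s₁ : State} {t : ℕ} :
      b.holds s → Runs P s s₁ t → Runs (.ite b P Q) s s₁ (b.cost + 1 + t)
  | iteFalse {b : Test} {P Q : Program} {s s₁ : State} {t : ℕ} :
      ¬ b.holds s → Runs Q s s₁ t → Runs (.ite b P Q) s s₁ (b.cost + 1 + t)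
  | loopDone {b : Test} {P : Program} {s : State} :
      ¬ b.holds s → Runs (.loop b P) s s (b.cost + 1)
  | loopStep {b : Test} {P : Program} {s s₁ s₂ : State} {t₁ t₂ : ℕ} :
      b.holds s → Runs P s s₁ t₁ → Runs (.loop b P) s₁ s₂ t₂ →
        Runs (.loop b P) s s₂ (b.cost + 1 + t₁ + t₂)

end RAM

/-! ## Input and output -/

/-- `adj v` lists the neighbours of `v`, each exactly once, in any order. -/
def IsAdjacencyList {n : ℕ} (G : SimpleGraph (Fin n)) (adj : Fin n → List (Fin n)) : Prop :=
  ∀ v, (adj v).Nodup ∧ ∀ w, w ∈ adj v ↔ G.Adj v w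

/-- The initial memory. Register `0` holds the number `n` of vertices. Array `1` holds the
adjacency lists of the vertices `0, …, n - 1`, one after the other; the list of `v` starts at
position `arr 0 v` and ends before position `arr 0 (v + 1)`. Weight array `0` holds the weights of
the vertices. Everything else is zero. -/
noncomputable def inputState {n : ℕ} (adj : Fin n → List (Fin n)) (c : Fin n → NNReal) :
    RAM.State where
  reg x := if x = 0 then n else 0
  arr a i :=
    if a = 0 then (if i ≤ n then ((List.ofFn adj).take i).flatten.length else 0)
    else if a = 1 then ((List.ofFn adj).flatten.map Fin.val).getD i 0
    else 0
  wreg _ := 0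
  warr a i := if a = 0 then (if h : i < n then c ⟨i, h⟩ else 0) else 0

/-- The vertex set that a final memory describes: array `2` is its indicator function. -/
def outputSet (n : ℕ) (s : RAM.State) : Finset (Fin n) :=
  Finset.univ.filter fun v => s.arr 2 v = 1

/-- The weight that a final memory describes: weight register `0`. -/
def outputWeight (s : RAM.State) : NNReal := s.wreg 0

/-! ### Reasoning about programs: execution without loops, frame conditions, loop rules -/

namespace RAM

/-! A cograph has a cotree. Its leaves are the vertices, its inner nodes are parallel or series, and
two vertices are adjacent iff the node at which their paths to the root meet is series. Along every
path the labels can be made to alternate. It follows that distances inside a component are at most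
`2`, so whether `w` resolves `u` and `v` depends only on equality, adjacency and lying in the same
component (`IsComponentRel.edist_eq`, `IsComponentRel.resolves_iff`). Moreover `R` is fault-tolerant
iff every pair is resolved by two members of `R` (`isFaultTolerantResolvingSet_iff`).

Dynamic program. Vertices outside the leaf set of a node see all its leaves alike, so pairs below a
node must be resolved from below that node. Let `u` and `v` lie below different children of a node.
At a parallel node of a connected part they are resolved by the selected closed neighbours of `u`
and of `v` on their own sides. At a series node the selected non-neighbours do it, and at a parallel
root all selected vertices of the two components. The least such counts, capped at `2`, and the
capped number of selected vertices form one of `27` states, and the state of a union is a function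
of the states of its parts (`localState_union`, `topState_union`). Since weights add up over
disjoint parts, it suffices to keep, for every node and state, the least weight and the pair of
states it comes from (`Tables.step`). An optimal selection is read off by tracing these pairs back
(`runs_traceBack`).

Cotree. The vertices are inserted one at a time. A node is full if the new vertex is adjacent to
everything below it, and a candidate is a non-full node with a full child. Because there is no
induced path on four vertices (`IsCograph.p4Free`), the children of a lowest candidate `u` are full
or see nothing of the new vertex (`Cotree.children_homogeneous`), and outside `u` the new vertex
looks like the vertices below `u` (`Cotree.mixed_outside`). So the new vertex is combined with one
part of `u` only: with the full children at a series node if `u` is parallel, with the other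
children at a parallel node if `u` is series. "Lowest" only needs to exclude candidates among
children and grandchildren, which can be tested by marking parents and grandparents.

Running time. Every inner node has two children, so there are at most twice as many full nodes as
earlier neighbours of the new vertex (`Cotree.card_fullNodes_le`), and they are found by counting
full children upwards. Counters, flags and marks carry the number of the insertion as a stamp and
need no reset. The only search that is not bounded by the degree is the search for the single
non-full child of a series node. It deletes the entries it passes, and the total length of all lists
of children is the potential that pays for it (`runs_findChild`, `runs_insertVertex`). Finally, if
all vertices are treated as neighbours, the same counting lists all nodes with children before
parents (`runs_listNodes`), which is the order that the dynamic program needs. -/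

@[simp] theorem State.setReg_reg (s : State) (x v y : ℕ) :
    (s.setReg x v).reg y = if y = x then v else s.reg y := by
  simp [State.setReg, Function.update_apply]
@[simp] theorem State.setReg_arr (s : State) (x v : ℕ) : (s.setReg x v).arr = s.arr := rfl
@[simp] theorem State.setReg_wreg (s : State) (x v : ℕ) : (s.setReg x v).wreg = s.wreg := rfl
@[simp] theorem State.setReg_warr (s : State) (x v : ℕ) : (s.setReg x v).warr = s.warr := rfl
@[simp] theorem State.setArr_reg (s : State) (a i v : ℕ) : (s.setArr a i v).reg = s.reg := rfl
@[simp] theorem State.setArr_arr (s : State) (a i v b : ℕ) :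
    (s.setArr a i v).arr b = if b = a then Function.update (s.arr a) i v else s.arr b := by
  simp [State.setArr, Function.update_apply]
@[simp] theorem State.setArr_wreg (s : State) (a i v : ℕ) : (s.setArr a i v).wreg = s.wreg := rfl
@[simp] theorem State.setArr_warr (s : State) (a i v : ℕ) : (s.setArr a i v).warr = s.warr := rfl
@[simp] theorem State.setWReg_reg (s : State) (x : ℕ) (w : NNReal) :
    (s.setWReg x w).reg = s.reg := rfl
@[simp] theorem State.setWReg_arr (s : State) (x : ℕ) (w : NNReal) :
    (s.setWReg x w).arr = s.arr := rfl
@[simp] theorem State.setWReg_wreg (s : State) (x : ℕ) (w : NNReal) (y : ℕ) :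
    (s.setWReg x w).wreg y = if y = x then w else s.wreg y := by
  simp [State.setWReg, Function.update_apply]
@[simp] theorem State.setWReg_warr (s : State) (x : ℕ) (w : NNReal) :
    (s.setWReg x w).warr = s.warr := rfl
@[simp] theorem State.setWArr_reg (s : State) (a i : ℕ) (w : NNReal) :
    (s.setWArr a i w).reg = s.reg := rfl
@[simp] theorem State.setWArr_arr (s : State) (a i : ℕ) (w : NNReal) :
    (s.setWArr a i w).arr = s.arr := rfl
@[simp] theorem State.setWArr_wreg (s : State) (a i : ℕ) (w : NNReal) :
    (s.setWArr a i w).wreg = s.wreg := rfl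
@[simp] theorem State.setWArr_warr (s : State) (a i : ℕ) (w : NNReal) (b : ℕ) :
    (s.setWArr a i w).warr b = if b = a then Function.update (s.warr a) i w else s.warr b := by
  simp [State.setWArr, Function.update_apply]

/-- Programs without loops. -/
def Program.loopFree : Program → Bool
  | .seq P Q => P.loopFree && Q.loopFree
  | .ite _ P Q => P.loopFree && Q.loopFree
  | .loop _ _ => false
  | _ => true

/-- A bound for the running time of a program without loops. -/
def Program.bound : Program → ℕ
  | .skip => 1
  | .setReg _ e => e.cost + 1
  | .setArr _ i e => i.cost + e.cost + 1
  | .setWReg _ p => p.cost + 1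
  | .setWArr _ i p => i.cost + p.cost + 1
  | .seq P Q => P.bound + Q.bound
  | .ite b P Q => b.cost + 1 + (P.bound + Q.bound)
  | .loop _ _ => 0

open Classical in
/-- The effect of a program without loops. -/
noncomputable def exec : Program → State → State
  | .skip, s => s
  | .setReg x e, s => s.setReg x (e.eval s)
  | .setArr a i e, s => s.setArr a (i.eval s) (e.eval s)
  | .setWReg x p, s => s.setWReg x (p.eval s)
  | .setWArr a i p, s => s.setWArr a (i.eval s) (p.eval s)
  | .seq P Q, s => exec Q (exec P s)
  | .ite b P Q, s => if b.holds s then exec P s else exec Q s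
  | .loop _ _, s => s

/-- Without loops the effect is a function of the state and the running time is bounded by a
constant of the syntax. Claims about loop bodies thus become computations with `exec`, and their
costs become decidable inequalities about `Program.bound`. -/
theorem runs_exec {P : Program} (h : P.loopFree = true) (s : State) :
    ∃ t, Runs P s (exec P s) t ∧ t ≤ P.bound := by
  induction P generalizing s with
  | skip => exact ⟨_, .skip s, le_rfl⟩
  | setReg x e => exact ⟨_, .setReg s x e, le_rfl⟩
  | setArr a i e => exact ⟨_, .setArr s a i e, le_rfl⟩
  | setWReg x p => exact ⟨_, .setWReg s x p, le_rfl⟩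
  | setWArr a i p => exact ⟨_, .setWArr s a i p, le_rfl⟩
  | seq P Q hP hQ =>
    simp only [Program.loopFree, Bool.and_eq_true] at h
    obtain ⟨t₁, h₁, b₁⟩ := hP h.1 s
    obtain ⟨t₂, h₂, b₂⟩ := hQ h.2 (exec P s)
    exact ⟨_, .seq h₁ h₂, Nat.add_le_add b₁ b₂⟩
  | ite b P Q hP hQ =>
    simp only [Program.loopFree, Bool.and_eq_true] at h
    obtain ⟨t₁, h₁, b₁⟩ := hP h.1 s
    obtain ⟨t₂, h₂, b₂⟩ := hQ h.2 s
    by_cases hb : b.holds s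
    · refine ⟨b.cost + 1 + t₁, ?_, ?_⟩
      · rw [exec, if_pos hb]; exact .iteTrue hb h₁
      · simp only [Program.bound]; omega
    · refine ⟨b.cost + 1 + t₂, ?_, ?_⟩
      · rw [exec, if_neg hb]; exact .iteFalse hb h₂
      · simp only [Program.bound]; omega
  | loop b P _ => simp [Program.loopFree] at h

/-- The natural-number registers that a program writes. -/
def Program.writesReg : Program → ℕ → Bool
  | .setReg x _, y => y == x
  | .seq P Q, y => P.writesReg y || Q.writesReg y
  | .ite _ P Q, y => P.writesReg y || Q.writesReg y
  | .loop _ P, y => P.writesReg y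
  | _, _ => false

/-- The natural-number arrays that a program writes. -/
def Program.writesArr : Program → ℕ → Bool
  | .setArr a _ _, y => y == a
  | .seq P Q, y => P.writesArr y || Q.writesArr y
  | .ite _ P Q, y => P.writesArr y || Q.writesArr y
  | .loop _ P, y => P.writesArr y
  | _, _ => false

/-- The weight registers that a program writes. -/
def Program.writesWReg : Program → ℕ → Bool
  | .setWReg x _, y => y == x
  | .seq P Q, y => P.writesWReg y || Q.writesWReg y
  | .ite _ P Q, y => P.writesWReg y || Q.writesWReg y
  | .loop _ P, y => P.writesWReg y
  | _, _ => false

/-- The weight arrays that a program writes. -/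
def Program.writesWArr : Program → ℕ → Bool
  | .setWArr a _ _, y => y == a
  | .seq P Q, y => P.writesWArr y || Q.writesWArr y
  | .ite _ P Q, y => P.writesWArr y || Q.writesWArr y
  | .loop _ P, y => P.writesWArr y
  | _, _ => false

/-- Two memories agree on everything that `P` does not write. -/
structure Agree (P : Program) (s s' : State) : Prop where
  reg : ∀ x, P.writesReg x = false → s'.reg x = s.reg x
  arr : ∀ x, P.writesArr x = false → s'.arr x = s.arr x
  wreg : ∀ x, P.writesWReg x = false → s'.wreg x = s.wreg x
  warr : ∀ x, P.writesWArr x = false → s'.warr x = s.warr x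

theorem Agree.refl (P : Program) (s : State) : Agree P s s :=
  ⟨fun _ _ => rfl, fun _ _ => rfl, fun _ _ => rfl, fun _ _ => rfl⟩

theorem Agree.trans {P : Program} {s s' s'' : State} (h : Agree P s s') (h' : Agree P s' s'') :
    Agree P s s'' :=
  ⟨fun x hx => (h'.reg x hx).trans (h.reg x hx), fun x hx => (h'.arr x hx).trans (h.arr x hx),
    fun x hx => (h'.wreg x hx).trans (h.wreg x hx), fun x hx => (h'.warr x hx).trans (h.warr x hx)⟩

theorem Agree.mono {P Q : Program} {s s' : State} (h : Agree P s s')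
    (h1 : ∀ x, Q.writesReg x = false → P.writesReg x = false)
    (h2 : ∀ x, Q.writesArr x = false → P.writesArr x = false)
    (h3 : ∀ x, Q.writesWReg x = false → P.writesWReg x = false)
    (h4 : ∀ x, Q.writesWArr x = false → P.writesWArr x = false) : Agree Q s s' :=
  ⟨fun x hx => h.reg x (h1 x hx), fun x hx => h.arr x (h2 x hx),
    fun x hx => h.wreg x (h3 x hx), fun x hx => h.warr x (h4 x hx)⟩

/-- The frame rule: what a program does not mention as a target is unchanged. The write sets are
computed from the syntax, so for concrete small programs the side conditions hold by `rfl`. -/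
theorem Runs.agree {P : Program} {s s' : State} {t : ℕ} (h : Runs P s s' t) : Agree P s s' := by
  induction h with
  | skip s => exact .refl _ _
  | setReg s x e =>
    refine ⟨fun y hy => ?_, fun _ _ => rfl, fun _ _ => rfl, fun _ _ => rfl⟩
    simp [Program.writesReg] at hy; simp [hy]
  | setArr s a i e =>
    refine ⟨fun _ _ => rfl, fun y hy => ?_, fun _ _ => rfl, fun _ _ => rfl⟩
    simp [Program.writesArr] at hy; simp [hy]
  | setWReg s x p =>
    refine ⟨fun _ _ => rfl, fun _ _ => rfl, fun y hy => ?_, fun _ _ => rfl⟩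
    simp [Program.writesWReg] at hy; simp [hy]
  | setWArr s a i p =>
    refine ⟨fun _ _ => rfl, fun _ _ => rfl, fun _ _ => rfl, fun y hy => ?_⟩
    simp [Program.writesWArr] at hy; simp [hy]
  | seq _ _ h₁ h₂ =>
    refine .trans (h₁.mono ?_ ?_ ?_ ?_) (h₂.mono ?_ ?_ ?_ ?_) <;> intro x hx <;>
      simp_all [Program.writesReg, Program.writesArr, Program.writesWReg, Program.writesWArr]
  | iteTrue _ _ h =>
    refine h.mono ?_ ?_ ?_ ?_ <;> intro x hx <;>
      simp_all [Program.writesReg, Program.writesArr, Program.writesWReg, Program.writesWArr]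
  | iteFalse _ _ h =>
    refine h.mono ?_ ?_ ?_ ?_ <;> intro x hx <;>
      simp_all [Program.writesReg, Program.writesArr, Program.writesWReg, Program.writesWArr]
  | loopDone _ => exact .refl _ _
  | loopStep _ _ _ h₁ h₂ =>
    exact .trans (h₁.mono (fun _ h => h) (fun _ h => h) (fun _ h => h) fun _ h => h) h₂

/-- Loops with an invariant `I` and a potential `φ`, both depending on auxiliary data. -/
theorem runs_loop {b : Test} {P : Program} {α : Type*} (I : α → State → Prop)
    (φ : α → State → ℕ)
    (step : ∀ a s, I a s → b.holds s → ∃ a' s' t, Runs P s s' t ∧ I a' s' ∧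
      t + (b.cost + 1) + φ a' s' ≤ φ a s) (a : α) (s : State) (h : I a s) :
    ∃ a' s' t, Runs (.loop b P) s s' t ∧ I a' s' ∧ ¬ b.holds s' ∧
      t + φ a' s' ≤ φ a s + (b.cost + 1) := by
  -- The test costs at least one step and is charged to the potential in `step`, so the potential
  -- strictly decreases in every iteration; termination comes with the time bound.
  induction hk : φ a s using Nat.strong_induction_on generalizing a s with
  | _ k ih =>
    by_cases hb : b.holds s
    · obtain ⟨a₁, s₁, t₁, hr, hI, ht⟩ := step a s h hb
      obtain ⟨a₂, s₂, t₂, hr', hI', hb', ht'⟩ := ih (φ a₁ s₁) (by omega) a₁ s₁ hI rfl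
      exact ⟨a₂, s₂, _, .loopStep hb hr hr', hI', hb', by omega⟩
    · exact ⟨a, s, _, .loopDone hb, h, hb, by omega⟩

/-- Count register `j` up from `0` to the value of register `m`. -/
def forTo (j m : ℕ) (body : Program) : Program :=
  .seq (.setReg j (.const 0))
    (.loop (.lt (.reg j) (.reg m)) (.seq body (.setReg j (.succ (.reg j)))))

/-- The step receives agreement with the initial state, so that an invariant only has to speak about
what the body changes. Per round, `7` is the cost of the test and of the increment; the final `6` is
the initial assignment and the last test. -/
theorem runs_forTo {j m : ℕ} {body : Program} (hjm : m ≠ j) (hb : body.loopFree = true)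
    (hj : body.writesReg j = false) (hm : body.writesReg m = false)
    (I : ℕ → State → Prop) (s₀ : State) (h0 : I 0 (s₀.setReg j 0))
    (step : ∀ k s, k < s₀.reg m → s.reg j = k → s.reg m = s₀.reg m →
      Agree (forTo j m body) s₀ s → I k s → I (k + 1) ((exec body s).setReg j (k + 1))) :
    ∃ s' t, Runs (forTo j m body) s₀ s' t ∧ I (s₀.reg m) s' ∧
      t ≤ (body.bound + 7) * s₀.reg m + 6 := by
  have hsub : ∀ s s', Agree (.seq body (.setReg j (.succ (.reg j)))) s s' →
      Agree (forTo j m body) s s' := by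
    intro s s' h
    refine h.mono ?_ ?_ ?_ ?_ <;> intro x hx <;>
      simp_all [forTo, Program.writesReg, Program.writesArr, Program.writesWReg,
        Program.writesWArr]
  obtain ⟨a, s', t, hr, ⟨hI, hj', hm', hle, hA⟩, hnb, ht⟩ :=
    runs_loop (b := .lt (.reg j) (.reg m)) (P := .seq body (.setReg j (.succ (.reg j))))
    (fun (k : ℕ) s => I k s ∧ s.reg j = k ∧ s.reg m = s₀.reg m ∧ k ≤ s₀.reg m ∧
      Agree (forTo j m body) s₀ s)
    (fun k _ => (body.bound + 7) * (s₀.reg m - k))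
    (by
      rintro k s ⟨hI, hk, hm', hle, hA⟩ hlt
      simp only [Test.holds, NatExpr.eval, hk, hm'] at hlt
      obtain ⟨t, ht, htb⟩ := runs_exec hb s
      have hr : Runs (.seq body (.setReg j (.succ (.reg j)))) s _ _ := .seq ht (.setReg _ _ _)
      have hag := hA.trans (hsub _ _ hr.agree)
      have hkk : (NatExpr.succ (.reg j)).eval (exec body s) = k + 1 := by
        simp [NatExpr.eval, ht.agree.reg j hj, hk]
      rw [hkk] at hr hag
      refine ⟨k + 1, _, _, hr, ⟨step k s hlt hk hm' hA hI, by simp, ?_, hlt, hag⟩, ?_⟩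
      · simp [hjm, ht.agree.reg m hm, hm']
      · simp only [Test.cost, NatExpr.cost]
        obtain ⟨d, hd⟩ : ∃ d, s₀.reg m - k = d + 1 := ⟨s₀.reg m - k - 1, by omega⟩
        have : s₀.reg m - (k + 1) = d := by omega
        rw [hd, this, Nat.mul_succ]; omega)
    0 (s₀.setReg j 0) ⟨h0, by simp, by simp [hjm], by omega, by
      have := (Runs.setReg s₀ j (.const 0)).agree
      refine this.mono ?_ ?_ ?_ ?_ <;> intro x hx <;>
        simp_all [forTo, Program.writesReg, Program.writesArr, Program.writesWReg,
          Program.writesWArr]⟩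
  have : a = s₀.reg m := by
    simp only [Test.holds, NatExpr.eval] at hnb; omega
  subst this
  refine ⟨s', _, .seq (.setReg _ _ _) hr, hI, ?_⟩
  simp only [NatExpr.cost, Test.cost, Nat.sub_zero] at ht ⊢
  omega

/-- Programs in a list, one after the other. -/
def seqList : List Program → Program
  | [] => .skip
  | P :: l => .seq P (seqList l)

theorem seqList_loopFree {l : List Program} (h : ∀ P ∈ l, P.loopFree = true) :
    (seqList l).loopFree = true := by
  induction l with
  | nil => rfl
  | cons P l ih => simp_all [seqList, Program.loopFree]

theorem seqList_writesReg {l : List Program} {x : ℕ} (h : ∀ P ∈ l, P.writesReg x = false) :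
    (seqList l).writesReg x = false := by
  induction l with
  | nil => rfl
  | cons P l ih => simp_all [seqList, Program.writesReg]

theorem seqList_writesArr {l : List Program} {x : ℕ} (h : ∀ P ∈ l, P.writesArr x = false) :
    (seqList l).writesArr x = false := by
  induction l with
  | nil => rfl
  | cons P l ih => simp_all [seqList, Program.writesArr]

theorem seqList_writesWReg {l : List Program} {x : ℕ} (h : ∀ P ∈ l, P.writesWReg x = false) :
    (seqList l).writesWReg x = false := by
  induction l with
  | nil => rfl
  | cons P l ih => simp_all [seqList, Program.writesWReg]

theorem seqList_writesWArr {l : List Program} {x : ℕ} (h : ∀ P ∈ l, P.writesWArr x = false) :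
    (seqList l).writesWArr x = false := by
  induction l with
  | nil => rfl
  | cons P l ih => simp_all [seqList, Program.writesWArr]

end RAM

/-! ### Cotrees and their elementary properties -/

/-- A relation without an induced path on four vertices. -/
def P4Free (A : ℕ → ℕ → Prop) : Prop :=
  ∀ a b c d, A a b → A b c → A c d → ¬ A a c → ¬ A b d → A a d

/-- The nodes of a cotree of the graph on the first `i` of `n` vertices: the leaves
`0, …, i - 1` and the inner nodes `n + 2, …, N - 1`. -/
def treeNodes (n i N : ℕ) : Finset ℕ := Finset.range i ∪ Finset.Ico (n + 2) N

theorem mem_treeNodes {n i N w : ℕ} : w ∈ treeNodes n i N ↔ w < i ∨ n + 2 ≤ w ∧ w < N := by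
  simp [treeNodes]

/-- A cotree of the graph on the first `i` of `n` vertices, in terms of parents, labels (`0` for
leaves, `1` for disjoint unions, `2` for joins), numbers of children, and the sets `D w` of the
vertices below the nodes `w`. The node `n` is an artificial parent of the root. -/
structure Cotree (A : ℕ → ℕ → Prop) (n i N : ℕ) (par lab nch : ℕ → ℕ) (D : ℕ → Finset ℕ) :
    Prop where
  pos : 0 < i
  le : i ≤ n
  le_N : n + 2 ≤ N
  leafD : ∀ v < i, D v = {v}
  leafLab : ∀ v < i, lab v = 0
  innerLab : ∀ w, n + 2 ≤ w → w < N → lab w = 1 ∨ lab w = 2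
  parent : ∀ c ∈ treeNodes n i N, par c = n ∨ n + 2 ≤ par c ∧ par c < N
  sub : ∀ c ∈ treeNodes n i N, par c ≠ n → D c ⊆ D (par c)
  cover : ∀ w, n + 2 ≤ w → w < N → ∀ y ∈ D w, ∃ c ∈ treeNodes n i N, par c = w ∧ y ∈ D c
  disj : ∀ c ∈ treeNodes n i N, ∀ c' ∈ treeNodes n i N, c ≠ c' → par c = par c' →
    Disjoint (D c) (D c')
  adj : ∀ c ∈ treeNodes n i N, ∀ c' ∈ treeNodes n i N, c ≠ c' → par c = par c' →
    ∀ y ∈ D c, ∀ y' ∈ D c', (A y y' ↔ lab (par c) = 2)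
  root : ∃ r ∈ treeNodes n i N, par r = n
  rootD : ∀ r ∈ treeNodes n i N, par r = n → D r = Finset.range i
  nonempty : ∀ c ∈ treeNodes n i N, (D c).Nonempty
  children : ∀ w, n + 2 ≤ w → w < N → nch w = ((treeNodes n i N).filter (par · = w)).card
  two_le : ∀ w, n + 2 ≤ w → w < N → 2 ≤ nch w
  nch_root : nch n = 0
  lab_root : lab n = 0

/-- No inner node has the label of its parent. -/
def Alternating (n i N : ℕ) (par lab : ℕ → ℕ) : Prop :=
  ∀ c ∈ treeNodes n i N, par c ≠ n → lab c ≠ lab (par c)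

namespace Cotree

variable {A : ℕ → ℕ → Prop} {n i N : ℕ} {par lab nch : ℕ → ℕ} {D : ℕ → Finset ℕ}

theorem inner_mem (_ : Cotree A n i N par lab nch D) {w : ℕ} (h1 : n + 2 ≤ w) (h2 : w < N) :
    w ∈ treeNodes n i N := mem_treeNodes.2 (.inr ⟨h1, h2⟩)

theorem par_inner (T : Cotree A n i N par lab nch D) {c : ℕ} (hc : c ∈ treeNodes n i N)
    (h : par c ≠ n) : n + 2 ≤ par c ∧ par c < N := (T.parent c hc).resolve_left h

theorem par_mem (T : Cotree A n i N par lab nch D) {c : ℕ} (hc : c ∈ treeNodes n i N)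
    (h : par c ≠ n) : par c ∈ treeNodes n i N := mem_treeNodes.2 (.inr (T.par_inner hc h))

theorem root_unique (T : Cotree A n i N par lab nch D) {r r' : ℕ} (hr : r ∈ treeNodes n i N)
    (hr' : r' ∈ treeNodes n i N) (h : par r = n) (h' : par r' = n) : r = r' := by
  by_contra hne
  have := T.disj r hr r' hr' hne (h.trans h'.symm)
  rw [T.rootD r hr h, T.rootD r' hr' h'] at this
  have h0 := T.pos
  simp at this; omega

theorem exists_sibling (T : Cotree A n i N par lab nch D) {w : ℕ} (h1 : n + 2 ≤ w) (h2 : w < N)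
    (c : ℕ) : ∃ c' ∈ treeNodes n i N, par c' = w ∧ c' ≠ c := by
  have h := T.two_le w h1 h2
  rw [T.children w h1 h2] at h
  obtain ⟨c', hc', hne⟩ := Finset.exists_mem_ne h c
  simp only [Finset.mem_filter] at hc'
  exact ⟨c', hc'.1, hc'.2, hne⟩

/-- A sibling of `c` contributes vertices that are not below `c`. The number of vertices below a
node is therefore a rank, by which all inductions along paths of the tree are run. -/
theorem ssub (T : Cotree A n i N par lab nch D) {c : ℕ} (hc : c ∈ treeNodes n i N)
    (h : par c ≠ n) : D c ⊂ D (par c) := by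
  refine (T.sub c hc h).ssubset_of_ne fun heq => ?_
  obtain ⟨h1, h2⟩ := T.par_inner hc h
  obtain ⟨c', hc', hp, hne⟩ := T.exists_sibling h1 h2 c
  obtain ⟨y, hy⟩ := T.nonempty c' hc'
  have := T.disj c' hc' c hc hne hp
  have hy' := T.sub c' hc' (by omega) hy
  rw [hp, ← heq] at hy'
  exact Finset.disjoint_left.1 this hy hy'

/-- Every chain of parents reaches the root, where the set is `range i`. That chains end is not an
axiom: the sets grow strictly, and beyond cardinality `i` no node could be the root, so the growth
would never stop although there are finitely many nodes. -/
theorem sub_range (T : Cotree A n i N par lab nch D) {c : ℕ} (hc : c ∈ treeNodes n i N) :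
    D c ⊆ Finset.range i := by
  induction hk : i - (D c).card using Nat.strong_induction_on generalizing c with
  | _ k ih =>
    by_cases h : par c = n
    · exact (T.rootD c hc h).le
    · refine (T.sub c hc h).trans ?_
      by_cases hle : (D (par c)).card ≤ i
      · have := Finset.card_lt_card (T.ssub hc h)
        exact ih _ (by omega) (T.par_mem hc h) rfl
      · -- a largest node is the root
        exfalso
        have key : ∀ m, ∃ c ∈ treeNodes n i N, par c ≠ n ∧ i + m < (D (par c)).card := by
          intro m
          induction m with
          | zero => exact ⟨c, hc, h, by omega⟩
          | succ m ihm =>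
            obtain ⟨c, hc, h, hlt⟩ := ihm
            have hp := T.par_mem hc h
            by_cases h' : par (par c) = n
            · rw [T.rootD _ hp h'] at hlt; simp at hlt
            · have := Finset.card_lt_card (T.ssub hp h')
              exact ⟨par c, hp, h', by omega⟩
        obtain ⟨c, hc, h, hlt⟩ := key ((treeNodes n i N).sup fun w => (D w).card)
        have : (D (par c)).card ≤ (treeNodes n i N).sup fun w => (D w).card :=
          Finset.le_sup (f := fun w => (D w).card) (T.par_mem hc h)
        omega

theorem card_le (T : Cotree A n i N par lab nch D) {c : ℕ} (hc : c ∈ treeNodes n i N) :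
    (D c).card ≤ i := by
  simpa using Finset.card_le_card (T.sub_range hc)

theorem inner_of (T : Cotree A n i N par lab nch D) {c : ℕ} (hc : c ∈ treeNodes n i N)
    (h : lab c ≠ 0) : n + 2 ≤ c ∧ c < N := by
  rcases mem_treeNodes.1 hc with h' | h'
  · exact absurd (T.leafLab c h') h
  · exact h'

/-- One step up in the tree, not beyond the root. -/
def Step (n i N : ℕ) (par : ℕ → ℕ) (a b : ℕ) : Prop :=
  a ∈ treeNodes n i N ∧ par a = b ∧ b ≠ n

/-- `w` is `f` or lies above `f`. -/
def Above (n i N : ℕ) (par : ℕ → ℕ) (f w : ℕ) : Prop := Relation.ReflTransGen (Step n i N par) f w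

theorem Above.mem (T : Cotree A n i N par lab nch D) {f w : ℕ} (hf : f ∈ treeNodes n i N)
    (h : Above n i N par f w) : w ∈ treeNodes n i N := by
  induction h with
  | refl => exact hf
  | tail _ h ih => obtain ⟨h1, rfl, h3⟩ := h; exact T.par_mem h1 h3

theorem Above.sub (T : Cotree A n i N par lab nch D) {f w : ℕ} (h : Above n i N par f w) :
    D f ⊆ D w := by
  induction h with
  | refl => exact subset_rfl
  | tail _ h ih => obtain ⟨h1, rfl, h3⟩ := h; exact ih.trans (T.sub _ h1 h3)

theorem Above.up {f w : ℕ} (h : Above n i N par f w) (hw : w ∈ treeNodes n i N)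
    (hn : par w ≠ n) : Above n i N par f (par w) := h.tail ⟨hw, rfl, hn⟩

theorem Above.exists_child {f w : ℕ} (h : Above n i N par f w) (hne : w ≠ f) :
    ∃ c, Above n i N par f c ∧ c ∈ treeNodes n i N ∧ par c = w ∧ w ≠ n := by
  rcases Relation.ReflTransGen.cases_tail h with h | ⟨c, hc, h⟩
  · exact absurd h hne
  · exact ⟨c, hc, h.1, h.2⟩

theorem above_root (T : Cotree A n i N par lab nch D) {f r : ℕ} (hf : f ∈ treeNodes n i N)
    (hr : r ∈ treeNodes n i N) (h : par r = n) : Above n i N par f r := by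
  induction hk : i - (D f).card using Nat.strong_induction_on generalizing f with
  | _ k ih =>
    by_cases hfn : par f = n
    · rw [T.root_unique hf hr hfn h]; exact .refl
    · have := Finset.card_lt_card (T.ssub hf hfn)
      have := T.card_le (T.par_mem hf hfn)
      exact .head ⟨hf, rfl, hfn⟩ (ih _ (by omega) (T.par_mem hf hfn) rfl)

theorem Above.unique (T : Cotree A n i N par lab nch D) {f c c' : ℕ} (hf : f ∈ treeNodes n i N)
    (h : Above n i N par f c) (h' : Above n i N par f c') (hp : par c = par c') : c = c' := by
  by_contra hne
  obtain ⟨y, hy⟩ := T.nonempty f hf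
  exact Finset.disjoint_left.1 (T.disj c (h.mem T hf) c' (h'.mem T hf) hne hp)
    (h.sub T hy) (h'.sub T hy)

theorem Above.antisymm (T : Cotree A n i N par lab nch D) {f : ℕ} (hf : f ∈ treeNodes n i N)
    (hn : par f ≠ n) : ¬ Above n i N par (par f) f := fun h =>
  (T.ssub hf hn).not_subset (h.sub T)

end Cotree

/-! ### Inserting a leaf into a cotree -/

namespace Cotree

variable {A : ℕ → ℕ → Prop} {n i N : ℕ} {par lab nch : ℕ → ℕ} {D : ℕ → Finset ℕ}

theorem mem_old (T : Cotree A n i N par lab nch D) (hi : i < n) {c : ℕ}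
    (hc : c ∈ treeNodes n i N) : c ≠ i ∧ c ≠ N ∧ c ≠ n ∧ par c ≠ i ∧ par c ≠ N := by
  have := T.parent c hc
  have := T.le_N
  rcases mem_treeNodes.1 hc with h | h <;> refine ⟨?_, ?_, ?_, ?_, ?_⟩ <;> omega

open Classical in
/-- Adding the new vertex as a child of an inner node. -/
theorem addChild (T : Cotree A n i N par lab nch D) (hsymm : ∀ a b, A a b → A b a)
    (hi : i < n) (hlab : lab i = 0) {f : ℕ} (hf : f ∈ treeNodes n i N) (hf0 : lab f ≠ 0)
    (hin : ∀ y ∈ D f, (A i y ↔ lab f = 2))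
    (hout : ∀ y < i, y ∉ D f → ∀ t ∈ D f, (A i y ↔ A t y)) :
    Cotree A n (i + 1) N (Function.update par i f) lab (Function.update nch f (nch f + 1))
      (fun w => if w = i then {i} else if Above n i N par f w then insert i (D w) else D w) := by
  have hfi := T.inner_of hf hf0
  have hleN := T.le_N
  have hnodes : ∀ c, c ∈ treeNodes n (i + 1) N ↔ c = i ∨ c ∈ treeNodes n i N := by
    intro c; simp only [mem_treeNodes]; omega
  have hold := fun c hc => T.mem_old hi (c := c) hc
  have hiD : ∀ c ∈ treeNodes n i N, i ∉ D c := fun c hc h => by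
    simpa using T.sub_range hc h
  have hDsub : ∀ c ∈ treeNodes n i N, D c ⊆
      (fun w => if w = i then {i} else if Above n i N par f w then insert i (D w) else D w) c := by
    intro c hc
    simp only [(hold c hc).1, if_false]
    split_ifs
    · exact Finset.subset_insert _ _
    · exact subset_rfl
  -- Only nodes above `f` gain the new vertex. A sibling of such a node is disjoint from `D f`, and
  -- there `hout` says that the new vertex is adjacent to the same vertices as those below `f`, so
  -- the old adjacency rule carries over.
  have hpair : ∀ c ∈ treeNodes n i N, ∀ c' ∈ treeNodes n i N, c ≠ c' → par c = par c' →
      Above n i N par f c → ¬ Above n i N par f c' ∧ Disjoint (insert i (D c)) (D c') ∧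
        ∀ y ∈ insert i (D c), ∀ y' ∈ D c', (A y y' ↔ lab (par c) = 2) := by
    intro c hc c' hc' hne hp hU
    refine ⟨fun hU' => hne (hU.unique T hf hU' hp), ?_, ?_⟩
    · rw [Finset.disjoint_insert_left]
      exact ⟨hiD c' hc', T.disj c hc c' hc' hne hp⟩
    · intro y hy y' hy'
      rcases Finset.mem_insert.1 hy with rfl | hy
      · obtain ⟨t, ht⟩ := T.nonempty f hf
        rw [hout y' (by simpa using T.sub_range hc' hy') (fun h => Finset.disjoint_left.1
          (T.disj c hc c' hc' hne hp) (hU.sub T h) hy') t ht]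
        exact T.adj c hc c' hc' hne hp t (hU.sub T ht) y' hy'
      · exact T.adj c hc c' hc' hne hp y hy y' hy'
  have hchild : ∀ c ∈ treeNodes n i N, par c = f → ¬ Above n i N par f c := by
    intro c hc hp h
    have : par c ≠ n := by omega
    subst hp
    exact h.antisymm T hc this
  have hcomm : ∀ a b, A a b ↔ A b a := fun a b => ⟨hsymm a b, hsymm b a⟩
  have key : ∀ c ∈ treeNodes n (i + 1) N, ∀ c' ∈ treeNodes n (i + 1) N, c ≠ c' →
      Function.update par i f c = Function.update par i f c' →
      Disjoint ((fun w => if w = i then {i} else if Above n i N par f w then insert i (D w)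
        else D w) c) ((fun w => if w = i then {i} else if Above n i N par f w then insert i (D w)
        else D w) c') ∧
      ∀ y ∈ (fun w => if w = i then {i} else if Above n i N par f w then insert i (D w)
        else D w) c, ∀ y' ∈ (fun w => if w = i then {i} else if Above n i N par f w then
          insert i (D w) else D w) c',
        (A y y' ↔ lab (Function.update par i f c) = 2) := by
    intro c hc c' hc' hne hp
    rcases (hnodes c).1 hc with rfl | hc <;> rcases (hnodes c').1 hc' with h' | hc'
    · exact absurd h'.symm hne
    · have h1 := (hold c' hc').1
      simp only [Function.update_self, Function.update_of_ne h1] at hp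
      have h2 := hchild c' hc' hp.symm
      simp only [h1, h2, if_true, if_false, Function.update_self]
      refine ⟨by simpa using hiD c' hc', fun y hy y' hy' => ?_⟩
      rw [Finset.mem_singleton.1 hy]
      refine hin y' ?_
      have := T.sub c' hc' (by omega) hy'
      rwa [← hp] at this
    · subst h'
      have h1 := (hold c hc).1
      simp only [Function.update_self, Function.update_of_ne h1] at hp
      have h2 := hchild c hc hp
      simp only [h1, h2, if_true, if_false, Function.update_of_ne h1]
      refine ⟨by simpa using hiD c hc, fun y hy y' hy' => ?_⟩
      rw [Finset.mem_singleton.1 hy', hcomm, hp]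
      refine hin y ?_
      have := T.sub c hc (by omega) hy
      rwa [hp] at this
    · have h1 := (hold c hc).1
      have h1' := (hold c' hc').1
      simp only [Function.update_of_ne h1, Function.update_of_ne h1'] at hp
      simp only [h1, h1', if_false, Function.update_of_ne h1]
      by_cases hU : Above n i N par f c
      · obtain ⟨h3, h4, h5⟩ := hpair c hc c' hc' hne hp hU
        simp only [hU, h3, if_true, if_false]
        exact ⟨h4, h5⟩
      · by_cases hU' : Above n i N par f c'
        · obtain ⟨h3, h4, h5⟩ := hpair c' hc' c hc hne.symm hp.symm hU'
          simp only [hU, hU', if_true, if_false]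
          exact ⟨h4.symm, fun y hy y' hy' => by rw [hcomm, hp]; exact h5 y' hy' y hy⟩
        · simp only [hU, hU', if_false]
          exact ⟨T.disj c hc c' hc' hne hp, T.adj c hc c' hc' hne hp⟩
  refine
    { pos := by omega
      le := hi
      le_N := hleN
      leafD := ?_
      leafLab := ?_
      innerLab := T.innerLab
      parent := ?_
      sub := ?_
      cover := ?_
      disj := fun c hc c' hc' h1 h2 => (key c hc c' hc' h1 h2).1
      adj := fun c hc c' hc' h1 h2 => (key c hc c' hc' h1 h2).2
      root := ?_
      rootD := ?_
      nonempty := ?_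
      children := ?_
      two_le := ?_
      nch_root := ?_
      lab_root := T.lab_root }
  · intro v hv
    by_cases h : v = i
    · simp [h]
    · have hv' : v ∈ treeNodes n i N := mem_treeNodes.2 (.inl (by omega))
      have : ¬ Above n i N par f v := by
        intro hU
        obtain ⟨c, -, hc, hp, -⟩ := hU.exists_child (by omega)
        have := T.parent c hc
        omega
      simp [h, this, T.leafD v (by omega)]
  · intro v hv
    by_cases h : v = i
    · rw [h, hlab]
    · exact T.leafLab v (by omega)
  · intro c hc
    rcases (hnodes c).1 hc with rfl | hc
    · simp [hfi]
    · rw [Function.update_of_ne (hold c hc).1]; exact T.parent c hc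
  · intro c hc hn
    rcases (hnodes c).1 hc with rfl | hc
    · have h : Above n c N par f f := .refl
      simp [(hold f hf).1, h]
    · rw [Function.update_of_ne (hold c hc).1] at hn ⊢
      have hs := T.sub c hc hn
      by_cases hU : Above n i N par f c
      · simp only [(hold c hc).1, hU, hU.up hc hn, (hold c hc).2.2.2.1, if_true, if_false]
        exact Finset.insert_subset_insert _ hs
      · simp only [(hold c hc).1, hU, if_false]
        exact hs.trans (hDsub _ (T.par_mem hc hn))
  · intro w h1 h2 y hy
    have hw := T.inner_mem h1 h2
    have hold' : ∀ y ∈ D w, ∃ c ∈ treeNodes n (i + 1) N, Function.update par i f c = w ∧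
        y ∈ (fun w => if w = i then {i} else if Above n i N par f w then insert i (D w)
          else D w) c := by
      intro y hy
      obtain ⟨c, hc, hp, hy⟩ := T.cover w h1 h2 y hy
      exact ⟨c, (hnodes c).2 (.inr hc), by rw [Function.update_of_ne (hold c hc).1, hp],
        hDsub c hc hy⟩
    simp only [(hold w hw).1, if_false] at hy
    split_ifs at hy with hU
    · rcases Finset.mem_insert.1 hy with rfl | hy
      · by_cases hwf : w = f
        · exact ⟨y, (hnodes y).2 (.inl rfl), by simp [hwf]⟩
        · obtain ⟨c, hU', hc, hp, -⟩ := hU.exists_child hwf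
          refine ⟨c, (hnodes c).2 (.inr hc), by rw [Function.update_of_ne (hold c hc).1, hp], ?_⟩
          simp [(hold c hc).1, hU']
      · exact hold' y hy
    · exact hold' y hy
  · obtain ⟨r, hr, hp⟩ := T.root
    exact ⟨r, (hnodes r).2 (.inr hr), by rw [Function.update_of_ne (hold r hr).1, hp]⟩
  · intro r hr hp
    rcases (hnodes r).1 hr with rfl | hr
    · simp at hp; omega
    · rw [Function.update_of_ne (hold r hr).1] at hp
      simp only [(hold r hr).1, T.above_root hf hr hp, if_true, if_false, T.rootD r hr hp]
      rw [Finset.range_add_one]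
  · intro c hc
    rcases (hnodes c).1 hc with rfl | hc
    · simp
    · exact (T.nonempty c hc).mono (hDsub c hc)
  · intro w h1 h2
    have hfilter : (treeNodes n (i + 1) N).filter (Function.update par i f · = w) =
        if w = f then insert i ((treeNodes n i N).filter (par · = w))
        else (treeNodes n i N).filter (par · = w) := by
      ext c
      by_cases hci : c = i
      · subst hci
        have hni : c ∉ treeNodes n c N := fun h => (hold c h).1 rfl
        split_ifs with h
        · simp [hnodes, h]
        · simp [hnodes, hni, Ne.symm h]
      · split_ifs with h <;> simp [hnodes, hci]
    have hni : i ∉ (treeNodes n i N).filter (par · = w) := fun h =>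
      (hold i (Finset.mem_filter.1 h).1).1 rfl
    rw [hfilter]
    split_ifs with h
    · rw [Finset.card_insert_of_notMem hni, ← T.children w h1 h2, h, Function.update_self]
    · rw [Function.update_of_ne h, T.children w h1 h2]
  · intro w h1 h2
    have := T.two_le w h1 h2
    rw [Function.update_apply]
    split_ifs with h
    · subst h; omega
    · exact this
  · rw [Function.update_of_ne (by omega), T.nch_root]

end Cotree

namespace Cotree

variable {A : ℕ → ℕ → Prop} {n i N : ℕ} {par lab nch : ℕ → ℕ} {D : ℕ → Finset ℕ}

open Classical in
/-- Replacing the node `f` by a new node `N` with the children `f` and the new vertex. -/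
theorem addParent (T : Cotree A n i N par lab nch D) (hsymm : ∀ a b, A a b → A b a)
    (hi : i < n) (hlab : lab i = 0) {f ℓ : ℕ} (hf : f ∈ treeNodes n i N) (hℓ : ℓ = 1 ∨ ℓ = 2)
    (hin : ∀ y ∈ D f, (A i y ↔ ℓ = 2))
    (hout : ∀ y < i, y ∉ D f → ∀ t ∈ D f, (A i y ↔ A t y)) :
    Cotree A n (i + 1) (N + 1)
      (Function.update (Function.update (Function.update par N (par f)) f N) i N)
      (Function.update lab N ℓ) (Function.update nch N 2)
      (fun w => if w = i then {i} else if w = N then insert i (D f)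
        else if w ≠ f ∧ Above n i N par f w then insert i (D w) else D w) := by
  have hleN := T.le_N
  have hnodes : ∀ c, c ∈ treeNodes n (i + 1) (N + 1) ↔ c = i ∨ c = N ∨ c ∈ treeNodes n i N := by
    intro c; simp only [mem_treeNodes]; omega
  have hold := fun c hc => T.mem_old hi (c := c) hc
  have hiN : i ≠ N := by omega
  have hNi : N ≠ i := by omega
  have hfi : f ≠ i := (hold f hf).1
  have hfN : f ≠ N := (hold f hf).2.1
  have hNf : N ≠ f := hfN.symm
  set par' := Function.update (Function.update (Function.update par N (par f)) f N) i N with hpar'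
  set D' : ℕ → Finset ℕ := fun w => if w = i then {i} else if w = N then insert i (D f)
        else if w ≠ f ∧ Above n i N par f w then insert i (D w) else D w with hD'
  have pari : par' i = N := by simp [hpar']
  have parf : par' f = N := by simp [hpar', hfi]
  have parN : par' N = par f := by simp [hpar', hNi, hNf]
  have paro : ∀ c ∈ treeNodes n i N, c ≠ f → par' c = par c := by
    intro c hc hcf
    simp [hpar', (hold c hc).1, (hold c hc).2.1, hcf]
  have Di : D' i = {i} := by simp [hD']
  have DN : D' N = insert i (D f) := by simp [hD', hNi]
  have Df : D' f = D f := by simp [hD', hfi, hfN]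
  have Do : ∀ c ∈ treeNodes n i N, c ≠ f →
      D' c = if Above n i N par f c then insert i (D c) else D c := by
    intro c hc hcf
    simp [hD', (hold c hc).1, (hold c hc).2.1, hcf]
  have hcases : ∀ c, c ∈ treeNodes n (i + 1) (N + 1) →
      c = i ∨ c = N ∨ c = f ∨ (c ∈ treeNodes n i N ∧ c ≠ f) := by
    intro c hc
    rcases (hnodes c).1 hc with h | h | h
    · exact .inl h
    · exact .inr (.inl h)
    · by_cases h' : c = f
      · exact .inr (.inr (.inl h'))
      · exact .inr (.inr (.inr ⟨h, h'⟩))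
  have hiD : ∀ c ∈ treeNodes n i N, i ∉ D c := fun c hc h => by
    simpa using T.sub_range hc h
  have hDsub : ∀ c ∈ treeNodes n i N, D c ⊆ D' c := by
    intro c hc
    by_cases hcf : c = f
    · rw [hcf, Df]
    · rw [Do c hc hcf]
      split_ifs
      · exact Finset.subset_insert _ _
      · exact subset_rfl
  have hpair : ∀ c ∈ treeNodes n i N, ∀ c' ∈ treeNodes n i N, c ≠ c' → par c = par c' →
      Above n i N par f c → ¬ Above n i N par f c' ∧ Disjoint (insert i (D c)) (D c') ∧
        ∀ y ∈ insert i (D c), ∀ y' ∈ D c', (A y y' ↔ lab (par c) = 2) := by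
    intro c hc c' hc' hne hp hU
    refine ⟨fun hU' => hne (hU.unique T hf hU' hp), ?_, ?_⟩
    · rw [Finset.disjoint_insert_left]
      exact ⟨hiD c' hc', T.disj c hc c' hc' hne hp⟩
    · intro y hy y' hy'
      rcases Finset.mem_insert.1 hy with rfl | hy
      · obtain ⟨t, ht⟩ := T.nonempty f hf
        rw [hout y' (by simpa using T.sub_range hc' hy') (fun h => Finset.disjoint_left.1
          (T.disj c hc c' hc' hne hp) (hU.sub T h) hy') t ht]
        exact T.adj c hc c' hc' hne hp t (hU.sub T ht) y' hy'
      · exact T.adj c hc c' hc' hne hp y hy y' hy'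
  have hcomm : ∀ a b, A a b ↔ A b a := fun a b => ⟨hsymm a b, hsymm b a⟩
  have labo : ∀ c ∈ treeNodes n i N, Function.update lab N ℓ (par c) = lab (par c) := by
    intro c hc; rw [Function.update_of_ne (hold c hc).2.2.2.2]
  -- Up to exchanging `c` and `c'`, these are the only ways to be siblings: the two children of `N`,
  -- the node `N` in the former place of `f`, and two old nodes of which at most one lies above `f`.
  have key1 : ∀ c ∈ treeNodes n (i + 1) (N + 1), ∀ c' ∈ treeNodes n (i + 1) (N + 1), c ≠ c' →
      par' c = par' c' → ((c = i ∧ c' = f) ∨ (c = N ∧ c' ∈ treeNodes n i N ∧ c' ≠ f) ∨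
        (c ∈ treeNodes n i N ∧ c ≠ f ∧ Above n i N par f c ∧ c' ∈ treeNodes n i N ∧ c' ≠ f) ∨
        (c ∈ treeNodes n i N ∧ c ≠ f ∧ ¬ Above n i N par f c ∧
          c' ∈ treeNodes n i N ∧ c' ≠ f ∧ ¬ Above n i N par f c')) →
      Disjoint (D' c) (D' c') ∧ ∀ y ∈ D' c, ∀ y' ∈ D' c',
        (A y y' ↔ Function.update lab N ℓ (par' c) = 2) := by
    intro c hc c' hc' hne hp h
    rcases h with ⟨rfl, rfl⟩ | ⟨rfl, h1, h2⟩ | ⟨h1, h2, h3, h4, h5⟩ | ⟨h1, h2, h3, h4, h5, h6⟩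
    · rw [Di, Df, pari, Function.update_self]
      refine ⟨by simpa using hiD c' hf, fun y hy y' hy' => ?_⟩
      rw [Finset.mem_singleton.1 hy]
      exact hin y' hy'
    · rw [parN, paro c' h1 h2] at hp
      obtain ⟨h3, h4, h5⟩ := hpair f hf c' h1 h2.symm hp .refl
      rw [DN, Do c' h1 h2, if_neg h3, parN, labo f hf]
      exact ⟨h4, h5⟩
    · rw [paro c h1 h2, paro c' h4 h5] at hp
      obtain ⟨h6, h7, h8⟩ := hpair c h1 c' h4 hne hp h3
      rw [Do c h1 h2, if_pos h3, Do c' h4 h5, if_neg h6, paro c h1 h2, labo c h1]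
      exact ⟨h7, h8⟩
    · rw [paro c h1 h2, paro c' h4 h5] at hp
      rw [Do c h1 h2, if_neg h3, Do c' h4 h5, if_neg h6, paro c h1 h2, labo c h1]
      exact ⟨T.disj c h1 c' h4 hne hp, T.adj c h1 c' h4 hne hp⟩
  have key : ∀ c ∈ treeNodes n (i + 1) (N + 1), ∀ c' ∈ treeNodes n (i + 1) (N + 1), c ≠ c' →
      par' c = par' c' →
      Disjoint (D' c) (D' c') ∧ ∀ y ∈ D' c, ∀ y' ∈ D' c',
        (A y y' ↔ Function.update lab N ℓ (par' c) = 2) := by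
    intro c hc c' hc' hne hp
    have hs : Disjoint (D' c') (D' c) ∧ (∀ y ∈ D' c', ∀ y' ∈ D' c,
        (A y y' ↔ Function.update lab N ℓ (par' c') = 2)) → Disjoint (D' c) (D' c') ∧
        ∀ y ∈ D' c, ∀ y' ∈ D' c', (A y y' ↔ Function.update lab N ℓ (par' c) = 2) :=
      fun ⟨h1, h2⟩ => ⟨h1.symm, fun y hy y' hy' => by rw [hcomm, hp]; exact h2 y' hy' y hy⟩
    have k1 := key1 c hc c' hc' hne hp
    have k2 := fun h => hs (key1 c' hc' c hc hne.symm hp.symm h)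
    have hparf := (hold f hf).2.2.2.2
    rcases hcases c hc with rfl | rfl | rfl | ⟨h, h'⟩ <;>
      rcases hcases c' hc' with rfl | rfl | rfl | ⟨g, g'⟩
    · exact absurd rfl hne
    · rw [pari, parN] at hp; exact absurd hp.symm hparf
    · exact k1 (.inl ⟨rfl, rfl⟩)
    · rw [pari, paro c' g g'] at hp; exact absurd hp.symm (hold c' g).2.2.2.2
    · rw [pari, parN] at hp; exact absurd hp hparf
    · exact absurd rfl hne
    · rw [parN, parf] at hp; exact absurd hp hparf
    · exact k1 (.inr (.inl ⟨rfl, g, g'⟩))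
    · exact k2 (.inl ⟨rfl, rfl⟩)
    · rw [parN, parf] at hp; exact absurd hp.symm hparf
    · exact absurd rfl hne
    · rw [parf, paro c' g g'] at hp; exact absurd hp.symm (hold c' g).2.2.2.2
    · rw [pari, paro c h h'] at hp; exact absurd hp (hold c h).2.2.2.2
    · exact k2 (.inr (.inl ⟨rfl, h, h'⟩))
    · rw [parf, paro c h h'] at hp; exact absurd hp (hold c h).2.2.2.2
    · by_cases hU : Above n i N par f c
      · exact k1 (.inr (.inr (.inl ⟨h, h', hU, g, g'⟩)))
      by_cases hU' : Above n i N par f c'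
      · exact k2 (.inr (.inr (.inl ⟨g, g', hU', h, h'⟩)))
      exact k1 (.inr (.inr (.inr ⟨h, h', hU, g, g', hU'⟩)))
  have hparf' := T.parent f hf
  refine
    { pos := by omega
      le := hi
      le_N := by omega
      leafD := ?_
      leafLab := ?_
      innerLab := ?_
      parent := ?_
      sub := ?_
      cover := ?_
      disj := fun c hc c' hc' h1 h2 => (key c hc c' hc' h1 h2).1
      adj := fun c hc c' hc' h1 h2 => (key c hc c' hc' h1 h2).2
      root := ?_
      rootD := ?_
      nonempty := ?_
      children := ?_
      two_le := ?_
      nch_root := by rw [Function.update_of_ne (by omega), T.nch_root]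
      lab_root := by rw [Function.update_of_ne (by omega), T.lab_root] }
  · intro v hv
    by_cases h : v = i
    · rw [h, Di]
    · have hv' : v ∈ treeNodes n i N := mem_treeNodes.2 (.inl (by omega))
      by_cases hvf : v = f
      · rw [hvf, Df, T.leafD f (by omega)]
      have : ¬ Above n i N par f v := by
        intro hU
        obtain ⟨c, -, hc, hp, -⟩ := hU.exists_child hvf
        have := T.parent c hc
        omega
      rw [Do v hv' hvf, if_neg this, T.leafD v (by omega)]
  · intro v hv
    rw [Function.update_of_ne (by omega)]
    by_cases h : v = i
    · rw [h, hlab]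
    · exact T.leafLab v (by omega)
  · intro w h1 h2
    by_cases h : w = N
    · rw [h, Function.update_self]; exact hℓ
    · rw [Function.update_of_ne h]; exact T.innerLab w h1 (by omega)
  · intro c hc
    rcases hcases c hc with rfl | rfl | rfl | ⟨h, h'⟩
    · rw [pari]; omega
    · rw [parN]; omega
    · rw [parf]; omega
    · rw [paro c h h']; have := T.parent c h; omega
  · have hup : ∀ c ∈ treeNodes n i N, par c ≠ n → Above n i N par f c →
        D' (par c) = insert i (D (par c)) := by
      intro c hc hn hU
      have : par c ≠ f := fun h => by subst h; exact hU.antisymm T hc hn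
      rw [Do _ (T.par_mem hc hn) this, if_pos (hU.up hc hn)]
    intro c hc hn
    rcases hcases c hc with rfl | rfl | rfl | ⟨h, h'⟩
    · rw [pari, Di, DN]; simp
    · rw [parN] at hn ⊢
      rw [DN, hup f hf hn .refl]
      exact Finset.insert_subset_insert _ (T.sub f hf hn)
    · rw [parf, Df, DN]; exact Finset.subset_insert _ _
    · rw [paro c h h'] at hn ⊢
      rw [Do c h h']
      split_ifs with hU
      · rw [hup c h hn hU]; exact Finset.insert_subset_insert _ (T.sub c h hn)
      · exact (T.sub c h hn).trans (hDsub _ (T.par_mem h hn))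
  · intro w h1 h2 y hy
    by_cases hwN : w = N
    · subst hwN
      rw [DN] at hy
      rcases Finset.mem_insert.1 hy with rfl | hy
      · exact ⟨y, (hnodes y).2 (.inl rfl), pari, by rw [Di]; simp⟩
      · exact ⟨f, (hnodes f).2 (.inr (.inr hf)), parf, by rwa [Df]⟩
    have h3 : w < N := by omega
    have hw := T.inner_mem h1 h3
    have hold' : ∀ y ∈ D w, ∃ c ∈ treeNodes n (i + 1) (N + 1), par' c = w ∧ y ∈ D' c := by
      intro y hy
      obtain ⟨c, hc, hp, hyc⟩ := T.cover w h1 h3 y hy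
      by_cases hcf : c = f
      · subst hcf
        exact ⟨N, (hnodes N).2 (.inr (.inl rfl)), by rw [parN, hp],
          by rw [DN]; exact Finset.mem_insert_of_mem hyc⟩
      · exact ⟨c, (hnodes c).2 (.inr (.inr hc)), by rw [paro c hc hcf, hp], hDsub c hc hyc⟩
    by_cases hwf : w = f
    · subst hwf; rw [Df] at hy; exact hold' y hy
    rw [Do w hw hwf] at hy
    split_ifs at hy with hU
    · rcases Finset.mem_insert.1 hy with rfl | hy
      · obtain ⟨c, hU', hc, hp, -⟩ := hU.exists_child hwf
        by_cases hcf : c = f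
        · subst hcf
          exact ⟨N, (hnodes N).2 (.inr (.inl rfl)), by rw [parN, hp], by rw [DN]; simp⟩
        · refine ⟨c, (hnodes c).2 (.inr (.inr hc)), by rw [paro c hc hcf, hp], ?_⟩
          rw [Do c hc hcf, if_pos hU']; simp
      · exact hold' y hy
    · exact hold' y hy
  · obtain ⟨r, hr, hp⟩ := T.root
    by_cases hrf : r = f
    · subst hrf
      exact ⟨N, (hnodes N).2 (.inr (.inl rfl)), by rw [parN, hp]⟩
    · exact ⟨r, (hnodes r).2 (.inr (.inr hr)), by rw [paro r hr hrf, hp]⟩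
  · intro c hc hp
    rcases hcases c hc with rfl | rfl | rfl | ⟨h, h'⟩
    · rw [pari] at hp; omega
    · rw [parN] at hp; rw [DN, T.rootD f hf hp, Finset.range_add_one]
    · rw [parf] at hp; omega
    · rw [paro c h h'] at hp
      rw [Do c h h', if_pos (T.above_root hf h hp), T.rootD c h hp, Finset.range_add_one]
  · intro c hc
    rcases hcases c hc with rfl | rfl | rfl | ⟨h, h'⟩
    · rw [Di]; simp
    · rw [DN]; simp
    · rw [Df]; exact T.nonempty c hf
    · exact (T.nonempty c h).mono (hDsub c h)
  · intro w h1 h2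
    by_cases hwN : w = N
    · subst hwN
      have : (treeNodes n (i + 1) (w + 1)).filter (par' · = w) = {i, f} := by
        ext c
        simp only [Finset.mem_filter, Finset.mem_insert, Finset.mem_singleton]
        constructor
        · rintro ⟨hc, hp⟩
          rcases hcases c hc with h | rfl | h | ⟨h, h'⟩
          · exact .inl h
          · rw [parN] at hp; exact absurd hp (hold f hf).2.2.2.2
          · exact .inr h
          · rw [paro c h h'] at hp; exact absurd hp (hold c h).2.2.2.2
        · rintro (rfl | rfl)
          · exact ⟨(hnodes c).2 (.inl rfl), pari⟩
          · exact ⟨(hnodes c).2 (.inr (.inr hf)), parf⟩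
      rw [this, Function.update_self, Finset.card_pair hfi.symm]
    · rw [Function.update_of_ne hwN, T.children w h1 (by omega)]
      have : (treeNodes n (i + 1) (N + 1)).filter (par' · = w) =
          ((treeNodes n i N).filter (par · = w)).image (fun c => if c = f then N else c) := by
        ext c
        simp only [Finset.mem_filter, Finset.mem_image]
        constructor
        · rintro ⟨hc, hp⟩
          rcases hcases c hc with rfl | rfl | rfl | ⟨h, h'⟩
          · rw [pari] at hp; exact absurd hp.symm hwN
          · rw [parN] at hp; exact ⟨f, ⟨hf, hp⟩, by simp⟩
          · rw [parf] at hp; exact absurd hp.symm hwN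
          · rw [paro c h h'] at hp; exact ⟨c, ⟨h, hp⟩, by simp [h']⟩
        · rintro ⟨c', ⟨hc', hp⟩, rfl⟩
          split_ifs with h
          · subst h; exact ⟨(hnodes N).2 (.inr (.inl rfl)), by rw [parN, hp]⟩
          · exact ⟨(hnodes c').2 (.inr (.inr hc')), by rw [paro c' hc' h, hp]⟩
      rw [this, Finset.card_image_of_injOn]
      intro a ha b hb hab
      simp only [Finset.coe_filter, Set.mem_ofPred_eq] at ha hb
      simp only at hab
      split_ifs at hab with h3 h4 h4
      · rw [h3, h4]
      · exact absurd hab.symm (hold b hb.1).2.1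
      · exact absurd hab (hold a ha.1).2.1
      · exact hab
  · intro w h1 h2
    by_cases hwN : w = N
    · rw [hwN, Function.update_self]
    · rw [Function.update_of_ne hwN]; exact T.two_le w h1 (by omega)

end Cotree

/-! ### Regrouping the children of a node -/

namespace Cotree

variable {A : ℕ → ℕ → Prop} {n i N : ℕ} {par lab nch : ℕ → ℕ} {D : ℕ → Finset ℕ}

/-- Moving some children of `u` below a new child `N` of `u`. -/
theorem groupChildren (T : Cotree A n i N par lab nch D) (hsymm : ∀ a b, A a b → A b a)
    {u : ℕ} (hu : n + 2 ≤ u) (huN : u < N) {S : Finset ℕ}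
    (hS : ∀ c ∈ S, c ∈ treeNodes n i N ∧ par c = u) (h2S : 2 ≤ S.card) (hlt : S.card < nch u)
    {par' lab' nch' : ℕ → ℕ} {D' : ℕ → Finset ℕ}
    (parS : ∀ c ∈ S, par' c = N) (parN : par' N = u)
    (paro : ∀ c ∈ treeNodes n i N, c ∉ S → par' c = par c)
    (labN : lab' N = lab u) (labo : ∀ c, c ≠ N → lab' c = lab c)
    (nchN : nch' N = S.card) (nchu : nch' u + S.card = nch u + 1)
    (ncho : ∀ c, c ≠ N → c ≠ u → nch' c = nch c)
    (DN : D' N = S.biUnion D) (Do : ∀ c, c ≠ N → D' c = D c) :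
    Cotree A n i (N + 1) par' lab' nch' D' := by
  have hleN := T.le_N
  have hle := T.le
  have hold : ∀ c ∈ treeNodes n i N, c ≠ N ∧ c ≠ n ∧ par c ≠ N := by
    intro c hc
    have := T.parent c hc
    rcases mem_treeNodes.1 hc with h | h <;> refine ⟨?_, ?_, ?_⟩ <;> omega
  have hnodes : ∀ c, c ∈ treeNodes n i (N + 1) ↔ c = N ∨ c ∈ treeNodes n i N := by
    intro c; simp only [mem_treeNodes]; omega
  have hNS : N ∉ S := fun h => (hold N (hS N h).1).1 rfl
  have hcases : ∀ c, c ∈ treeNodes n i (N + 1) →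
      c = N ∨ c ∈ S ∨ (c ∈ treeNodes n i N ∧ c ∉ S) := by
    intro c hc
    rcases (hnodes c).1 hc with h | h
    · exact .inl h
    · by_cases h' : c ∈ S
      · exact .inr (.inl h')
      · exact .inr (.inr ⟨h, h'⟩)
  have hDS : ∀ c ∈ S, D' c = D c := fun c hc => Do c (hold c (hS c hc).1).1
  have hDO : ∀ c ∈ treeNodes n i N, D' c = D c := fun c hc => Do c (hold c hc).1
  have hlabp : ∀ c ∈ treeNodes n i N, lab' (par c) = lab (par c) :=
    fun c hc => labo _ (hold c hc).2.2
  have hcomm : ∀ a b, A a b ↔ A b a := fun a b => ⟨hsymm a b, hsymm b a⟩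
  have huN' : u ≠ N := by omega
  -- A vertex below `N` lies below some member of `S`, which was a sibling of `c'`, so the old rule
  -- at `u` applies.
  have key1 : ∀ c' ∈ treeNodes n i N, c' ∉ S → par c' = u →
      Disjoint (D' N) (D' c') ∧ ∀ y ∈ D' N, ∀ y' ∈ D' c', (A y y' ↔ lab' u = 2) := by
    intro c' hc' hc'S hp
    rw [DN, hDO c' hc', Finset.disjoint_biUnion_left]
    refine ⟨fun s hs => T.disj s (hS s hs).1 c' hc' (fun h => hc'S (h ▸ hs))
      ((hS s hs).2.trans hp.symm), ?_⟩
    intro y hy y' hy'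
    obtain ⟨s, hs, hy⟩ := Finset.mem_biUnion.1 hy
    have := T.adj s (hS s hs).1 c' hc' (fun h => hc'S (h ▸ hs))
      ((hS s hs).2.trans hp.symm) y hy y' hy'
    rw [this, (hS s hs).2, labo u huN']
  have key : ∀ c ∈ treeNodes n i (N + 1), ∀ c' ∈ treeNodes n i (N + 1), c ≠ c' →
      par' c = par' c' →
      Disjoint (D' c) (D' c') ∧ ∀ y ∈ D' c, ∀ y' ∈ D' c', (A y y' ↔ lab' (par' c) = 2) := by
    intro c hc c' hc' hne hp
    rcases hcases c hc with rfl | h | ⟨h, h'⟩ <;> rcases hcases c' hc' with rfl | g | ⟨g, g'⟩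
    · exact absurd rfl hne
    · rw [parN, parS c' g] at hp; omega
    · rw [parN, paro c' g g'] at hp
      rw [parN]; exact key1 c' g g' hp.symm
    · rw [parN, parS c h] at hp; omega
    · obtain ⟨h1, h2⟩ := hS c h
      obtain ⟨g1, g2⟩ := hS c' g
      rw [hDS c h, hDS c' g, parS c h, labN, ← h2]
      exact ⟨T.disj c h1 c' g1 hne (h2.trans g2.symm), T.adj c h1 c' g1 hne (h2.trans g2.symm)⟩
    · rw [parS c h, paro c' g g'] at hp; exact absurd hp.symm (hold c' g).2.2
    · rw [parN, paro c h h'] at hp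
      obtain ⟨k1, k2⟩ := key1 c h h' hp
      rw [paro c h h', hp]
      exact ⟨k1.symm, fun y hy y' hy' => by rw [hcomm]; exact k2 y' hy' y hy⟩
    · rw [parS c' g, paro c h h'] at hp; exact absurd hp (hold c h).2.2
    · rw [paro c h h', paro c' g g'] at hp
      rw [hDO c h, hDO c' g, paro c h h', hlabp c h]
      exact ⟨T.disj c h c' g hne hp, T.adj c h c' g hne hp⟩
  have hSn : ∀ c ∈ S, par c ≠ n := fun c hc => by rw [(hS c hc).2]; omega
  refine
    { pos := T.pos
      le := hle
      le_N := by omega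
      leafD := fun v hv => by rw [Do v (by omega), T.leafD v hv]
      leafLab := fun v hv => by rw [labo v (by omega), T.leafLab v hv]
      innerLab := ?_
      parent := ?_
      sub := ?_
      cover := ?_
      disj := fun c hc c' hc' h1 h2 => (key c hc c' hc' h1 h2).1
      adj := fun c hc c' hc' h1 h2 => (key c hc c' hc' h1 h2).2
      root := ?_
      rootD := ?_
      nonempty := ?_
      children := ?_
      two_le := ?_
      nch_root := by rw [ncho n (by omega) (by omega), T.nch_root]
      lab_root := by rw [labo n (by omega), T.lab_root] }
  · intro w h1 h2
    by_cases h : w = N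
    · rw [h, labN]; exact T.innerLab u hu huN
    · rw [labo w h]; exact T.innerLab w h1 (by omega)
  · intro c hc
    rcases hcases c hc with rfl | h | ⟨h, h'⟩
    · rw [parN]; omega
    · rw [parS c h]; omega
    · rw [paro c h h']; have := T.parent c h; omega
  · intro c hc hn
    rcases hcases c hc with rfl | h | ⟨h, h'⟩
    · rw [parN, DN, Do u huN', Finset.biUnion_subset]
      intro s hs
      have := T.sub s (hS s hs).1 (hSn s hs)
      rwa [(hS s hs).2] at this
    · rw [parS c h, hDS c h, DN]; exact Finset.subset_biUnion_of_mem D h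
    · rw [paro c h h'] at hn ⊢
      rw [hDO c h, Do _ (hold c h).2.2]; exact T.sub c h hn
  · intro w h1 h2 y hy
    by_cases hwN : w = N
    · subst hwN
      rw [DN] at hy
      obtain ⟨s, hs, hy⟩ := Finset.mem_biUnion.1 hy
      exact ⟨s, (hnodes s).2 (.inr (hS s hs).1), parS s hs, by rwa [hDS s hs]⟩
    · rw [Do w hwN] at hy
      obtain ⟨c, hc, hp, hyc⟩ := T.cover w h1 (by omega) y hy
      by_cases hcS : c ∈ S
      · refine ⟨N, (hnodes N).2 (.inl rfl), ?_, ?_⟩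
        · rw [parN, ← hp, (hS c hcS).2]
        · rw [DN]; exact Finset.mem_biUnion.2 ⟨c, hcS, hyc⟩
      · exact ⟨c, (hnodes c).2 (.inr hc), by rw [paro c hc hcS, hp], by rwa [hDO c hc]⟩
  · obtain ⟨r, hr, hp⟩ := T.root
    exact ⟨r, (hnodes r).2 (.inr hr), by rw [paro r hr (fun h => hSn r h hp), hp]⟩
  · intro c hc hp
    rcases hcases c hc with rfl | h | ⟨h, h'⟩
    · rw [parN] at hp; omega
    · rw [parS c h] at hp; omega
    · rw [paro c h h'] at hp; rw [hDO c h, T.rootD c h hp]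
  · intro c hc
    rcases (hnodes c).1 hc with rfl | h
    · rw [DN]
      obtain ⟨s, hs⟩ : S.Nonempty := Finset.card_pos.1 (by omega)
      exact (T.nonempty s (hS s hs).1).mono (Finset.subset_biUnion_of_mem D hs)
    · rw [hDO c h]; exact T.nonempty c h
  · intro w h1 h2
    by_cases hwN : w = N
    · subst hwN
      rw [nchN]
      congr 1
      ext c
      simp only [Finset.mem_filter]
      refine ⟨fun h => ⟨(hnodes c).2 (.inr (hS c h).1), parS c h⟩, fun ⟨hc, hp⟩ => ?_⟩
      rcases hcases c hc with rfl | h | ⟨h, h'⟩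
      · rw [parN] at hp; omega
      · exact h
      · rw [paro c h h'] at hp; exact absurd hp (hold c h).2.2
    · by_cases hwu : w = u
      · subst hwu
        have h3 : (treeNodes n i (N + 1)).filter (par' · = w) =
            insert N (((treeNodes n i N).filter (par · = w)) \ S) := by
          ext c
          simp only [Finset.mem_filter, Finset.mem_insert, Finset.mem_sdiff]
          constructor
          · rintro ⟨hc, hp⟩
            rcases hcases c hc with rfl | h | ⟨h, h'⟩
            · exact .inl rfl
            · rw [parS c h] at hp; omega
            · rw [paro c h h'] at hp; exact .inr ⟨⟨h, hp⟩, h'⟩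
          · rintro (rfl | ⟨⟨h, hp⟩, h'⟩)
            · exact ⟨(hnodes c).2 (.inl rfl), parN⟩
            · exact ⟨(hnodes c).2 (.inr h), by rw [paro c h h', hp]⟩
        have h4 : S ⊆ (treeNodes n i N).filter (par · = w) := fun s hs =>
          Finset.mem_filter.2 (hS s hs)
        rw [h3, Finset.card_insert_of_notMem, Finset.card_sdiff_of_subset h4,
          ← T.children w h1 huN]
        · omega
        · simp only [Finset.mem_sdiff, Finset.mem_filter]
          exact fun h => (hold N h.1.1).1 rfl
      · rw [ncho w hwN hwu, T.children w h1 (by omega)]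
        congr 1
        ext c
        simp only [Finset.mem_filter]
        constructor
        · rintro ⟨hc, hp⟩
          have : c ∉ S := fun h => hwu (hp.symm.trans (hS c h).2)
          exact ⟨(hnodes c).2 (.inr hc), by rw [paro c hc this, hp]⟩
        · rintro ⟨hc, hp⟩
          rcases hcases c hc with rfl | h | ⟨h, h'⟩
          · rw [parN] at hp; omega
          · rw [parS c h] at hp; omega
          · rw [paro c h h'] at hp; exact ⟨h, hp⟩
  · intro w h1 h2
    by_cases hwN : w = N
    · rw [hwN, nchN]; exact h2S
    · by_cases hwu : w = u
      · subst hwu; omega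
      · rw [ncho w hwN hwu]; exact T.two_le w h1 (by omega)

/-- Moving some children of `u` to a new node `N` with the child `u` in the place of `u`. -/
theorem splitChildren (T : Cotree A n i N par lab nch D) (hsymm : ∀ a b, A a b → A b a)
    {u : ℕ} (hu : n + 2 ≤ u) (huN : u < N) {S : Finset ℕ}
    (hS : ∀ c ∈ S, c ∈ treeNodes n i N ∧ par c = u) (h2S : 1 ≤ S.card)
    (hlt : S.card + 2 ≤ nch u)
    {par' lab' nch' : ℕ → ℕ} {D' : ℕ → Finset ℕ}
    (parS : ∀ c ∈ S, par' c = N) (parN : par' N = par u) (paru : par' u = N)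
    (paro : ∀ c ∈ treeNodes n i N, c ∉ S → c ≠ u → par' c = par c)
    (labN : lab' N = lab u) (labo : ∀ c, c ≠ N → lab' c = lab c)
    (nchN : nch' N = S.card + 1) (nchu : nch' u + S.card = nch u)
    (ncho : ∀ c, c ≠ N → c ≠ u → nch' c = nch c)
    (DN : D' N = D u) (Du : D' u = D u \ S.biUnion D)
    (Do : ∀ c, c ≠ N → c ≠ u → D' c = D c) :
    Cotree A n i (N + 1) par' lab' nch' D' := by
  have hleN := T.le_N
  have hle := T.le
  have hum := T.inner_mem hu huN
  have hold : ∀ c ∈ treeNodes n i N, c ≠ N ∧ c ≠ n ∧ par c ≠ N := by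
    intro c hc
    have := T.parent c hc
    rcases mem_treeNodes.1 hc with h | h <;> refine ⟨?_, ?_, ?_⟩ <;> omega
  have hnodes : ∀ c, c ∈ treeNodes n i (N + 1) ↔ c = N ∨ c ∈ treeNodes n i N := by
    intro c; simp only [mem_treeNodes]; omega
  have hparne : ∀ c ∈ treeNodes n i N, par c ≠ c := fun c hc h =>
    (T.ssub hc (by rw [h]; exact (hold c hc).2.1)).ne (by rw [h])
  have huS : u ∉ S := fun h => hparne u hum (hS u h).2
  have hcases : ∀ c, c ∈ treeNodes n i (N + 1) →
      c = N ∨ c = u ∨ c ∈ S ∨ (c ∈ treeNodes n i N ∧ c ∉ S ∧ c ≠ u) := by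
    intro c hc
    rcases (hnodes c).1 hc with h | h
    · exact .inl h
    · by_cases h' : c ∈ S
      · exact .inr (.inr (.inl h'))
      · by_cases h'' : c = u
        · exact .inr (.inl h'')
        · exact .inr (.inr (.inr ⟨h, h', h''⟩))
  have hDS : ∀ c ∈ S, D' c = D c := fun c hc =>
    Do c (hold c (hS c hc).1).1 (fun h => huS (h ▸ hc))
  have hDO : ∀ c ∈ treeNodes n i N, c ≠ u → D' c = D c := fun c hc => Do c (hold c hc).1
  have hlabp : ∀ c ∈ treeNodes n i N, lab' (par c) = lab (par c) :=
    fun c hc => labo _ (hold c hc).2.2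
  have hcomm : ∀ a b, A a b ↔ A b a := fun a b => ⟨hsymm a b, hsymm b a⟩
  have huN' : u ≠ N := by omega
  have hpu : par u ≠ N := (hold u hum).2.2
  have hSu : ∀ s ∈ S, D s ⊆ D u := fun s hs => by
    have := T.sub s (hS s hs).1 (by rw [(hS s hs).2]; omega)
    rwa [(hS s hs).2] at this
  have hDu : ∀ y ∈ D' u, ∃ c ∈ treeNodes n i N, par c = u ∧ c ∉ S ∧ y ∈ D c := by
    intro y hy
    rw [Du, Finset.mem_sdiff] at hy
    obtain ⟨c, hc, hp, hyc⟩ := T.cover u hu huN y hy.1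
    exact ⟨c, hc, hp, fun h => hy.2 (Finset.mem_biUnion.2 ⟨c, h, hyc⟩), hyc⟩
  have hsubDu : ∀ c ∈ treeNodes n i N, par c = u → c ∉ S → D c ⊆ D' u := by
    intro c hc hp hcS y hy
    rw [Du, Finset.mem_sdiff]
    refine ⟨?_, fun h => ?_⟩
    · have := T.sub c hc (by omega) hy
      rwa [hp] at this
    · obtain ⟨s, hs, hys⟩ := Finset.mem_biUnion.1 h
      exact Finset.disjoint_left.1 (T.disj c hc s (hS s hs).1 (fun h => hcS (h ▸ hs))
        (hp.trans (hS s hs).2.symm)) hy hys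
  -- The vertices that remain below `u` lie below former siblings of the members of `S`. Since `N`
  -- inherits the label of `u`, the old rule at `u` is the new rule at `N`.
  have key1 : ∀ c ∈ S, Disjoint (D' u) (D' c) ∧
      ∀ y ∈ D' u, ∀ y' ∈ D' c, (A y y' ↔ lab' N = 2) := by
    intro c hc
    rw [hDS c hc]
    refine ⟨?_, ?_⟩
    · rw [Du]
      exact Finset.disjoint_left.2 fun y hy hy' =>
        (Finset.mem_sdiff.1 hy).2 (Finset.mem_biUnion.2 ⟨c, hc, hy'⟩)
    · intro y hy y' hy'
      obtain ⟨d, hd, hp, hdS, hyd⟩ := hDu y hy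
      rw [labN, ← hp]
      exact T.adj d hd c (hS c hc).1 (fun h => hdS (h ▸ hc)) (hp.trans (hS c hc).2.symm) y hyd
        y' hy'
  have key2 : ∀ c ∈ treeNodes n i N, c ≠ u → par u = par c → Disjoint (D' N) (D' c) ∧
      ∀ y ∈ D' N, ∀ y' ∈ D' c, (A y y' ↔ lab' (par u) = 2) := by
    intro c hc hcu hp
    rw [DN, hDO c hc hcu, hlabp u hum]
    exact ⟨T.disj u hum c hc hcu.symm hp, T.adj u hum c hc hcu.symm hp⟩
  have key : ∀ c ∈ treeNodes n i (N + 1), ∀ c' ∈ treeNodes n i (N + 1), c ≠ c' →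
      par' c = par' c' →
      Disjoint (D' c) (D' c') ∧ ∀ y ∈ D' c, ∀ y' ∈ D' c', (A y y' ↔ lab' (par' c) = 2) := by
    intro c hc c' hc' hne hp
    rcases hcases c hc with rfl | rfl | h | ⟨h, h', h''⟩ <;>
      rcases hcases c' hc' with rfl | rfl | g | ⟨g, g', g''⟩
    · exact absurd rfl hne
    · rw [parN, paru] at hp; exact absurd hp hpu
    · rw [parN, parS c' g] at hp; exact absurd hp hpu
    · rw [parN, paro c' g g' g''] at hp
      rw [parN]; exact key2 c' g g'' hp
    · rw [parN, paru] at hp; exact absurd hp.symm hpu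
    · exact absurd rfl hne
    · rw [paru]; exact key1 c' g
    · rw [paru, paro c' g g' g''] at hp; exact absurd hp.symm (hold c' g).2.2
    · rw [parN, parS c h] at hp; exact absurd hp.symm hpu
    · obtain ⟨k1, k2⟩ := key1 c h
      rw [parS c h]
      exact ⟨k1.symm, fun y hy y' hy' => by rw [hcomm]; exact k2 y' hy' y hy⟩
    · obtain ⟨h1, h2⟩ := hS c h
      obtain ⟨g1, g2⟩ := hS c' g
      rw [hDS c h, hDS c' g, parS c h, labN, ← h2]
      exact ⟨T.disj c h1 c' g1 hne (h2.trans g2.symm), T.adj c h1 c' g1 hne (h2.trans g2.symm)⟩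
    · rw [parS c h, paro c' g g' g''] at hp; exact absurd hp.symm (hold c' g).2.2
    · rw [parN, paro c h h' h''] at hp
      obtain ⟨k1, k2⟩ := key2 c h h'' hp.symm
      rw [paro c h h' h'', hp]
      exact ⟨k1.symm, fun y hy y' hy' => by rw [hcomm]; exact k2 y' hy' y hy⟩
    · rw [paru, paro c h h' h''] at hp; exact absurd hp (hold c h).2.2
    · rw [parS c' g, paro c h h' h''] at hp; exact absurd hp (hold c h).2.2
    · rw [paro c h h' h'', paro c' g g' g''] at hp
      rw [hDO c h h'', hDO c' g g'', paro c h h' h'', hlabp c h]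
      exact ⟨T.disj c h c' g hne hp, T.adj c h c' g hne hp⟩
  have hcard : ((treeNodes n i (N + 1)).filter (par' · = u)).card = nch' u := by
    have h4 : S ⊆ (treeNodes n i N).filter (par · = u) := fun s hs => Finset.mem_filter.2 (hS s hs)
    have h3 : (treeNodes n i (N + 1)).filter (par' · = u) =
        ((treeNodes n i N).filter (par · = u)) \ S := by
      ext c
      simp only [Finset.mem_filter, Finset.mem_sdiff]
      constructor
      · rintro ⟨hc, hp⟩
        rcases hcases c hc with rfl | rfl | h | ⟨h, h', h''⟩
        · rw [parN] at hp; exact absurd hp (hparne u hum)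
        · rw [paru] at hp; omega
        · rw [parS c h] at hp; omega
        · rw [paro c h h' h''] at hp; exact ⟨⟨h, hp⟩, h'⟩
      · rintro ⟨⟨h, hp⟩, h'⟩
        have : c ≠ u := fun h => hparne c ‹_› (hp.trans h.symm)
        exact ⟨(hnodes c).2 (.inr h), by rw [paro c h h' this, hp]⟩
    rw [h3, Finset.card_sdiff_of_subset h4, ← T.children u hu huN]
    omega
  refine
    { pos := T.pos
      le := hle
      le_N := by omega
      leafD := fun v hv => by rw [Do v (by omega) (by omega), T.leafD v hv]
      leafLab := fun v hv => by rw [labo v (by omega), T.leafLab v hv]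
      innerLab := ?_
      parent := ?_
      sub := ?_
      cover := ?_
      disj := fun c hc c' hc' h1 h2 => (key c hc c' hc' h1 h2).1
      adj := fun c hc c' hc' h1 h2 => (key c hc c' hc' h1 h2).2
      root := ?_
      rootD := ?_
      nonempty := ?_
      children := ?_
      two_le := ?_
      nch_root := by rw [ncho n (by omega) (by omega), T.nch_root]
      lab_root := by rw [labo n (by omega), T.lab_root] }
  · intro w h1 h2
    by_cases h : w = N
    · rw [h, labN]; exact T.innerLab u hu huN
    · rw [labo w h]; exact T.innerLab w h1 (by omega)
  · intro c hc
    have := T.parent u hum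
    rcases hcases c hc with rfl | rfl | h | ⟨h, h', h''⟩
    · rw [parN]; omega
    · rw [paru]; omega
    · rw [parS c h]; omega
    · rw [paro c h h' h'']; have := T.parent c h; omega
  · intro c hc hn
    rcases hcases c hc with rfl | rfl | h | ⟨h, h', h''⟩
    · rw [parN] at hn ⊢
      rw [DN, Do _ hpu (hparne u hum)]; exact T.sub u hum hn
    · rw [paru, DN, Du]; exact Finset.sdiff_subset
    · rw [parS c h, hDS c h, DN]; exact hSu c h
    · rw [paro c h h' h''] at hn ⊢
      rw [hDO c h h'']
      by_cases hp : par c = u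
      · rw [hp]; exact hsubDu c h hp h'
      · rw [Do _ (hold c h).2.2 hp]; exact T.sub c h hn
  · intro w h1 h2 y hy
    by_cases hwN : w = N
    · subst hwN
      rw [DN] at hy
      by_cases hyu : y ∈ D' u
      · exact ⟨u, (hnodes u).2 (.inr hum), paru, hyu⟩
      · rw [Du, Finset.mem_sdiff, not_and, not_not] at hyu
        obtain ⟨s, hs, hy⟩ := Finset.mem_biUnion.1 (hyu hy)
        exact ⟨s, (hnodes s).2 (.inr (hS s hs).1), parS s hs, by rwa [hDS s hs]⟩
    · by_cases hwu : w = u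
      · subst hwu
        obtain ⟨c, hc, hp, hcS, hyc⟩ := hDu y hy
        have : c ≠ w := fun h => hparne c hc (hp.trans h.symm)
        exact ⟨c, (hnodes c).2 (.inr hc), by rw [paro c hc hcS this, hp],
          by rwa [hDO c hc this]⟩
      · rw [Do w hwN hwu] at hy
        obtain ⟨c, hc, hp, hyc⟩ := T.cover w h1 (by omega) y hy
        have hcS : c ∉ S := fun h => hwu (hp.symm.trans (hS c h).2)
        by_cases hcu : c = u
        · subst hcu
          exact ⟨N, (hnodes N).2 (.inl rfl), by rw [parN, hp], by rwa [DN]⟩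
        · exact ⟨c, (hnodes c).2 (.inr hc), by rw [paro c hc hcS hcu, hp],
            by rwa [hDO c hc hcu]⟩
  · obtain ⟨r, hr, hp⟩ := T.root
    by_cases hru : r = u
    · subst hru; exact ⟨N, (hnodes N).2 (.inl rfl), by rw [parN, hp]⟩
    · have : r ∉ S := fun h => by have := (hS r h).2; omega
      exact ⟨r, (hnodes r).2 (.inr hr), by rw [paro r hr this hru, hp]⟩
  · intro c hc hp
    rcases hcases c hc with rfl | rfl | h | ⟨h, h', h''⟩
    · rw [parN] at hp; rw [DN, T.rootD u hum hp]
    · rw [paru] at hp; omega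
    · rw [parS c h] at hp; omega
    · rw [paro c h h' h''] at hp; rw [hDO c h h'', T.rootD c h hp]
  · intro c hc
    by_cases hcN : c = N
    · subst hcN; rw [DN]; exact T.nonempty u hum
    by_cases hcu : c = u
    · subst hcu
      have h4 : S ⊆ (treeNodes n i N).filter (par · = c) :=
        fun s hs => Finset.mem_filter.2 (hS s hs)
      have h5 : S ≠ (treeNodes n i N).filter (par · = c) := by
        rintro rfl
        rw [← T.children c hu huN] at hlt; omega
      obtain ⟨d, hd, hdS⟩ := Finset.exists_of_ssubset (h4.ssubset_of_ne h5)
      obtain ⟨hd, hp⟩ := Finset.mem_filter.1 hd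
      exact (T.nonempty d hd).mono (hsubDu d hd hp hdS)
    · have h := ((hnodes c).1 hc).resolve_left hcN
      rw [hDO c h hcu]; exact T.nonempty c h
  · intro w h1 h2
    by_cases hwN : w = N
    · subst hwN
      rw [nchN, ← Finset.card_insert_of_notMem huS]
      congr 1
      ext c
      simp only [Finset.mem_filter, Finset.mem_insert]
      constructor
      · rintro (rfl | h)
        · exact ⟨(hnodes c).2 (.inr hum), paru⟩
        · exact ⟨(hnodes c).2 (.inr (hS c h).1), parS c h⟩
      · rintro ⟨hc, hp⟩
        rcases hcases c hc with rfl | rfl | h | ⟨h, h', h''⟩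
        · rw [parN] at hp; exact absurd hp hpu
        · exact .inl rfl
        · exact .inr h
        · rw [paro c h h' h''] at hp; exact absurd hp (hold c h).2.2
    · by_cases hwu : w = u
      · subst hwu; exact hcard.symm
      · rw [ncho w hwN hwu, T.children w h1 (by omega)]
        have : (treeNodes n i (N + 1)).filter (par' · = w) =
            ((treeNodes n i N).filter (par · = w)).image (fun c => if c = u then N else c) := by
          ext c
          simp only [Finset.mem_filter, Finset.mem_image]
          constructor
          · rintro ⟨hc, hp⟩
            rcases hcases c hc with rfl | rfl | h | ⟨h, h', h''⟩
            · rw [parN] at hp; exact ⟨u, ⟨hum, hp⟩, by simp⟩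
            · rw [paru] at hp; exact absurd hp.symm hwN
            · rw [parS c h] at hp; exact absurd hp.symm hwN
            · rw [paro c h h' h''] at hp; exact ⟨c, ⟨h, hp⟩, by simp [h'']⟩
          · rintro ⟨c', ⟨hc', hp⟩, rfl⟩
            split_ifs with h
            · subst h; exact ⟨(hnodes N).2 (.inl rfl), by rw [parN, hp]⟩
            · have : c' ∉ S := fun h => hwu (hp.symm.trans (hS c' h).2)
              exact ⟨(hnodes c').2 (.inr hc'), by rw [paro c' hc' this h, hp]⟩
        rw [this, Finset.card_image_of_injOn]
        intro a ha b hb hab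
        simp only [Finset.coe_filter, Set.mem_ofPred_eq] at ha hb
        simp only at hab
        split_ifs at hab with h3 h4 h4
        · rw [h3, h4]
        · exact absurd hab.symm (hold b hb.1).1
        · exact absurd hab (hold a ha.1).1
        · exact hab
  · intro w h1 h2
    by_cases hwN : w = N
    · rw [hwN, nchN]; omega
    · by_cases hwu : w = u
      · subst hwu; omega
      · rw [ncho w hwN hwu]; exact T.two_le w h1 (by omega)

end Cotree

/-! ### Full nodes and lowest candidates -/

/-- The nodes all of whose vertices lie in `X`. -/
noncomputable def fullNodes (n i N : ℕ) (D : ℕ → Finset ℕ) (X : Finset ℕ) : Finset ℕ :=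
  (treeNodes n i N).filter (fun w => D w ⊆ X)

theorem mem_fullNodes {n i N : ℕ} {D : ℕ → Finset ℕ} {X : Finset ℕ} {w : ℕ} :
    w ∈ fullNodes n i N D X ↔ w ∈ treeNodes n i N ∧ D w ⊆ X := by simp [fullNodes]

/-- The nodes that are not full but have a full child. -/
def IsCandidate (n i N : ℕ) (par : ℕ → ℕ) (D : ℕ → Finset ℕ) (X : Finset ℕ) (u : ℕ) : Prop :=
  u ∉ fullNodes n i N D X ∧ ∃ f ∈ fullNodes n i N D X, par f = u

namespace Cotree

variable {A : ℕ → ℕ → Prop} {n i N : ℕ} {par lab nch : ℕ → ℕ} {D : ℕ → Finset ℕ}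

theorem child_full (T : Cotree A n i N par lab nch D) {X : Finset ℕ} {c : ℕ}
    (hc : c ∈ treeNodes n i N) (h : par c ∈ fullNodes n i N D X) : c ∈ fullNodes n i N D X := by
  have h' := mem_fullNodes.1 h
  refine mem_fullNodes.2 ⟨hc, (T.sub c hc fun hn => ?_).trans h'.2⟩
  have := T.le
  have := T.le_N
  rcases mem_treeNodes.1 h'.1 with h | h <;> omega

/-- Each full inner node has at least two children, all of them full. Double counting shows that
there are at most as many full inner nodes as full leaves, and the full leaves lie in `X`. This
bound makes an insertion cost no more than the degree, up to the amortized search. -/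
theorem card_fullNodes_le (T : Cotree A n i N par lab nch D) (X : Finset ℕ) :
    (fullNodes n i N D X).card ≤ 2 * X.card := by
  have hle := T.le
  set F := fullNodes n i N D X with hF
  set I := F.filter (fun w => n + 2 ≤ w) with hI
  have h1 : (F.filter (fun w => ¬ n + 2 ≤ w)).card ≤ X.card := by
    refine Finset.card_le_card fun v hv => ?_
    obtain ⟨hv, hlt⟩ := Finset.mem_filter.1 hv
    obtain ⟨hv, hs⟩ := mem_fullNodes.1 hv
    have : v < i := by rcases mem_treeNodes.1 hv with h | h <;> omega
    rw [T.leafD v this] at hs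
    simpa using hs
  have h2 : I.card + (F.filter (fun w => ¬ n + 2 ≤ w)).card = F.card :=
    Finset.card_filter_add_card_filter_not _
  have h3 : (F.filter (fun c => par c ∈ I)).card =
      ∑ w ∈ I, ((F.filter (fun c => par c ∈ I)).filter (fun c => par c = w)).card :=
    Finset.card_eq_sum_card_fiberwise (fun c hc => by
      have := (Finset.mem_filter.1 hc).2
      exact this)
  have h4 : ∑ w ∈ I, 2 ≤
      ∑ w ∈ I, ((F.filter (fun c => par c ∈ I)).filter (fun c => par c = w)).card := by
    refine Finset.sum_le_sum fun w hw => ?_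
    obtain ⟨hwF, hw2⟩ := Finset.mem_filter.1 hw
    have hwm := (mem_fullNodes.1 hwF).1
    have hwN : w < N := by rcases mem_treeNodes.1 hwm with h | h <;> omega
    have := T.two_le w hw2 hwN
    rw [T.children w hw2 hwN] at this
    refine this.trans (Finset.card_le_card fun c hc => ?_)
    obtain ⟨hc, hp⟩ := Finset.mem_filter.1 hc
    exact Finset.mem_filter.2 ⟨Finset.mem_filter.2 ⟨T.child_full hc (hp ▸ hwF), hp ▸ hw⟩, hp⟩
  have h5 := Finset.card_filter_le F (fun c => par c ∈ I)
  simp only [Finset.sum_const, smul_eq_mul] at h4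
  omega

theorem full_of_children (T : Cotree A n i N par lab nch D) {X : Finset ℕ} {w : ℕ}
    (h1 : n + 2 ≤ w) (h2 : w < N)
    (h : ∀ c ∈ treeNodes n i N, par c = w → c ∈ fullNodes n i N D X) :
    w ∈ fullNodes n i N D X := by
  refine mem_fullNodes.2 ⟨T.inner_mem h1 h2, fun y hy => ?_⟩
  obtain ⟨c, hc, hp, hyc⟩ := T.cover w h1 h2 y hy
  exact (mem_fullNodes.1 (h c hc hp)).2 hyc

/-- Two children of an inner node containing vertices with and without the property `p`. -/
theorem exists_split (T : Cotree A n i N par lab nch D) {w : ℕ} (h1 : n + 2 ≤ w) (h2 : w < N)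
    {p : ℕ → Prop} (ha : ∃ y ∈ D w, p y) (hb : ∃ y ∈ D w, ¬ p y) :
    ∃ a ∈ D w, ∃ b ∈ D w, p a ∧ ¬ p b ∧ (A a b ↔ lab w = 2) := by
  obtain ⟨a, ha, hpa⟩ := ha
  obtain ⟨b, hb, hpb⟩ := hb
  obtain ⟨c, hc, hpc, hac⟩ := T.cover w h1 h2 a ha
  obtain ⟨c', hc', hpc', hbc⟩ := T.cover w h1 h2 b hb
  by_cases hcc : c = c'
  · subst hcc
    -- If both vertices lie below the same child, a vertex `z` below another child replaces `a` or
    -- `b`, depending on whether `z` has the property.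
    obtain ⟨d, hd, hpd, hdc⟩ := T.exists_sibling h1 h2 c
    obtain ⟨z, hz⟩ := T.nonempty d hd
    have hzw : z ∈ D w := hpd ▸ T.sub d hd (by omega) hz
    by_cases hpz : p z
    · refine ⟨z, hzw, b, hb, hpz, hpb, ?_⟩
      rw [T.adj d hd c hc hdc (hpd.trans hpc.symm) z hz b hbc, hpd]
    · refine ⟨a, ha, z, hzw, hpa, hpz, ?_⟩
      rw [T.adj c hc d hd hdc.symm (hpc.trans hpd.symm) a hac z hz, hpc]
  · refine ⟨a, ha, b, hb, hpa, hpb, ?_⟩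
    rw [T.adj c hc c' hc' hcc (hpc.trans hpc'.symm) a hac b hbc, hpc]

/-- Vertices below the parent of `w` but not below `w` see all vertices below `w` alike. -/
theorem adj_outside (T : Cotree A n i N par lab nch D) {w : ℕ} (hw : w ∈ treeNodes n i N)
    (hn : par w ≠ n) {y t : ℕ} (hy : y ∈ D (par w)) (hyw : y ∉ D w) (ht : t ∈ D w) :
    A t y ↔ lab (par w) = 2 := by
  obtain ⟨h1, h2⟩ := T.par_inner hw hn
  obtain ⟨c, hc, hp, hyc⟩ := T.cover _ h1 h2 y hy
  exact T.adj w hw c hc (fun h => hyw (h ▸ hyc)) hp.symm t ht y hyc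

/-- Among the vertices below `w` choose a neighbour `p` and a non-neighbour `r` of the new vertex
such that the label of `w` decides whether `p` and `r` are adjacent. The label of the parent is the
opposite one and decides how both see `y`. If the new vertex disagreed with them about `y`, the four
vertices would induce a path. -/
theorem mixed_step (T : Cotree A n i N par lab nch D) (hsymm : ∀ a b, A a b → A b a)
    (hP4 : P4Free A) (halt : Alternating n i N par lab) {w : ℕ} (hw : w ∈ treeNodes n i N)
    (hn : par w ≠ n) (ha : ∃ y ∈ D w, A i y) (hb : ∃ y ∈ D w, ¬ A i y) {y : ℕ}
    (hy : y ∈ D (par w)) (hyw : y ∉ D w) : A i y ↔ lab (par w) = 2 := by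
  have hw' : n + 2 ≤ w ∧ w < N := by
    rcases mem_treeNodes.1 hw with h | h
    · obtain ⟨a, ha, ha'⟩ := ha
      obtain ⟨b, hb, hb'⟩ := hb
      rw [T.leafD w h, Finset.mem_singleton] at ha hb
      subst ha; subst hb; exact absurd ha' hb'
    · exact h
  obtain ⟨p, hp, r, hr, hpX, hrX, hpr⟩ := T.exists_split hw'.1 hw'.2 ha hb
  have h1 := T.adj_outside hw hn hy hyw hp
  have h2 := T.adj_outside hw hn hy hyw hr
  obtain ⟨h3, h4⟩ := T.par_inner hw hn
  have hl1 := T.innerLab _ h3 h4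
  have hl2 := T.innerLab _ hw'.1 hw'.2
  have hl3 := halt w hw hn
  by_cases hl : lab (par w) = 2
  · refine iff_of_true ?_ hl
    have hpr' : ¬ A p r := fun h => by have := hpr.1 h; omega
    by_contra hyX
    -- r - y - p - i
    have := hP4 r y p i (h2.2 hl) (hsymm _ _ (h1.2 hl)) (hsymm _ _ hpX)
      (fun h => hpr' (hsymm _ _ h)) (fun h => hyX (hsymm _ _ h))
    exact hrX (hsymm _ _ this)
  · refine iff_of_false ?_ hl
    have hpr' : A p r := hpr.2 (by omega)
    intro hyX
    -- r - p - i - y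
    exact hl (h2.1 (hP4 r p i y (hsymm _ _ hpr') (hsymm _ _ hpX) hyX
      (fun h => hrX (hsymm _ _ h)) (fun h => hl (h1.1 h))))

/-- A new vertex that is adjacent to some but not to all vertices below `w` sees the other
vertices as the vertices below `w` do. -/
theorem mixed_outside (T : Cotree A n i N par lab nch D) (hsymm : ∀ a b, A a b → A b a)
    (hP4 : P4Free A) (halt : Alternating n i N par lab) {w : ℕ} (hw : w ∈ treeNodes n i N)
    (ha : ∃ y ∈ D w, A i y) (hb : ∃ y ∈ D w, ¬ A i y) {y t : ℕ}
    (hy : y < i) (hyw : y ∉ D w) (ht : t ∈ D w) : A i y ↔ A t y := by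
  induction hk : i - (D w).card using Nat.strong_induction_on generalizing w with
  | _ k ih =>
    by_cases hn : par w = n
    · rw [T.rootD w hw hn] at hyw; simp at hyw; omega
    by_cases hyp : y ∈ D (par w)
    · rw [T.mixed_step hsymm hP4 halt hw hn ha hb hyp hyw, T.adj_outside hw hn hyp hyw ht]
    -- Adjacency to some but not all vertices passes to the parent, so the argument continues one
    -- level higher.
    · have hs := T.sub w hw hn
      have := Finset.card_lt_card (T.ssub hw hn)
      have := T.card_le (T.par_mem hw hn)
      obtain ⟨a, ha, ha'⟩ := ha
      obtain ⟨b, hb, hb'⟩ := hb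
      exact ih _ (by omega) (T.par_mem hw hn) ⟨a, hs ha, ha'⟩ ⟨b, hs hb, hb'⟩ hyp (hs ht) rfl

theorem not_full_iff (T : Cotree A n i N par lab nch D) {X : Finset ℕ}
    (hX : ∀ y, y ∈ X ↔ y < i ∧ A i y) {w : ℕ} (hw : w ∈ treeNodes n i N) :
    w ∉ fullNodes n i N D X ↔ ∃ y ∈ D w, ¬ A i y := by
  rw [mem_fullNodes, not_and, Finset.not_subset]
  constructor
  · intro h
    obtain ⟨y, hy, hyX⟩ := h hw
    refine ⟨y, hy, fun h => hyX ((hX y).2 ⟨?_, h⟩)⟩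
    simpa using T.sub_range hw hy
  · rintro ⟨y, hy, h⟩ -
    exact ⟨y, hy, fun h' => h ((hX y).1 h').2⟩

/-- The children of a lowest candidate are full or empty. -/
theorem children_homogeneous (T : Cotree A n i N par lab nch D)
    (hsymm : ∀ a b, A a b → A b a) (hP4 : P4Free A) (halt : Alternating n i N par lab)
    {X : Finset ℕ} (hX : ∀ y, y ∈ X ↔ y < i ∧ A i y) {u : ℕ} (hun : u ≠ n)
    (hu : IsCandidate n i N par D X u)
    (hlow : ∀ w, IsCandidate n i N par D X w → par w ≠ u ∧ par (par w) ≠ u)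
    {c : ℕ} (hc : c ∈ treeNodes n i N) (hp : par c = u) (hcX : c ∉ fullNodes n i N D X) :
    ∀ y ∈ D c, ¬ A i y := by
  by_contra! hmix
  obtain ⟨huX, f, hf, hpf⟩ := hu
  have hfm := (mem_fullNodes.1 hf).1
  have hn : par c ≠ n := by omega
  -- a mixed child `d` of a node
  have hfull : ∀ d ∈ treeNodes n i N, par d ≠ n → (∃ y ∈ D d, A i y) →
      d ∉ fullNodes n i N D X →
      ∀ g ∈ treeNodes n i N, par g = par d → g ≠ d →
        (g ∈ fullNodes n i N D X ↔ lab (par d) = 2) := by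
    intro d hd hdn hda hdX g hg hpg hgd
    have hdb := (T.not_full_iff hX hd).1 hdX
    have hdis := T.disj g hg d hd hgd hpg
    have hsub : D g ⊆ D (par d) := hpg ▸ T.sub g hg (by omega)
    have hiff : ∀ y ∈ D g, (A i y ↔ lab (par d) = 2) := fun y hy =>
      T.mixed_step hsymm hP4 halt hd hdn hda hdb (hsub hy) (Finset.disjoint_left.1 hdis hy)
    rw [← not_iff_not, T.not_full_iff hX hg]
    constructor
    · rintro ⟨y, hy, h⟩ h'; exact h ((hiff y hy).2 h')
    · intro h
      obtain ⟨y, hy⟩ := T.nonempty g hg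
      exact ⟨y, hy, fun h' => h ((hiff y hy).1 h')⟩
  have hinner : ∀ d ∈ treeNodes n i N, (∃ y ∈ D d, A i y) → d ∉ fullNodes n i N D X →
      n + 2 ≤ d ∧ d < N := by
    rintro d hd ⟨a, ha, ha'⟩ hdX
    rcases mem_treeNodes.1 hd with h | h
    · obtain ⟨b, hb, hb'⟩ := (T.not_full_iff hX hd).1 hdX
      rw [T.leafD d h, Finset.mem_singleton] at ha hb
      subst ha; subst hb; exact absurd ha' hb'
    · exact h
  -- a mixed node that is not a candidate has a mixed child
  have hdown : ∀ d ∈ treeNodes n i N, (∃ y ∈ D d, A i y) → d ∉ fullNodes n i N D X →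
      ¬ IsCandidate n i N par D X d → ∃ g ∈ treeNodes n i N, par g = d ∧
        (∃ y ∈ D g, A i y) ∧ g ∉ fullNodes n i N D X := by
    intro d hd hda hdX hcand
    obtain ⟨h1, h2⟩ := hinner d hd hda hdX
    obtain ⟨a, ha, ha'⟩ := hda
    obtain ⟨g, hg, hpg, hag⟩ := T.cover d h1 h2 a ha
    exact ⟨g, hg, hpg, ⟨a, hag, ha'⟩, fun h => hcand ⟨hdX, g, h, hpg⟩⟩
  -- Siblings of a mixed node are full iff their parent is series. The full child `f` makes `u`
  -- series; alternation makes the mixed child `c` parallel and its mixed child `d` series. As `d`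
  -- is not a candidate it has a mixed child `e`, but then the siblings of `e` are full and `d` is a
  -- candidate after all. This is why excluding children and grandchildren suffices.
  have h1 : lab u = 2 := by
    have := hfull c hc hn hmix hcX f hfm (hpf.trans hp.symm) (fun h => hcX (h ▸ hf))
    rw [← hp]; exact this.1 hf
  have h2 : ¬ IsCandidate n i N par D X c := fun h => (hlow c h).1 hp
  obtain ⟨d, hd, hpd, hda, hdX⟩ := hdown c hc hmix hcX h2
  have h3 : ¬ IsCandidate n i N par D X d := fun h => (hlow d h).2 (by rw [hpd, hp])
  obtain ⟨e, he, hpe, hea, heX⟩ := hdown d hd hda hdX h3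
  obtain ⟨hc1, hc2⟩ := hinner c hc hmix hcX
  obtain ⟨hd1, hd2⟩ := hinner d hd hda hdX
  have hlc : lab c = 1 := by
    have := halt c hc hn
    rw [hp, h1] at this
    exact (T.innerLab c hc1 hc2).resolve_right this
  have hld : lab d = 2 := by
    have := halt d hd (by omega)
    rw [hpd, hlc] at this
    exact (T.innerLab d hd1 hd2).resolve_left this
  obtain ⟨g, hg, hpg, hge⟩ := T.exists_sibling hd1 hd2 e
  have := (hfull e he (by omega) hea heX g hg (hpg.trans hpe.symm) hge).2 (by rw [hpe, hld])
  exact h3 ⟨hdX, g, this, hpg⟩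

theorem candidate_inner (T : Cotree A n i N par lab nch D) {X : Finset ℕ} {u : ℕ}
    (hu : IsCandidate n i N par D X u) (hun : u ≠ n) : n + 2 ≤ u ∧ u < N := by
  obtain ⟨-, f, hf, rfl⟩ := hu
  exact T.par_inner (mem_fullNodes.1 hf).1 hun

/-- The only child of the artificial node `n` is the root. So `n` can be a candidate only if the new
vertex is adjacent to all earlier vertices. -/
theorem root_full (T : Cotree A n i N par lab nch D) {X : Finset ℕ}
    (hu : IsCandidate n i N par D X n) : ∀ c ∈ treeNodes n i N, c ∈ fullNodes n i N D X := by
  obtain ⟨-, f, hf, hp⟩ := hu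
  obtain ⟨hf, hs⟩ := mem_fullNodes.1 hf
  rw [T.rootD f hf hp] at hs
  exact fun c hc => mem_fullNodes.2 ⟨hc, (T.sub_range hc).trans hs⟩

/-- If the root is full, `n` is the only candidate, and the hypotheses on `par` keep its own parent
and grandparent away from `n`. Otherwise the parent of a largest full node is a candidate, and one
with fewest vertices below it has no candidate among its children and grandchildren, by strict
inclusion. -/
theorem exists_candidate (T : Cotree A n i N par lab nch D) {X : Finset ℕ} (hXi : ∃ y < i, y ∈ X)
    (hpn : par n = n + 1) (hpn1 : par (n + 1) ≠ n) :
    ∃ u, IsCandidate n i N par D X u ∧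
      ∀ w, IsCandidate n i N par D X w → par w ≠ u ∧ par (par w) ≠ u := by
  by_cases hZ : IsCandidate n i N par D X n
  · have hall := T.root_full hZ
    refine ⟨n, hZ, fun w hw => ?_⟩
    have : w = n := by
      by_contra hne
      obtain ⟨h1, h2⟩ := T.candidate_inner hw hne
      exact hw.1 (hall w (T.inner_mem h1 h2))
    rw [this, hpn]
    exact ⟨by omega, hpn1⟩
  · have hne : ∃ u, IsCandidate n i N par D X u := by
      obtain ⟨y, hyi, hyX⟩ := hXi
      have hFne : (fullNodes n i N D X).Nonempty :=
        ⟨y, mem_fullNodes.2 ⟨mem_treeNodes.2 (.inl hyi), by simpa [T.leafD y hyi] using hyX⟩⟩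
      obtain ⟨f, hf, hmax⟩ := Finset.exists_max_image _ (fun w => (D w).card) hFne
      refine ⟨par f, fun h => ?_, f, hf, rfl⟩
      have hfm := (mem_fullNodes.1 hf).1
      have hle := T.le
      have hle' := T.le_N
      have hn : par f ≠ n := fun hn => by
        rw [hn] at h
        rcases mem_treeNodes.1 (mem_fullNodes.1 h).1 with h | h <;> omega
      have := Finset.card_lt_card (T.ssub hfm hn)
      have := hmax _ h
      omega
    classical
    obtain ⟨u, hu, hmin⟩ : ∃ u, IsCandidate n i N par D X u ∧
        ∀ w, IsCandidate n i N par D X w → (D u).card ≤ (D w).card := by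
      have hex : ∃ k, ∃ u, IsCandidate n i N par D X u ∧ (D u).card = k :=
        ⟨_, hne.choose, hne.choose_spec, rfl⟩
      obtain ⟨u, hu, hk⟩ := Nat.find_spec hex
      exact ⟨u, hu, fun w hw => by rw [hk]; exact Nat.find_min' hex ⟨w, hw, rfl⟩⟩
    refine ⟨u, hu, fun w hw => ?_⟩
    have hun : u ≠ n := fun h => hZ (h ▸ hu)
    have hwn : w ≠ n := fun h => hZ (h ▸ hw)
    obtain ⟨hw1, hw2⟩ := T.candidate_inner hw hwn
    have hwm := T.inner_mem hw1 hw2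
    have hle := hmin w hw
    have hle' := T.le
    obtain ⟨hu1, hu2⟩ := T.candidate_inner hu hun
    refine ⟨fun h => ?_, fun h => ?_⟩
    · have := Finset.card_lt_card (T.ssub hwm (by omega))
      rw [h] at this; omega
    · by_cases h' : par w = n
      · rw [h', hpn] at h; rw [← h] at hu1; omega
      · have e1 := Finset.card_lt_card (T.ssub hwm h')
        have e2 := Finset.card_lt_card (T.ssub (T.par_mem hwm h') (by omega))
        rw [h] at e2; omega

open Classical in
/-- The part of a lowest candidate with which the new vertex is to be combined. -/
theorem lowest_candidate (T : Cotree A n i N par lab nch D)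
    (hsymm : ∀ a b, A a b → A b a) (hP4 : P4Free A) (halt : Alternating n i N par lab)
    {X : Finset ℕ} (hX : ∀ y, y ∈ X ↔ y < i ∧ A i y) {u : ℕ} (hun : u ≠ n)
    (hu : IsCandidate n i N par D X u)
    (hlow : ∀ w, IsCandidate n i N par D X w → par w ≠ u ∧ par (par w) ≠ u)
    {S B : Finset ℕ} (hS : S = (fullNodes n i N D X).filter (par · = u))
    (hB : B = if lab u = 2 then D u \ S.biUnion D else S.biUnion D) :
    (∀ y ∈ B, (A i y ↔ lab u = 1)) ∧ (∀ y < i, y ∉ B → ∀ t ∈ B, (A i y ↔ A t y)) ∧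
      1 ≤ S.card ∧ S.card < nch u := by
  obtain ⟨hu1, hu2⟩ := T.candidate_inner hu hun
  have hum := T.inner_mem hu1 hu2
  have hhom := fun c => T.children_homogeneous hsymm hP4 halt hX hun hu hlow (c := c)
  have hl := T.innerLab u hu1 hu2
  have hSX : ∀ y ∈ S.biUnion D, A i y := by
    intro y hy
    obtain ⟨s, hs, hy⟩ := Finset.mem_biUnion.1 hy
    rw [hS, Finset.mem_filter] at hs
    exact ((hX y).1 ((mem_fullNodes.1 hs.1).2 hy)).2
  have hSE : ∀ y ∈ D u, y ∉ S.biUnion D → ¬ A i y := by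
    intro y hy hyS
    obtain ⟨c, hc, hp, hyc⟩ := T.cover u hu1 hu2 y hy
    refine hhom c hc hp (fun h => hyS ?_) y hyc
    exact Finset.mem_biUnion.2 ⟨c, by rw [hS, Finset.mem_filter]; exact ⟨h, hp⟩, hyc⟩
  have hSu : S.biUnion D ⊆ D u := by
    intro y hy
    obtain ⟨s, hs, hy⟩ := Finset.mem_biUnion.1 hy
    rw [hS, Finset.mem_filter] at hs
    have := T.sub s (mem_fullNodes.1 hs.1).1 (by omega) hy
    rwa [hs.2] at this
  have hadj : ∀ y ∈ S.biUnion D, ∀ t ∈ D u, t ∉ S.biUnion D → (A t y ↔ lab u = 2) := by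
    intro y hy t ht htS
    obtain ⟨s, hs, hy⟩ := Finset.mem_biUnion.1 hy
    obtain ⟨c, hc, hp, htc⟩ := T.cover u hu1 hu2 t ht
    have hs' := hs
    rw [hS, Finset.mem_filter] at hs'
    rw [T.adj c hc s (mem_fullNodes.1 hs'.1).1
      (fun h => htS (Finset.mem_biUnion.2 ⟨c, h ▸ hs, htc⟩)) (hp.trans hs'.2.symm) t htc y hy, hp]
  obtain ⟨huX, f, hf, hpf⟩ := hu
  have hfS : f ∈ S := by rw [hS, Finset.mem_filter]; exact ⟨hf, hpf⟩
  have hSsub : S ⊆ (treeNodes n i N).filter (par · = u) := by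
    intro s hs
    rw [hS, Finset.mem_filter] at hs
    exact Finset.mem_filter.2 ⟨(mem_fullNodes.1 hs.1).1, hs.2⟩
  have hcard : S.card < nch u := by
    rw [T.children u hu1 hu2]
    refine Finset.card_lt_card (hSsub.ssubset_of_ne fun h => huX ?_)
    refine T.full_of_children hu1 hu2 fun c hc hp => ?_
    have : c ∈ S := by rw [h]; exact Finset.mem_filter.2 ⟨hc, hp⟩
    rw [hS] at this
    exact (Finset.mem_filter.1 this).1
  have hfm := (mem_fullNodes.1 hf).1
  have hmixa : ∃ y ∈ D u, A i y := by
    obtain ⟨y, hy⟩ := T.nonempty f hfm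
    have hyS := Finset.mem_biUnion.2 ⟨f, hfS, hy⟩
    exact ⟨y, hSu hyS, hSX y hyS⟩
  have hmixb := (T.not_full_iff hX hum).1 huX
  have hcomm : ∀ a b, A a b ↔ A b a := fun a b => ⟨hsymm a b, hsymm b a⟩
  -- The new vertex sees everything below the full children and nothing else below `u`, so its
  -- relation to `B` is the one of the label opposite to that of `u`. To the rest of `D u` it is
  -- related as `B` is, namely according to the label of `u`, and outside `D u` the lemma
  -- `mixed_outside` applies because `u` is mixed.
  refine ⟨?_, ?_, Finset.card_pos.2 ⟨f, hfS⟩, hcard⟩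
  · intro y hy
    rw [hB] at hy
    split_ifs at hy with h2
    · obtain ⟨hyu, hyS⟩ := Finset.mem_sdiff.1 hy
      exact iff_of_false (hSE y hyu hyS) (by omega)
    · exact iff_of_true (hSX y hy) (by omega)
  · intro y hyi hyB t ht
    have htu : t ∈ D u := by
      rw [hB] at ht
      split_ifs at ht with h2
      · exact (Finset.mem_sdiff.1 ht).1
      · exact hSu ht
    by_cases hyu : y ∈ D u
    · rw [hB] at hyB ht
      split_ifs at hyB ht with h2
      · have hyS : y ∈ S.biUnion D := by
          by_contra h; exact hyB (Finset.mem_sdiff.2 ⟨hyu, h⟩)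
        obtain ⟨-, htS⟩ := Finset.mem_sdiff.1 ht
        exact iff_of_true (hSX y hyS) ((hadj y hyS t htu htS).2 h2)
      · refine iff_of_false (hSE y hyu hyB) fun h => h2 ?_
        exact (hadj t ht y hyu hyB).1 ((hcomm _ _).1 h)
    · exact T.mixed_outside hsymm hP4 halt hum hmixa hmixb hyi hyu htu

end Cotree

/-! ### Finding the full nodes by counting full children -/

/-- The number of `j < h` such that the parent of `q j` is `p`. -/
def childCount (par q : ℕ → ℕ) (h p : ℕ) : ℕ :=
  ((Finset.range h).filter (fun j => par (q j) = p)).card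

theorem childCount_zero (par q : ℕ → ℕ) (p : ℕ) : childCount par q 0 p = 0 := by
  simp [childCount]

theorem childCount_succ (par q : ℕ → ℕ) (h p : ℕ) :
    childCount par q (h + 1) p = childCount par q h p + if par (q h) = p then 1 else 0 := by
  unfold childCount
  rw [Finset.range_add_one, Finset.filter_insert]
  split_ifs
  · rw [Finset.card_insert_of_notMem (by simp)]
  · simp

theorem childCount_congr {par q q' : ℕ → ℕ} {h : ℕ} (hq : ∀ j < h, q' j = q j) (p : ℕ) :
    childCount par q' h p = childCount par q h p := by
  unfold childCount
  congr 1
  refine Finset.filter_congr fun j hj => ?_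
  rw [hq j (Finset.mem_range.1 hj)]

/-- The queue `q` of length `m` contains full nodes, its first `h` entries have been counted in the
counters of their parents, and an inner node enters the queue when its counter is complete. Counters
and flags are valid if they have the stamp `σ`. -/
structure Marking (n i N : ℕ) (par nch : ℕ → ℕ) (D : ℕ → Finset ℕ) (X : Finset ℕ)
    (σ : ℕ) (q : ℕ → ℕ) (m h : ℕ) (cnt cst full : ℕ → ℕ) : Prop where
  le : h ≤ m
  full_mem : ∀ j < m, q j ∈ fullNodes n i N D X
  inj : ∀ j < m, ∀ j' < m, q j = q j' → j = j'
  leaf : ∀ y ∈ X, ∃ j < m, q j = y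
  inner : ∀ p, n + 2 ≤ p → p < N → ((∃ j < m, q j = p) ↔ childCount par q h p = nch p)
  order : ∀ j < m, n + 2 ≤ q j → ∀ c ∈ treeNodes n i N, par c = q j → ∃ j' < j, q j' = c
  count : ∀ p, (if cst p = σ then cnt p else 0) = childCount par q h p
  stamp : ∀ p, cst p ≤ σ
  flag : ∀ w, full w = σ ↔ ∃ j < m, q j = w
  flag_le : ∀ w, full w ≤ σ

namespace Marking

variable {A : ℕ → ℕ → Prop} {n i N : ℕ} {par lab nch : ℕ → ℕ} {D : ℕ → Finset ℕ}
  {X : Finset ℕ} {σ m h : ℕ} {q cnt cst full : ℕ → ℕ}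

/-- The queue injects the counted positions into the children of `p`. So the count never exceeds the
number of children, and by the pigeonhole principle equality means that every child has been
counted. -/
theorem children_of_count (T : Cotree A n i N par lab nch D)
    (hfull : ∀ j < m, q j ∈ fullNodes n i N D X)
    (hinj : ∀ j < m, ∀ j' < m, q j = q j' → j = j') (hle : h ≤ m) {p : ℕ}
    (h1 : n + 2 ≤ p) (h2 : p < N) :
    childCount par q h p ≤ nch p ∧ (childCount par q h p = nch p →
      ∀ c ∈ treeNodes n i N, par c = p → ∃ j < h, q j = c) := by
  rw [T.children p h1 h2]
  have hmaps : Set.MapsTo q ↑((Finset.range h).filter (fun j => par (q j) = p))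
      ↑((treeNodes n i N).filter (par · = p)) := by
    intro j hj
    simp only [Finset.coe_filter, Finset.mem_range, Set.mem_ofPred_eq] at hj ⊢
    exact ⟨(mem_fullNodes.1 (hfull j (by omega))).1, hj.2⟩
  have hinj' : Set.InjOn q ↑((Finset.range h).filter (fun j => par (q j) = p)) := by
    intro a ha b hb hab
    simp only [Finset.coe_filter, Finset.mem_range, Set.mem_ofPred_eq] at ha hb
    exact hinj a (by omega) b (by omega) hab
  refine ⟨Finset.card_le_card_of_injOn q hmaps hinj', fun heq c hc hp => ?_⟩
  have hs := Finset.surj_on_of_inj_on_of_card_le (s := (Finset.range h).filter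
    (fun j => par (q j) = p)) (t := (treeNodes n i N).filter (par · = p)) (fun j _ => q j)
    (fun j hj => hmaps hj) (fun a b ha hb hab => hinj' ha hb hab) (le_of_eq heq.symm) c
    (Finset.mem_filter.2 ⟨hc, hp⟩)
  obtain ⟨j, hj, rfl⟩ := hs
  exact ⟨j, Finset.mem_range.1 (Finset.mem_filter.1 hj).1, rfl⟩

theorem card_le (M : Marking n i N par nch D X σ q m h cnt cst full) :
    m ≤ (fullNodes n i N D X).card := by
  have := Finset.card_le_card_of_injOn (s := Finset.range m) (t := fullNodes n i N D X) q
    (fun j hj => M.full_mem j (by simpa using hj))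
    (fun a ha b hb hab => M.inj a (by simpa using ha) b (by simpa using hb) hab)
  simpa using this

/-- Counting the entry `h`, without a new entry of the queue. -/
theorem step_skip (T : Cotree A n i N par lab nch D)
    (M : Marking n i N par nch D X σ q m h cnt cst full) (hlt : h < m) {c : ℕ}
    (hc : c = (if cst (par (q h)) = σ then cnt (par (q h)) else 0) + 1)
    (hne : c ≠ nch (par (q h))) :
    Marking n i N par nch D X σ q m (h + 1) (Function.update cnt (par (q h)) c)
      (Function.update cst (par (q h)) σ) full := by
  have hcc : c = childCount par q (h + 1) (par (q h)) := by
    rw [hc, M.count, childCount_succ, if_pos rfl]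
  refine
    { le := hlt
      full_mem := M.full_mem
      inj := M.inj
      leaf := M.leaf
      inner := fun p h1 h2 => ?_
      order := M.order
      count := fun p => ?_
      stamp := fun p => ?_
      flag := M.flag
      flag_le := M.flag_le }
  · rw [M.inner p h1 h2, childCount_succ]
    split_ifs with hp
    · subst hp
      -- Neither side can hold: a count that was complete before would now exceed the number of
      -- children, and the new count is not complete by `hne`.
      refine iff_of_false (fun heq => ?_) (fun heq => ?_)
      · have := (children_of_count T M.full_mem M.inj (show h + 1 ≤ m from hlt) h1 h2).1
        rw [childCount_succ, if_pos rfl] at this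
        omega
      · rw [childCount_succ, if_pos rfl] at hcc; omega
    · simp
  · by_cases hp : p = par (q h)
    · subst hp; simp [hcc]
    · rw [Function.update_of_ne hp, Function.update_of_ne hp, M.count, childCount_succ,
        if_neg (Ne.symm hp), add_zero]
  · rw [Function.update_apply]; split_ifs
    · exact le_rfl
    · exact M.stamp p

/-- Counting the entry `h`, whose parent enters the queue. -/
theorem step_push (T : Cotree A n i N par lab nch D)
    (M : Marking n i N par nch D X σ q m h cnt cst full) (hlt : h < m) {c : ℕ}
    (hc : c = (if cst (par (q h)) = σ then cnt (par (q h)) else 0) + 1)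
    (heq : c = nch (par (q h))) :
    Marking n i N par nch D X σ (Function.update q m (par (q h))) (m + 1) (h + 1)
      (Function.update cnt (par (q h)) c)
      (Function.update cst (par (q h)) σ) (Function.update full (par (q h)) σ) := by
  have hcc : c = childCount par q (h + 1) (par (q h)) := by
    rw [hc, M.count, childCount_succ, if_pos rfl]
  -- The artificial node has `nch n = 0` while the counter is already positive, so it never counts
  -- as complete and never enters the queue.
  have hpn : par (q h) ≠ n := fun hn => by rw [hn, T.nch_root] at heq; omega
  have hm := (mem_fullNodes.1 (M.full_mem h hlt)).1
  obtain ⟨hp1, hp2⟩ := T.par_inner hm hpn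
  have hch := (children_of_count T M.full_mem M.inj (show h + 1 ≤ m from hlt) hp1 hp2).2
    (by omega)
  have hpfull : par (q h) ∈ fullNodes n i N D X := by
    refine T.full_of_children hp1 hp2 fun c hc hp => ?_
    obtain ⟨j, hj, rfl⟩ := hch c hc hp
    exact M.full_mem j (by omega)
  have hpnew : ∀ j < m, q j ≠ par (q h) := by
    intro j hj hjp
    have := (M.inner _ hp1 hp2).1 ⟨j, hj, hjp⟩
    rw [childCount_succ, if_pos rfl] at hcc
    omega
  set p := par (q h) with hpdef
  set q' := Function.update q m p with hq'
  have q'm : q' m = p := by simp [hq']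
  have q'o : ∀ j < m, q' j = q j := fun j hj => by
    rw [hq', Function.update_of_ne (by omega)]
  have hcong : ∀ p', childCount par q' (h + 1) p' = childCount par q (h + 1) p' :=
    fun p' => childCount_congr (fun j hj => q'o j (by omega)) p'
  have hex : ∀ w, (∃ j < m + 1, q' j = w) ↔ w = p ∨ ∃ j < m, q j = w := by
    intro w
    constructor
    · rintro ⟨j, hj, rfl⟩
      by_cases hjm : j = m
      · left; rw [hjm, q'm]
      · right; exact ⟨j, by omega, (q'o j (by omega)).symm⟩
    · rintro (rfl | ⟨j, hj, rfl⟩)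
      · exact ⟨m, by omega, q'm⟩
      · exact ⟨j, by omega, q'o j hj⟩
  refine
    { le := by omega
      full_mem := fun j hj => ?_
      inj := fun j hj j' hj' hjj => ?_
      leaf := fun y hy => (hex y).2 (.inr (M.leaf y hy))
      inner := fun p' h1 h2 => ?_
      order := fun j hj hin c hc hp => ?_
      count := fun p' => ?_
      stamp := fun p' => ?_
      flag := fun w => ?_
      flag_le := fun w => ?_ }
  · by_cases hjm : j = m
    · rw [hjm, q'm]; exact hpfull
    · rw [q'o j (by omega)]; exact M.full_mem j (by omega)
  · by_cases hjm : j = m <;> by_cases hjm' : j' = m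
    · omega
    · rw [hjm, q'm, q'o j' (by omega)] at hjj; exact absurd hjj.symm (hpnew j' (by omega))
    · rw [hjm', q'm, q'o j (by omega)] at hjj; exact absurd hjj (hpnew j (by omega))
    · rw [q'o j (by omega), q'o j' (by omega)] at hjj
      exact M.inj j (by omega) j' (by omega) hjj
  · rw [hex, M.inner p' h1 h2, hcong, childCount_succ]
    by_cases hp : p' = p
    · subst hp
      rw [if_pos rfl]
      rw [childCount_succ, if_pos rfl] at hcc
      simp only [true_or, true_iff]; omega
    · rw [if_neg (Ne.symm hp)]; simp [hp]
  · by_cases hjm : j = m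
    · rw [hjm, q'm] at hp
      obtain ⟨j', hj', rfl⟩ := hch c hc hp
      exact ⟨j', by omega, q'o j' (by omega)⟩
    · have hjlt : j < m := by omega
      rw [q'o j hjlt] at hp hin
      obtain ⟨j', hj', rfl⟩ := M.order j hjlt hin c hc hp
      exact ⟨j', hj', q'o j' (by omega)⟩
  · rw [hcong]
    by_cases hp : p' = p
    · subst hp; simp [hcc]
    · rw [Function.update_of_ne hp, Function.update_of_ne hp, M.count, childCount_succ,
        if_neg (Ne.symm hp), add_zero]
  · rw [Function.update_apply]; split_ifs
    · exact le_rfl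
    · exact M.stamp p'
  · rw [hex, ← M.flag w, Function.update_apply]
    split_ifs with hw
    · simp [hw]
    · simp [hw]
  · rw [Function.update_apply]; split_ifs
    · exact le_rfl
    · exact M.flag_le w

/-- When all entries have been counted, the queue contains all full nodes. -/
theorem complete (T : Cotree A n i N par lab nch D)
    (M : Marking n i N par nch D X σ q m m cnt cst full) {w : ℕ} :
    (∃ j < m, q j = w) ↔ w ∈ fullNodes n i N D X := by
  constructor
  · rintro ⟨j, hj, rfl⟩; exact M.full_mem j hj
  · intro hw
    induction hk : (D w).card using Nat.strong_induction_on generalizing w with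
    | _ k ih =>
      obtain ⟨hwm, hs⟩ := mem_fullNodes.1 hw
      rcases mem_treeNodes.1 hwm with hlt | ⟨h1, h2⟩
      · exact M.leaf w (hs (by simp [T.leafD w hlt]))
      · rw [M.inner w h1 h2]
        refine le_antisymm (children_of_count T M.full_mem M.inj le_rfl h1 h2).1 ?_
        rw [T.children w h1 h2]
        have : (treeNodes n i N).filter (par · = w) ⊆
            ((Finset.range m).filter (fun j => par (q j) = w)).image q := by
          intro c hc
          obtain ⟨hc, hp⟩ := Finset.mem_filter.1 hc
          have hlt := Finset.card_lt_card (T.ssub hc (by omega))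
          rw [hp] at hlt
          obtain ⟨j, hj, rfl⟩ := ih _ (by omega) (T.child_full hc (by rwa [hp])) rfl
          exact Finset.mem_image.2 ⟨j, Finset.mem_filter.2 ⟨Finset.mem_range.2 hj, hp⟩, rfl⟩
        exact (Finset.card_le_card this).trans Finset.card_image_le

/-- When all entries are processed, the queue enumerates the full nodes without repetition. The
program relies on the resulting counter values to tell how many children of a candidate are full. -/
theorem count_eq (T : Cotree A n i N par lab nch D)
    (M : Marking n i N par nch D X σ q m m cnt cst full) (p : ℕ) :
    childCount par q m p = ((fullNodes n i N D X).filter (par · = p)).card := by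
  have : (fullNodes n i N D X).filter (par · = p) =
      ((Finset.range m).filter (fun j => par (q j) = p)).image q := by
    ext c
    simp only [Finset.mem_filter, Finset.mem_image, Finset.mem_range, ← M.complete T]
    constructor
    · rintro ⟨⟨j, hj, rfl⟩, hp⟩; exact ⟨j, ⟨hj, hp⟩, rfl⟩
    · rintro ⟨j, ⟨hj, hp⟩, rfl⟩; exact ⟨⟨j, hj, rfl⟩, hp⟩
  rw [this, Finset.card_image_of_injOn]
  · rfl
  · intro a ha b hb hab
    simp only [Finset.coe_filter, Finset.mem_range, Set.mem_ofPred_eq] at ha hb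
    exact M.inj a ha.1 b hb.1 hab

/-- Parents of entries are candidates iff their counters are not complete. -/
theorem candidate_iff (T : Cotree A n i N par lab nch D)
    (M : Marking n i N par nch D X σ q m m cnt cst full) {j : ℕ} (hj : j < m) :
    cst (par (q j)) = σ ∧ (cnt (par (q j)) ≠ nch (par (q j)) ↔
      IsCandidate n i N par D X (par (q j))) := by
  have hpos : 0 < childCount par q m (par (q j)) :=
    Finset.card_pos.2 ⟨j, Finset.mem_filter.2 ⟨Finset.mem_range.2 hj, rfl⟩⟩
  have hc := M.count (par (q j))
  have hst : cst (par (q j)) = σ := by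
    by_contra h; rw [if_neg h] at hc; omega
  rw [if_pos hst] at hc
  refine ⟨hst, ?_⟩
  have hqm := (mem_fullNodes.1 (M.full_mem j hj)).1
  by_cases hn : par (q j) = n
  -- Here too `nch n = 0` is chosen so that the artificial node passes the test for candidates as
  -- soon as its child, the root, is full.
  · refine iff_of_true ?_ ⟨?_, q j, M.full_mem j hj, rfl⟩
    · rw [hn] at hpos hc ⊢; rw [T.nch_root]; omega
    · rw [hn]
      intro h
      have := T.le
      rcases mem_treeNodes.1 (mem_fullNodes.1 h).1 with h | h <;> omega
  · obtain ⟨h1, h2⟩ := T.par_inner hqm hn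
    rw [hc, Ne, ← M.inner _ h1 h2, M.complete T]
    exact ⟨fun h => ⟨h, q j, M.full_mem j hj, rfl⟩, fun h => h.1⟩

end Marking

set_option linter.unusedSimpArgs false

/-! ## The construction of the cotree: the program

Names of the arrays and registers. -/

local notation "aPar" => (3 : ℕ)
local notation "aLab" => (4 : ℕ)
local notation "aNch" => (5 : ℕ)
local notation "aHead" => (6 : ℕ)
local notation "aCell" => (7 : ℕ)
local notation "aNxt" => (8 : ℕ)
local notation "aCnt" => (9 : ℕ)
local notation "aCst" => (10 : ℕ)
local notation "aFull" => (11 : ℕ)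
local notation "aMark" => (12 : ℕ)
local notation "aQueue" => (13 : ℕ)
local notation "rVerts" => (0 : ℕ)
local notation "rNew" => (1 : ℕ)
local notation "rNode" => (2 : ℕ)
local notation "rCell" => (3 : ℕ)
local notation "rLen" => (4 : ℕ)
local notation "rPos" => (5 : ℕ)
local notation "rLow" => (6 : ℕ)
local notation "rPart" => (7 : ℕ)
local notation "rTmp" => (8 : ℕ)
local notation "rLab" => (9 : ℕ)
local notation "rDest" => (10 : ℕ)
local notation "rEnd" => (11 : ℕ)

namespace RAM

open Program NatExpr

/-- Append register `rTmp` to the queue. -/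
def enqueue : Program := seqList
  [setArr aQueue (reg rLen) (reg rTmp),
   setArr aFull (reg rTmp) (succ (reg rNew)),
   setReg rLen (succ (reg rLen))]

/-- Count the current entry of the queue in the counter of its parent. -/
def markBody : Program := seqList
  [setReg rTmp (read aPar (read aQueue (reg rPos))),
   ite (.eq (read aCst (reg rTmp)) (succ (reg rNew))) skip
     (seqList [setArr aCst (reg rTmp) (succ (reg rNew)), setArr aCnt (reg rTmp) (const 0)]),
   setArr aCnt (reg rTmp) (succ (read aCnt (reg rTmp))),
   ite (.eq (read aCnt (reg rTmp)) (read aNch (reg rTmp))) enqueue skip,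
   setReg rPos (succ (reg rPos))]

/-- Find all full nodes. -/
def markFull : Program := seqList
  [setReg rPos (const 0), loop (.lt (reg rPos) (reg rLen)) markBody]

/-- The queue grows while it is processed, so the potential counts down from the number of all full
nodes, which bounds its length at any time. That number is at most twice the size of `X`. -/
theorem runs_markFull {A : ℕ → ℕ → Prop} {n i N : ℕ} {par lab nch : ℕ → ℕ} {D : ℕ → Finset ℕ}
    {X : Finset ℕ} {σ : ℕ} (T : Cotree A n i N par lab nch D) (s : State)
    (hpar : s.arr aPar = par) (hnch : s.arr aNch = nch) (hσ : s.reg rNew + 1 = σ)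
    (M : Marking n i N par nch D X σ (s.arr aQueue) (s.reg rLen) 0 (s.arr aCnt) (s.arr aCst)
      (s.arr aFull)) :
    ∃ s' t, Runs markFull s s' t ∧
      Marking n i N par nch D X σ (s'.arr aQueue) (s'.reg rLen) (s'.reg rLen) (s'.arr aCnt)
        (s'.arr aCst) (s'.arr aFull) ∧ t ≤ 100 * X.card + 10 := by
  set K := (fullNodes n i N D X).card with hK
  obtain ⟨h, s', t, hr, ⟨M', -, -, -, hpos⟩, hnb, ht⟩ :=
    runs_loop (b := .lt (reg rPos) (reg rLen)) (P := markBody)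
    (fun (h : ℕ) s => Marking n i N par nch D X σ (s.arr aQueue) (s.reg rLen) h (s.arr aCnt)
      (s.arr aCst) (s.arr aFull) ∧ s.arr aPar = par ∧ s.arr aNch = nch ∧ s.reg rNew + 1 = σ ∧
      s.reg rPos = h)
    (fun h _ => 50 * (K - h))
    (by
      rintro h s ⟨M, hpar, hnch, hσ, hpos⟩ hlt
      simp only [Test.holds, NatExpr.eval, hpos] at hlt
      obtain ⟨t, hr, ht⟩ := runs_exec (P := markBody) rfl s
      have hKm := M.card_le
      refine ⟨h + 1, _, t, hr, ?_, ?_⟩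
      · by_cases h1 : s.arr aCst (par (s.arr aQueue h)) = σ
        · have e : Function.update (s.arr aCst) (par (s.arr aQueue h)) σ = s.arr aCst := by
            rw [← h1]; exact Function.update_eq_self _ _
          by_cases h2 : s.arr aCnt (par (s.arr aQueue h)) + 1 = nch (par (s.arr aQueue h))
          · have := M.step_push T hlt (c := s.arr aCnt (par (s.arr aQueue h)) + 1)
              (by rw [if_pos h1]) h2
            simp only [markBody, enqueue, seqList, exec, NatExpr.eval, Test.holds, State.setReg_reg,
              State.setReg_arr, State.setArr_reg, State.setArr_arr, hpar, hnch, hσ, hpos]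
            simpa [h1, h2, hσ, hpos, hpar, hnch, e] using this
          · have := M.step_skip T hlt (c := s.arr aCnt (par (s.arr aQueue h)) + 1)
              (by rw [if_pos h1]) h2
            simp only [markBody, enqueue, seqList, exec, NatExpr.eval, Test.holds, State.setReg_reg,
              State.setReg_arr, State.setArr_reg, State.setArr_arr, hpar, hnch, hσ, hpos]
            simpa [h1, h2, hσ, hpos, hpar, hnch, e] using this
        · by_cases h2 : 1 = nch (par (s.arr aQueue h))
          · have := M.step_push T hlt (c := 1) (by rw [if_neg h1]) h2
            simp only [markBody, enqueue, seqList, exec, NatExpr.eval, Test.holds, State.setReg_reg,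
              State.setReg_arr, State.setArr_reg, State.setArr_arr, hpar, hnch, hσ, hpos]
            simpa [h1, h2.symm, hσ, hpos, hpar, hnch] using this
          · have := M.step_skip T hlt (c := 1) (by rw [if_neg h1]) h2
            simp only [markBody, enqueue, seqList, exec, NatExpr.eval, Test.holds, State.setReg_reg,
              State.setReg_arr, State.setArr_reg, State.setArr_arr, hpar, hnch, hσ, hpos]
            simpa [h1, h2, hσ, hpos, hpar, hnch] using this
      · have hb : markBody.bound + 4 ≤ 50 := by decide
        simp only [Test.cost, NatExpr.cost]
        omega)
    0 (s.setReg rPos 0) ⟨by simpa using M, by simpa using hpar, by simpa using hnch,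
      by simpa using hσ, by simp⟩
  have hh : h = s'.reg rLen := by
    have := M'.le
    simp only [Test.holds, NatExpr.eval, hpos] at hnb
    omega
  rw [hh] at M'
  refine ⟨s', _, .seq (.setReg _ _ _) (.seq hr (.skip _)), M', ?_⟩
  have := T.card_fullNodes_le X
  simp only [NatExpr.cost, Test.cost] at ht ⊢
  omega

end RAM



/-! ### Linked lists of children and moving full children -/

/-- The list at `h`, in memory cells before `K`, with entries `cell` and links `nxt`. -/
inductive Chain (cell nxt : ℕ → ℕ) (K : ℕ) : ℕ → List ℕ → Prop
  | nil : Chain cell nxt K 0 []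
  | cons (h : ℕ) (l : List ℕ) : 0 < h → h < K → Chain cell nxt K (nxt h) l →
      Chain cell nxt K h (cell h :: l)

/-- All cells in use lie before `K`, so writing the fresh cell `K` disturbs no list. Cell `0` is
never allocated and serves as the end of every list. -/
theorem Chain.push {cell nxt : ℕ → ℕ} {K h : ℕ} {l : List ℕ} (H : Chain cell nxt K h l)
    (c d : ℕ) : Chain (Function.update cell K c) (Function.update nxt K d) (K + 1) h l := by
  induction H with
  | nil => exact .nil
  | cons h l h1 h2 _ ih =>
    have := Chain.cons (cell := Function.update cell K c) (nxt := Function.update nxt K d)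
      (K := K + 1) h l h1 (by omega) (by rwa [Function.update_of_ne (by omega)])
    rwa [Function.update_of_ne (by omega)] at this

/-- `L w` is the list at `head w`, for all `w`. -/
structure ChildLists (K : ℕ) (head cell nxt : ℕ → ℕ) (L : ℕ → List ℕ) : Prop where
  pos : 0 < K
  chain : ∀ w, Chain cell nxt K (head w) (L w)

theorem ChildLists.push {K : ℕ} {head cell nxt : ℕ → ℕ} {L : ℕ → List ℕ}
    (H : ChildLists K head cell nxt L) (p c : ℕ) :
    ChildLists (K + 1) (Function.update head p K) (Function.update cell K c)
      (Function.update nxt K (head p)) (Function.update L p (c :: L p)) := by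
  refine ⟨by omega, fun w => ?_⟩
  by_cases hw : w = p
  · subst hw
    have := Chain.cons (cell := Function.update cell K c)
      (nxt := Function.update nxt K (head w)) (K := K + 1) K (L w) H.pos (by omega)
      (by rw [Function.update_self]; exact (H.chain w).push c (head w))
    simpa using this
  · rw [Function.update_of_ne hw, Function.update_of_ne hw]
    exact (H.chain w).push c (head p)

/-- The total length of the lists of the nodes before `N`. -/
def totalLength (N : ℕ) (L : ℕ → List ℕ) : ℕ := ∑ w ∈ Finset.range N, (L w).length

/-- The total length is the amortization potential. The equation is additive to avoid truncated
subtraction. -/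
theorem totalLength_update (N : ℕ) (L : ℕ → List ℕ) {p : ℕ} (hp : p < N) (l : List ℕ) :
    totalLength N (Function.update L p l) + (L p).length = totalLength N L + l.length := by
  unfold totalLength
  rw [← Finset.add_sum_erase _ _ (Finset.mem_range.2 hp),
    ← Finset.add_sum_erase (Finset.range N) (fun w => (L w).length) (Finset.mem_range.2 hp)]
  have : ∑ w ∈ (Finset.range N).erase p, (Function.update L p l w).length =
      ∑ w ∈ (Finset.range N).erase p, (L w).length :=
    Finset.sum_congr rfl fun w hw => by rw [Function.update_of_ne (Finset.ne_of_mem_erase hw)]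
  rw [this, Function.update_self]
  omega

theorem totalLength_succ (N : ℕ) (L : ℕ → List ℕ) :
    totalLength (N + 1) L = totalLength N L + (L N).length := Finset.sum_range_succ _ _

namespace RAM

open Program NatExpr

attribute [local simp] exec seqList NatExpr.eval Test.holds

/-- Put a node at the front of the list of children of another node. -/
def push (p c : NatExpr) : Program := seqList
  [setArr aCell (reg rCell) c, setArr aNxt (reg rCell) (read aHead p),
   setArr aHead p (reg rCell), setReg rCell (succ (reg rCell))]

/-- The memory represents a cotree of the graph on the first `i` of `n` vertices. -/
structure TreeState (A : ℕ → ℕ → Prop) (n i N : ℕ) (D : ℕ → Finset ℕ) (L : ℕ → List ℕ)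
    (s : State) : Prop where
  verts : s.reg rVerts = n
  node : s.reg rNode = N
  tree : Cotree A n i N (s.arr aPar) (s.arr aLab) (s.arr aNch) D
  lists : ChildLists (s.reg rCell) (s.arr aHead) (s.arr aCell) (s.arr aNxt) L
  -- Only this inclusion is kept. When a node gets another parent it is not removed from its old
  -- list, so lists may contain obsolete entries and a reader must compare with the array of
  -- parents.
  listed : ∀ c ∈ treeNodes n i N, c ∈ L (s.arr aPar c)
  rootFirst : ∃ r ∈ treeNodes n i N, s.arr aPar r = n ∧ ∃ l, L n = r :: l
  fresh : ∀ w ≥ N, s.arr aHead w = 0 ∧ s.arr aNch w = 0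
  leafLab : ∀ v < n, s.arr aLab v = 0
  -- Candidates have their parents and grandparents marked. These two values make that harmless for
  -- the candidate `n`: neither `n + 1` nor `0` is the node `n`.
  par_super : s.arr aPar n = n + 1
  par_super' : s.arr aPar (n + 1) = 0
  -- Hence an entry whose parent is an inner node is certainly a node of the present tree.
  par_dead : ∀ c, c ∉ treeNodes n i N → s.arr aPar c < n + 2

theorem TreeState.fresh_list {A : ℕ → ℕ → Prop} {n i N : ℕ} {D : ℕ → Finset ℕ}
    {L : ℕ → List ℕ} {s : State} (H : TreeState A n i N D L s) {w : ℕ} (hw : N ≤ w) :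
    L w = [] := by
  have h := H.lists.chain w
  rw [(H.fresh w hw).1] at h
  generalize L w = l at h
  cases h with
  | nil => rfl
  | cons _ _ h => omega

/-- Move a child of node `rLow` in the queue to node `rDest`. -/
def moveBody : Program := seqList
  [setReg rTmp (read aQueue (reg rPos)),
   ite (.eq (read aPar (reg rTmp)) (reg rLow))
     (seqList [setArr aPar (reg rTmp) (reg rDest), push (reg rDest) (reg rTmp),
       setArr aNch (reg rDest) (succ (read aNch (reg rDest))),
       setArr aNch (reg rLow) (pred (read aNch (reg rLow)))])
     skip]

/-- Move all children of node `rLow` in the queue to node `rDest`. -/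
def moveFull : Program := forTo rPos rLen moveBody

-- The case `u = d` is allowed and is used to put full children back at the front of their own list.
-- Therefore the numbers of children are compared by adding on both sides, where for `u = d` the
-- change cancels. The bound `hle` ensures that the decrements never truncate. If `u ≠ d`, the list
-- of `u` keeps the moved nodes as obsolete entries.
open Classical in
theorem runs_moveFull (s₀ : State) {u d m : ℕ} {L : ℕ → List ℕ}
    (hu : s₀.reg rLow = u) (hd : s₀.reg rDest = d) (hm : s₀.reg rLen = m)
    (hinj : ∀ j < m, ∀ j' < m, s₀.arr aQueue j = s₀.arr aQueue j' → j = j')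
    (hle : childCount (s₀.arr aPar) (s₀.arr aQueue) m u ≤ s₀.arr aNch u)
    (hL : ChildLists (s₀.reg rCell) (s₀.arr aHead) (s₀.arr aCell) (s₀.arr aNxt) L) :
    ∃ s' t l, Runs moveFull s₀ s' t ∧ t ≤ 100 * m + 10 ∧
      (∀ c, s'.arr aPar c = if (∃ j < m, s₀.arr aQueue j = c) ∧ s₀.arr aPar c = u then d
        else s₀.arr aPar c) ∧
      (∀ w, s'.arr aNch w +
        (if w = u then childCount (s₀.arr aPar) (s₀.arr aQueue) m u else 0) =
        s₀.arr aNch w + if w = d then childCount (s₀.arr aPar) (s₀.arr aQueue) m u else 0) ∧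
      ChildLists (s'.reg rCell) (s'.arr aHead) (s'.arr aCell) (s'.arr aNxt)
        (Function.update L d (l ++ L d)) ∧
      (∀ w, w ≠ d → s'.arr aHead w = s₀.arr aHead w) ∧
      l.length = childCount (s₀.arr aPar) (s₀.arr aQueue) m u ∧
      ∀ j < m, s₀.arr aPar (s₀.arr aQueue j) = u → s₀.arr aQueue j ∈ l := by
  subst hm
  obtain ⟨s', t, hr, ⟨l, h1, h2, h3, h4, h5, h6⟩, ht⟩ := runs_forTo (j := rPos) (m := rLen)
    (body := moveBody) (by decide) rfl rfl rfl
    (fun h s => ∃ l,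
      (∀ c, s.arr aPar c = if (∃ j < h, s₀.arr aQueue j = c) ∧ s₀.arr aPar c = u then d
        else s₀.arr aPar c) ∧
      (∀ w, s.arr aNch w +
        (if w = u then childCount (s₀.arr aPar) (s₀.arr aQueue) h u else 0) =
        s₀.arr aNch w + if w = d then childCount (s₀.arr aPar) (s₀.arr aQueue) h u else 0) ∧
      ChildLists (s.reg rCell) (s.arr aHead) (s.arr aCell) (s.arr aNxt)
        (Function.update L d (l ++ L d)) ∧
      (∀ w, w ≠ d → s.arr aHead w = s₀.arr aHead w) ∧
      l.length = childCount (s₀.arr aPar) (s₀.arr aQueue) h u ∧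
      ∀ j < h, s₀.arr aPar (s₀.arr aQueue j) = u → s₀.arr aQueue j ∈ l)
    s₀ ⟨[], by simp, by simp [childCount_zero], by simpa using hL, by simp,
      by simp [childCount_zero], by simp⟩
    (by
      rintro h s hlt hpos hlen hA ⟨l, h1, h2, h3, h4, h5, h6⟩
      have hq : s.arr aQueue = s₀.arr aQueue := hA.arr _ rfl
      have hu' : s.reg rLow = u := (hA.reg _ rfl).trans hu
      have hd' : s.reg rDest = d := (hA.reg _ rfl).trans hd
      have hnew : ¬ ∃ j < h, s₀.arr aQueue j = s₀.arr aQueue h := by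
        rintro ⟨j, hj, heq⟩
        have := hinj j (by omega) h hlt heq
        omega
      have hex : ∀ c, (∃ j < h + 1, s₀.arr aQueue j = c) ↔
          s₀.arr aQueue h = c ∨ ∃ j < h, s₀.arr aQueue j = c := by
        intro c
        simp only [Nat.lt_succ_iff_lt_or_eq]
        constructor
        · rintro ⟨j, hj | rfl, hc⟩
          · exact .inr ⟨j, hj, hc⟩
          · exact .inl hc
        · rintro (hc | ⟨j, hj, hc⟩)
          · exact ⟨h, .inr rfl, hc⟩
          · exact ⟨j, .inl hj, hc⟩
      have hp0 := h1 (s₀.arr aQueue h)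
      rw [if_neg (fun h => hnew h.1)] at hp0
      by_cases hp : s₀.arr aPar (s₀.arr aQueue h) = u
      · have hcs := childCount_succ (s₀.arr aPar) (s₀.arr aQueue) h u
        rw [if_pos hp] at hcs
        have hmono : childCount (s₀.arr aPar) (s₀.arr aQueue) (h + 1) u ≤
            childCount (s₀.arr aPar) (s₀.arr aQueue) (s₀.reg rLen) u := by
          refine Finset.card_le_card (Finset.filter_subset_filter _ ?_)
          intro j hj; simp only [Finset.mem_range] at *; omega
        have he : (exec moveBody s).setReg rPos (h + 1) =
            ((((((((s.setReg rTmp (s₀.arr aQueue h)).setArr aPar (s₀.arr aQueue h) d).setArr aCell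
              (s.reg rCell) (s₀.arr aQueue h)).setArr aNxt (s.reg rCell) (s.arr aHead d)).setArr
              aHead d (s.reg rCell)).setReg rCell (s.reg rCell + 1)).setArr aNch d
              (s.arr aNch d + 1)).setArr aNch u
              ((if u = d then s.arr aNch d + 1 else s.arr aNch u) - 1)).setReg rPos (h + 1) := by
          simp only [moveBody, push, seqList, exec, NatExpr.eval, Test.holds, hpos, hq, hu']
          simp [hp0, hp, hu', hd', Function.update_apply]
        rw [he]
        refine ⟨s₀.arr aQueue h :: l, ?_, ?_, ?_, ?_, ?_, ?_⟩
        · intro c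
          simp only [hex, State.setReg_arr, State.setArr_arr, Function.update_apply]
          by_cases hc : c = s₀.arr aQueue h
          · subst hc; simp [hp]
          · simp [hc, h1 c, Ne.symm hc]
        · intro w
          have h2w := h2 w
          have h2u := h2 u
          rw [hcs] at hmono ⊢
          simp only [State.setReg_arr, State.setArr_arr, Function.update_apply]
          by_cases hwu : w = u <;> by_cases hwd : w = d
          · subst hwu; subst hwd; simp at *; omega
          · subst hwu; simp [hwd] at *; omega
          · subst hwd; simp [hwu] at *; omega
          · simp [hwu, hwd] at *; omega
        · have := h3.push d (s₀.arr aQueue h)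
          simpa using this
        · intro w hw
          simp [hw, h4 w hw]
        · simp [h5, hcs]
        · intro j hj hjp
          by_cases hjh : j = h
          · simp [hjh]
          · exact List.mem_cons_of_mem _ (h6 j (by omega) hjp)
      · have hcs := childCount_succ (s₀.arr aPar) (s₀.arr aQueue) h u
        rw [if_neg hp, add_zero] at hcs
        have he : (exec moveBody s).setReg rPos (h + 1) =
            (s.setReg rTmp (s₀.arr aQueue h)).setReg rPos (h + 1) := by
          simp only [moveBody, push, seqList, exec, NatExpr.eval, Test.holds, hpos, hq, hu']
          simp [hp0, hp, hu']
        rw [he]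
        refine ⟨l, ?_, ?_, by simpa using h3, by simpa using h4, by rw [h5, hcs], ?_⟩
        · intro c
          simp only [State.setReg_arr, h1 c, hex]
          by_cases hc : s₀.arr aQueue h = c
          · subst hc; simp [hp]
          · simp [hc]
        · simpa [hcs] using h2
        · intro j hj hjp
          by_cases hjh : j = h
          · subst hjh; exact absurd hjp hp
          · exact h6 j (by omega) hjp)
  refine ⟨s', t, l, hr, ?_, h1, h2, h3, h4, h5, h6⟩
  have hb : moveBody.bound + 7 ≤ 100 := by decide
  refine ht.trans (Nat.add_le_add (Nat.mul_le_mul_right _ hb) (by norm_num))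

end RAM



/-! ### Attaching the new vertex -/

namespace RAM

open Program NatExpr

/-- Combine node `rPart` and the new vertex at a node with label `rLab`. -/
def attach : Program :=
  ite (.eq (read aLab (reg rPart)) (reg rLab))
    (seqList [setArr aPar (reg rNew) (reg rPart), push (reg rPart) (reg rNew),
      setArr aNch (reg rPart) (succ (read aNch (reg rPart)))])
    (seqList [setArr aLab (reg rNode) (reg rLab),
      setArr aPar (reg rNode) (read aPar (reg rPart)),
      push (read aPar (reg rPart)) (reg rNode),
      setArr aPar (reg rPart) (reg rNode), push (reg rNode) (reg rPart),
      setArr aPar (reg rNew) (reg rNode), push (reg rNode) (reg rNew),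
      setArr aNch (reg rNode) (const 2), setReg rNode (succ (reg rNode))])

/-- If `f` already has the desired label, the new vertex becomes a child of `f`; otherwise a new
node with that label takes the place of `f`. Alternation at `f` itself is not assumed, because the
preparation may have given `f` the label of its parent; `haltf` asks for it only at the node that
will end up below the parent of `f`. At most three list entries are created. -/
theorem exec_attach {A : ℕ → ℕ → Prop} {n i N : ℕ} {D : ℕ → Finset ℕ} {L : ℕ → List ℕ}
    {s : State} (H : TreeState A n i N D L s) (hsymm : ∀ a b, A a b → A b a) (hi : i < n)
    (hnew : s.reg rNew = i) {f ℓ : ℕ} (hpart : s.reg rPart = f) (hlab : s.reg rLab = ℓ)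
    (hf : f ∈ treeNodes n i N) (hℓ : ℓ = 1 ∨ ℓ = 2)
    (hin : ∀ y ∈ D f, (A i y ↔ ℓ = 2))
    (hout : ∀ y < i, y ∉ D f → ∀ t ∈ D f, (A i y ↔ A t y))
    (halt : ∀ c ∈ treeNodes n i N, s.arr aPar c ≠ n → c ≠ f →
      s.arr aLab c ≠ s.arr aLab (s.arr aPar c))
    (haltf : s.arr aPar f ≠ n → if s.arr aLab f = ℓ then s.arr aLab f ≠ s.arr aLab (s.arr aPar f)
      else ℓ ≠ s.arr aLab (s.arr aPar f)) :
    ∃ N' D' L', TreeState A n (i + 1) N' D' L' (exec attach s) ∧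
      Alternating n (i + 1) N' ((exec attach s).arr aPar) ((exec attach s).arr aLab) ∧
      totalLength N' L' ≤ totalLength N L + 3 := by
  have T := H.tree
  have hleN := T.le_N
  obtain ⟨hfi, hfN, hfn, -, hpfN⟩ := T.mem_old hi hf
  have hpf := T.parent f hf
  by_cases hl : s.arr aLab f = ℓ
  · have hfin := T.inner_of hf (by omega)
    have hnodes : ∀ c, c ∈ treeNodes n (i + 1) N ↔ c = i ∨ c ∈ treeNodes n i N := by
      intro c; simp only [mem_treeNodes]; omega
    have he : exec attach s = (((((s.setArr aPar i f).setArr aCell (s.reg rCell) i).setArr aNxt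
        (s.reg rCell) (s.arr aHead f)).setArr aHead f (s.reg rCell)).setReg rCell
        (s.reg rCell + 1)).setArr aNch f (s.arr aNch f + 1) := by
      simp [attach, push, exec, seqList, NatExpr.eval, Test.holds, hpart, hlab, hl, hnew]
    obtain ⟨D', T'⟩ : ∃ D', Cotree A n (i + 1) N (Function.update (s.arr aPar) i f) (s.arr aLab)
        (Function.update (s.arr aNch) f (s.arr aNch f + 1)) D' :=
      ⟨_, T.addChild hsymm hi (H.leafLab i hi) hf (by omega) (by rwa [hl]) hout⟩
    refine ⟨N, D', Function.update L f (i :: L f), ?_, ?_, ?_⟩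
    · rw [he]
      refine
        { verts := by simpa using H.verts
          node := by simpa using H.node
          tree := by simpa using T'
          lists := by simpa using H.lists.push f i
          listed := ?_
          rootFirst := ?_
          fresh := ?_
          leafLab := by simpa using H.leafLab
          par_super := ?_
          par_super' := ?_
          par_dead := ?_ }
      · intro c hc
        rcases (hnodes c).1 hc with rfl | hc
        · simp
        · have := H.listed c hc
          have hci := (T.mem_old hi hc).1
          simp only [State.setArr_arr, State.setReg_arr, Function.update_apply]
          by_cases hp : s.arr aPar c = f
          · simp [hci, hp]; rwa [hp] at this
          · simpa [hci, hp] using this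
      · obtain ⟨r, hr, hp, l, hl⟩ := H.rootFirst
        refine ⟨r, (hnodes r).2 (.inr hr), ?_, l, ?_⟩
        · simp [(T.mem_old hi hr).1, hp]
        · rw [Function.update_of_ne (by omega), hl]
      · intro w hw
        have := H.fresh w hw
        simp [Function.update_apply, show w ≠ f by omega, this]
      · simp [Function.update_apply, show n ≠ i by omega, H.par_super]
      · simp [Function.update_apply, show n + 1 ≠ i by omega, H.par_super']
      · intro c hc
        rw [hnodes, not_or] at hc
        simpa [Function.update_apply, hc.1] using H.par_dead c hc.2
    · rw [he]
      intro c hc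
      rcases (hnodes c).1 hc with rfl | hc
      · intro _
        simp [H.leafLab c hi, hl]; omega
      · have hci := (T.mem_old hi hc).1
        simp [Function.update_apply, hci]
        intro h
        by_cases hcf : c = f
        · subst hcf
          have := haltf (by simpa using h)
          rw [if_pos hl] at this
          simpa using this
        · simpa using halt c hc (by simpa using h) hcf
    · have := totalLength_update N L hfin.2 (i :: L f)
      simp only [List.length_cons] at this
      omega
  · have hnodes : ∀ c, c ∈ treeNodes n (i + 1) (N + 1) ↔
        c = i ∨ c = N ∨ c ∈ treeNodes n i N := by
      intro c; simp only [mem_treeNodes]; omega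
    set K := s.reg rCell with hK
    have hiN : i ≠ N := by omega
    have hcells : (K + 1 ≠ K) ∧ (K + 2 ≠ K) ∧ (K + 2 ≠ K + 1) := by omega
    have hev : (exec attach s).reg rVerts = n ∧ (exec attach s).reg rNode = N + 1 ∧
        (exec attach s).reg rCell = K + 1 + 1 + 1 ∧
        (exec attach s).arr aPar = Function.update (Function.update
          (Function.update (s.arr aPar) N (s.arr aPar f)) f N) i N ∧
        (exec attach s).arr aLab = Function.update (s.arr aLab) N ℓ ∧
        (exec attach s).arr aNch = Function.update (s.arr aNch) N 2 ∧
        (exec attach s).arr aCell = Function.update (Function.update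
          (Function.update (s.arr aCell) K N) (K + 1) f) (K + 1 + 1) i ∧
        (exec attach s).arr aHead = Function.update (Function.update
          (Function.update (s.arr aHead) (s.arr aPar f) K) N (K + 1)) N (K + 1 + 1) ∧
        (exec attach s).arr aNxt = Function.update (Function.update
          (Function.update (s.arr aNxt) K (s.arr aHead (s.arr aPar f))) (K + 1)
            (Function.update (s.arr aHead) (s.arr aPar f) K N)) (K + 1 + 1)
            (Function.update (Function.update
              (s.arr aHead) (s.arr aPar f) K) N (K + 1) N) := by
      simp [attach, push, exec, seqList, NatExpr.eval, Test.holds, hpart, hlab, hl, hnew,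
        H.node, hfN, hfi, H.verts, ← hK]
    obtain ⟨e1, e2, e3, e4, e5, e6, e7, e8, e9⟩ := hev
    obtain ⟨D', T'⟩ : ∃ D', Cotree A n (i + 1) (N + 1) (Function.update (Function.update
        (Function.update (s.arr aPar) N (s.arr aPar f)) f N) i N)
        (Function.update (s.arr aLab) N ℓ) (Function.update (s.arr aNch) N 2) D' :=
      ⟨_, T.addParent hsymm hi (H.leafLab i hi) hf hℓ hin hout⟩
    refine ⟨N + 1, D', Function.update (Function.update (Function.update L (s.arr aPar f)
      (N :: L (s.arr aPar f))) N (f :: Function.update L (s.arr aPar f)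
      (N :: L (s.arr aPar f)) N)) N (i :: Function.update (Function.update L (s.arr aPar f)
      (N :: L (s.arr aPar f))) N (f :: Function.update L (s.arr aPar f)
      (N :: L (s.arr aPar f)) N) N), ?_, ?_, ?_⟩
    · refine
        { verts := e1
          node := e2
          tree := by rw [e4, e5, e6]; exact T'
          lists := ?_
          listed := ?_
          rootFirst := ?_
          fresh := ?_
          leafLab := ?_
          par_super := ?_
          par_super' := ?_
          par_dead := ?_ }
      · rw [e3, e7, e8, e9]
        exact ((H.lists.push (s.arr aPar f) N).push N f).push N i
      · intro c hc
        rw [e4]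
        by_cases hci : c = i
        · simp [hci]
        by_cases hcf : c = f
        · simp [hcf, hfi]
        by_cases hcN : c = N
        · subst hcN
          simp [Function.update_apply, hiN.symm, hfN.symm, hpfN]
        · have hc := (((hnodes c).1 hc).resolve_left hci).resolve_left hcN
          have := H.listed c hc
          have hpc := (T.mem_old hi hc).2.2.2.2
          simp only [Function.update_apply, hci, hcf, hcN, hpc, if_false]
          split_ifs with h
          · rw [h] at this; exact List.mem_cons_of_mem _ this
          · exact this
      · obtain ⟨r, hr, hp, l, hl⟩ := H.rootFirst
        have hnN : n ≠ N := by omega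
        by_cases hrf : r = f
        · subst hrf
          refine ⟨N, (hnodes N).2 (.inr (.inl rfl)), ?_, L n, ?_⟩
          · rw [e4]; simp [Function.update_apply, hiN.symm, hfN.symm, hp]
          · simp [Function.update_apply, hnN, hp]
        · have hpfn : s.arr aPar f ≠ n := fun h => hrf (T.root_unique hr hf hp h)
          refine ⟨r, (hnodes r).2 (.inr (.inr hr)), ?_, l, ?_⟩
          · rw [e4]
            simp [Function.update_apply, (T.mem_old hi hr).1, (T.mem_old hi hr).2.1, hrf, hp]
          · simp [Function.update_apply, hnN, hpfn.symm, hl]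
      · intro w hw
        have := H.fresh w (by omega)
        rw [e8, e6]
        simp [Function.update_apply, show w ≠ N by omega, show w ≠ s.arr aPar f by omega, this]
      · intro v hv
        rw [e5]; simp [Function.update_apply, show v ≠ N by omega, H.leafLab v hv]
      · rw [e4]
        simp [Function.update_apply, show n ≠ i by omega, show n ≠ N by omega, hfn.symm,
          H.par_super]
      · have hfn1 : n + 1 ≠ f := by rcases mem_treeNodes.1 hf with h | h <;> omega
        rw [e4]
        simp [Function.update_apply, show n + 1 ≠ i by omega, show n + 1 ≠ N by omega, hfn1,
          H.par_super']
      · intro c hc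
        rw [hnodes, not_or, not_or] at hc
        have hcf : c ≠ f := fun h => hc.2.2 (h ▸ hf)
        rw [e4]
        simpa [Function.update_apply, hc.1, hc.2.1, hcf] using H.par_dead c hc.2.2
    · rw [e4, e5]
      intro c hc
      simp only [Function.update_apply]
      by_cases hci : c = i
      · intro _
        simp [hci, hiN, H.leafLab i hi]; omega
      by_cases hcf : c = f
      · intro _
        simp [hcf, hfi, hfN, hl]
      by_cases hcN : c = N
      · subst hcN
        simp only [hci, hcf, hpfN, if_true, if_false]
        intro h
        have := haltf h
        rwa [if_neg hl] at this
      · have hc := (((hnodes c).1 hc).resolve_left hci).resolve_left hcN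
        have hpc := (T.mem_old hi hc).2.2.2.2
        simp only [hci, hcf, hcN, hpc, if_false]
        intro h
        exact halt c hc h hcf
    · have h0 : L N = [] := H.fresh_list le_rfl
      have h1 := totalLength_update (N + 1) L (p := s.arr aPar f) (by omega)
        (N :: L (s.arr aPar f))
      have h2 := totalLength_update (N + 1) (Function.update L (s.arr aPar f)
        (N :: L (s.arr aPar f))) (p := N) (by omega) (f :: Function.update L (s.arr aPar f)
        (N :: L (s.arr aPar f)) N)
      have h3 := totalLength_update (N + 1) (Function.update (Function.update L (s.arr aPar f)
        (N :: L (s.arr aPar f))) N (f :: Function.update L (s.arr aPar f)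
        (N :: L (s.arr aPar f)) N)) (p := N) (by omega) (i :: Function.update (Function.update L
        (s.arr aPar f) (N :: L (s.arr aPar f))) N (f :: Function.update L (s.arr aPar f)
        (N :: L (s.arr aPar f)) N) N)
      have h4 := totalLength_succ N L
      simp only [List.length_cons, h0, List.length_nil] at h1 h2 h3 h4
      omega

end RAM



/-- All stamps are older than `σ`, so every counter reads as zero without being reset. No inner node
is complete, since each has at least two children, and the queue holds exactly the leaves in `X`. -/
theorem Marking.init {A : ℕ → ℕ → Prop} {n i N : ℕ} {par lab nch : ℕ → ℕ} {D : ℕ → Finset ℕ}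
    {X : Finset ℕ} {σ m : ℕ} {q cnt cst full : ℕ → ℕ} (T : Cotree A n i N par lab nch D)
    (hX : ∀ y ∈ X, y < i) (hq : ∀ j < m, q j ∈ X)
    (hinj : ∀ j < m, ∀ j' < m, q j = q j' → j = j') (hsurj : ∀ y ∈ X, ∃ j < m, q j = y)
    (hst : ∀ p, cst p < σ) (hflag : ∀ w, full w = σ ↔ ∃ j < m, q j = w)
    (hfle : ∀ w, full w ≤ σ) : Marking n i N par nch D X σ q m 0 cnt cst full := by
  have hle := T.le
  refine
    { le := by omega
      full_mem := fun j hj => ?_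
      inj := hinj
      leaf := hsurj
      inner := fun p h1 h2 => ?_
      order := fun j hj h => ?_
      count := fun p => ?_
      stamp := fun p => (hst p).le
      flag := hflag
      flag_le := hfle }
  · have h := hX _ (hq j hj)
    exact mem_fullNodes.2 ⟨mem_treeNodes.2 (.inl h), by simpa [T.leafD _ h] using hq j hj⟩
  · rw [childCount_zero]
    have := T.two_le p h1 h2
    refine iff_of_false ?_ (by omega)
    rintro ⟨j, hj, rfl⟩
    have := hX _ (hq j hj)
    omega
  · have := hX _ (hq j hj)
    omega
  · rw [if_neg (hst p).ne, childCount_zero]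

/-! ### Scanning the neighbours of the new vertex -/

namespace RAM

open Program NatExpr

/-- Enqueue the neighbours of the new vertex among the earlier vertices. -/
def enqueueNeighbors : Program := seqList
  [setReg rLen (const 0), setReg rPos (read 0 (reg rNew)), setReg rEnd (read 0 (succ (reg rNew))),
   loop (.lt (reg rPos) (reg rEnd)) (seqList
     [setReg rTmp (read 1 (reg rPos)), ite (.lt (reg rTmp) (reg rNew)) enqueue skip,
      setReg rPos (succ (reg rPos))])]

/-- The part of the memory with the neighbours of a vertex. -/
structure HasNeighbors (s : State) (i : ℕ) (nb : List ℕ) : Prop where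
  nodup : nb.Nodup
  next : s.arr 0 (i + 1) = s.arr 0 i + nb.length
  get : ∀ k (h : k < nb.length), s.arr 1 (s.arr 0 i + k) = nb[k]

/-- The whole adjacency list is read, though only earlier vertices are queued; this is affordable
because the lists have total length `2 * |E|`. Distinct list entries give distinct queue entries. -/
theorem runs_enqueueNeighbors (s₀ : State) {i : ℕ} {nb : List ℕ} (hi : s₀.reg rNew = i)
    (hnb : HasNeighbors s₀ i nb) (hfull : ∀ w, s₀.arr aFull w ≤ i) :
    ∃ s' t, Runs enqueueNeighbors s₀ s' t ∧ t ≤ 40 * nb.length + 20 ∧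
      (∀ j < s'.reg rLen, s'.arr aQueue j ∈ nb ∧ s'.arr aQueue j < i) ∧
      (∀ j < s'.reg rLen, ∀ j' < s'.reg rLen, s'.arr aQueue j = s'.arr aQueue j' → j = j') ∧
      (∀ y ∈ nb, y < i → ∃ j < s'.reg rLen, s'.arr aQueue j = y) ∧
      (∀ w, s'.arr aFull w = i + 1 ↔ ∃ j < s'.reg rLen, s'.arr aQueue j = w) ∧
      (∀ w, s'.arr aFull w ≤ i + 1) := by
  obtain ⟨k, s', t, hr, ⟨hk, hpos, hend, -, -, -, h1, h2, h3, h4, h5⟩, hnb', ht⟩ :=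
    runs_loop (b := .lt (reg rPos) (reg rEnd)) (P := seqList
     [setReg rTmp (read 1 (reg rPos)), ite (.lt (reg rTmp) (reg rNew)) enqueue skip,
      setReg rPos (succ (reg rPos))])
    (fun (k : ℕ) s => k ≤ nb.length ∧ s.reg rPos = s₀.arr 0 i + k ∧
      s.reg rEnd = s₀.arr 0 i + nb.length ∧ s.reg rNew = i ∧ s.arr 0 = s₀.arr 0 ∧
      s.arr 1 = s₀.arr 1 ∧
      (∀ j < s.reg rLen, s.arr aQueue j ∈ nb.take k ∧ s.arr aQueue j < i) ∧
      (∀ j < s.reg rLen, ∀ j' < s.reg rLen, s.arr aQueue j = s.arr aQueue j' → j = j') ∧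
      (∀ y ∈ nb.take k, y < i → ∃ j < s.reg rLen, s.arr aQueue j = y) ∧
      (∀ w, s.arr aFull w = i + 1 ↔ ∃ j < s.reg rLen, s.arr aQueue j = w) ∧
      (∀ w, s.arr aFull w ≤ i + 1))
    (fun k _ => 40 * (nb.length - k))
    (by
      rintro k s ⟨hk, hpos, hend, hnew, h0, h1, a1, a2, a3, a4, a5⟩ hlt
      simp only [Test.holds, NatExpr.eval, hpos, hend] at hlt
      have hlt : k < nb.length := by omega
      obtain ⟨t, hr, ht⟩ := runs_exec (P := seqList
        [setReg rTmp (read 1 (reg rPos)), ite (.lt (reg rTmp) (reg rNew)) enqueue skip,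
          setReg rPos (succ (reg rPos))]) rfl s
      have hget : s.arr 1 (s₀.arr 0 i + k) = nb[k] := by rw [h1]; exact hnb.get k hlt
      have htake : nb.take (k + 1) = nb.take k ++ [nb[k]] := List.take_succ_eq_append_getElem hlt
      have hnotin : nb[k] ∉ nb.take k := by
        have := (List.nodup_append.1 (htake ▸ hnb.nodup.sublist (List.take_sublist (k + 1) nb))).2.2
        intro h
        exact this _ h _ (by simp) rfl
      refine ⟨k + 1, _, t, hr, ?_, ?_⟩
      · by_cases hc : nb[k] < i
        · have he : exec (seqList [setReg rTmp (read 1 (reg rPos)),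
              ite (.lt (reg rTmp) (reg rNew)) enqueue skip,
              setReg rPos (succ (reg rPos))]) s = ((((s.setReg rTmp nb[k]).setArr aQueue
                (s.reg rLen) nb[k]).setArr aFull nb[k] (i + 1)).setReg rLen
                (s.reg rLen + 1)).setReg rPos (s₀.arr 0 i + k + 1) := by
            simp [exec, seqList, enqueue, NatExpr.eval, Test.holds, hpos, hget, hnew, hc]
          rw [he]
          have hq : ∀ j < s.reg rLen, Function.update (s.arr aQueue) (s.reg rLen) nb[k] j =
              s.arr aQueue j := fun j hj => Function.update_of_ne (by omega) _ _
          have hqn : ∀ j < s.reg rLen, s.arr aQueue j ≠ nb[k] := fun j hj h =>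
            hnotin (h ▸ (a1 j hj).1)
          have hex : ∀ w, (∃ j < s.reg rLen + 1,
              Function.update (s.arr aQueue) (s.reg rLen) nb[k] j = w) ↔
              w = nb[k] ∨ ∃ j < s.reg rLen, s.arr aQueue j = w := by
            intro w
            constructor
            · rintro ⟨j, hj, rfl⟩
              by_cases hjm : j = s.reg rLen
              · left; simp [hjm]
              · right; exact ⟨j, by omega, (hq j (by omega)).symm⟩
            · rintro (rfl | ⟨j, hj, rfl⟩)
              · exact ⟨s.reg rLen, by omega, by simp⟩
              · exact ⟨j, by omega, hq j hj⟩
          set s₁ := ((((s.setReg rTmp nb[k]).setArr aQueue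
                (s.reg rLen) nb[k]).setArr aFull nb[k] (i + 1)).setReg rLen
                (s.reg rLen + 1)).setReg rPos (s₀.arr 0 i + k + 1) with hs₁
          have el : s₁.reg rLen = s.reg rLen + 1 := by simp [hs₁]
          have eq : s₁.arr aQueue = Function.update (s.arr aQueue) (s.reg rLen) nb[k] := by
            simp [hs₁]
          have ef : s₁.arr aFull = Function.update (s.arr aFull) nb[k] (i + 1) := by simp [hs₁]
          refine ⟨hlt, by simp [hs₁]; omega, by simpa [hs₁] using hend, by simpa [hs₁] using hnew,
            by simpa [hs₁] using h0, by simpa [hs₁] using h1, ?_, ?_, ?_, ?_, ?_⟩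
          · intro j hj
            rw [el] at hj
            rw [eq, htake]
            by_cases hjm : j = s.reg rLen
            · rw [hjm, Function.update_self]
              exact ⟨List.mem_append_right _ (List.mem_singleton.2 rfl), hc⟩
            · rw [hq j (by omega)]
              exact ⟨List.mem_append_left _ (a1 j (by omega)).1, (a1 j (by omega)).2⟩
          · intro j hj j' hj'
            rw [el] at hj hj'
            rw [eq]
            by_cases hjm : j = s.reg rLen <;> by_cases hjm' : j' = s.reg rLen
            · omega
            · rw [hq j' (by omega), hjm, Function.update_self]
              exact fun h => absurd h.symm (hqn j' (by omega))
            · rw [hq j (by omega), hjm', Function.update_self]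
              exact fun h => absurd h (hqn j (by omega))
            · rw [hq j (by omega), hq j' (by omega)]
              exact a2 j (by omega) j' (by omega)
          · intro y hy hyi
            rw [el, eq]
            refine (hex y).2 ?_
            rw [htake, List.mem_append, List.mem_singleton] at hy
            exact hy.symm.imp id fun h => a3 y h hyi
          · intro w
            rw [el, eq, hex w, ef, ← a4 w, Function.update_apply]
            split_ifs with h
            · exact iff_of_true rfl (.inl h)
            · exact ⟨.inr, fun h' => h'.resolve_left h⟩
          · intro w
            rw [ef, Function.update_apply]
            split_ifs
            · exact le_rfl
            · exact a5 w
        · have he : exec (seqList [setReg rTmp (read 1 (reg rPos)),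
              ite (.lt (reg rTmp) (reg rNew)) enqueue skip,
              setReg rPos (succ (reg rPos))]) s = (s.setReg rTmp nb[k]).setReg rPos
                (s₀.arr 0 i + k + 1) := by
            simp [exec, seqList, enqueue, NatExpr.eval, Test.holds, hpos, hget, hnew, hc]
          rw [he]
          refine ⟨hlt, by simp; omega, by simpa using hend, by simpa using hnew, by simpa using h0,
            by simpa using h1, ?_, by simpa using a2, ?_, by simpa using a4, by simpa using a5⟩
          · intro j hj
            simp at hj ⊢
            rw [htake]
            exact ⟨List.mem_append_left _ (a1 j hj).1, (a1 j hj).2⟩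
          · intro y hy hyi
            rw [htake, List.mem_append, List.mem_singleton] at hy
            rcases hy with hy | rfl
            · simpa using a3 y hy hyi
            · exact absurd hyi hc
      · have hb : (seqList [setReg rTmp (read 1 (reg rPos)),
              ite (.lt (reg rTmp) (reg rNew)) enqueue skip,
              setReg rPos (succ (reg rPos))]).bound + 4 ≤ 40 := by decide
        simp only [Test.cost, NatExpr.cost]
        omega)
    0 (((s₀.setReg rLen 0).setReg rPos (s₀.arr 0 i)).setReg rEnd (s₀.arr 0 (i + 1)))
    ⟨by omega, by simp, by simp [hnb.next], by simp [hi], by simp, by simp, by simp, by simp,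
      by simp, by
        intro w
        have := hfull w
        simp; omega, by
        intro w
        have := hfull w
        simp; omega⟩
  have hkk : k = nb.length := by
    simp only [Test.holds, NatExpr.eval, hpos, hend] at hnb'; omega
  subst hkk
  rw [List.take_length] at h1 h3
  have hrun : Runs enqueueNeighbors s₀ s' (_ + (_ + (_ + (_ + _)))) :=
    .seq (.setReg _ _ _) (.seq (.setReg _ _ _) (.seq (.setReg _ _ _) (.seq
      (by simpa [NatExpr.eval, hi] using hr) (.skip _))))
  refine ⟨s', _, hrun, ?_, h1, h2, h3, h4, h5⟩
  simp only [NatExpr.cost, Test.cost] at ht ⊢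
  omega

end RAM



/-! ### Finding a lowest candidate -/

namespace RAM

open Program NatExpr

/-- Mark the parent and the grandparent of the parent of the current entry of the queue, if that is
a candidate. -/
def markCandidatesBody : Program := seqList
  [setReg rTmp (read aPar (read aQueue (reg rPos))),
   ite (.eq (read aCnt (reg rTmp)) (read aNch (reg rTmp))) skip (seqList
     [setArr aMark (read aPar (reg rTmp)) (succ (reg rNew)),
      setArr aMark (read aPar (read aPar (reg rTmp))) (succ (reg rNew))])]

/-- Mark the nodes that are not lowest candidates. -/
def markCandidates : Program := forTo rPos rLen markCandidatesBody

/-- Select the parent of the current entry of the queue, if it is an unmarked candidate. -/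
def findLowestBody : Program := seqList
  [setReg rTmp (read aPar (read aQueue (reg rPos))),
   ite (.eq (read aCnt (reg rTmp)) (read aNch (reg rTmp))) skip
     (ite (.eq (read aMark (reg rTmp)) (succ (reg rNew))) skip (seqList
       [setReg rLow (reg rTmp), setReg rPart (read aQueue (reg rPos))]))]

/-- Find a lowest candidate and one of its full children. -/
def findLowest : Program := seqList [markCandidates, forTo rPos rLen findLowestBody]

/-- Every candidate is the parent of a queue entry and is recognized by an incomplete counter, so
one pass over the queue reaches all of them. Older marks are at most `i` and cannot be confused with
the stamp `i + 1`. -/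
theorem runs_markCandidates (s₀ : State) {i : ℕ} {C : ℕ → Prop} (hi : s₀.reg rNew = i)
    (hC : ∀ j < s₀.reg rLen, s₀.arr aCnt (s₀.arr aPar (s₀.arr aQueue j)) ≠
      s₀.arr aNch (s₀.arr aPar (s₀.arr aQueue j)) ↔ C (s₀.arr aPar (s₀.arr aQueue j)))
    (hC' : ∀ v, C v → ∃ j < s₀.reg rLen, s₀.arr aPar (s₀.arr aQueue j) = v)
    (hmark : ∀ w, s₀.arr aMark w ≤ i) :
    ∃ s' t, Runs markCandidates s₀ s' t ∧ t ≤ 60 * s₀.reg rLen + 6 ∧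
      (∀ w, s'.arr aMark w = i + 1 ↔
        ∃ v, C v ∧ (s₀.arr aPar v = w ∨ s₀.arr aPar (s₀.arr aPar v) = w)) ∧
      ∀ w, s'.arr aMark w ≤ i + 1 := by
  obtain ⟨s', t, hr, ⟨h1, h2⟩, ht⟩ := runs_forTo (j := rPos) (m := rLen)
    (body := markCandidatesBody) (by decide) rfl rfl rfl
    (fun h s => (∀ w, s.arr aMark w = i + 1 ↔ ∃ v, (C v ∧ ∃ j < h,
        s₀.arr aPar (s₀.arr aQueue j) = v) ∧
        (s₀.arr aPar v = w ∨ s₀.arr aPar (s₀.arr aPar v) = w)) ∧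
      ∀ w, s.arr aMark w ≤ i + 1)
    s₀ ⟨fun w => by have := hmark w; simp; omega, fun w => by have := hmark w; simp; omega⟩
    (by
      rintro h s hlt hpos hlen hA ⟨h1, h2⟩
      have hq : s.arr aQueue = s₀.arr aQueue := hA.arr _ rfl
      have hp : s.arr aPar = s₀.arr aPar := hA.arr _ rfl
      have hc : s.arr aCnt = s₀.arr aCnt := hA.arr _ rfl
      have hn : s.arr aNch = s₀.arr aNch := hA.arr _ rfl
      have hi' : s.reg rNew = i := (hA.reg _ rfl).trans hi
      have hCh := hC h hlt
      have hex : ∀ v, (∃ j < h + 1, s₀.arr aPar (s₀.arr aQueue j) = v) ↔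
          s₀.arr aPar (s₀.arr aQueue h) = v ∨ ∃ j < h, s₀.arr aPar (s₀.arr aQueue j) = v := by
        intro v
        constructor
        · rintro ⟨j, hj, hv⟩
          rcases Nat.lt_succ_iff_lt_or_eq.1 hj with hj | rfl
          · exact .inr ⟨j, hj, hv⟩
          · exact .inl hv
        · rintro (hv | ⟨j, hj, hv⟩)
          · exact ⟨h, by omega, hv⟩
          · exact ⟨j, by omega, hv⟩
      set p := s₀.arr aPar (s₀.arr aQueue h) with hpdef
      by_cases hc0 : s₀.arr aCnt p = s₀.arr aNch p
      · have he : exec markCandidatesBody s = s.setReg rTmp p := by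
          simp [markCandidatesBody, exec, seqList, NatExpr.eval, Test.holds, hpos, hq, hp, hc, hn,
            ← hpdef, hc0]
        rw [he]
        have hnC : ¬ C p := fun h => (hCh.2 h) hc0
        refine ⟨fun w => ?_, by simpa using h2⟩
        simp only [State.setReg_arr, h1 w]
        refine exists_congr fun v => and_congr_left fun _ => and_congr_right fun hv => ?_
        rw [hex]
        refine ⟨.inr, fun h => h.resolve_left fun h => hnC (h ▸ hv)⟩
      · have he : exec markCandidatesBody s = ((s.setReg rTmp p).setArr aMark (s₀.arr aPar p)
            (i + 1)).setArr aMark (s₀.arr aPar (s₀.arr aPar p)) (i + 1) := by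
          simp [markCandidatesBody, exec, seqList, NatExpr.eval, Test.holds, hpos, hq, hp, hc, hn,
            ← hpdef, hc0, hi']
        rw [he]
        have hpC : C p := hCh.1 hc0
        have e1 : (((((s.setReg rTmp p).setArr aMark (s₀.arr aPar p)
            (i + 1)).setArr aMark (s₀.arr aPar (s₀.arr aPar p)) (i + 1))).setReg rPos
              (h + 1)).arr aMark = Function.update (Function.update (s.arr aMark) (s₀.arr aPar p)
            (i + 1)) (s₀.arr aPar (s₀.arr aPar p)) (i + 1) := by simp
        rw [e1]
        refine ⟨fun w => ?_, fun w => ?_⟩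
        · simp only [Function.update_apply, hex]
          split_ifs with h3 h4
          · simp only [true_iff]
            exact ⟨p, ⟨hpC, .inl rfl⟩, .inr h3.symm⟩
          · simp only [true_iff]
            exact ⟨p, ⟨hpC, .inl rfl⟩, .inl h4.symm⟩
          · rw [h1 w]
            refine exists_congr fun v => ⟨fun ⟨⟨a, b⟩, c⟩ => ⟨⟨a, .inr b⟩, c⟩, ?_⟩
            rintro ⟨⟨a, b | b⟩, d⟩
            · subst b
              rcases d with d | d
              · exact absurd d.symm h4
              · exact absurd d.symm h3
            · exact ⟨⟨a, b⟩, d⟩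
        · simp only [Function.update_apply]
          split_ifs
          · exact le_rfl
          · exact le_rfl
          · exact h2 w)
  refine ⟨s', t, hr, ?_, fun w => ?_, h2⟩
  · have hb : markCandidatesBody.bound + 7 ≤ 60 := by decide
    exact ht.trans (Nat.add_le_add_right (Nat.mul_le_mul_right _ hb) _)
  · rw [h1 w]
    exact exists_congr fun v => and_congr_left fun _ => ⟨fun h => h.1, fun h => ⟨h, hC' v h⟩⟩

/-- A candidate is lowest iff it is unmarked after the first pass. The second pass overwrites its
find whenever it meets another unmarked candidate, since any of them will do; `hlow` guarantees that
there is one. The queue entry through which it is reached is kept as a full child. -/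
theorem runs_findLowest (s₀ : State) {i : ℕ} {C : ℕ → Prop} (hi : s₀.reg rNew = i)
    (hC : ∀ j < s₀.reg rLen, s₀.arr aCnt (s₀.arr aPar (s₀.arr aQueue j)) ≠
      s₀.arr aNch (s₀.arr aPar (s₀.arr aQueue j)) ↔ C (s₀.arr aPar (s₀.arr aQueue j)))
    (hC' : ∀ v, C v → ∃ j < s₀.reg rLen, s₀.arr aPar (s₀.arr aQueue j) = v)
    (hmark : ∀ w, s₀.arr aMark w ≤ i)
    (hlow : ∃ u, C u ∧ ∀ v, C v → s₀.arr aPar v ≠ u ∧ s₀.arr aPar (s₀.arr aPar v) ≠ u) :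
    ∃ s' t, Runs findLowest s₀ s' t ∧ t ≤ 120 * s₀.reg rLen + 20 ∧
      (∀ w, s'.arr aMark w ≤ i + 1) ∧ C (s'.reg rLow) ∧
      (∀ v, C v → s₀.arr aPar v ≠ s'.reg rLow ∧ s₀.arr aPar (s₀.arr aPar v) ≠ s'.reg rLow) ∧
      s₀.arr aPar (s'.reg rPart) = s'.reg rLow ∧
      ∃ j < s₀.reg rLen, s₀.arr aQueue j = s'.reg rPart := by
  obtain ⟨s₁, t₁, hr₁, ht₁, hm, hm'⟩ := runs_markCandidates s₀ hi hC hC' hmark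
  have hA₁ := hr₁.agree
  have eq : s₁.arr aQueue = s₀.arr aQueue := hA₁.arr _ rfl
  have ep : s₁.arr aPar = s₀.arr aPar := hA₁.arr _ rfl
  have ec : s₁.arr aCnt = s₀.arr aCnt := hA₁.arr _ rfl
  have en : s₁.arr aNch = s₀.arr aNch := hA₁.arr _ rfl
  have ei : s₁.reg rNew = i := (hA₁.reg _ rfl).trans hi
  have el : s₁.reg rLen = s₀.reg rLen := hA₁.reg _ rfl
  obtain ⟨s', t, hr, h1, ht⟩ := runs_forTo (j := rPos) (m := rLen)
    (body := findLowestBody) (by decide) rfl rfl rfl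
    (fun h s => (∃ j < h, C (s₀.arr aPar (s₀.arr aQueue j)) ∧
        s₁.arr aMark (s₀.arr aPar (s₀.arr aQueue j)) ≠ i + 1) →
      C (s.reg rLow) ∧ s₁.arr aMark (s.reg rLow) ≠ i + 1 ∧
      s₀.arr aPar (s.reg rPart) = s.reg rLow ∧
      ∃ j < s₀.reg rLen, s₀.arr aQueue j = s.reg rPart)
    s₁ (by rintro ⟨j, hj, -⟩; omega)
    (by
      rintro h s hlt hpos hlen hA hI
      have hq : s.arr aQueue = s₀.arr aQueue := (hA.arr _ rfl).trans eq
      have hp : s.arr aPar = s₀.arr aPar := (hA.arr _ rfl).trans ep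
      have hc : s.arr aCnt = s₀.arr aCnt := (hA.arr _ rfl).trans ec
      have hn : s.arr aNch = s₀.arr aNch := (hA.arr _ rfl).trans en
      have hmk : s.arr aMark = s₁.arr aMark := hA.arr _ rfl
      have hi' : s.reg rNew = i := (hA.reg _ rfl).trans ei
      have hlt' : h < s₀.reg rLen := el ▸ hlt
      have hCh := hC h hlt'
      set p := s₀.arr aPar (s₀.arr aQueue h) with hpdef
      by_cases hgood : C p ∧ s₁.arr aMark p ≠ i + 1
      · have he : exec findLowestBody s = ((s.setReg rTmp p).setReg rLow p).setReg rPart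
            (s₀.arr aQueue h) := by
          simp [findLowestBody, exec, seqList, NatExpr.eval, Test.holds, hpos, hq, hp, hc, hn,
            ← hpdef, hCh.2 hgood.1, hgood.2, hi', hmk]
        rw [he]
        intro _
        exact ⟨by simpa using hgood.1, by simpa using hgood.2, by simp [hpdef], h, hlt', by simp⟩
      · have he : exec findLowestBody s = s.setReg rTmp p := by
          by_cases hCp : C p
          · have hmp : s₁.arr aMark p = i + 1 := by
              by_contra h; exact hgood ⟨hCp, h⟩
            simp [findLowestBody, exec, seqList, NatExpr.eval, Test.holds, hpos, hq, hp, hc, hn,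
              ← hpdef, hmp, hi', hmk]
          · have : s₀.arr aCnt p = s₀.arr aNch p := by
              by_contra h; exact hCp (hCh.1 h)
            simp [findLowestBody, exec, seqList, NatExpr.eval, Test.holds, hpos, hq, hp, hc, hn,
              ← hpdef, this]
        rw [he]
        rintro ⟨j, hj, hj'⟩
        have hjh : j ≠ h := fun h => hgood (by rw [hpdef, ← h]; exact hj')
        simpa using hI ⟨j, by omega, hj'⟩)
  rw [el] at h1
  obtain ⟨u, hu, hul⟩ := hlow
  have hum : ∀ v, C v → (s₁.arr aMark v ≠ i + 1 ↔
      ∀ w, C w → s₀.arr aPar w ≠ v ∧ s₀.arr aPar (s₀.arr aPar w) ≠ v) := by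
    intro v _
    rw [Ne, hm]
    push Not
    rfl
  obtain ⟨ju, hju, hju'⟩ := hC' u hu
  obtain ⟨k1, k2, k3, k4⟩ := h1 ⟨ju, hju, by rw [hju']; exact ⟨hu, (hum u hu).2 hul⟩⟩
  refine ⟨s', _, .seq hr₁ (.seq hr (.skip _)), ?_, ?_, k1, (hum _ k1).1 k2, k3, k4⟩
  · have hb : findLowestBody.bound + 7 ≤ 60 := by decide
    have := Nat.mul_le_mul_right (s₁.reg rLen) hb
    rw [el] at this ht
    omega
  · rw [hr.agree.arr _ rfl]; exact hm'

end RAM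



/-! ### A series candidate with a single non-full child -/

namespace RAM

open Program NatExpr

/-- Search the list of node `rLow` for a child that is not full. -/
def findChild : Program :=
  loop (.not (.and (.eq (read aPar (read aCell (read aHead (reg rLow)))) (reg rLow))
      (.not (.eq (read aFull (read aCell (read aHead (reg rLow)))) (succ (reg rNew))))))
    (setArr aHead (reg rLow) (read aNxt (read aHead (reg rLow))))

/-- Advancing the head of the list deletes the entries that are passed, and each deleted entry pays
`40` steps out of the potential. The entry `e` stops the search before the list is exhausted. -/
theorem runs_findChild (s₀ : State) {u i : ℕ} {L : ℕ → List ℕ} (hu : s₀.reg rLow = u)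
    (hi : s₀.reg rNew = i)
    (hL : ChildLists (s₀.reg rCell) (s₀.arr aHead) (s₀.arr aCell) (s₀.arr aNxt) L)
    (hex : ∃ e ∈ L u, s₀.arr aPar e = u ∧ s₀.arr aFull e ≠ i + 1) :
    ∃ s' t l, Runs findChild s₀ s' t ∧
      ChildLists (s₀.reg rCell) (s'.arr aHead) (s₀.arr aCell) (s₀.arr aNxt)
        (Function.update L u l) ∧ t + 40 * l.length ≤ 40 * (L u).length + 40 ∧
      s₀.arr aPar (s₀.arr aCell (s'.arr aHead u)) = u ∧
      s₀.arr aFull (s₀.arr aCell (s'.arr aHead u)) ≠ i + 1 ∧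
      s₀.arr aCell (s'.arr aHead u) ∈ l ∧ ∀ w, w ≠ u → s'.arr aHead w = s₀.arr aHead w := by
  obtain ⟨e, he, hep, hef⟩ := hex
  have hcons : ∀ {cell nxt : ℕ → ℕ} {K h : ℕ} {l : List ℕ}, Chain cell nxt K h l → e ∈ l →
      ∃ l', l = cell h :: l' ∧ Chain cell nxt K (nxt h) l' := by
    intro cell nxt K h l H hl
    cases H with
    | nil => simp at hl
    | cons h l _ _ H => exact ⟨l, rfl, H⟩
  obtain ⟨l, s', t, hr, ⟨h1, h2, h3, h4⟩, hnb, ht⟩ := runs_loop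
    (b := .not (.and (.eq (read aPar (read aCell (read aHead (reg rLow)))) (reg rLow))
      (.not (.eq (read aFull (read aCell (read aHead (reg rLow)))) (succ (reg rNew))))))
    (P := setArr aHead (reg rLow) (read aNxt (read aHead (reg rLow))))
    (fun (l : List ℕ) s => Chain (s₀.arr aCell) (s₀.arr aNxt) (s₀.reg rCell) (s.arr aHead u) l ∧
      e ∈ l ∧ (∀ w, w ≠ u → s.arr aHead w = s₀.arr aHead w) ∧ Agree findChild s₀ s)
    (fun l _ => 40 * l.length)
    (by
      rintro l s ⟨h1, h2, h3, h4⟩ hb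
      have ep : s.arr aPar = s₀.arr aPar := h4.arr _ rfl
      have ec : s.arr aCell = s₀.arr aCell := h4.arr _ rfl
      have en : s.arr aNxt = s₀.arr aNxt := h4.arr _ rfl
      have ef : s.arr aFull = s₀.arr aFull := h4.arr _ rfl
      have eu : s.reg rLow = u := (h4.reg _ rfl).trans hu
      have ei : s.reg rNew = i := (h4.reg _ rfl).trans hi
      obtain ⟨l', rfl, hl'⟩ := hcons h1 h2
      have hr := Runs.setArr s aHead (reg rLow) (read aNxt (read aHead (reg rLow)))
      refine ⟨l', _, _, hr, ⟨?_, ?_, ?_, h4.trans (hr.agree.mono (fun _ h => h) (fun _ h => h)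
        (fun _ h => h) fun _ h => h)⟩, ?_⟩
      · simpa [NatExpr.eval, eu, en] using hl'
      · rcases List.mem_cons.1 h2 with h | h
        · exfalso
          simp only [Test.holds, NatExpr.eval, ep, ec, ef, eu, ei, ← h] at hb
          exact hb ⟨hep, hef⟩
        · exact h
      · intro w hw
        simp [NatExpr.eval, eu, hw, h3 w hw]
      · simp only [NatExpr.cost, Test.cost, List.length_cons]
        omega)
    (L u) s₀ ⟨hL.chain u, he, fun _ _ => rfl, .refl _ _⟩
  have ep : s'.arr aPar = s₀.arr aPar := h4.arr _ rfl
  have ec : s'.arr aCell = s₀.arr aCell := h4.arr _ rfl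
  have ef : s'.arr aFull = s₀.arr aFull := h4.arr _ rfl
  have eu : s'.reg rLow = u := (h4.reg _ rfl).trans hu
  have ei : s'.reg rNew = i := (h4.reg _ rfl).trans hi
  simp only [Test.holds, NatExpr.eval, ep, ec, ef, eu, ei, not_not] at hnb
  obtain ⟨l', rfl, -⟩ := hcons h1 h2
  refine ⟨s', t, s₀.arr aCell (s'.arr aHead u) :: l', hr, ⟨hL.pos, fun w => ?_⟩, ?_, hnb.1, hnb.2, by simp, h3⟩
  · by_cases hw : w = u
    · subst hw; simpa using h1
    · rw [h3 w hw, Function.update_of_ne hw]; exact hL.chain w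
  · simp only [NatExpr.cost, Test.cost] at ht ⊢
    omega

/-- Node `rPart` and the new vertex are to be combined at a node with label `rLab`. -/
structure Picked (A : ℕ → ℕ → Prop) (n i N : ℕ) (D : ℕ → Finset ℕ) (L : ℕ → List ℕ) (s : State)
    (f ℓ : ℕ) : Prop where
  state : TreeState A n i N D L s
  part : s.reg rPart = f
  lab : s.reg rLab = ℓ
  mem : f ∈ treeNodes n i N
  lab_eq : ℓ = 1 ∨ ℓ = 2
  inside : ∀ y ∈ D f, (A i y ↔ ℓ = 2)
  outside : ∀ y < i, y ∉ D f → ∀ t ∈ D f, (A i y ↔ A t y)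
  alt : ∀ c ∈ treeNodes n i N, s.arr aPar c ≠ n → c ≠ f →
      s.arr aLab c ≠ s.arr aLab (s.arr aPar c)
  alt_part : s.arr aPar f ≠ n → if s.arr aLab f = ℓ then
      s.arr aLab f ≠ s.arr aLab (s.arr aPar f) else ℓ ≠ s.arr aLab (s.arr aPar f)

/-- The situation after a lowest candidate has been found. -/
structure Found (A : ℕ → ℕ → Prop) (n i N : ℕ) (D : ℕ → Finset ℕ) (L : ℕ → List ℕ)
    (X : Finset ℕ) (s : State) (u m : ℕ) : Prop where
  state : TreeState A n i N D L s
  alt : Alternating n i N (s.arr aPar) (s.arr aLab)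
  nbrs : ∀ y, y ∈ X ↔ y < i ∧ A i y
  marking : Marking n i N (s.arr aPar) (s.arr aNch) D X (i + 1) (s.arr aQueue) m m (s.arr aCnt)
    (s.arr aCst) (s.arr aFull)
  len : s.reg rLen = m
  new : s.reg rNew = i
  low : s.reg rLow = u
  candidate : IsCandidate n i N (s.arr aPar) D X u
  lowest : ∀ w, IsCandidate n i N (s.arr aPar) D X w →
    s.arr aPar w ≠ u ∧ s.arr aPar (s.arr aPar w) ≠ u

/-- Take the only child of node `rLow` that is not full. -/
def takeChild : Program := seqList
  [findChild, setReg rPart (read aCell (read aHead (reg rLow))), setReg rDest (reg rLow), moveFull]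

/-- With one non-full child `e`, the vertices below `u` that the new vertex does not see are exactly
those below `e`, so no regrouping is needed and tree and labels stay as they are. Only the list of
`u` has to be repaired, because the search may have deleted full children from it. -/
theorem runs_takeChild {A : ℕ → ℕ → Prop} {n i N : ℕ} {D : ℕ → Finset ℕ} {L : ℕ → List ℕ}
    {X : Finset ℕ} {s : State} {u m : ℕ} (F : Found A n i N D L X s u m)
    (hsymm : ∀ a b, A a b → A b a) (hP4 : P4Free A) (hun : u ≠ n) (hl : s.arr aLab u = 2)
    (hone : ((fullNodes n i N D X).filter (s.arr aPar · = u)).card + 1 = s.arr aNch u)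
    (hlab : s.reg rLab = 1) :
    ∃ s' t N' D' L' f, Runs takeChild s s' t ∧ Picked A n i N' D' L' s' f 1 ∧
      t + 40 * totalLength N' L' ≤ 40 * totalLength N L + 140 * m + 100 := by
  have H := F.state
  have T := H.tree
  obtain ⟨hu1, hu2⟩ := T.candidate_inner F.candidate hun
  set S := (fullNodes n i N D X).filter (s.arr aPar · = u) with hS
  obtain ⟨hin, hout, hS1, hS2⟩ := T.lowest_candidate hsymm hP4 F.alt F.nbrs hun F.candidate
    F.lowest hS rfl
  rw [if_pos hl] at hin hout
  have hSsub : S ⊆ (treeNodes n i N).filter (s.arr aPar · = u) := by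
    intro c hc
    rw [hS, Finset.mem_filter] at hc
    exact Finset.mem_filter.2 ⟨(mem_fullNodes.1 hc.1).1, hc.2⟩
  have hcard : (((treeNodes n i N).filter (s.arr aPar · = u)) \ S).card = 1 := by
    rw [Finset.card_sdiff_of_subset hSsub, ← T.children u hu1 hu2]; omega
  obtain ⟨e, he⟩ := Finset.card_eq_one.1 hcard
  have hfl : ∀ w, s.arr aFull w = i + 1 ↔ w ∈ fullNodes n i N D X := fun w => by
    rw [F.marking.flag, F.marking.complete T]
  have hchar : ∀ c, c = e ↔ s.arr aPar c = u ∧ s.arr aFull c ≠ i + 1 := by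
    intro c
    have : c ∈ ((treeNodes n i N).filter (s.arr aPar · = u)) \ S ↔ c = e := by rw [he]; simp
    rw [← this, Finset.mem_sdiff, Finset.mem_filter, hS, Finset.mem_filter, Ne, hfl]
    constructor
    · rintro ⟨⟨h1, h2⟩, h3⟩; exact ⟨h2, fun h => h3 ⟨h, h2⟩⟩
    · rintro ⟨h1, h2⟩
      refine ⟨⟨?_, h1⟩, fun h => h2 h.1⟩
      by_contra h
      have := H.par_dead c h
      omega
  have hem : e ∈ treeNodes n i N ∧ s.arr aPar e = u := by
    have : e ∈ ((treeNodes n i N).filter (s.arr aPar · = u)) \ S := by rw [he]; simp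
    simpa using (Finset.mem_sdiff.1 this).1
  have hDe : D e = D u \ S.biUnion D := by
    ext y
    rw [Finset.mem_sdiff]
    constructor
    · intro hy
      have hyu := T.sub e hem.1 (by omega) hy
      rw [hem.2] at hyu
      refine ⟨hyu, fun h => ?_⟩
      obtain ⟨c, hc, hyc⟩ := Finset.mem_biUnion.1 h
      rw [hS, Finset.mem_filter] at hc
      have hce : e ≠ c := fun h => ((hchar e).1 rfl).2 ((hfl e).2 (h ▸ hc.1))
      exact Finset.disjoint_left.1 (T.disj e hem.1 c (mem_fullNodes.1 hc.1).1 hce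
        (hem.2.trans hc.2.symm)) hy hyc
    · rintro ⟨hyu, hyS⟩
      obtain ⟨c, hc, hp, hyc⟩ := T.cover u hu1 hu2 y hyu
      have hcf : s.arr aFull c ≠ i + 1 := fun h => hyS (Finset.mem_biUnion.2
        ⟨c, by rw [hS, Finset.mem_filter]; exact ⟨(hfl c).1 h, hp⟩, hyc⟩)
      rwa [← (hchar c).2 ⟨hp, hcf⟩]
  obtain ⟨s₁, t₁, l, hr₁, hL₁, ht₁, hp₁, hf₁, hcl, hh₁⟩ := runs_findChild s F.low F.new H.lists
    ⟨e, hem.2 ▸ H.listed e hem.1, (hchar e).1 rfl⟩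
  have hce := (hchar _).2 ⟨hp₁, hf₁⟩
  have A₁ := hr₁.agree
  rw [hce] at hcl
  set s₂ := (s₁.setReg rPart e).setReg rDest u with hs₂
  have hr₂ : Runs (setReg rPart (read aCell (read aHead (reg rLow)))) s₁ (s₁.setReg rPart e)
      ((read aCell (read aHead (reg rLow))).cost + 1) := by
    have := Runs.setReg s₁ rPart (read aCell (read aHead (reg rLow)))
    have h0 : (read aCell (read aHead (reg rLow))).eval s₁ = e := by
      simp only [NatExpr.eval]
      rw [A₁.arr aCell rfl, A₁.reg rLow rfl, F.low, hce]
    rwa [h0] at this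
  have hr₃ : Runs (setReg rDest (reg rLow)) (s₁.setReg rPart e) s₂
      ((reg rLow).cost + 1) := by
    have := Runs.setReg (s₁.setReg rPart e) rDest (reg rLow)
    have h0 : (reg rLow).eval (s₁.setReg rPart e) = u := by
      simp [NatExpr.eval, A₁.reg rLow rfl, F.low]
    rwa [h0] at this
  have e2p : s₂.arr aPar = s.arr aPar := A₁.arr aPar rfl
  have e2q : s₂.arr aQueue = s.arr aQueue := A₁.arr aQueue rfl
  have e2n : s₂.arr aNch = s.arr aNch := A₁.arr aNch rfl
  have e2c : s₂.arr aCell = s.arr aCell := A₁.arr aCell rfl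
  have e2x : s₂.arr aNxt = s.arr aNxt := A₁.arr aNxt rfl
  have e2l : s₂.arr aLab = s.arr aLab := A₁.arr aLab rfl
  have e2h : s₂.arr aHead = s₁.arr aHead := rfl
  have e2m : s₂.reg rLen = m := by simp [hs₂, A₁.reg rLen rfl, F.len]
  have e2k : s₂.reg rCell = s.reg rCell := by simp [hs₂, A₁.reg rCell rfl]
  have hcc := F.marking.count_eq T u
  rw [← hS] at hcc
  -- Source and destination are both `u`: parents and numbers of children come out unchanged, and
  -- all full children are listed again.
  obtain ⟨s₃, t₃, l', hr₄, ht₄, hpar, hnch, hL₃, hh₃, hlen, hl'⟩ := runs_moveFull s₂ (u := u)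
    (d := u) (m := m) (L := Function.update L u l)
    (by simp [hs₂, A₁.reg rLow rfl, F.low]) (by simp [hs₂]) e2m
    (by rw [e2q]; exact F.marking.inj)
    (by rw [e2p, e2q, e2n, hcc]; omega)
    (by rw [e2k, e2h, e2c, e2x]; exact hL₁)
  have A₃ := hr₄.agree
  have e3p : s₃.arr aPar = s.arr aPar := by
    funext c
    rw [hpar, e2p, e2q]
    split_ifs with h
    · exact h.2.symm
    · rfl
  have e3n : s₃.arr aNch = s.arr aNch := by
    funext w
    have := hnch w
    rw [e2n] at this
    omega
  have e3l : s₃.arr aLab = s.arr aLab := (A₃.arr aLab rfl).trans e2l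
  rw [e2p, e2q, hcc] at hlen
  refine ⟨s₃, _, N, D, Function.update L u (l' ++ l), e,
    .seq hr₁ (.seq hr₂ (.seq hr₃ (.seq hr₄ (.skip _)))), ?_, ?_⟩
  · refine
      { state := ?_
        part := by rw [A₃.reg rPart rfl]; simp [hs₂]
        lab := by rw [A₃.reg rLab rfl]; simp [hs₂, A₁.reg rLab rfl, hlab]
        mem := hem.1
        lab_eq := .inl rfl
        inside := by
          intro y hy
          rw [hDe] at hy
          rw [hin y hy]; omega
        outside := by rw [hDe]; exact hout
        alt := by rw [e3p, e3l]; exact fun c hc h _ => F.alt c hc h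
        alt_part := by
          rw [e3p, e3l, hem.2, hl]
          intro _
          split_ifs <;> omega }
    refine
      { verts := by rw [A₃.reg rVerts rfl]; simp [hs₂, A₁.reg rVerts rfl, H.verts]
        node := by rw [A₃.reg rNode rfl]; simp [hs₂, A₁.reg rNode rfl, H.node]
        tree := by rw [e3p, e3l, e3n]; exact T
        lists := by simpa using hL₃
        listed := ?_
        rootFirst := ?_
        fresh := ?_
        leafLab := by rw [e3l]; exact H.leafLab
        par_super := by rw [e3p]; exact H.par_super
        par_super' := by rw [e3p]; exact H.par_super'
        par_dead := by rw [e3p]; exact H.par_dead }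
    · intro c hc
      rw [e3p]
      by_cases hp : s.arr aPar c = u
      · rw [hp, Function.update_self, List.mem_append]
        by_cases hf : s.arr aFull c = i + 1
        · left
          obtain ⟨j, hj, rfl⟩ := (F.marking.complete T).2 ((hfl c).1 hf)
          have := hl' j hj (by rw [e2p, e2q, hp])
          rwa [e2q] at this
        · right
          rwa [(hchar c).2 ⟨hp, hf⟩]
      · rw [Function.update_of_ne hp]; exact H.listed c hc
    · obtain ⟨r, hr, hp, l₀, hl₀⟩ := H.rootFirst
      exact ⟨r, hr, by rw [e3p, hp], l₀, by rw [Function.update_of_ne hun.symm, hl₀]⟩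
    · intro w hw
      have := H.fresh w hw
      have hwu : w ≠ u := by omega
      rw [hh₃ w hwu, e2h, hh₁ w hwu, e3n]
      exact this
  · have h1 := totalLength_update N L hu2 (l' ++ l)
    have h2 := F.marking.card_le
    have h3 : S.card ≤ m := by
      rw [← hcc]
      exact (Finset.card_filter_le _ _).trans (by simp)
    simp only [List.length_append, NatExpr.cost] at h1 ⊢
    omega

end RAM



/-! ### Separating the full children of a candidate -/

namespace RAM

open Program NatExpr

/-- Move the full children of node `rLow` to a new node with label `ℓ`. -/
def collect (ℓ : ℕ) : Program := seqList
  [setArr aLab (reg rNode) (const ℓ), setReg rDest (reg rNode), moveFull]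

theorem runs_collect {A : ℕ → ℕ → Prop} {n i N : ℕ} {D : ℕ → Finset ℕ} {L : ℕ → List ℕ}
    {X : Finset ℕ} {s : State} {u m : ℕ} (F : Found A n i N D L X s u m)
    {S : Finset ℕ} (hS : S = (fullNodes n i N D X).filter (s.arr aPar · = u))
    (hle : S.card ≤ s.arr aNch u) (huN : u ≠ N) (ℓ : ℕ) :
    ∃ s' t l, Runs (collect ℓ) s s' t ∧ t ≤ 100 * m + 20 ∧
      (∀ c, s'.arr aPar c = if c ∈ S then N else s.arr aPar c) ∧
      s'.arr aNch N = S.card ∧ s'.arr aNch u + S.card = s.arr aNch u ∧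
      (∀ w, w ≠ N → w ≠ u → s'.arr aNch w = s.arr aNch w) ∧
      s'.arr aLab = Function.update (s.arr aLab) N ℓ ∧
      ChildLists (s'.reg rCell) (s'.arr aHead) (s'.arr aCell) (s'.arr aNxt)
        (Function.update L N l) ∧
      (∀ w, w ≠ N → s'.arr aHead w = s.arr aHead w) ∧
      l.length = S.card ∧ ∀ c ∈ S, c ∈ l := by
  have H := F.state
  have T := H.tree
  have hcc := F.marking.count_eq T u
  rw [← hS] at hcc
  have hcomp : ∀ c, ((∃ j < m, s.arr aQueue j = c) ∧ s.arr aPar c = u) ↔ c ∈ S := by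
    intro c
    rw [F.marking.complete T, hS, Finset.mem_filter]
  set s₁ := (s.setArr aLab N ℓ).setReg rDest N with hs₁
  have hr₁ : Runs (setArr aLab (reg rNode) (const ℓ)) s (s.setArr aLab N ℓ) 3 := by
    have := Runs.setArr s aLab (reg rNode) (const ℓ)
    simpa [NatExpr.eval, NatExpr.cost, H.node] using this
  have hr₂ : Runs (setReg rDest (reg rNode)) (s.setArr aLab N ℓ) s₁ 2 := by
    have := Runs.setReg (s.setArr aLab N ℓ) rDest (reg rNode)
    simpa [NatExpr.eval, NatExpr.cost, H.node] using this
  have e2p : s₁.arr aPar = s.arr aPar := rfl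
  have e2q : s₁.arr aQueue = s.arr aQueue := rfl
  have e2n : s₁.arr aNch = s.arr aNch := rfl
  obtain ⟨s₃, t₃, l, hr₄, ht₄, hpar, hnch, hL₃, hh₃, hlen, hl'⟩ := runs_moveFull s₁ (u := u)
    (d := N) (m := m) (L := L) (by simp [hs₁, F.low]) (by simp [hs₁]) (by simp [hs₁, F.len])
    (by rw [e2q]; exact F.marking.inj) (by rw [e2p, e2q, e2n, hcc]; exact hle)
    (by simpa [hs₁] using H.lists)
  rw [e2p, e2q] at hpar hnch hlen hl'
  rw [e2n] at hnch
  simp only [hcc] at hnch hlen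
  rw [H.fresh_list le_rfl, List.append_nil] at hL₃
  have A₃ := hr₄.agree
  refine ⟨s₃, _, l, .seq hr₁ (.seq hr₂ (.seq hr₄ (.skip _))), by omega, ?_, ?_, ?_, ?_, ?_, hL₃,
    ?_, hlen, ?_⟩
  · intro c
    rw [hpar c]
    simp only [hcomp]
  · have := hnch N
    rw [if_neg huN.symm, if_pos rfl, (H.fresh N le_rfl).2] at this
    omega
  · have := hnch u
    rw [if_pos rfl, if_neg huN] at this
    omega
  · intro w h1 h2
    have := hnch w
    rw [if_neg h2, if_neg h1] at this
    omega
  · rw [A₃.arr aLab rfl]; simp [hs₁]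
  · intro w hw
    rw [hh₃ w hw]; simp [hs₁]
  · intro c hc
    obtain ⟨⟨j, hj, rfl⟩, hp⟩ := (hcomp c).2 hc
    exact hl' j hj hp

/-- Move the full children of the parallel node `rLow` to a new child. -/
def group : Program := .seq (collect 1) (seqList
  [setArr aPar (reg rNode) (reg rLow), push (reg rLow) (reg rNode),
   setArr aNch (reg rLow) (succ (read aNch (reg rLow))), setReg rPart (reg rNode),
   setReg rNode (succ (reg rNode))])

/-- The new node `N` collects the full children and is a parallel child of the parallel node `u`.
Alternation fails at `N` only, and attaching the new vertex with label `2` repairs it, because this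
puts a series node between `u` and `N`. -/
theorem runs_group {A : ℕ → ℕ → Prop} {n i N : ℕ} {D : ℕ → Finset ℕ} {L : ℕ → List ℕ}
    {X : Finset ℕ} {s : State} {u m : ℕ} (F : Found A n i N D L X s u m)
    (hsymm : ∀ a b, A a b → A b a) (hP4 : P4Free A) (hun : u ≠ n) (hl : s.arr aLab u = 1)
    (htwo : 2 ≤ ((fullNodes n i N D X).filter (s.arr aPar · = u)).card)
    (hlab : s.reg rLab = 2) :
    ∃ s' t N' D' L' f, Runs group s s' t ∧ Picked A n i N' D' L' s' f 2 ∧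
      t + 40 * totalLength N' L' ≤ 40 * totalLength N L + 140 * m + 100 := by
  have H := F.state
  have T := H.tree
  have hle := T.le
  have hleN := T.le_N
  obtain ⟨hu1, hu2⟩ := T.candidate_inner F.candidate hun
  set S := (fullNodes n i N D X).filter (s.arr aPar · = u) with hS
  obtain ⟨hin, hout, hS1, hS2⟩ := T.lowest_candidate hsymm hP4 F.alt F.nbrs hun F.candidate
    F.lowest hS rfl
  rw [if_neg (by omega)] at hin hout
  have hSm : ∀ c ∈ S, c ∈ treeNodes n i N ∧ s.arr aPar c = u := by
    intro c hc
    rw [hS, Finset.mem_filter] at hc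
    exact ⟨(mem_fullNodes.1 hc.1).1, hc.2⟩
  have huN : u ≠ N := by omega
  obtain ⟨s₁, t₁, l, hr₁, ht₁, hpar, hnN, hnu, hno, hlb, hL₁, hh₁, hlen, hSl⟩ :=
    runs_collect F hS hS2.le huN 1
  have A₁ := hr₁.agree
  have e1u : s₁.reg rLow = u := (A₁.reg _ rfl).trans F.low
  have e1N : s₁.reg rNode = N := (A₁.reg _ rfl).trans H.node
  obtain ⟨t₂, hr₂, ht₂⟩ := runs_exec (P := seqList
    [setArr aPar (reg rNode) (reg rLow), push (reg rLow) (reg rNode),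
     setArr aNch (reg rLow) (succ (read aNch (reg rLow))), setReg rPart (reg rNode),
     setReg rNode (succ (reg rNode))]) rfl s₁
  set s₂ := exec (seqList
    [setArr aPar (reg rNode) (reg rLow), push (reg rLow) (reg rNode),
     setArr aNch (reg rLow) (succ (read aNch (reg rLow))), setReg rPart (reg rNode),
     setReg rNode (succ (reg rNode))]) s₁ with hs₂
  have he : s₂ = ((((((((s₁.setArr aPar N u).setArr aCell (s₁.reg rCell) N).setArr aNxt
      (s₁.reg rCell) (s₁.arr aHead u)).setArr aHead u (s₁.reg rCell)).setReg rCell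
      (s₁.reg rCell + 1)).setArr aNch u (s₁.arr aNch u + 1)).setReg rPart N).setReg rNode
      (N + 1)) := by
    rw [hs₂]
    simp [push, exec, seqList, NatExpr.eval, e1u, e1N]
  have hNt : N ∉ treeNodes n i N := by rw [mem_treeNodes]; omega
  have hNS : N ∉ S := fun h => hNt (hSm N h).1
  have e2p : ∀ c, s₂.arr aPar c = if c = N then u else if c ∈ S then N else s.arr aPar c := by
    intro c
    rw [he]
    simp [Function.update_apply, hpar]
  have e2l : s₂.arr aLab = Function.update (s.arr aLab) N 1 := by rw [he]; simp [hlb]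
  have e2n : ∀ w, s₂.arr aNch w = if w = u then s₁.arr aNch u + 1 else s₁.arr aNch w := by
    intro w; rw [he]; simp [Function.update_apply]
  have hnodes : ∀ c, c ∈ treeNodes n i (N + 1) ↔ c = N ∨ c ∈ treeNodes n i N := by
    intro c; simp only [mem_treeNodes]; omega
  have T' : Cotree A n i (N + 1) (s₂.arr aPar) (s₂.arr aLab) (s₂.arr aNch)
      (Function.update D N (S.biUnion D)) := by
    refine T.groupChildren hsymm hu1 hu2 hSm htwo hS2 ?_ ?_ ?_ ?_ ?_ ?_ ?_ ?_ ?_ ?_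
    · intro c hc
      rw [e2p, if_neg (ne_of_mem_of_not_mem hc hNS), if_pos hc]
    · rw [e2p, if_pos rfl]
    · intro c hc hcS
      rw [e2p, if_neg (ne_of_mem_of_not_mem hc hNt), if_neg hcS]
    · rw [e2l, hl]; simp
    · intro c hc; rw [e2l, Function.update_of_ne hc]
    · rw [e2n, if_neg huN.symm, hnN]
    · rw [e2n, if_pos rfl]; omega
    · intro c h1 h2; rw [e2n, if_neg h2, hno c h1 h2]
    · simp
    · intro c hc; rw [Function.update_of_ne hc]
  refine ⟨s₂, _, N + 1, Function.update D N (S.biUnion D),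
    Function.update (Function.update L N l) u
    (N :: Function.update L N l u), N, .seq hr₁ hr₂, ?_, ?_⟩
  · refine
      { state := ?_
        part := by rw [he]; simp
        lab := by
          have : s₁.reg rLab = s.reg rLab := A₁.reg rLab rfl
          rw [he]; simp [this, hlab]
        mem := (hnodes N).2 (.inl rfl)
        lab_eq := .inr rfl
        inside := by
          intro y hy
          rw [Function.update_self] at hy
          rw [hin y hy]; omega
        outside := by rw [Function.update_self]; exact hout
        alt := ?_
        alt_part := by
          rw [e2p, if_pos rfl, e2l, Function.update_self, Function.update_of_ne huN, hl]
          intro _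
          split_ifs <;> omega }
    · refine
        { verts := by
            have : s₁.reg rVerts = s.reg rVerts := A₁.reg rVerts rfl
            rw [he]; simp [this, H.verts]
          node := by rw [he]; simp
          tree := T'
          lists := ?_
          listed := ?_
          rootFirst := ?_
          fresh := ?_
          leafLab := ?_
          par_super := ?_
          par_super' := ?_
          par_dead := ?_ }
      · have := hL₁.push u N
        rw [he]
        simpa using this
      · intro c hc
        rw [e2p]
        by_cases hcN : c = N
        · simp [hcN]
        · have hc := ((hnodes c).1 hc).resolve_left hcN
          rw [if_neg hcN]
          have hpN := T.parent c hc
          by_cases hcS : c ∈ S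
          · rw [if_pos hcS, Function.update_of_ne huN.symm, Function.update_self]
            exact hSl c hcS
          · rw [if_neg hcS]
            have := H.listed c hc
            simp only [Function.update_apply, if_neg huN]
            rw [if_neg (show s.arr aPar c ≠ N by omega)]
            split_ifs with h
            · rw [h] at this; exact List.mem_cons_of_mem _ this
            · exact this
      · obtain ⟨r, hr, hp, l₀, hl₀⟩ := H.rootFirst
        refine ⟨r, (hnodes r).2 (.inr hr), ?_, l₀, ?_⟩
        · rw [e2p, if_neg (ne_of_mem_of_not_mem hr hNt), if_neg, hp]
          intro h
          exact hun ((hSm r h).2.symm.trans hp)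
        · rw [Function.update_of_ne hun.symm, Function.update_of_ne (by omega), hl₀]
      · intro w hw
        have := H.fresh w (by omega)
        have h1 : w ≠ u := by omega
        have h2 : w ≠ N := by omega
        rw [e2n, if_neg h1, hno w h2 h1, he]
        simp [Function.update_apply, h1, hh₁ w h2, this]
      · intro v hv
        rw [e2l, Function.update_of_ne (by omega)]; exact H.leafLab v hv
      · rw [e2p, if_neg (by omega), if_neg]
        · exact H.par_super
        · intro h; have := (hSm n h).1; rw [mem_treeNodes] at this; omega
      · rw [e2p, if_neg (by omega), if_neg]
        · exact H.par_super'
        · intro h; have := (hSm _ h).1; rw [mem_treeNodes] at this; omega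
      · intro c hc
        rw [hnodes, not_or] at hc
        rw [e2p, if_neg hc.1, if_neg (fun h => hc.2 (hSm c h).1)]
        exact H.par_dead c hc.2
    · intro c hc hp hcN
      have hc := ((hnodes c).1 hc).resolve_left hcN
      rw [e2p, if_neg hcN] at hp ⊢
      rw [e2l, Function.update_of_ne hcN]
      split_ifs at hp ⊢ with h
      · rw [Function.update_self]
        have := F.alt c hc (by rw [(hSm c h).2]; exact hun)
        rw [(hSm c h).2, hl] at this
        exact this
      · have hpN := T.parent c hc
        rw [Function.update_of_ne (by omega)]
        exact F.alt c hc hp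
  · have h0 : L N = [] := H.fresh_list le_rfl
    have h1 := totalLength_update (N + 1) L (p := N) (by omega) l
    have h2 := totalLength_update (N + 1) (Function.update L N l) (p := u) (by omega)
      (N :: Function.update L N l u)
    have h4 := totalLength_succ N L
    have h5 : S.card ≤ m := by
      rw [hS, ← F.marking.count_eq T u]
      exact (Finset.card_filter_le _ _).trans (by simp)
    have hb : (seqList
      [setArr aPar (reg rNode) (reg rLow), push (reg rLow) (reg rNode),
       setArr aNch (reg rLow) (succ (read aNch (reg rLow))), setReg rPart (reg rNode),
       setReg rNode (succ (reg rNode))]).bound ≤ 39 := by decide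
    simp only [List.length_cons, h0, List.length_nil] at h1 h2 h4
    omega

/-- Let a new node with the full children of the series node `rLow` take the place of that node,
which becomes a child of the new node. -/
def split : Program := .seq (collect 2) (seqList
  [setArr aPar (reg rNode) (read aPar (reg rLow)), push (read aPar (reg rLow)) (reg rNode),
   setArr aPar (reg rLow) (reg rNode), push (reg rNode) (reg rLow),
   setArr aNch (reg rNode) (succ (read aNch (reg rNode))), setReg rPart (reg rLow),
   setReg rNode (succ (reg rNode))])

/-- The full children are moved rather than the others, because only their number is bounded by the
degree. So the new series node `N` takes them and the place of `u`, while `u` keeps the remaining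
children and becomes a child of `N`. Alternation fails only at `u`, where the parallel node of the
new vertex will be inserted. -/
theorem runs_split {A : ℕ → ℕ → Prop} {n i N : ℕ} {D : ℕ → Finset ℕ} {L : ℕ → List ℕ}
    {X : Finset ℕ} {s : State} {u m : ℕ} (F : Found A n i N D L X s u m)
    (hsymm : ∀ a b, A a b → A b a) (hP4 : P4Free A) (hun : u ≠ n) (hl : s.arr aLab u = 2)
    (htwo : ((fullNodes n i N D X).filter (s.arr aPar · = u)).card + 1 ≠ s.arr aNch u)
    (hlab : s.reg rLab = 1) :
    ∃ s' t N' D' L' f, Runs split s s' t ∧ Picked A n i N' D' L' s' f 1 ∧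
      t + 40 * totalLength N' L' ≤ 40 * totalLength N L + 140 * m + 150 := by
  have H := F.state
  have T := H.tree
  have hle := T.le
  have hleN := T.le_N
  obtain ⟨hu1, hu2⟩ := T.candidate_inner F.candidate hun
  have hum := T.inner_mem hu1 hu2
  set S := (fullNodes n i N D X).filter (s.arr aPar · = u) with hS
  obtain ⟨hin, hout, hS1, hS2⟩ := T.lowest_candidate hsymm hP4 F.alt F.nbrs hun F.candidate
    F.lowest hS rfl
  rw [if_pos hl] at hin hout
  have hSm : ∀ c ∈ S, c ∈ treeNodes n i N ∧ s.arr aPar c = u := by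
    intro c hc
    rw [hS, Finset.mem_filter] at hc
    exact ⟨(mem_fullNodes.1 hc.1).1, hc.2⟩
  have huN : u ≠ N := by omega
  have hpu : s.arr aPar u ≠ u := fun h => by
    have := T.ssub hum (by rw [h]; exact hun)
    rw [h] at this
    exact this.ne rfl
  have huS : u ∉ S := fun h => hpu (hSm u h).2
  have hpuN : s.arr aPar u ≠ N := by have := T.parent u hum; omega
  obtain ⟨s₁, t₁, l, hr₁, ht₁, hpar, hnN, hnu, hno, hlb, hL₁, hh₁, hlen, hSl⟩ :=
    runs_collect F hS hS2.le huN 2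
  have A₁ := hr₁.agree
  have e1u : s₁.reg rLow = u := (A₁.reg _ rfl).trans F.low
  have e1N : s₁.reg rNode = N := (A₁.reg _ rfl).trans H.node
  have e1p : s₁.arr aPar u = s.arr aPar u := by rw [hpar, if_neg huS]
  obtain ⟨t₂, hr₂, ht₂⟩ := runs_exec (P := seqList
    [setArr aPar (reg rNode) (read aPar (reg rLow)), push (read aPar (reg rLow)) (reg rNode),
     setArr aPar (reg rLow) (reg rNode), push (reg rNode) (reg rLow),
     setArr aNch (reg rNode) (succ (read aNch (reg rNode))), setReg rPart (reg rLow),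
     setReg rNode (succ (reg rNode))]) rfl s₁
  set s₂ := exec (seqList
    [setArr aPar (reg rNode) (read aPar (reg rLow)), push (read aPar (reg rLow)) (reg rNode),
     setArr aPar (reg rLow) (reg rNode), push (reg rNode) (reg rLow),
     setArr aNch (reg rNode) (succ (read aNch (reg rNode))), setReg rPart (reg rLow),
     setReg rNode (succ (reg rNode))]) s₁ with hs₂
  set K := s₁.reg rCell with hK
  set p := s.arr aPar u with hp
  have hev : s₂.reg rVerts = s₁.reg rVerts ∧ s₂.reg rLab = s₁.reg rLab ∧ s₂.reg rPart = u ∧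
      s₂.reg rNode = N + 1 ∧ s₂.reg rCell = K + 1 + 1 ∧
      s₂.arr aPar = Function.update (Function.update (s₁.arr aPar) N p) u N ∧
      s₂.arr aLab = s₁.arr aLab ∧
      s₂.arr aNch = Function.update (s₁.arr aNch) N (s₁.arr aNch N + 1) ∧
      s₂.arr aCell = Function.update (Function.update (s₁.arr aCell) K N) (K + 1) u ∧
      s₂.arr aHead = Function.update (Function.update (s₁.arr aHead) p K) N (K + 1) ∧
      s₂.arr aNxt = Function.update (Function.update (s₁.arr aNxt) K (s₁.arr aHead p)) (K + 1)
        (Function.update (s₁.arr aHead) p K N) := by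
    rw [hs₂]
    simp [push, exec, seqList, NatExpr.eval, e1u, e1N, e1p, huN, huN.symm, hpuN, hpuN.symm, ← hK]
  obtain ⟨ev, elb, ept, end', ek, ep, el, en, ec, eh, ex⟩ := hev
  have hNt : N ∉ treeNodes n i N := by rw [mem_treeNodes]; omega
  have hNS : N ∉ S := fun h => hNt (hSm N h).1
  have e2p : ∀ c, s₂.arr aPar c = if c = u then N else if c = N then p else
      if c ∈ S then N else s.arr aPar c := by
    intro c
    rw [ep]
    simp [Function.update_apply, hpar]
  have e2l : s₂.arr aLab = Function.update (s.arr aLab) N 2 := by rw [el, hlb]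
  have e2n : ∀ w, s₂.arr aNch w = if w = N then s₁.arr aNch N + 1 else s₁.arr aNch w := by
    intro w; rw [en]; simp [Function.update_apply]
  have hnodes : ∀ c, c ∈ treeNodes n i (N + 1) ↔ c = N ∨ c ∈ treeNodes n i N := by
    intro c; simp only [mem_treeNodes]; omega
  have T' : Cotree A n i (N + 1) (s₂.arr aPar) (s₂.arr aLab) (s₂.arr aNch)
      (Function.update (Function.update D N (D u)) u (D u \ S.biUnion D)) := by
    refine T.splitChildren hsymm hu1 hu2 hSm hS1 (by omega) ?_ ?_ ?_ ?_ ?_ ?_ ?_ ?_ ?_ ?_ ?_ ?_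
    · intro c hc
      rw [e2p, if_neg (ne_of_mem_of_not_mem hc huS), if_neg (ne_of_mem_of_not_mem hc hNS), if_pos hc]
    · rw [e2p, if_neg huN.symm, if_pos rfl]
    · rw [e2p, if_pos rfl]
    · intro c hc hcS hcu
      rw [e2p, if_neg hcu, if_neg (ne_of_mem_of_not_mem hc hNt), if_neg hcS]
    · rw [e2l, hl]; simp
    · intro c hc; rw [e2l, Function.update_of_ne hc]
    · rw [e2n, if_pos rfl, hnN]
    · rw [e2n, if_neg huN]; omega
    · intro c h1 h2; rw [e2n, if_neg h1, hno c h1 h2]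
    · simp [huN.symm]
    · simp
    · intro c h1 h2; simp [h1, h2]
  refine ⟨s₂, _, N + 1, Function.update (Function.update D N (D u)) u (D u \ S.biUnion D),
    Function.update (Function.update (Function.update L N l) p
    (N :: Function.update L N l p)) N (u :: Function.update (Function.update L N l) p
    (N :: Function.update L N l p) N), u, .seq hr₁ hr₂, ?_, ?_⟩
  · refine
      { state := ?_
        part := ept
        lab := by rw [elb, A₁.reg rLab rfl, hlab]
        mem := (hnodes u).2 (.inr hum)
        lab_eq := .inl rfl
        inside := by
          intro y hy
          rw [Function.update_self] at hy
          rw [hin y hy]; omega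
        outside := by rw [Function.update_self]; exact hout
        alt := ?_
        alt_part := by
          rw [e2p, if_pos rfl, e2l, Function.update_self, Function.update_of_ne huN, hl]
          intro _
          split_ifs <;> omega }
    · refine
        { verts := by rw [ev, A₁.reg rVerts rfl, H.verts]
          node := end'
          tree := T'
          lists := ?_
          listed := ?_
          rootFirst := ?_
          fresh := ?_
          leafLab := ?_
          par_super := ?_
          par_super' := ?_
          par_dead := ?_ }
      · rw [ek, ec, eh, ex]
        exact (hL₁.push p N).push N u
      · intro c hc
        rw [e2p]
        by_cases hcu : c = u
        · simp [hcu]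
        by_cases hcN : c = N
        · simp [hcN, huN.symm, Function.update_apply, hpuN]
        have hc := ((hnodes c).1 hc).resolve_left hcN
        rw [if_neg hcu, if_neg hcN]
        have hpN := T.parent c hc
        by_cases hcS : c ∈ S
        · rw [if_pos hcS, Function.update_self, Function.update_of_ne hpuN.symm,
            Function.update_self]
          exact List.mem_cons_of_mem _ (hSl c hcS)
        · rw [if_neg hcS]
          have := H.listed c hc
          rw [Function.update_of_ne (by omega)]
          simp only [Function.update_apply, if_neg hpuN]
          rw [if_neg (show s.arr aPar c ≠ N by omega)]
          split_ifs with h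
          · rw [h] at this; exact List.mem_cons_of_mem _ this
          · exact this
      · obtain ⟨r, hr, hp', l₀, hl₀⟩ := H.rootFirst
        have hnN' : n ≠ N := by omega
        by_cases hru : r = u
        · refine ⟨N, (hnodes N).2 (.inl rfl), ?_, L n, ?_⟩
          · rw [e2p, if_neg huN.symm, if_pos rfl, hp, ← hru, hp']
          · have hpn : p = n := by rw [hp, ← hru, hp']
            rw [Function.update_of_ne hnN', hpn, Function.update_self,
              Function.update_of_ne hnN']
        · have hpn : p ≠ n := fun h => hru (T.root_unique hr hum hp' h)
          refine ⟨r, (hnodes r).2 (.inr hr), ?_, l₀, ?_⟩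
          · rw [e2p, if_neg hru, if_neg (ne_of_mem_of_not_mem hr hNt), if_neg, hp']
            intro h
            exact hun ((hSm r h).2.symm.trans hp')
          · rw [Function.update_of_ne hnN', Function.update_of_ne hpn.symm,
              Function.update_of_ne hnN', hl₀]
      · intro w hw
        have := H.fresh w (by omega)
        have h1 : w ≠ u := by omega
        have h2 : w ≠ N := by omega
        have h3 : w ≠ p := by have := T.parent u hum; omega
        rw [e2n, if_neg h2, hno w h2 h1, eh]
        simp [Function.update_apply, h2, h3, hh₁ w h2, this]
      · intro v hv
        rw [e2l, Function.update_of_ne (by omega)]; exact H.leafLab v hv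
      · rw [e2p, if_neg (by omega), if_neg (by omega), if_neg]
        · exact H.par_super
        · intro h; have := (hSm n h).1; rw [mem_treeNodes] at this; omega
      · rw [e2p, if_neg (by omega), if_neg (by omega), if_neg]
        · exact H.par_super'
        · intro h; have := (hSm _ h).1; rw [mem_treeNodes] at this; omega
      · intro c hc
        rw [hnodes, not_or] at hc
        rw [e2p, if_neg (ne_of_mem_of_not_mem hum hc.2).symm, if_neg hc.1, if_neg (fun h => hc.2 (hSm c h).1)]
        exact H.par_dead c hc.2
    · intro c hc hpc hcu
      rw [e2p, if_neg hcu] at hpc ⊢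
      by_cases hcN : c = N
      · rw [if_pos hcN] at hpc ⊢
        rw [e2l, hcN, Function.update_self, Function.update_of_ne hpuN, ← hl]
        exact F.alt u hum hpc
      · have hc := ((hnodes c).1 hc).resolve_left hcN
        rw [if_neg hcN] at hpc ⊢
        rw [e2l, Function.update_of_ne hcN]
        split_ifs at hpc ⊢ with h
        · rw [Function.update_self]
          have := F.alt c hc (by rw [(hSm c h).2]; exact hun)
          rw [(hSm c h).2, hl] at this
          exact this
        · have hpN := T.parent c hc
          rw [Function.update_of_ne (by omega)]
          exact F.alt c hc hpc
  · have h0 : L N = [] := H.fresh_list le_rfl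
    have hpN := T.parent u hum
    have h1 := totalLength_update (N + 1) L (p := N) (by omega) l
    have h2 := totalLength_update (N + 1) (Function.update L N l) (p := p) (by omega)
      (N :: Function.update L N l p)
    have h3 := totalLength_update (N + 1) (Function.update (Function.update L N l) p
      (N :: Function.update L N l p)) (p := N) (by omega) (u :: Function.update (Function.update
      L N l) p (N :: Function.update L N l p) N)
    have h4 := totalLength_succ N L
    have h5 : S.card ≤ m := by
      rw [hS, ← F.marking.count_eq T u]
      exact (Finset.card_filter_le _ _).trans (by simp)
    have hb : (seqList
      [setArr aPar (reg rNode) (read aPar (reg rLow)), push (read aPar (reg rLow)) (reg rNode),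
       setArr aPar (reg rLow) (reg rNode), push (reg rNode) (reg rLow),
       setArr aNch (reg rNode) (succ (read aNch (reg rNode))), setReg rPart (reg rLow),
       setReg rNode (succ (reg rNode))]).bound ≤ 49 := by decide
    simp only [List.length_cons, h0, List.length_nil] at h1 h2 h3 h4
    omega

end RAM



/-! ### Inserting one vertex -/

namespace RAM

open Program NatExpr

theorem TreeState.congr {A : ℕ → ℕ → Prop} {n i N : ℕ} {D : ℕ → Finset ℕ} {L : ℕ → List ℕ}
    {s s' : State} (H : TreeState A n i N D L s) (h0 : s'.reg rVerts = s.reg rVerts)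
    (h2 : s'.reg rNode = s.reg rNode) (h3 : s'.reg rCell = s.reg rCell)
    (hp : s'.arr aPar = s.arr aPar) (hl : s'.arr aLab = s.arr aLab)
    (hn : s'.arr aNch = s.arr aNch) (hh : s'.arr aHead = s.arr aHead)
    (hc : s'.arr aCell = s.arr aCell) (hx : s'.arr aNxt = s.arr aNxt) :
    TreeState A n i N D L s' := by
  obtain ⟨a1, a2, a3, a4, a5, a6, a7, a8, a9, a10, a11⟩ := H
  constructor <;> simpa only [h0, h2, h3, hp, hl, hn, hh, hc, hx]

/-- Find the node to combine with the new vertex, given a lowest candidate. -/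
def pickPart : Program :=
  ite (.eq (read aLab (reg rLow)) (const 2))
    (.seq (setReg rLab (const 1))
      (ite (.eq (succ (read aCnt (reg rLow))) (read aNch (reg rLow))) takeChild split))
    (.seq (setReg rLab (const 2)) (ite (.eq (read aCnt (reg rLow)) (const 1)) skip group))

theorem Found.setLab {A : ℕ → ℕ → Prop} {n i N : ℕ} {D : ℕ → Finset ℕ} {L : ℕ → List ℕ}
    {X : Finset ℕ} {s : State} {u m : ℕ} (F : Found A n i N D L X s u m) (ℓ : ℕ) :
    Found A n i N D L X (s.setReg rLab ℓ) u m :=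
  { state := F.state.congr (by simp) (by simp) (by simp) rfl rfl rfl rfl rfl rfl
    alt := F.alt
    nbrs := F.nbrs
    marking := F.marking
    len := by simpa using F.len
    new := by simpa using F.new
    low := by simpa using F.low
    candidate := F.candidate
    lowest := F.lowest }

/-- The part to combine with consists of the full children of a parallel candidate or of the other
children of a series candidate. If it is a single child, that child is taken; otherwise the part is
first made a node. The artificial candidate `n` has label `0` and follows the parallel branch, with
the root as its only full child. -/
theorem runs_pickPart {A : ℕ → ℕ → Prop} {n i N : ℕ} {D : ℕ → Finset ℕ} {L : ℕ → List ℕ}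
    {X : Finset ℕ} {s : State} {u m : ℕ} (F : Found A n i N D L X s u m)
    (hsymm : ∀ a b, A a b → A b a) (hP4 : P4Free A) (hpart : s.arr aPar (s.reg rPart) = u)
    (hq : ∃ j < m, s.arr aQueue j = s.reg rPart) :
    ∃ s' t N' D' L' f ℓ, Runs pickPart s s' t ∧ Picked A n i N' D' L' s' f ℓ ∧
      t + 40 * totalLength N' L' ≤ 40 * totalLength N L + 140 * m + 200 := by
  have T := F.state.tree
  obtain ⟨j, hj, hjq⟩ := hq
  set S := (fullNodes n i N D X).filter (s.arr aPar · = u) with hS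
  have hcnt : s.arr aCnt u = S.card := by
    have h1 := (F.marking.candidate_iff T hj).1
    rw [hjq, hpart] at h1
    have h2 := F.marking.count u
    rwa [if_pos h1, F.marking.count_eq T] at h2
  have hn0 : s.arr aLab n = 0 := T.lab_root
  by_cases hl : s.arr aLab u = 2
  · have hun : u ≠ n := by rintro rfl; omega
    have hb : (Test.eq (read aLab (reg rLow)) (const 2)).holds s := by
      simp [Test.holds, NatExpr.eval, F.low, hl]
    have F' := F.setLab 1
    by_cases hone : S.card + 1 = s.arr aNch u
    · obtain ⟨s', t, N', D', L', f, hr, hp, ht⟩ := runs_takeChild F' hsymm hP4 hun hl hone (by simp)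
      refine ⟨s', _, N', D', L', f, 1, .iteTrue hb (.seq (.setReg _ _ _) (.iteTrue ?_ hr)), hp, ?_⟩
      · simp [Test.holds, NatExpr.eval, F.low, hcnt, hone]
      · simp only [Test.cost, NatExpr.cost]; omega
    · obtain ⟨s', t, N', D', L', f, hr, hp, ht⟩ := runs_split F' hsymm hP4 hun hl hone (by simp)
      refine ⟨s', _, N', D', L', f, 1, .iteTrue hb (.seq (.setReg _ _ _) (.iteFalse ?_ hr)), hp, ?_⟩
      · simp [Test.holds, NatExpr.eval, F.low, hcnt, hone]
      · simp only [Test.cost, NatExpr.cost]; omega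
  · have hb : ¬ (Test.eq (read aLab (reg rLow)) (const 2)).holds s := by
      simp [Test.holds, NatExpr.eval, F.low, hl]
    have F' := F.setLab 2
    have hfull : s.reg rPart ∈ fullNodes n i N D X := hjq ▸ F.marking.full_mem j hj
    obtain ⟨hfm, hfX⟩ := mem_fullNodes.1 hfull
    by_cases hone : S.card = 1
    · refine ⟨_, _, N, D, L, s.reg rPart, 2, .iteFalse hb (.seq (.setReg _ _ _)
        (.iteTrue ?_ (.skip _))), ?_, ?_⟩
      · simp [Test.holds, NatExpr.eval, F.low, hcnt, hone]
      · have hSf : S.biUnion D = D (s.reg rPart) := by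
          obtain ⟨g, hg⟩ := Finset.card_eq_one.1 hone
          have : s.reg rPart ∈ S := Finset.mem_filter.2 ⟨hfull, hpart⟩
          rw [hg, Finset.mem_singleton] at this
          rw [hg, this, Finset.singleton_biUnion]
        refine
          { state := F'.state
            part := by simp [NatExpr.eval]
            lab := by simp [NatExpr.eval]
            mem := hfm
            lab_eq := .inr rfl
            inside := fun y hy => ?_
            outside := ?_
            alt := fun c hc h _ => F.alt c hc h
            alt_part := ?_ }
        · simpa using ((F.nbrs y).1 (hfX hy)).2
        · by_cases hun : u = n
          · intro y hy hyD
            rw [T.rootD _ hfm (hpart.trans hun)] at hyD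
            exact absurd (Finset.mem_range.2 hy) hyD
          · have := (T.lowest_candidate hsymm hP4 F.alt F.nbrs hun F.candidate
              F.lowest hS rfl).2.1
            rwa [if_neg hl, hSf] at this
        · have h1 := F.alt _ hfm
          simp only [State.setReg_arr, hpart] at h1 ⊢
          intro hun
          split_ifs with h2
          · rw [h2]; exact fun h => hl h.symm
          · exact fun h => hl h.symm
      · simp only [Test.cost, NatExpr.cost]; omega
    -- The artificial node has only the root below it, so two or more full children exclude it.
    · have hun : u ≠ n := by
        rintro rfl
        refine hone (Finset.card_eq_one.2 ⟨s.reg rPart, ?_⟩)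
        ext c
        rw [Finset.mem_singleton, hS, Finset.mem_filter]
        constructor
        · rintro ⟨h1, h2⟩
          exact T.root_unique (mem_fullNodes.1 h1).1 hfm h2 hpart
        · rintro rfl
          exact ⟨hfull, hpart⟩
      obtain ⟨hu1, hu2⟩ := T.candidate_inner F.candidate hun
      have hl1 := (T.innerLab u hu1 hu2).resolve_right hl
      have hpos : 0 < S.card := Finset.card_pos.2 ⟨_, Finset.mem_filter.2 ⟨hfull, hpart⟩⟩
      obtain ⟨s', t, N', D', L', f, hr, hp, ht⟩ := runs_group F' hsymm hP4 hun hl1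
        (show 2 ≤ S.card by omega) (by simp)
      refine ⟨s', _, N', D', L', f, 2, .iteFalse hb (.seq (.setReg _ _ _) (.iteFalse ?_ hr)), hp, ?_⟩
      · simp [Test.holds, NatExpr.eval, F.low, hcnt, hone]
      · simp only [Test.cost, NatExpr.cost]; omega

/-- The root is to be combined with the new vertex. -/
def pickRoot : Program := seqList
  [setReg rPart (read aCell (read aHead (reg rVerts))), setReg rLab (const 1)]

/-- A vertex without earlier neighbours is put beside everything else at a parallel root. The root
is found as the first entry in the list of `n`. -/
theorem picked_pickRoot {A : ℕ → ℕ → Prop} {n i N : ℕ} {D : ℕ → Finset ℕ} {L : ℕ → List ℕ}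
    {s : State} (H : TreeState A n i N D L s)
    (halt : Alternating n i N (s.arr aPar) (s.arr aLab)) (hX : ∀ y < i, ¬ A i y) :
    ∃ f, Picked A n i N D L (exec pickRoot s) f 1 := by
  obtain ⟨r, hr, hp, l, hl⟩ := H.rootFirst
  have hcell : s.arr aCell (s.arr aHead n) = r := by
    have := H.lists.chain n
    rw [hl] at this
    generalize s.arr aHead n = h at this
    cases this
    rfl
  have he : exec pickRoot s = (s.setReg rPart r).setReg rLab 1 := by
    simp [pickRoot, exec, seqList, NatExpr.eval, H.verts, hcell]
  rw [he]
  refine ⟨r,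
    { state := H.congr (by simp) (by simp) (by simp) rfl rfl rfl rfl rfl rfl
      part := by simp
      lab := by simp
      mem := hr
      lab_eq := .inl rfl
      inside := fun y hy => ?_
      outside := fun y hy hyD => ?_
      alt := fun c hc h _ => halt c hc h
      alt_part := fun h => absurd hp h }⟩
  · rw [H.tree.rootD r hr hp, Finset.mem_range] at hy
    exact iff_of_false (hX y hy) (by omega)
  · rw [H.tree.rootD r hr hp, Finset.mem_range] at hyD
    exact absurd hy hyD

/-- Insert the vertex `rNew` into the cotree of the earlier vertices. -/
def insertVertex : Program := seqList
  [enqueueNeighbors, markFull,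
   ite (.eq (reg rLen) (const 0)) pickRoot (.seq findLowest pickPart), attach,
   setReg rNew (succ (reg rNew))]

/-- The first `i` of `n` vertices are in the cotree. -/
structure Built (A : ℕ → ℕ → Prop) (n i N : ℕ) (D : ℕ → Finset ℕ) (L : ℕ → List ℕ)
    (s : State) : Prop where
  state : TreeState A n i N D L s
  alt : Alternating n i N (s.arr aPar) (s.arr aLab)
  new : s.reg rNew = i
  stamp : ∀ w, s.arr aCst w ≤ i
  flag : ∀ w, s.arr aFull w ≤ i
  mark : ∀ w, s.arr aMark w ≤ i

/-- The amortized bound: the time plus the increase of `40` times the total length of the lists is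
linear in the degree. All stamps are at most `i` before and at most `i + 1` after the insertion, so
the next one starts clean. -/
theorem runs_insertVertex {A : ℕ → ℕ → Prop} {n i N : ℕ} {D : ℕ → Finset ℕ} {L : ℕ → List ℕ}
    {s : State} (B : Built A n i N D L s) (hsymm : ∀ a b, A a b → A b a) (hP4 : P4Free A)
    (hi : i < n) {nb : List ℕ} (hnb : HasNeighbors s i nb) (hA : ∀ y, y ∈ nb ↔ A i y) :
    ∃ s' t N' D' L', Runs insertVertex s s' t ∧ Built A n (i + 1) N' D' L' s' ∧
      t + 40 * totalLength N' L' ≤ 40 * totalLength N L + 700 * nb.length + 700 := by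
  obtain ⟨s₁, t₁, hr₁, ht₁, q1, q2, q3, q4, q5⟩ := runs_enqueueNeighbors s B.new hnb B.flag
  have A₁ := hr₁.agree
  have H₁ : TreeState A n i N D L s₁ := B.state.congr (A₁.reg _ rfl) (A₁.reg _ rfl)
    (A₁.reg _ rfl) (A₁.arr _ rfl) (A₁.arr _ rfl) (A₁.arr _ rfl) (A₁.arr _ rfl) (A₁.arr _ rfl)
    (A₁.arr _ rfl)
  have n₁ : s₁.reg rNew = i := (A₁.reg _ rfl).trans B.new
  set X := nb.toFinset.filter (· < i) with hX
  have hXm : ∀ y, y ∈ X ↔ y < i ∧ A i y := by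
    intro y
    rw [hX, Finset.mem_filter, List.mem_toFinset, hA, and_comm]
  have hXc : X.card ≤ nb.length :=
    (Finset.card_filter_le _ _).trans (List.toFinset_card_le nb)
  have M₀ : Marking n i N (s₁.arr aPar) (s₁.arr aNch) D X (i + 1) (s₁.arr aQueue) (s₁.reg rLen) 0
      (s₁.arr aCnt) (s₁.arr aCst) (s₁.arr aFull) := by
    refine Marking.init H₁.tree (fun y hy => ((hXm y).1 hy).1) (fun j hj => ?_) q2 (fun y hy => ?_)
      (fun p => ?_) q4 q5
    · rw [hXm, ← hA]; exact (q1 j hj).symm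
    · rw [hXm, ← hA] at hy; exact q3 y hy.2 hy.1
    · rw [A₁.arr aCst rfl]; exact Nat.lt_succ_of_le (B.stamp p)
  obtain ⟨s₂, t₂, hr₂, M, ht₂⟩ := runs_markFull H₁.tree s₁ rfl rfl (by rw [n₁]) M₀
  have A₂ := hr₂.agree
  have H₂ : TreeState A n i N D L s₂ := H₁.congr (A₂.reg _ rfl) (A₂.reg _ rfl)
    (A₂.reg _ rfl) (A₂.arr _ rfl) (A₂.arr _ rfl) (A₂.arr _ rfl) (A₂.arr _ rfl) (A₂.arr _ rfl)
    (A₂.arr _ rfl)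
  rw [← A₂.arr aPar rfl, ← A₂.arr aNch rfl] at M
  have n₂ : s₂.reg rNew = i := (A₂.reg _ rfl).trans n₁
  have alt₂ : Alternating n i N (s₂.arr aPar) (s₂.arr aLab) := by
    rw [A₂.arr aPar rfl, A₂.arr aLab rfl, A₁.arr aPar rfl, A₁.arr aLab rfl]; exact B.alt
  have mk₂ : ∀ w, s₂.arr aMark w ≤ i := by
    rw [A₂.arr aMark rfl, A₁.arr aMark rfl]; exact B.mark
  have hm := M.card_le.trans (H₂.tree.card_fullNodes_le X)
  have key : ∃ s₃ t₃ N' D' L' f ℓ, Runs (ite (.eq (reg rLen) (const 0)) pickRoot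
      (.seq findLowest pickPart)) s₂ s₃ t₃ ∧ Picked A n i N' D' L' s₃ f ℓ ∧
      (∀ w, s₃.arr aMark w ≤ i + 1) ∧
      t₃ + 40 * totalLength N' L' ≤ 40 * totalLength N L + 260 * s₂.reg rLen + 300 := by
    by_cases h0 : s₂.reg rLen = 0
    · obtain ⟨f, hf⟩ := picked_pickRoot H₂ alt₂ (fun y hy hA' => by
        obtain ⟨j, hj, -⟩ := M.leaf y ((hXm y).2 ⟨hy, hA'⟩)
        omega)
      obtain ⟨t, hr, ht⟩ := runs_exec (P := pickRoot) rfl s₂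
      have hb : pickRoot.bound ≤ 20 := by decide
      refine ⟨_, _, N, D, L, f, 1, .iteTrue ?_ hr, hf, ?_, ?_⟩
      · simpa [Test.holds, NatExpr.eval] using h0
      · intro w
        rw [hr.agree.arr aMark rfl]
        exact (mk₂ w).trans (Nat.le_succ i)
      · simp only [Test.cost, NatExpr.cost]; omega
    · have hpos : 0 < X.card := by omega
      obtain ⟨y, hy⟩ := Finset.card_pos.1 hpos
      obtain ⟨s₃, t₃, hr₃, ht₃, m1, m2, m3, m4, m5⟩ := runs_findLowest s₂
        (C := IsCandidate n i N (s₂.arr aPar) D X) n₂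
        (fun j hj => (M.candidate_iff H₂.tree hj).2)
        (fun v hv => by
          obtain ⟨-, f, hf, hp⟩ := hv
          obtain ⟨j, hj, rfl⟩ := (M.complete H₂.tree).2 hf
          exact ⟨j, hj, hp⟩) mk₂
        (H₂.tree.exists_candidate ⟨y, ((hXm y).1 hy).1, hy⟩ H₂.par_super
          (by rw [H₂.par_super']; omega))
      have A₃ := hr₃.agree
      have F : Found A n i N D L X s₃ (s₃.reg rLow) (s₂.reg rLen) :=
        { state := H₂.congr (A₃.reg _ rfl) (A₃.reg _ rfl)
            (A₃.reg _ rfl) (A₃.arr _ rfl) (A₃.arr _ rfl) (A₃.arr _ rfl) (A₃.arr _ rfl)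
            (A₃.arr _ rfl) (A₃.arr _ rfl)
          alt := by rw [A₃.arr aPar rfl, A₃.arr aLab rfl]; exact alt₂
          nbrs := hXm
          marking := by
            rw [A₃.arr aPar rfl, A₃.arr aNch rfl, A₃.arr aQueue rfl, A₃.arr aCnt rfl,
              A₃.arr aCst rfl, A₃.arr aFull rfl]
            exact M
          len := A₃.reg _ rfl
          new := (A₃.reg _ rfl).trans n₂
          low := rfl
          candidate := by rw [A₃.arr aPar rfl]; exact m2
          lowest := by rw [A₃.arr aPar rfl]; exact m3 }
      obtain ⟨s₄, t₄, N', D', L', f, ℓ, hr₄, P₄, ht₄⟩ := runs_pickPart F hsymm hP4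
        (by rw [A₃.arr aPar rfl]; exact m4) (by rw [A₃.arr aQueue rfl]; exact m5)
      refine ⟨s₄, _, N', D', L', f, ℓ, .iteFalse ?_ (.seq hr₃ hr₄), P₄, ?_, ?_⟩
      · simpa [Test.holds, NatExpr.eval] using h0
      · rw [hr₄.agree.arr aMark rfl]; exact m1
      · simp only [Test.cost, NatExpr.cost]; omega
  obtain ⟨s₃, t₃, N', D', L', f, ℓ, hr₃, P, hmk, ht₃⟩ := key
  have A₃ := hr₃.agree
  have n₃ : s₃.reg rNew = i := (A₃.reg _ rfl).trans n₂
  obtain ⟨N'', D'', L'', H₄, alt₄, hL₄⟩ := exec_attach P.state hsymm hi n₃ P.part P.lab P.mem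
    P.lab_eq P.inside P.outside P.alt P.alt_part
  obtain ⟨t₄, hr₄, ht₄⟩ := runs_exec (P := attach) rfl s₃
  have A₄ := hr₄.agree
  have hb : attach.bound ≤ 100 := by decide
  refine ⟨_, _, N'', D'', L'', .seq hr₁ (.seq hr₂ (.seq hr₃ (.seq hr₄ (.seq (.setReg _ _ _)
    (.skip _))))), ?_, ?_⟩
  · have hst : ∀ w, (exec attach s₃).arr aCst w ≤ i + 1 := by
      rw [A₄.arr aCst rfl, A₃.arr aCst rfl]; exact M.stamp
    have hfl : ∀ w, (exec attach s₃).arr aFull w ≤ i + 1 := by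
      rw [A₄.arr aFull rfl, A₃.arr aFull rfl]; exact M.flag_le
    have hmk' : ∀ w, (exec attach s₃).arr aMark w ≤ i + 1 := by
      rw [A₄.arr aMark rfl]; exact hmk
    exact
      { state := H₄.congr (by simp) (by simp) (by simp) rfl rfl rfl rfl rfl rfl
        alt := alt₄
        new := by simp [NatExpr.eval, A₄.reg rNew rfl, n₃]
        stamp := hst
        flag := hfl
        mark := hmk' }
  · simp only [NatExpr.cost]
    omega

end RAM



/-! ### Building the cotree and ordering its nodes -/

namespace RAM

open Program NatExpr

/-- Build the cotree of the first vertex. -/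
def initTree : Program := seqList
  [setReg rNode (succ (succ (reg rVerts))), setReg rCell (const 1),
   setArr aPar (reg rVerts) (succ (reg rVerts)), setArr aPar (const 0) (reg rVerts),
   push (reg rVerts) (const 0), setReg rNew (const 1)]

/-- The natural-number part of the memory at the start, except for the adjacency lists. -/
structure Initial (n : ℕ) (s : State) : Prop where
  verts : s.reg rVerts = n
  arr : ∀ a ≥ 2, s.arr a = 0

/-- The first tree is the leaf `0` below the artificial node `n`. Allocation begins at cell `1` and
at node `n + 2`, and the parent of `n + 1` is `0` because the memory is initially zero. -/
theorem built_initTree {A : ℕ → ℕ → Prop} {n : ℕ} {s : State} (hn : 0 < n) (hs : Initial n s) :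
    ∃ N D L, Built A n 1 N D L (exec initTree s) ∧ totalLength N L ≤ 1 := by
  have he : exec initTree s = ((((((((s.setReg rNode (n + 2)).setReg rCell 1).setArr aPar n
      (n + 1)).setArr aPar 0 n).setArr aCell 1 0).setArr aNxt 1 0).setArr aHead n 1).setReg rCell
      2).setReg rNew 1 := by
    simp [initTree, push, exec, seqList, NatExpr.eval, hs.verts, hs.arr]
  set s' := exec initTree s with hs'
  have ep : s'.arr aPar = Function.update (Function.update (0 : ℕ → ℕ) n (n + 1)) 0 n := by
    rw [he]; simp [hs.arr]
  have el : s'.arr aLab = 0 := by rw [he]; simp [hs.arr]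
  have en : s'.arr aNch = 0 := by rw [he]; simp [hs.arr]
  have eh : s'.arr aHead = Function.update (0 : ℕ → ℕ) n 1 := by rw [he]; simp [hs.arr]
  have ec : s'.arr aCell = Function.update (0 : ℕ → ℕ) 1 0 := by rw [he]; simp [hs.arr]
  have ex : s'.arr aNxt = Function.update (0 : ℕ → ℕ) 1 0 := by rw [he]; simp [hs.arr]
  have ek : s'.reg rCell = 2 := by rw [he]; simp
  have ep0 : s'.arr aPar 0 = n := by rw [ep]; simp
  have hmem : ∀ c, c ∈ treeNodes n 1 (n + 2) ↔ c = 0 := by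
    intro c; rw [mem_treeNodes]; omega
  refine ⟨n + 2, fun v => {v}, Function.update (fun _ => []) n [0],
    { state := ?_
      alt := ?_
      new := by rw [he]; simp
      stamp := by rw [he]; simp [hs.arr]
      flag := by rw [he]; simp [hs.arr]
      mark := by rw [he]; simp [hs.arr] }, ?_⟩
  · refine
      { verts := by rw [he]; simp [hs.verts]
        node := by rw [he]; simp
        tree := ?_
        lists := ?_
        listed := ?_
        rootFirst := ⟨0, (hmem 0).2 rfl, ep0, [], by simp⟩
        fresh := ?_
        leafLab := by rw [el]; simp
        par_super := by rw [ep]; simp [Function.update_apply]; omega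
        par_super' := by rw [ep]; simp [Function.update_apply]
        par_dead := ?_ }
    · refine
        { pos := Nat.one_pos
          le := hn
          le_N := le_rfl
          leafD := fun _ _ => rfl
          leafLab := by rw [el]; simp
          innerLab := fun w h1 h2 => by omega
          parent := fun c hc => by rw [(hmem c).1 hc]; exact .inl ep0
          sub := fun c hc h => by rw [(hmem c).1 hc] at h; exact absurd ep0 h
          cover := fun w h1 h2 => by omega
          disj := fun c hc c' hc' h => absurd (((hmem c).1 hc).trans ((hmem c').1 hc').symm) h
          adj := fun c hc c' hc' h => absurd (((hmem c).1 hc).trans ((hmem c').1 hc').symm) h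
          root := ⟨0, (hmem 0).2 rfl, ep0⟩
          rootD := fun r hr _ => by rw [(hmem r).1 hr]; rfl
          nonempty := fun c _ => Finset.singleton_nonempty c
          children := fun w h1 h2 => by omega
          two_le := fun w h1 h2 => by omega
          nch_root := by rw [en]; rfl
          lab_root := by rw [el]; rfl }
    · rw [ek, eh, ec, ex]
      refine ⟨by norm_num, fun w => ?_⟩
      by_cases hw : w = n
      · subst hw
        have := Chain.cons (cell := Function.update (0 : ℕ → ℕ) 1 0) (nxt := Function.update (0 : ℕ → ℕ) 1 0) (K := 2)
          1 [] (by norm_num) (by norm_num) (by simpa using Chain.nil)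
        simpa using this
      · simpa [hw] using Chain.nil
    · intro c hc
      rw [(hmem c).1 hc, ep0]; simp
    · intro w hw
      rw [eh, en]
      simp [Function.update_apply]; omega
    · intro c hc
      rw [ep]
      simp only [Function.update_apply, Pi.zero_apply]
      split_ifs <;> omega
  · intro c hc
    rw [(hmem c).1 hc]
    exact fun h => absurd ep0 h
  · have := totalLength_update (n + 2) (fun _ => []) (p := n) (by omega) [0]
    have h0 : totalLength (n + 2) (fun _ => []) = 0 := by simp [totalLength]
    simp only [List.length_nil, List.length_singleton] at this
    omega

theorem HasNeighbors.congr {s s' : State} {i : ℕ} {nb : List ℕ} (H : HasNeighbors s i nb)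
    (h0 : s'.arr 0 = s.arr 0) (h1 : s'.arr 1 = s.arr 1) : HasNeighbors s' i nb := by
  obtain ⟨a, b, c⟩ := H
  exact ⟨a, by rw [h0]; exact b, by rw [h0, h1]; exact c⟩

/-- Insert all vertices. -/
def insertAll : Program := .seq initTree (loop (.lt (reg rNew) (reg rVerts)) insertVertex)

theorem runs_insertAll {A : ℕ → ℕ → Prop} {n : ℕ} {s : State} (hn : 0 < n) (hs : Initial n s)
    (hsymm : ∀ a b, A a b → A b a) (hP4 : P4Free A) {nb : ℕ → List ℕ}
    (hnb : ∀ i < n, HasNeighbors s i (nb i)) (hA : ∀ i < n, ∀ y, y ∈ nb i ↔ A i y) :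
    ∃ s' t N D L, Runs insertAll s s' t ∧ Built A n n N D L s' ∧
      t ≤ 710 * ∑ i ∈ Finset.range n, (nb i).length + 710 * n + 200 := by
  obtain ⟨t₁, hr₁, ht₁⟩ := runs_exec (P := initTree) rfl s
  obtain ⟨N₁, D₁, L₁, B₁, hL₁⟩ := built_initTree (A := A) hn hs
  -- The cost of the insertions still to come. Together with the length potential it decreases by at
  -- least the time of each round.
  set φ : ℕ → ℕ := fun i => ∑ j ∈ Finset.Ico i n, (710 * (nb j).length + 710) with hφ
  have hA₁ : Agree insertAll s (exec initTree s) := by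
    refine hr₁.agree.mono ?_ ?_ ?_ ?_ <;> intro x hx <;>
      simp_all [insertAll, writesReg, writesArr, writesWReg, writesWArr]
  obtain ⟨⟨i, N, D, L⟩, s', t, hr, ⟨B, hi, hA'⟩, hnb', ht⟩ := runs_loop
    (b := .lt (reg rNew) (reg rVerts)) (P := insertVertex)
    (fun (a : ℕ × ℕ × (ℕ → Finset ℕ) × (ℕ → List ℕ)) s' =>
      Built A n a.1 a.2.1 a.2.2.1 a.2.2.2 s' ∧ a.1 ≤ n ∧ Agree insertAll s s')
    (fun a _ => 40 * totalLength a.2.1 a.2.2.2 + φ a.1)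
    (by
      rintro ⟨i, N, D, L⟩ s' ⟨B, hi, hA'⟩ hlt
      dsimp only at B hi hA' ⊢
      simp only [Test.holds, NatExpr.eval, B.new, B.state.verts] at hlt
      obtain ⟨s'', t, N', D', L', hr, B', ht⟩ := runs_insertVertex B hsymm hP4 hlt
        ((hnb i hlt).congr (hA'.arr 0 rfl) (hA'.arr 1 rfl)) (hA i hlt)
      refine ⟨⟨i + 1, N', D', L'⟩, s'', t, hr, ⟨B', hlt, hA'.trans ?_⟩, ?_⟩
      · refine hr.agree.mono ?_ ?_ ?_ ?_ <;> intro x hx <;>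
          simp_all [insertAll, writesReg, writesArr, writesWReg, writesWArr]
      · have : φ i = (710 * (nb i).length + 710) + φ (i + 1) :=
          Finset.sum_eq_sum_Ico_succ_bot hlt _
        simp only [Test.cost, NatExpr.cost] at ht ⊢
        omega)
    ⟨1, N₁, D₁, L₁⟩ _ ⟨B₁, hn, hA₁⟩
  have hin : i = n := by
    simp only [Test.holds, NatExpr.eval, B.new, B.state.verts] at hnb'
    exact le_antisymm hi (not_lt.1 hnb')
  subst hin
  refine ⟨s', _, N, D, L, .seq hr₁ hr, B, ?_⟩
  have hb : initTree.bound ≤ 50 := by decide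
  have h1 : φ 1 ≤ 710 * ∑ j ∈ Finset.range i, (nb j).length + 710 * i := by
    have : φ 1 ≤ ∑ j ∈ Finset.range i, (710 * (nb j).length + 710) :=
      Finset.sum_le_sum_of_subset (fun j hj => by
        simp only [Finset.mem_Ico, Finset.mem_range] at *; omega)
    rw [Finset.sum_add_distrib, ← Finset.mul_sum] at this
    simp only [Finset.sum_const, Finset.card_range, smul_eq_mul] at this
    omega
  simp only [Test.cost, NatExpr.cost] at ht
  omega

/-- List all nodes, children before their parents. -/
def listNodes : Program := seqList
  [setReg rLen (const 0), forTo rTmp rVerts enqueue, markFull]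

/-- If every vertex counts as a neighbour, every node is full, so the queue of the counting
procedure contains all nodes. A node enters only when its last child is counted, hence after all its
children. The stamp `n + 1` has not been used by any insertion. -/
theorem runs_listNodes {A : ℕ → ℕ → Prop} {n N : ℕ} {D : ℕ → Finset ℕ} {L : ℕ → List ℕ}
    {s : State} (B : Built A n n N D L s) :
    ∃ s' t, Runs listNodes s s' t ∧ t ≤ 200 * n + 50 ∧ s'.reg rLen ≤ 2 * n ∧
      (∀ j < s'.reg rLen, ∀ j' < s'.reg rLen, s'.arr aQueue j = s'.arr aQueue j' → j = j') ∧
      (∀ w, (∃ j < s'.reg rLen, s'.arr aQueue j = w) ↔ w ∈ treeNodes n n N) ∧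
      ∀ j < s'.reg rLen, ∀ j' < s'.reg rLen, s.arr aPar (s'.arr aQueue j') = s'.arr aQueue j →
        j' < j := by
  have T := B.state.tree
  obtain ⟨s₁, t₁, hr₁, ⟨l1, q1, f1, f2⟩, ht₁⟩ := runs_forTo (j := rTmp) (m := rVerts)
    (body := enqueue) (by decide) rfl rfl rfl
    (fun h s' => s'.reg rLen = h ∧ (∀ j < h, s'.arr aQueue j = j) ∧
      (∀ w, s'.arr aFull w = n + 1 ↔ w < h) ∧ ∀ w, s'.arr aFull w ≤ n + 1)
    (s.setReg rLen 0) ⟨by simp, by simp, fun w => by have := B.flag w; simp; omega,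
      fun w => by have := B.flag w; simp; omega⟩
    (by
      rintro k s' hk hj hm hA ⟨l1, q1, f1, f2⟩
      have hnew : s'.reg rNew = n := by
        rw [hA.reg rNew rfl]; simp [B.new]
      have he : (exec enqueue s').setReg rTmp (k + 1) = (((s'.setArr aQueue k k).setArr aFull k
          (n + 1)).setReg rLen (k + 1)).setReg rTmp (k + 1) := by
        simp [enqueue, exec, seqList, NatExpr.eval, hj, l1, hnew]
      rw [he]
      refine ⟨by simp, fun j hj => ?_, fun w => ?_, fun w => ?_⟩
      · simp only [State.setReg_arr, State.setArr_arr, Function.update_apply]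
        by_cases hjk : j = k
        · simp [hjk]
        · simpa [hjk] using q1 j (by omega)
      · have := f1 w
        by_cases hwk : w = k
        · simp [hwk]
        · simp [Function.update_apply, hwk, this]; omega
      · have := f2 w
        have e : (((((s'.setArr aQueue k k).setArr aFull k (n + 1)).setReg rLen (k + 1)).setReg rTmp
            (k + 1))).arr aFull w = if w = k then n + 1 else s'.arr aFull w := by
          simp [Function.update_apply]
        rw [e]
        split_ifs <;> omega)
  have A₁ := hr₁.agree
  have ev : (s.setReg rLen 0).reg rVerts = n := by simp [B.state.verts]
  rw [ev] at l1 q1 f1 ht₁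
  have ep : s₁.arr aPar = s.arr aPar := A₁.arr aPar rfl
  have en : s₁.arr aNch = s.arr aNch := A₁.arr aNch rfl
  have hnew : s₁.reg rNew = n := by rw [A₁.reg rNew rfl]; simp [B.new]
  have M₀ : Marking n n N (s.arr aPar) (s.arr aNch) D (Finset.range n) (n + 1) (s₁.arr aQueue)
      (s₁.reg rLen) 0 (s₁.arr aCnt) (s₁.arr aCst) (s₁.arr aFull) := by
    rw [l1]
    refine Marking.init T (fun y hy => Finset.mem_range.1 hy) (fun j hj => ?_) ?_ (fun y hy => ?_)
      (fun p => ?_) (fun w => ?_) f2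
    · rw [q1 j hj]; exact Finset.mem_range.2 hj
    · intro j hj j' hj' h
      rwa [q1 j hj, q1 j' hj'] at h
    · exact ⟨y, Finset.mem_range.1 hy, q1 y (Finset.mem_range.1 hy)⟩
    · rw [A₁.arr aCst rfl]; exact Nat.lt_succ_of_le (B.stamp p)
    · rw [f1 w]
      constructor
      · exact fun h => ⟨w, h, q1 w h⟩
      · rintro ⟨j, hj, rfl⟩; rwa [q1 j hj]
  obtain ⟨s₂, t₂, hr₂, M, ht₂⟩ := runs_markFull T s₁ ep en (by rw [hnew]) M₀
  have hall : fullNodes n n N D (Finset.range n) = treeNodes n n N := by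
    ext w
    rw [mem_fullNodes]
    exact ⟨fun h => h.1, fun h => ⟨h, T.sub_range h⟩⟩
  have hcomp : ∀ w, (∃ j < s₂.reg rLen, s₂.arr aQueue j = w) ↔ w ∈ treeNodes n n N := by
    intro w; rw [M.complete T, hall]
  refine ⟨s₂, _, .seq (.setReg _ _ _) (.seq hr₁ (.seq hr₂ (.skip _))), ?_, ?_, M.inj, hcomp, ?_⟩
  · have hb : enqueue.bound + 7 ≤ 100 := by decide
    have := Nat.mul_le_mul_right n hb
    simp only [Finset.card_range] at ht₂
    simp only [NatExpr.cost]
    omega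
  · have h1 := M.card_le
    have h2 := T.card_fullNodes_le (Finset.range n)
    rw [Finset.card_range] at h2
    omega
  · intro j hj j' hj' h
    have h1 := (hcomp _).1 ⟨j, hj, rfl⟩
    have h2 := (hcomp _).1 ⟨j', hj', rfl⟩
    have h3 := T.parent _ h2
    rw [h] at h3
    have h4 : n + 2 ≤ s₂.arr aQueue j := by
      rcases mem_treeNodes.1 h1 with h5 | h5 <;> omega
    obtain ⟨k, hk, hkq⟩ := M.order j hj h4 _ h2 h
    rwa [← M.inj k (by omega) j' hj' hkq]

/-- Mark the root with the label `3` if it is parallel. -/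
def markRoot : Program := .seq (setReg rLow (read aCell (read aHead (reg rVerts))))
  (ite (.eq (read aLab (reg rLow)) (const 1)) (setArr aLab (reg rLow) (const 3)) skip)

/-- Build the cotree and list its nodes. -/
def buildTree : Program := seqList [insertAll, listNodes, markRoot]

/-- The memory contains a cotree with label `3` for a parallel root `r`, and a list of the `m`
nodes in which children precede their parents. -/
structure Listed (A : ℕ → ℕ → Prop) (n N : ℕ) (lab nch : ℕ → ℕ) (D : ℕ → Finset ℕ) (r m : ℕ)
    (s : State) : Prop where
  verts : s.reg rVerts = n
  tree : Cotree A n n N (s.arr aPar) lab nch D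
  alt : Alternating n n N (s.arr aPar) lab
  root : r ∈ treeNodes n n N
  par_root : s.arr aPar r = n
  lab : s.arr aLab = if lab r = 1 then Function.update lab r 3 else lab
  len : s.reg rLen = m
  len_le : m ≤ 2 * n
  inj : ∀ j < m, ∀ j' < m, s.arr aQueue j = s.arr aQueue j' → j = j'
  mem : ∀ w, (∃ j < m, s.arr aQueue j = w) ↔ w ∈ treeNodes n n N
  order : ∀ j < m, ∀ j' < m, s.arr aPar (s.arr aQueue j') = s.arr aQueue j → j' < j

/-- A parallel root means that the graph is disconnected. There vertices of different children have
infinite distance and need their own merging rule, which the label `3` selects. -/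
theorem runs_buildTree {A : ℕ → ℕ → Prop} {n : ℕ} {s : State} (hn : 0 < n) (hs : Initial n s)
    (hsymm : ∀ a b, A a b → A b a) (hP4 : P4Free A) {nb : ℕ → List ℕ}
    (hnb : ∀ i < n, HasNeighbors s i (nb i)) (hA : ∀ i < n, ∀ y, y ∈ nb i ↔ A i y) :
    ∃ s' t N lab nch D r m, Runs buildTree s s' t ∧ Listed A n N lab nch D r m s' ∧
      t ≤ 710 * ∑ i ∈ Finset.range n, (nb i).length + 1000 * n + 300 := by
  obtain ⟨s₁, t₁, N, D, L, hr₁, B, ht₁⟩ := runs_insertAll hn hs hsymm hP4 hnb hA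
  obtain ⟨s₂, t₂, hr₂, ht₂, hm, hinj, hmem, hord⟩ := runs_listNodes B
  have A₂ := hr₂.agree
  obtain ⟨t₃, hr₃, ht₃⟩ := runs_exec (P := markRoot) rfl s₂
  have A₃ := hr₃.agree
  obtain ⟨r, hr, hp, l, hl⟩ := B.state.rootFirst
  have hcell : s₁.arr aCell (s₁.arr aHead n) = r := by
    have := B.state.lists.chain n
    rw [hl] at this
    generalize s₁.arr aHead n = h at this
    cases this
    rfl
  have e2 : s₂.arr aLab = s₁.arr aLab := A₂.arr aLab rfl
  have elb : (exec markRoot s₂).arr aLab =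
      if s₁.arr aLab r = 1 then Function.update (s₁.arr aLab) r 3 else s₁.arr aLab := by
    have h1 : s₂.arr aCell (s₂.arr aHead (s₂.reg rVerts)) = r := by
      rw [A₂.arr aCell rfl, A₂.arr aHead rfl, A₂.reg rVerts rfl, B.state.verts, hcell]
    simp only [markRoot, exec, Test.holds, NatExpr.eval, State.setReg_reg, State.setReg_arr, h1, e2]
    by_cases h : s₁.arr aLab r = 1 <;> simp [h, e2]
  have e3p : (exec markRoot s₂).arr aPar = s₁.arr aPar :=
    (A₃.arr aPar rfl).trans (A₂.arr aPar rfl)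
  have e3q : (exec markRoot s₂).arr aQueue = s₂.arr aQueue := A₃.arr aQueue rfl
  refine ⟨_, _, N, s₁.arr aLab, s₁.arr aNch, D, r, s₂.reg rLen,
    .seq hr₁ (.seq hr₂ (.seq hr₃ (.skip _))), ?_, ?_⟩
  · exact
      { verts := by rw [A₃.reg rVerts rfl, A₂.reg rVerts rfl, B.state.verts]
        tree := by rw [e3p]; exact B.state.tree
        alt := by rw [e3p]; exact B.alt
        root := hr
        par_root := by rw [e3p]; exact hp
        lab := elb
        len := A₃.reg rLen rfl
        len_le := hm
        inj := by rw [e3q]; exact hinj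
        mem := by rw [e3q]; exact hmem
        order := by rw [e3q, e3p]; exact hord }
  · have hb : markRoot.bound ≤ 50 := by decide
    omega

end RAM


/-! ## The dynamic program

The state of a vertex set `W` with a selection `R ⊆ W` consists of the minimum over `u ∈ W` of the
number of selected vertices in the closed neighbourhood of `u`, the minimum over `u ∈ W` of the
number of selected vertices that are not neighbours of `u`, and the number of selected vertices, all
of them capped at `2`. States are encoded as numbers such that a leaf has the state `1` if it is
selected and `0` otherwise. -/

/-- The code of a state. -/
def encode (a b s : ℕ) : ℕ := a + 3 * ((b + 2 * a) % 3) + 9 * ((s + 2 * a) % 3)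

/-- The first component of a state. -/
def codeA (r : ℕ) : ℕ := r % 3

/-- The second component of a state. -/
def codeB (r : ℕ) : ℕ := (r / 3 + r) % 3

/-- The third component of a state. -/
def codeS (r : ℕ) : ℕ := (r / 9 + r) % 3

theorem codeA_encode {a b s : ℕ} (ha : a ≤ 2) : codeA (encode a b s) = a := by
  unfold codeA encode; omega

theorem codeB_encode {a b s : ℕ} (ha : a ≤ 2) (hb : b ≤ 2) : codeB (encode a b s) = b := by
  unfold codeB encode
  interval_cases a <;> interval_cases b <;> omega

theorem codeS_encode {a b s : ℕ} (ha : a ≤ 2) (hs : s ≤ 2) : codeS (encode a b s) = s := by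
  unfold codeS encode
  have hk : (b + 2 * a) % 3 < 3 := Nat.mod_lt _ (by norm_num)
  generalize (b + 2 * a) % 3 = k at hk
  interval_cases a <;> interval_cases s <;> interval_cases k <;> rfl

theorem encode_lt {a : ℕ} (b s : ℕ) (ha : a ≤ 2) : encode a b s < 27 := by
  unfold encode; omega

/-- The state of the disjoint union of two vertex sets with the states `x` and `y`, combined at a
node with label `ℓ`, if no pair of vertices in different sets is resolved at most once. -/
def merge (ℓ x y : ℕ) : Option ℕ :=
  if ℓ = 2 then
    if 2 ≤ codeB x + codeB y then
      some (encode (min 2 (min (codeA x + codeS y) (codeA y + codeS x)))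
        (min (codeB x) (codeB y)) (min 2 (codeS x + codeS y)))
    else none
  else if ℓ = 3 then
    if 2 ≤ codeA x + codeS y then some (encode (min (codeA x) (codeS y)) 2 0) else none
  else
    if 2 ≤ codeA x + codeA y then
      some (encode (min (codeA x) (codeA y))
        (min 2 (min (codeB x + codeS y) (codeB y + codeS x))) (min 2 (codeS x + codeS y)))
    else none

theorem merge_lt {ℓ x y z : ℕ} (h : merge ℓ x y = some z) : z < 27 := by
  have h1 : codeA x ≤ 2 := by unfold codeA; omega
  unfold merge at h
  split_ifs at h <;> (cases h; exact encode_lt _ _ (by omega))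

section DynamicProgram

variable (n : ℕ) (par lab q : ℕ → ℕ)

/-- The leaves below `w`, when the first `h` entries of the list `q` have been merged into their
parents. -/
def below : ℕ → ℕ → Finset ℕ
  | 0, w => if w < n then {w} else ∅
  | h + 1, w => if w = par (q h) then below h w ∪ below h (q h) else below h w

/-- The state at `w` of the selection `R`, when the first `h` entries of the list `q` have been
merged into their parents. -/
def selState : ℕ → ℕ → Finset ℕ → Option ℕ
  | 0, w, R => some (if w < n then (if w ∈ R then 1 else 0) else 11)
  | h + 1, w, R => if w = par (q h) then
      (selState h w R).bind fun x => (selState h (q h) R).bind fun y => merge (lab w) x y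
    else selState h w R

/-- The selection that the choices `chA` and `chB` describe. -/
def choiceSet (chA chB : ℕ → ℕ → ℕ) : ℕ → ℕ → ℕ → Finset ℕ
  | 0, r, w => if w < n ∧ r = 1 then {w} else ∅
  | h + 1, r, w => if w = par (q h) then
      choiceSet chA chB h (chA r h) w ∪ choiceSet chA chB h (chB r h) (q h)
    else choiceSet chA chB h r w

variable {n par lab q}

theorem selState_lt {h w : ℕ} {R : Finset ℕ} {r : ℕ} (H : selState n par lab q h w R = some r) :
    r < 27 := by
  induction h generalizing w r with
  | zero =>
    simp only [selState, Option.some.injEq] at H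
    split_ifs at H <;> omega
  | succ h ih =>
    simp only [selState] at H
    split_ifs at H with hw
    · obtain ⟨x, -, hx⟩ := Option.bind_eq_some_iff.1 H
      obtain ⟨y, -, hy⟩ := Option.bind_eq_some_iff.1 hx
      exact merge_lt hy
    · exact ih H

/-- Only selected leaves below the node matter. This allows selections that were chosen separately
for a node and for its parent to be united without changing either state. -/
theorem selState_congr {h w : ℕ} {R R' : Finset ℕ}
    (H : ∀ v ∈ below n par q h w, v ∈ R ↔ v ∈ R') :
    selState n par lab q h w R = selState n par lab q h w R' := by
  induction h generalizing w with
  | zero =>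
    simp only [selState]
    by_cases hw : w < n
    · have := H w (by simp [below, hw])
      simp [hw, this]
    · simp [hw]
  | succ h ih =>
    simp only [selState]
    simp only [below] at H
    split_ifs at H ⊢ with hw
    · rw [ih (w := w) fun v hv => H v (Finset.mem_union_left _ hv),
        ih (w := q h) fun v hv => H v (Finset.mem_union_right _ hv)]
    · exact ih H

theorem choiceSet_congr {chA chB chA' chB' : ℕ → ℕ → ℕ} {h : ℕ}
    (hA : ∀ r, ∀ k < h, chA' r k = chA r k) (hB : ∀ r, ∀ k < h, chB' r k = chB r k) (r w : ℕ) :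
    choiceSet n par q chA' chB' h r w = choiceSet n par q chA chB h r w := by
  induction h generalizing r w with
  | zero => rfl
  | succ h ih =>
    have ih' := ih (fun r k hk => hA r k (by omega)) (fun r k hk => hB r k (by omega))
    simp only [choiceSet, hA r h (by omega), hB r h (by omega), ih']

/-- The list `q` of length `m` contains every node once, and every node before its parent. -/
structure NodeList (n m : ℕ) (par q : ℕ → ℕ) : Prop where
  inj : ∀ j < m, ∀ j' < m, q j = q j' → j = j'
  ne : ∀ j < m, q j ≠ n
  leaf : ∀ v < n, ∃ j < m, q j = v
  parent : ∀ h < m, par (q h) = n ∨ ∃ j < m, q j = par (q h)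
  order : ∀ j < m, ∀ h < m, par (q h) = q j → h < j

/-- The nodes that are not among the first `h` nodes of the list. -/
def IsActive (n m : ℕ) (q : ℕ → ℕ) (h w : ℕ) : Prop := w = n ∨ ∃ j, h ≤ j ∧ j < m ∧ q j = w

namespace NodeList

variable {m : ℕ}

theorem active_parent (H : NodeList n m par q) {h : ℕ} (hm : h < m) :
    IsActive n m q (h + 1) (par (q h)) := by
  rcases H.parent h hm with hp | ⟨j, hj, hp⟩
  · exact .inl hp
  · exact .inr ⟨j, H.order j hj h hm hp.symm, hj, hp⟩

theorem active_self {h : ℕ} (hm : h < m) : IsActive n m q h (q h) := .inr ⟨h, le_rfl, hm, rfl⟩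

theorem active_iff (_ : NodeList n m par q) {h : ℕ} (hm : h < m) (w : ℕ) :
    IsActive n m q h w ↔ w = q h ∨ IsActive n m q (h + 1) w := by
  constructor
  · rintro (hw | ⟨j, hj, hjm, rfl⟩)
    · exact .inr (.inl hw)
    · by_cases hjh : j = h
      · exact .inl (by rw [hjh])
      · exact .inr (.inr ⟨j, by omega, hjm, rfl⟩)
  · rintro (rfl | hw | ⟨j, hj, hjm, rfl⟩)
    · exact active_self hm
    · exact .inl hw
    · exact .inr ⟨j, by omega, hjm, rfl⟩

theorem not_active (H : NodeList n m par q) {h : ℕ} (hm : h < m) :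
    ¬ IsActive n m q (h + 1) (q h) := by
  rintro (hw | ⟨j, hj, hjm, hw⟩)
  · exact H.ne h hm hw
  · have := H.inj j hjm h hm hw
    omega

theorem par_ne (H : NodeList n m par q) {h : ℕ} (hm : h < m) : par (q h) ≠ q h := fun heq =>
  H.not_active hm (heq ▸ H.active_parent hm)

/-- Initially the sets are singletons or empty. A merge hands the leaves of `q h` to its parent and
makes `q h` inactive, so no leaf is ever shared by two active nodes. -/
theorem disjoint_below (H : NodeList n m par q) {h : ℕ} (hm : h ≤ m) {w w' : ℕ}
    (hw : IsActive n m q h w) (hw' : IsActive n m q h w') (hne : w ≠ w') :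
    Disjoint (below n par q h w) (below n par q h w') := by
  induction h generalizing w w' with
  | zero =>
    simp only [below]
    split_ifs <;> simp [hne]
  | succ h ih =>
    have hlt : h < m := hm
    have h1 := (H.active_iff hlt w).2 (.inr hw)
    have h2 := (H.active_iff hlt w').2 (.inr hw')
    have h3 : w ≠ q h := fun h => H.not_active hlt (h ▸ hw)
    have h4 : w' ≠ q h := fun h => H.not_active hlt (h ▸ hw')
    have h5 := active_self (n := n) (q := q) hlt
    have hle : h ≤ m := by omega
    simp only [below]
    split_ifs with e1 e2 e2
    · omega
    · exact Finset.disjoint_union_left.2 ⟨ih hle h1 h2 hne, ih hle h5 h2 h4.symm⟩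
    · exact Finset.disjoint_union_right.2 ⟨ih hle h1 h2 hne, ih hle h1 h5 h3⟩
    · exact ih hle h1 h2 hne

end NodeList

variable (n par lab q) in
/-- The tables contain the feasible states of all nodes with their least weights, and the choices
describe selections with these states and weights. -/
structure Tables (m h : ℕ) (c : ℕ → NNReal) (flag : ℕ → ℕ → ℕ) (wt : ℕ → ℕ → NNReal)
    (chA chB : ℕ → ℕ → ℕ) : Prop where
  sound : ∀ w, IsActive n m q 0 w → ∀ r < 27, flag r w = 1 →
    selState n par lab q h w (choiceSet n par q chA chB h r w) = some r ∧
    choiceSet n par q chA chB h r w ⊆ below n par q h w ∧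
    wt r w = ∑ v ∈ choiceSet n par q chA chB h r w, c v
  complete : ∀ w, IsActive n m q 0 w → ∀ R r, selState n par lab q h w R = some r →
    flag r w = 1 ∧ wt r w ≤ ∑ v ∈ below n par q h w with v ∈ R, c v

variable {m h : ℕ} {c : ℕ → NNReal}

/-- A leaf has the feasible states `0` and `1`. A node into which nothing has been merged has the
state `11`, which encodes minima `2` over the empty set and no selected vertex. -/
theorem Tables.init {flag : ℕ → ℕ → ℕ} {wt : ℕ → ℕ → NNReal} {chA chB : ℕ → ℕ → ℕ}
    (hleaf : ∀ w < n, ∀ r < 27, flag r w = if r = 0 ∨ r = 1 then 1 else 0)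
    (hinner : ∀ w, n ≤ w → IsActive n m q 0 w → ∀ r < 27, flag r w = if r = 11 then 1 else 0)
    (hwt : ∀ r < 27, ∀ w, wt r w = if r = 1 ∧ w < n then c w else 0) :
    Tables n par lab q m 0 c flag wt chA chB := by
  constructor
  · intro w hw r hr hf
    rw [hwt r hr w]
    simp only [selState, choiceSet, below]
    by_cases hwn : w < n
    · rw [hleaf w hwn r hr] at hf
      have : r = 0 ∨ r = 1 := by by_contra h; simp [h] at hf
      rcases this with rfl | rfl <;> simp [hwn]
    · rw [hinner w (by omega) hw r hr] at hf
      have : r = 11 := by by_contra h; simp [h] at hf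
      subst this
      simp [hwn]
  · intro w hw R r hr
    have hlt := selState_lt hr
    rw [hwt r hlt w]
    simp only [selState, below, Option.some.injEq] at hr ⊢
    by_cases hwn : w < n
    · rw [hleaf w hwn r hlt]
      by_cases hR : w ∈ R
      · simp only [hwn, hR, if_true] at hr
        subst hr
        simp [hwn, hR, Finset.filter_singleton]
      · simp only [hwn, hR, if_true, if_false] at hr
        subst hr
        simp [hwn, hR, Finset.filter_singleton]
    · rw [hinner w (by omega) hw r hlt]
      simp only [hwn, if_false] at hr
      subst hr
      simp [hwn]

/-- The new entries of the tables, when a node is merged into its parent. -/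
structure MergeStep (ℓ : ℕ) (fP fC : ℕ → ℕ) (wP wC : ℕ → NNReal) (f : ℕ → ℕ) (w : ℕ → NNReal)
    (a b : ℕ → ℕ) : Prop where
  sound : ∀ z < 27, f z = 1 → a z < 27 ∧ b z < 27 ∧ fP (a z) = 1 ∧ fC (b z) = 1 ∧
    merge ℓ (a z) (b z) = some z ∧ w z = wP (a z) + wC (b z)
  complete : ∀ x < 27, ∀ y < 27, ∀ z, merge ℓ x y = some z → fP x = 1 → fC y = 1 →
    f z = 1 ∧ w z ≤ wP x + wC y

/-- The leaves of `q h` and those already below its parent are disjoint. So any two selections can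
be combined freely, each selection splits into two, and weights add; a least weight for a merged
state is a minimum over pairs of states. -/
theorem Tables.step (H : NodeList n m par q) (hm : h < m) {flag flag' : ℕ → ℕ → ℕ}
    {wt wt' : ℕ → ℕ → NNReal} {chA chB chA' chB' : ℕ → ℕ → ℕ}
    (T : Tables n par lab q m h c flag wt chA chB)
    (hA : ∀ r, ∀ k < h, chA' r k = chA r k) (hB : ∀ r, ∀ k < h, chB' r k = chB r k)
    (hf : ∀ r < 27, ∀ w, w ≠ par (q h) → flag' r w = flag r w)
    (hw : ∀ r < 27, ∀ w, w ≠ par (q h) → wt' r w = wt r w)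
    (M : MergeStep (lab (par (q h))) (flag · (par (q h))) (flag · (q h)) (wt · (par (q h)))
      (wt · (q h)) (flag' · (par (q h))) (wt' · (par (q h))) (chA' · h) (chB' · h)) :
    Tables n par lab q m (h + 1) c flag' wt' chA' chB' := by
  have hle : h ≤ m := hm.le
  have act : ∀ {k w}, IsActive n m q k w → IsActive n m q 0 w := by
    rintro k w (hw | ⟨j, -, hj⟩)
    · exact .inl hw
    · exact .inr ⟨j, Nat.zero_le j, hj⟩
  have hpa := H.active_parent hm
  have hqa := NodeList.active_self (n := n) (q := q) hm
  have hdisj := H.disjoint_below hle ((H.active_iff hm _).2 (.inr hpa)) hqa (H.par_ne hm)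
  constructor
  · intro w hwa r hr hfl
    simp only [selState, choiceSet, below, choiceSet_congr hA hB]
    by_cases hwp : w = par (q h)
    · subst hwp
      obtain ⟨a27, b27, h1, h2, h3, h4⟩ := M.sound r hr hfl
      obtain ⟨p1, p2, p3⟩ := T.sound _ (act hpa) _ a27 h1
      obtain ⟨c1, c2, c3⟩ := T.sound _ (act hqa) _ b27 h2
      simp only [if_true]
      refine ⟨?_, Finset.union_subset_union p2 c2, ?_⟩
      -- Each half of the union is invisible to the other side, by disjointness.
      · rw [selState_congr (R' := choiceSet n par q chA chB h (chA' r h) (par (q h))),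
          selState_congr (w := q h) (R' := choiceSet n par q chA chB h (chB' r h) (q h)), p1, c1]
        · simpa using h3
        · intro v hv
          rw [Finset.mem_union, or_iff_right]
          exact fun hv' => Finset.disjoint_left.1 hdisj (p2 hv') hv
        · intro v hv
          rw [Finset.mem_union, or_iff_left]
          exact fun hv' => Finset.disjoint_left.1 hdisj hv (c2 hv')
      · rw [Finset.sum_union (hdisj.mono p2 c2), ← p3, ← c3]
        exact h4
    · simp only [if_neg hwp]
      rw [hf r hr w hwp] at hfl
      rw [hw r hr w hwp]
      exact T.sound w hwa r hr hfl
  · intro w hwa R r hr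
    have hlt := selState_lt hr
    simp only [selState, below] at hr ⊢
    by_cases hwp : w = par (q h)
    · subst hwp
      simp only [if_true] at hr ⊢
      obtain ⟨x, hx, hr⟩ := Option.bind_eq_some_iff.1 hr
      obtain ⟨y, hy, hr⟩ := Option.bind_eq_some_iff.1 hr
      obtain ⟨x1, x2⟩ := T.complete _ (act hpa) R x hx
      obtain ⟨y1, y2⟩ := T.complete _ (act hqa) R y hy
      obtain ⟨h1, h2⟩ := M.complete x (selState_lt hx) y (selState_lt hy) r hr x1 y1
      refine ⟨h1, h2.trans ?_⟩
      rw [Finset.filter_union, Finset.sum_union (Finset.disjoint_filter_filter hdisj)]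
      exact add_le_add x2 y2
    · simp only [if_neg hwp] at hr ⊢
      rw [hf r hlt w hwp, hw r hlt w hwp]
      exact T.complete w hwa R r hr

/-- Tracing back one step. -/
theorem mem_choiceSet_step (H : NodeList n m par q) (hm : h < m) {chA chB : ℕ → ℕ → ℕ}
    {st st' : ℕ → ℕ} (hp : st' (par (q h)) = chA (st (par (q h))) h)
    (hq : st' (q h) = chB (st (par (q h))) h)
    (ho : ∀ w, w ≠ par (q h) → w ≠ q h → st' w = st w) (v : ℕ) :
    (∃ w, IsActive n m q h w ∧ v ∈ choiceSet n par q chA chB h (st' w) w) ↔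
      ∃ w, IsActive n m q (h + 1) w ∧ v ∈ choiceSet n par q chA chB (h + 1) (st w) w := by
  simp only [H.active_iff hm, choiceSet]
  constructor
  · rintro ⟨w, rfl | hw, hv⟩
    · refine ⟨par (q h), H.active_parent hm, ?_⟩
      rw [if_pos rfl, Finset.mem_union]
      right; rwa [← hq]
    · by_cases hwp : w = par (q h)
      · subst hwp
        refine ⟨_, hw, ?_⟩
        rw [if_pos rfl, Finset.mem_union]
        left; rwa [← hp]
      · refine ⟨w, hw, ?_⟩
        rw [if_neg hwp]
        rwa [ho w hwp fun h => H.not_active hm (h ▸ hw)] at hv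
  · rintro ⟨w, hw, hv⟩
    by_cases hwp : w = par (q h)
    · subst hwp
      rw [if_pos rfl, Finset.mem_union] at hv
      rcases hv with hv | hv
      · exact ⟨_, .inr hw, by rwa [hp]⟩
      · exact ⟨_, .inl rfl, by rwa [hq]⟩
    · rw [if_neg hwp] at hv
      refine ⟨w, .inr hw, ?_⟩
      rwa [ho w hwp fun h => H.not_active hm (h ▸ hw)]

theorem mem_choiceSet_zero (H : NodeList n m par q) {chA chB : ℕ → ℕ → ℕ} {st : ℕ → ℕ} (v : ℕ) :
    (∃ w, IsActive n m q 0 w ∧ v ∈ choiceSet n par q chA chB 0 (st w) w) ↔ v < n ∧ st v = 1 := by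
  simp only [choiceSet]
  constructor
  · rintro ⟨w, -, hv⟩
    split_ifs at hv with h
    · rw [Finset.mem_singleton] at hv; rwa [hv]
    · simp at hv
  · rintro ⟨hv, hst⟩
    obtain ⟨j, hj, rfl⟩ := H.leaf v hv
    exact ⟨q j, .inr ⟨j, Nat.zero_le j, hj, rfl⟩, by simp [hv, hst]⟩

end DynamicProgram



/-! ### The tables of the dynamic program in memory -/

namespace RAM

open Program NatExpr

/-- Execution of a list of programs, with an invariant that depends on the processed part. -/
theorem exec_map {α : Type*} (f : α → Program) (I : List α → State → Prop) (l : List α)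
    (step : ∀ a l' s, a ∈ l → I l' s → I (l' ++ [a]) (exec (f a) s)) (l₀ : List α) (s : State)
    (h : I l₀ s) : I (l₀ ++ l) (exec (seqList (l.map f)) s) := by
  induction l generalizing l₀ s with
  | nil => simpa [seqList, exec] using h
  | cons a l ih =>
    have := ih (fun b l' s hb => step b l' s (List.mem_cons_of_mem _ hb)) (l₀ ++ [a])
      (exec (f a) s) (step a l₀ s (by simp) h)
    simpa [seqList, exec] using this

/-- Initialize the tables of the current entry of the queue. -/
def initTableBody : Program := seqList
  [setReg rTmp (read aQueue (reg rPos)),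
   ite (.lt (reg rTmp) (reg rVerts))
     (seqList [setArr 100 (reg rTmp) (const 1), setArr 101 (reg rTmp) (const 1),
       setWArr 101 (reg rTmp) (.read 0 (reg rTmp))])
     (setArr 111 (reg rTmp) (const 1))]

/-- Initialize the tables. -/
def initTables : Program := seqList
  [setArr 111 (reg rVerts) (const 1), forTo rPos rLen initTableBody]

/-- For a state `r` the arrays numbered `100 + r` hold feasibility and weight, indexed by nodes; the
arrays `200 + r` and `300 + r` hold the choices, indexed by positions in the queue. The artificial
node `n` is not in the queue and gets its entry in array `111` separately. -/
theorem runs_initTables {n m : ℕ} {s : State} (hn : s.reg rVerts = n) (hm : s.reg rLen = m)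
    (H : NodeList n m (s.arr aPar) (s.arr aQueue)) (hf : ∀ r < 27, s.arr (100 + r) = 0)
    (hw : ∀ r < 27, s.warr (100 + r) = 0) (lab : ℕ → ℕ) (chA chB : ℕ → ℕ → ℕ) :
    ∃ s' t, Runs initTables s s' t ∧ t ≤ 50 * m + 50 ∧
      Tables n (s.arr aPar) lab (s.arr aQueue) m 0 (s.warr 0) (fun r => s'.arr (100 + r))
        (fun r => s'.warr (100 + r)) chA chB := by
  subst hm
  set q := s.arr aQueue with hq
  have h0 : Runs (setArr 111 (reg rVerts) (const 1)) s (s.setArr 111 n 1) 3 := by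
    have := Runs.setArr s 111 (reg rVerts) (const 1)
    simpa [NatExpr.eval, NatExpr.cost, hn] using this
  obtain ⟨s', t, hr, ⟨h1, h2⟩, ht⟩ := runs_forTo (j := rPos) (m := rLen) (body := initTableBody)
    (by decide) rfl rfl rfl
    (fun k s' => (∀ r < 27, ∀ w, s'.arr (100 + r) w =
        if (w < n ∧ (r = 0 ∨ r = 1) ∧ ∃ j < k, q j = w) ∨
          (n ≤ w ∧ r = 11 ∧ (w = n ∨ ∃ j < k, q j = w)) then 1 else 0) ∧
      ∀ r < 27, ∀ w, s'.warr (100 + r) w =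
        if r = 1 ∧ w < n ∧ ∃ j < k, q j = w then s.warr 0 w else 0)
    (s.setArr 111 n 1) ⟨fun r hr w => by
        simp only [State.setReg_arr, State.setArr_arr, Function.update_apply]
        by_cases hr : r = 11
        · subst hr
          by_cases hwn : w = n <;> simp [hwn, hf 11 (by norm_num)]
        · rw [if_neg (by omega)]
          simp [hf r (by omega), hr],
      fun r hr w => by simp [hw r hr]⟩
    (by
      rintro k s' hk hj hm hA ⟨h1, h2⟩
      have e0 : s'.warr 0 = s.warr 0 := hA.warr 0 rfl
      have eq : s'.arr aQueue = q := hA.arr aQueue rfl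
      have ev : s'.reg rVerts = n := by rw [hA.reg rVerts rfl]; simp [hn]
      have hex : ∀ w, (∃ j < k + 1, q j = w) ↔ q k = w ∨ ∃ j < k, q j = w := by
        intro w
        constructor
        · rintro ⟨j, hj, hw⟩
          rcases Nat.lt_succ_iff_lt_or_eq.1 hj with hj | rfl
          · exact .inr ⟨j, hj, hw⟩
          · exact .inl hw
        · rintro (hw | ⟨j, hj, hw⟩)
          · exact ⟨k, by omega, hw⟩
          · exact ⟨j, by omega, hw⟩
      by_cases hlt : q k < n
      · have he : (exec initTableBody s').setReg rPos (k + 1) = ((((s'.setReg rTmp (q k)).setArr 100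
            (q k) 1).setArr 101 (q k) 1).setWArr 101 (q k) (s.warr 0 (q k))).setReg rPos
            (k + 1) := by
          simp [initTableBody, exec, seqList, NatExpr.eval, WeightExpr.eval, Test.holds, hj, eq, ev,
            hlt, e0]
        rw [he]
        refine ⟨fun r hr w => ?_, fun r hr w => ?_⟩
        · have e : (((((s'.setReg rTmp (q k)).setArr 100 (q k) 1).setArr 101 (q k) 1).setWArr 101
              (q k) (s.warr 0 (q k))).setReg rPos (k + 1)).arr (100 + r) w =
              if w = q k ∧ (r = 0 ∨ r = 1) then 1 else s'.arr (100 + r) w := by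
            by_cases hr0 : r = 0
            · subst hr0; simp [Function.update_apply]
            · by_cases hr1 : r = 1
              · subst hr1; simp [Function.update_apply]
              · simp [hr0, hr1, show ¬ 100 + r = 101 by omega]
          rw [e, h1 r hr w]
          simp only [hex]
          by_cases hwk : w = q k
          · subst hwk
            by_cases hr01 : r = 0 ∨ r = 1
            · simp [hr01, hlt]
            · simp [hr01, hlt.not_ge]
          · have hkw : ¬ q k = w := fun h => hwk h.symm
            simp [hwk, hkw]
        · have := h2 r hr w
          simp only [State.setReg_warr, State.setWArr_warr, State.setArr_warr,
            Function.update_apply, hex]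
          by_cases hr1 : r = 1
          · subst hr1
            by_cases hwk : w = q k
            · simp [hwk, hlt]
            · have hkw : ¬ q k = w := fun h => hwk h.symm
              simpa [hwk, hkw] using this
          · rw [if_neg (by omega), this]
            simp [hr1]
      · have he : (exec initTableBody s').setReg rPos (k + 1) = ((s'.setReg rTmp (q k)).setArr 111
            (q k) 1).setReg rPos (k + 1) := by
          simp [initTableBody, exec, seqList, NatExpr.eval, WeightExpr.eval, Test.holds, hj, eq, ev,
            hlt, e0]
        rw [he]
        refine ⟨fun r hr w => ?_, fun r hr w => ?_⟩
        · have := h1 r hr w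
          simp only [State.setReg_arr, State.setArr_arr, Function.update_apply, hex]
          by_cases hr1 : r = 11
          · subst hr1
            by_cases hwk : w = q k
            · subst hwk; simp [Nat.not_lt.1 hlt]
            · have hkw : ¬ q k = w := fun h => hwk h.symm
              simpa [hwk, hkw] using this
          · rw [if_neg (by omega), this]
            have hqw : ¬ (q k = w ∧ w < n) := by rintro ⟨rfl, h⟩; exact hlt h
            by_cases hwn : w < n
            · have : ¬ q k = w := fun h => hqw ⟨h, hwn⟩
              simp [hr1, this]
            · simp [hr1, hwn]
        · have := h2 r hr w
          simp only [State.setReg_warr, State.setArr_warr, hex]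
          rw [this]
          have hqw : ¬ (q k = w ∧ w < n) := by rintro ⟨rfl, h⟩; exact hlt h
          by_cases hwn : w < n
          · have : ¬ q k = w := fun h => hqw ⟨h, hwn⟩
            simp [this]
          · simp [hwn])
  have el : (s.setArr 111 n 1).reg rLen = s.reg rLen := rfl
  rw [el] at h1 h2 ht
  refine ⟨s', _, .seq h0 (.seq hr (.skip _)), ?_, Tables.init ?_ ?_ ?_⟩
  · have hb : initTableBody.bound + 7 ≤ 50 := by decide
    have := Nat.mul_le_mul_right (s.reg rLen) hb
    omega
  · intro w hwn r hr
    show s'.arr (100 + r) w = _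
    rw [h1 r hr w]
    have := H.leaf w hwn
    simp [hwn, hwn.not_ge, this]
  · intro w hwn hact r hr
    show s'.arr (100 + r) w = _
    rw [h1 r hr w]
    have : w = n ∨ ∃ j < s.reg rLen, q j = w := by
      rcases hact with h | ⟨j, -, hj, hjw⟩
      · exact .inl h
      · exact .inr ⟨j, hj, hjw⟩
    simp [hwn, this, hwn.not_gt]
  · intro r hr w
    show s'.warr (100 + r) w = _
    rw [h2 r hr w]
    by_cases hwn : w < n
    · have := H.leaf w hwn
      simp [hwn, this]
    · simp [hwn]

/-- Clear the registers for the new entries of the tables. -/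
def resetBest : Program := seqList ((List.range 27).map fun z => seqList
  [setReg (100 + z) (const 0), setReg (200 + z) (const 0), setReg (300 + z) (const 0)])

/-- Update the best selection found so far by the combination of a selection with state `x` at node
`rTmp` and one with state `y` at node `rLow`. -/
def mergePair (ℓ : ℕ) (p : ℕ × ℕ) : Program :=
  match merge ℓ p.1 p.2 with
  | none => skip
  | some z => ite (.and (.and (.eq (read (100 + p.1) (reg rTmp)) (const 1))
      (.eq (read (100 + p.2) (reg rLow)) (const 1)))
      (.not (.and (.eq (reg (100 + z)) (const 1)) (.wle (.reg (100 + z))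
        (.add (.read (100 + p.1) (reg rTmp)) (.read (100 + p.2) (reg rLow)))))))
      (seqList [setReg (100 + z) (const 1), setReg (200 + z) (const p.1),
        setReg (300 + z) (const p.2), setWReg (100 + z)
          (.add (.read (100 + p.1) (reg rTmp)) (.read (100 + p.2) (reg rLow)))])
      skip

/-- All pairs of states. -/
def statePairs : List (ℕ × ℕ) := (List.range 27).product (List.range 27)

theorem mem_statePairs {x y : ℕ} : (x, y) ∈ statePairs ↔ x < 27 ∧ y < 27 := by
  simp [statePairs]

/-- Find the best combinations for a node with label `ℓ`. -/
def mergeAll (ℓ : ℕ) : Program := seqList (statePairs.map (mergePair ℓ))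

/-- Write the new entries of the tables. -/
def storeBest : Program := seqList ((List.range 27).map fun z => seqList
  [setArr (100 + z) (reg rTmp) (reg (100 + z)), setWArr (100 + z) (reg rTmp) (.reg (100 + z)),
   setArr (200 + z) (reg rPos) (reg (200 + z)), setArr (300 + z) (reg rPos) (reg (300 + z))])

/-- Merge the current entry of the queue into its parent. -/
def mergeBody : Program := seqList
  [setReg rLow (read aQueue (reg rPos)), setReg rTmp (read aPar (reg rLow)), resetBest,
   ite (.eq (read aLab (reg rTmp)) (const 2)) (mergeAll 2)
     (ite (.eq (read aLab (reg rTmp)) (const 3)) (mergeAll 3) (mergeAll 1)), storeBest]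

theorem exec_resetBest (s : State) :
    (exec resetBest s).arr = s.arr ∧ (exec resetBest s).warr = s.warr ∧
      (∀ x < 100, (exec resetBest s).reg x = s.reg x) ∧
      ∀ z < 27, (exec resetBest s).reg (100 + z) = 0 ∧ (exec resetBest s).reg (200 + z) = 0 ∧
        (exec resetBest s).reg (300 + z) = 0 := by
  have := exec_map (fun z => seqList
    [setReg (100 + z) (const 0), setReg (200 + z) (const 0), setReg (300 + z) (const 0)])
    (fun l s' => s'.arr = s.arr ∧ s'.warr = s.warr ∧ (∀ x < 100, s'.reg x = s.reg x) ∧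
      ∀ z ∈ l, s'.reg (100 + z) = 0 ∧ s'.reg (200 + z) = 0 ∧ s'.reg (300 + z) = 0)
    (List.range 27) (by
      rintro a l s' ha ⟨h1, h2, h3, h4⟩
      have he : exec (seqList [setReg (100 + a) (const 0), setReg (200 + a) (const 0),
          setReg (300 + a) (const 0)]) s' = ((s'.setReg (100 + a) 0).setReg (200 + a) 0).setReg
          (300 + a) 0 := by
        simp [exec, seqList, NatExpr.eval]
      rw [he]
      refine ⟨h1, h2, fun x hx => ?_, fun z hz => ?_⟩
      · simp only [State.setReg_reg]
        rw [if_neg (by omega), if_neg (by omega), if_neg (by omega), h3 x hx]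
      · simp only [State.setReg_reg]
        rcases List.mem_append.1 hz with hz | hz
        · obtain ⟨k1, k2, k3⟩ := h4 z hz
          refine ⟨?_, ?_, ?_⟩ <;> split_ifs <;> first | rfl | assumption
        · rw [List.mem_singleton] at hz
          subst hz
          refine ⟨?_, ?_, ?_⟩ <;> split_ifs <;> first | rfl | omega)
    [] s ⟨rfl, rfl, fun _ _ => rfl, by simp⟩
  rw [List.nil_append] at this
  obtain ⟨h1, h2, h3, h4⟩ := this
  exact ⟨h1, h2, h3, fun z hz => h4 z (List.mem_range.2 hz)⟩

/-- A running minimum over all pairs of states: for every result `z` the registers hold a pair that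
produces `z` together with its weight, and this weight is at most that of every pair processed so
far. -/
theorem exec_mergeAll (ℓ : ℕ) (s : State) (hs : ∀ z < 27, s.reg (100 + z) = 0 ∧
      s.reg (200 + z) = 0 ∧ s.reg (300 + z) = 0) :
    (exec (mergeAll ℓ) s).arr = s.arr ∧ (exec (mergeAll ℓ) s).warr = s.warr ∧
      (∀ x < 100, (exec (mergeAll ℓ) s).reg x = s.reg x) ∧
      (∀ z < 27, (exec (mergeAll ℓ) s).reg (200 + z) < 27 ∧
        (exec (mergeAll ℓ) s).reg (300 + z) < 27) ∧
      MergeStep ℓ (fun r => s.arr (100 + r) (s.reg rTmp)) (fun r => s.arr (100 + r) (s.reg rLow))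
        (fun r => s.warr (100 + r) (s.reg rTmp)) (fun r => s.warr (100 + r) (s.reg rLow))
        (fun z => (exec (mergeAll ℓ) s).reg (100 + z))
        (fun z => (exec (mergeAll ℓ) s).wreg (100 + z))
        (fun z => (exec (mergeAll ℓ) s).reg (200 + z))
        (fun z => (exec (mergeAll ℓ) s).reg (300 + z)) := by
  have := exec_map (mergePair ℓ)
    (fun l s' => s'.arr = s.arr ∧ s'.warr = s.warr ∧ (∀ x < 100, s'.reg x = s.reg x) ∧
      (∀ z < 27, s'.reg (200 + z) < 27 ∧ s'.reg (300 + z) < 27) ∧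
      (∀ z < 27, s'.reg (100 + z) = 1 →
        s.arr (100 + s'.reg (200 + z)) (s.reg rTmp) = 1 ∧
        s.arr (100 + s'.reg (300 + z)) (s.reg rLow) = 1 ∧
        merge ℓ (s'.reg (200 + z)) (s'.reg (300 + z)) = some z ∧
        s'.wreg (100 + z) = s.warr (100 + s'.reg (200 + z)) (s.reg rTmp) +
          s.warr (100 + s'.reg (300 + z)) (s.reg rLow)) ∧
      ∀ p ∈ l, ∀ z, merge ℓ p.1 p.2 = some z → s.arr (100 + p.1) (s.reg rTmp) = 1 →
        s.arr (100 + p.2) (s.reg rLow) = 1 → s'.reg (100 + z) = 1 ∧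
        s'.wreg (100 + z) ≤ s.warr (100 + p.1) (s.reg rTmp) + s.warr (100 + p.2) (s.reg rLow))
    statePairs (by
      rintro ⟨x, y⟩ l s' ha ⟨h1, h2, h3, h4, h5, h6⟩
      have hxy := mem_statePairs.1 ha
      cases hmg : merge ℓ x y with
      | none =>
        have he : exec (mergePair ℓ (x, y)) s' = s' := by simp [mergePair, hmg, exec]
        rw [he]
        refine ⟨h1, h2, h3, h4, h5, fun p hp z hz => ?_⟩
        rcases List.mem_append.1 hp with hp | hp
        · exact h6 p hp z hz
        · rw [List.mem_singleton] at hp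
          subst hp
          rw [hmg] at hz; cases hz
      | some z =>
        have hz27 := merge_lt hmg
        by_cases hc : (s.arr (100 + x) (s.reg rTmp) = 1 ∧ s.arr (100 + y) (s.reg rLow) = 1) ∧
            ¬ (s'.reg (100 + z) = 1 ∧ s'.wreg (100 + z) ≤
              s.warr (100 + x) (s.reg rTmp) + s.warr (100 + y) (s.reg rLow))
        · have he : exec (mergePair ℓ (x, y)) s' = ((((s'.setReg (100 + z) 1).setReg (200 + z)
              x).setReg (300 + z) y).setWReg (100 + z) (s.warr (100 + x) (s.reg rTmp) +
                s.warr (100 + y) (s.reg rLow))) := by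
            simp only [mergePair, hmg, exec, Test.holds, NatExpr.eval, WeightExpr.eval, h1, h2,
              h3 8 (by norm_num), h3 6 (by norm_num), seqList]
            rw [if_pos hc]
            simp [h3 8 (by norm_num), h3 6 (by norm_num), h2,
              show ¬ 8 = 300 + z by omega, show ¬ 8 = 200 + z by omega, show ¬ 8 = 100 + z by omega,
              show ¬ 6 = 300 + z by omega, show ¬ 6 = 200 + z by omega, show ¬ 6 = 100 + z by omega]
          have er1 : ∀ k < 27, (exec (mergePair ℓ (x, y)) s').reg (100 + k) =
              if k = z then 1 else s'.reg (100 + k) := by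
            intro k hk
            rw [he]
            simp only [State.setWReg_reg, State.setReg_reg]
            rw [if_neg (by omega), if_neg (by omega)]
            exact if_congr (by omega) rfl rfl
          have er2 : ∀ k < 27, (exec (mergePair ℓ (x, y)) s').reg (200 + k) =
              if k = z then x else s'.reg (200 + k) := by
            intro k hk
            rw [he]
            simp only [State.setWReg_reg, State.setReg_reg]
            rw [if_neg (by omega), if_neg (show ¬ 200 + k = 100 + z by omega)]
            exact if_congr (by omega) rfl rfl
          have er3 : ∀ k < 27, (exec (mergePair ℓ (x, y)) s').reg (300 + k) =
              if k = z then y else s'.reg (300 + k) := by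
            intro k hk
            rw [he]
            simp only [State.setWReg_reg, State.setReg_reg]
            rw [if_neg (show ¬ 300 + k = 200 + z by omega),
              if_neg (show ¬ 300 + k = 100 + z by omega)]
            exact if_congr (by omega) rfl rfl
          have er4 : ∀ k < 27, (exec (mergePair ℓ (x, y)) s').wreg (100 + k) =
              if k = z then s.warr (100 + x) (s.reg rTmp) + s.warr (100 + y) (s.reg rLow)
              else s'.wreg (100 + k) := by
            intro k hk
            rw [he]
            simp only [State.setWReg_wreg, State.setReg_wreg]
            exact if_congr (by omega) rfl rfl
          refine ⟨by rw [he]; exact h1, by rw [he]; exact h2, fun k hk => ?_, fun k hk => ?_,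
            fun k hk hf => ?_, fun p hp k hk hp1 hp2 => ?_⟩
          · rw [he]
            simp only [State.setWReg_reg, State.setReg_reg]
            rw [if_neg (by omega), if_neg (by omega), if_neg (by omega), h3 k hk]
          · rw [er2 k hk, er3 k hk]
            have := h4 k hk
            split_ifs
            · exact hxy
            · exact this
          · rw [er1 k hk] at hf
            rw [er2 k hk, er3 k hk, er4 k hk]
            by_cases hkz : k = z
            · subst hkz
              simp only [if_true]
              exact ⟨hc.1.1, hc.1.2, hmg, trivial⟩
            · rw [if_neg hkz] at hf
              simp only [if_neg hkz]
              exact h5 k hk hf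
          · have hk27 := merge_lt hk
            rw [er1 k hk27, er4 k hk27]
            by_cases hkz : k = z
            · subst hkz
              simp only [if_true, true_and]
              rcases List.mem_append.1 hp with hp | hp
              · obtain ⟨k1, k2⟩ := h6 p hp k hk hp1 hp2
                have := not_and.1 hc.2 k1
                exact (le_of_lt (not_le.1 this)).trans k2
              · rw [List.mem_singleton] at hp
                subst hp
                exact le_rfl
            · simp only [if_neg hkz]
              rcases List.mem_append.1 hp with hp | hp
              · exact h6 p hp k hk hp1 hp2
              · rw [List.mem_singleton] at hp
                subst hp
                rw [hmg] at hk
                exact absurd (Option.some.inj hk).symm hkz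
        · have he : exec (mergePair ℓ (x, y)) s' = s' := by
            simp only [mergePair, hmg, exec, Test.holds, NatExpr.eval, WeightExpr.eval, h1, h2,
              h3 8 (by norm_num), h3 6 (by norm_num)]
            rw [if_neg hc]
          rw [he]
          refine ⟨h1, h2, h3, h4, h5, fun p hp k hk hp1 hp2 => ?_⟩
          rcases List.mem_append.1 hp with hp | hp
          · exact h6 p hp k hk hp1 hp2
          · rw [List.mem_singleton] at hp
            subst hp
            rw [hmg] at hk
            cases hk
            by_contra hcon
            exact hc ⟨⟨hp1, hp2⟩, hcon⟩)
    [] s ⟨rfl, rfl, fun _ _ => rfl, fun z hz => by rw [(hs z hz).2.1, (hs z hz).2.2]; norm_num,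
      fun z hz h => absurd ((hs z hz).1.symm.trans h) (by norm_num), by simp⟩
  rw [List.nil_append, ← mergeAll] at this
  generalize exec (mergeAll ℓ) s = s' at this ⊢
  obtain ⟨h1, h2, h3, h4, h5, h6⟩ := this
  refine ⟨h1, h2, h3, h4, fun z hz hf => ?_, fun x hx y hy z hz hp hc => ?_⟩
  · obtain ⟨k1, k2, k3, k4⟩ := h5 z hz hf
    exact ⟨(h4 z hz).1, (h4 z hz).2, k1, k2, k3, k4⟩
  · exact h6 (x, y) (mem_statePairs.2 ⟨hx, hy⟩) z hz hp hc

theorem exec_storeBest (s : State) :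
    (∀ z < 27, (exec storeBest s).arr (100 + z) =
        Function.update (s.arr (100 + z)) (s.reg rTmp) (s.reg (100 + z)) ∧
      (exec storeBest s).warr (100 + z) =
        Function.update (s.warr (100 + z)) (s.reg rTmp) (s.wreg (100 + z)) ∧
      (exec storeBest s).arr (200 + z) =
        Function.update (s.arr (200 + z)) (s.reg rPos) (s.reg (200 + z)) ∧
      (exec storeBest s).arr (300 + z) =
        Function.update (s.arr (300 + z)) (s.reg rPos) (s.reg (300 + z))) := by
  have := exec_map (fun z => seqList
    [setArr (100 + z) (reg rTmp) (reg (100 + z)), setWArr (100 + z) (reg rTmp) (.reg (100 + z)),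
     setArr (200 + z) (reg rPos) (reg (200 + z)), setArr (300 + z) (reg rPos) (reg (300 + z))])
    (fun l s' => s'.reg = s.reg ∧ s'.wreg = s.wreg ∧ ∀ z < 27,
      s'.arr (100 + z) = (if z ∈ l then
        Function.update (s.arr (100 + z)) (s.reg rTmp) (s.reg (100 + z)) else s.arr (100 + z)) ∧
      s'.warr (100 + z) = (if z ∈ l then
        Function.update (s.warr (100 + z)) (s.reg rTmp) (s.wreg (100 + z))
        else s.warr (100 + z)) ∧
      s'.arr (200 + z) = (if z ∈ l then
        Function.update (s.arr (200 + z)) (s.reg rPos) (s.reg (200 + z)) else s.arr (200 + z)) ∧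
      s'.arr (300 + z) = (if z ∈ l then
        Function.update (s.arr (300 + z)) (s.reg rPos) (s.reg (300 + z)) else s.arr (300 + z)))
    (List.range 27) (by
      rintro a l s' ha ⟨h1, h2, h3⟩
      have ha := List.mem_range.1 ha
      have he : exec (seqList
          [setArr (100 + a) (reg rTmp) (reg (100 + a)),
           setWArr (100 + a) (reg rTmp) (.reg (100 + a)),
           setArr (200 + a) (reg rPos) (reg (200 + a)),
           setArr (300 + a) (reg rPos) (reg (300 + a))]) s' =
          (((s'.setArr (100 + a) (s.reg rTmp) (s.reg (100 + a))).setWArr (100 + a) (s.reg rTmp)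
            (s.wreg (100 + a))).setArr (200 + a) (s.reg rPos) (s.reg (200 + a))).setArr (300 + a)
            (s.reg rPos) (s.reg (300 + a)) := by
        simp [exec, seqList, NatExpr.eval, WeightExpr.eval, h1, h2]
      rw [he]
      refine ⟨h1, h2, fun z hz => ?_⟩
      obtain ⟨k1, k2, k3, k4⟩ := h3 z hz
      simp only [State.setArr_arr, State.setWArr_arr, State.setArr_warr, State.setWArr_warr,
        List.mem_append, List.mem_singleton]
      rw [if_neg (show ¬ 100 + z = 300 + a by omega), if_neg (show ¬ 100 + z = 200 + a by omega),
        if_neg (show ¬ 200 + z = 300 + a by omega), if_neg (show ¬ 200 + z = 100 + a by omega),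
        if_neg (show ¬ 200 + a = 100 + a by omega), if_neg (show ¬ 300 + z = 200 + a by omega),
        if_neg (show ¬ 300 + z = 100 + a by omega), if_neg (show ¬ 300 + a = 200 + a by omega),
        if_neg (show ¬ 300 + a = 100 + a by omega)]
      by_cases hza : z = a
      · subst hza
        simp only [if_true, or_true, k1, k2, k3, k4]
        by_cases hzl : z ∈ l
        · simp [hzl]
        · simp [hzl]
      · rw [if_neg (show ¬ 100 + z = 100 + a by omega), if_neg (show ¬ 200 + z = 200 + a by omega),
          if_neg (show ¬ 300 + z = 300 + a by omega), if_neg (show ¬ 100 + z = 100 + a by omega)]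
        simp only [hza, or_false]
        exact ⟨k1, k2, k3, k4⟩)
    [] s ⟨rfl, rfl, by simp⟩
  rw [List.nil_append] at this
  intro z hz
  have h := this.2.2 z hz
  simp only [List.mem_range, hz, if_true] at h
  exact h

/-- The program is a concatenation of `27 * 27` pieces, so its write set is obtained from those of
the pieces rather than by evaluation. -/
theorem mergeAll_writes (ℓ : ℕ) : (mergeAll ℓ).loopFree = true ∧
    ∀ x < 100, (mergeAll ℓ).writesReg x = false ∧ (mergeAll ℓ).writesArr x = false ∧
      (mergeAll ℓ).writesWReg x = false ∧ (mergeAll ℓ).writesWArr x = false := by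
  have key : ∀ P ∈ statePairs.map (mergePair ℓ), P.loopFree = true ∧ ∀ x < 100,
      P.writesReg x = false ∧ P.writesArr x = false ∧ P.writesWReg x = false ∧
        P.writesWArr x = false := by
    intro P hP
    obtain ⟨⟨x, y⟩, -, rfl⟩ := List.mem_map.1 hP
    unfold mergePair
    split
    · simp [loopFree, writesReg, writesArr, writesWReg, writesWArr]
    · refine ⟨rfl, fun k hk => ?_⟩
      simp [seqList, writesReg, writesArr, writesWReg, writesWArr]
      omega
  exact ⟨seqList_loopFree fun P hP => (key P hP).1, fun x hx =>
    ⟨seqList_writesReg fun P hP => ((key P hP).2 x hx).1,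
      seqList_writesArr fun P hP => ((key P hP).2 x hx).2.1,
      seqList_writesWReg fun P hP => ((key P hP).2 x hx).2.2.1,
      seqList_writesWArr fun P hP => ((key P hP).2 x hx).2.2.2⟩⟩

theorem resetBest_writes : resetBest.loopFree = true ∧
    ∀ x < 100, resetBest.writesReg x = false ∧ resetBest.writesArr x = false ∧
      resetBest.writesWReg x = false ∧ resetBest.writesWArr x = false := by
  have key : ∀ P ∈ (List.range 27).map fun z => seqList
      [setReg (100 + z) (const 0), setReg (200 + z) (const 0), setReg (300 + z) (const 0)],
      P.loopFree = true ∧ ∀ x < 100,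
      P.writesReg x = false ∧ P.writesArr x = false ∧ P.writesWReg x = false ∧
        P.writesWArr x = false := by
    intro P hP
    obtain ⟨x, -, rfl⟩ := List.mem_map.1 hP
    refine ⟨rfl, fun k hk => ?_⟩
    simp [seqList, writesReg, writesArr, writesWReg, writesWArr]
    omega
  exact ⟨seqList_loopFree fun P hP => (key P hP).1, fun x hx =>
    ⟨seqList_writesReg fun P hP => ((key P hP).2 x hx).1,
      seqList_writesArr fun P hP => ((key P hP).2 x hx).2.1,
      seqList_writesWReg fun P hP => ((key P hP).2 x hx).2.2.1,
      seqList_writesWArr fun P hP => ((key P hP).2 x hx).2.2.2⟩⟩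

theorem storeBest_writes : storeBest.loopFree = true ∧
    ∀ x < 100, storeBest.writesReg x = false ∧ storeBest.writesArr x = false ∧
      storeBest.writesWReg x = false ∧ storeBest.writesWArr x = false := by
  have key : ∀ P ∈ (List.range 27).map fun z => seqList
      [setArr (100 + z) (reg rTmp) (reg (100 + z)), setWArr (100 + z) (reg rTmp) (.reg (100 + z)),
       setArr (200 + z) (reg rPos) (reg (200 + z)), setArr (300 + z) (reg rPos) (reg (300 + z))],
      P.loopFree = true ∧ ∀ x < 100,
      P.writesReg x = false ∧ P.writesArr x = false ∧ P.writesWReg x = false ∧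
        P.writesWArr x = false := by
    intro P hP
    obtain ⟨x, -, rfl⟩ := List.mem_map.1 hP
    refine ⟨rfl, fun k hk => ?_⟩
    simp [seqList, writesReg, writesArr, writesWReg, writesWArr]
    omega
  exact ⟨seqList_loopFree fun P hP => (key P hP).1, fun x hx =>
    ⟨seqList_writesReg fun P hP => ((key P hP).2 x hx).1,
      seqList_writesArr fun P hP => ((key P hP).2 x hx).2.1,
      seqList_writesWReg fun P hP => ((key P hP).2 x hx).2.2.1,
      seqList_writesWArr fun P hP => ((key P hP).2 x hx).2.2.2⟩⟩

theorem mergeBody_writes : mergeBody.loopFree = true ∧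
    (∀ x < 100, x ≠ rLow → x ≠ rTmp → mergeBody.writesReg x = false) ∧
    (∀ x < 100, mergeBody.writesArr x = false) ∧
    (∀ x < 100, mergeBody.writesWReg x = false) ∧
    ∀ x < 100, mergeBody.writesWArr x = false := by
  have h1 := mergeAll_writes 1
  have h2 := mergeAll_writes 2
  have h3 := mergeAll_writes 3
  have h4 := resetBest_writes
  have h5 := storeBest_writes
  refine ⟨?_, fun x hx hl ht => ?_, fun x hx => ?_, fun x hx => ?_, fun x hx => ?_⟩
  · simp [mergeBody, seqList, loopFree, h1.1, h2.1, h3.1, h4.1, h5.1]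
  · simp [mergeBody, seqList, writesReg, h1.2 x hx, h2.2 x hx, h3.2 x hx, h4.2 x hx, h5.2 x hx, hl,
      ht]
  · simp [mergeBody, seqList, writesArr, h1.2 x hx, h2.2 x hx, h3.2 x hx, h4.2 x hx, h5.2 x hx]
  · simp [mergeBody, seqList, writesWReg, h1.2 x hx, h2.2 x hx, h3.2 x hx, h4.2 x hx, h5.2 x hx]
  · simp [mergeBody, seqList, writesWArr, h1.2 x hx, h2.2 x hx, h3.2 x hx, h4.2 x hx, h5.2 x hx]

end RAM



/-! ### Merging all nodes, selecting the best state, tracing back -/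

namespace RAM

open Program NatExpr

theorem forTo_writesReg {j m : ℕ} {P : Program} {x : ℕ} (hx : x ≠ j)
    (h : P.writesReg x = false) : (forTo j m P).writesReg x = false := by
  simp [forTo, writesReg, hx, h]

theorem forTo_writesArr {j m : ℕ} {P : Program} {x : ℕ}
    (h : P.writesArr x = false) : (forTo j m P).writesArr x = false := by
  simp [forTo, writesArr, h]

/-- The rule `merge` treats every label other than `2` and `3` like `1`. The program uses this for
the artificial node, whose label is `0`. -/
theorem exec_mergeBody {s : State} {c p : ℕ} (hc : s.arr aQueue (s.reg rPos) = c)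
    (hp : s.arr aPar c = p) :
    ∃ ℓ, (∀ x y, merge ℓ x y = merge (s.arr aLab p) x y) ∧ exec mergeBody s =
      exec storeBest (exec (mergeAll ℓ) (exec resetBest ((s.setReg rLow c).setReg rTmp p))) := by
  have h1 : exec mergeBody s = exec storeBest (exec (ite (.eq (read aLab (reg rTmp)) (const 2))
      (mergeAll 2) (ite (.eq (read aLab (reg rTmp)) (const 3)) (mergeAll 3) (mergeAll 1)))
      (exec resetBest ((s.setReg rLow c).setReg rTmp p))) := by
    rw [mergeBody]
    simp only [seqList, exec.eq_6, exec.eq_2, exec.eq_1]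
    simp [NatExpr.eval, hc, hp]
  obtain ⟨r1, -, r3, -⟩ := exec_resetBest ((s.setReg rLow c).setReg rTmp p)
  have r8 : (exec resetBest ((s.setReg rLow c).setReg rTmp p)).reg rTmp = p := by
    rw [r3 _ (by norm_num)]; simp
  have ht : ∀ k, (Test.eq (read aLab (reg rTmp)) (const k)).holds
      (exec resetBest ((s.setReg rLow c).setReg rTmp p)) ↔ s.arr aLab p = k := by
    intro k
    simp only [Test.holds, NatExpr.eval, r8, r1]
    rfl
  rw [h1, exec.eq_7, ht]
  by_cases h2 : s.arr aLab p = 2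
  · exact ⟨2, fun x y => by rw [h2], by rw [if_pos h2]⟩
  · rw [if_neg h2, exec.eq_7, ht]
    by_cases h3 : s.arr aLab p = 3
    · exact ⟨3, fun x y => by rw [h3], by rw [if_pos h3]⟩
    · exact ⟨1, fun x y => by simp [merge, h2, h3], by rw [if_neg h3]⟩

/-- The entries of a family of arrays that starts at number `a`. -/
def tableAt (s : State) (a : ℕ) : ℕ → ℕ → ℕ := fun r k => if r < 27 then s.arr (a + r) k else 0

/-- Merge all nodes into their parents. -/
def mergeNodes : Program := forTo rPos rLen mergeBody

/-- Round `k` changes the tables only at the parent of `q k` and the choices only at position `k`,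
as `Tables.step` requires. That all stored choices are below `27` is needed for tracing back through
infeasible entries as well. -/
theorem runs_mergeNodes {n m : ℕ} {s : State} {par lab q : ℕ → ℕ} {c : ℕ → NNReal}
    (hm : s.reg rLen = m) (hpar : s.arr aPar = par) (hlab : s.arr aLab = lab)
    (hq : s.arr aQueue = q) (H : NodeList n m par q)
    (T : Tables n par lab q m 0 c (fun r => s.arr (100 + r)) (fun r => s.warr (100 + r))
      (tableAt s 200) (tableAt s 300)) :
    ∃ s' t, Runs mergeNodes s s' t ∧ t ≤ (mergeBody.bound + 7) * m + 6 ∧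
      Tables n par lab q m m c (fun r => s'.arr (100 + r)) (fun r => s'.warr (100 + r))
        (tableAt s' 200) (tableAt s' 300) ∧
      ∀ k < m, ∀ z < 27, s'.arr (200 + z) k < 27 ∧ s'.arr (300 + z) k < 27 := by
  subst hm
  obtain ⟨wl, wr, wa, -, ww⟩ := mergeBody_writes
  obtain ⟨s', t, hr, ⟨h1, h2⟩, ht⟩ := runs_forTo (j := rPos) (m := rLen) (body := mergeBody)
    (by decide) wl (wr _ (by norm_num) (by norm_num) (by norm_num))
    (wr _ (by norm_num) (by norm_num) (by norm_num))
    (fun k s' => Tables n par lab q (s.reg rLen) k c (fun r => s'.arr (100 + r))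
        (fun r => s'.warr (100 + r)) (tableAt s' 200) (tableAt s' 300) ∧
      ∀ j < k, ∀ z < 27, s'.arr (200 + z) j < 27 ∧ s'.arr (300 + z) j < 27)
    s ⟨T, by simp⟩
    (by
      rintro k s' hk hj hm hA ⟨T, hlt⟩
      have eq : s'.arr aQueue = q := (hA.arr _ (forTo_writesArr (wa _ (by norm_num)))).trans hq
      have ep : s'.arr aPar = par := (hA.arr _ (forTo_writesArr (wa _ (by norm_num)))).trans hpar
      have el : s'.arr aLab = lab := (hA.arr _ (forTo_writesArr (wa _ (by norm_num)))).trans hlab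
      obtain ⟨ℓ, hℓ, he⟩ := exec_mergeBody (s := s') (c := q k) (p := par (q k))
        (by rw [hj, eq]) (by rw [ep])
      rw [el] at hℓ
      obtain ⟨r1, r2, r3, r4⟩ := exec_resetBest ((s'.setReg rLow (q k)).setReg rTmp (par (q k)))
      rw [he]
      generalize exec resetBest ((s'.setReg rLow (q k)).setReg rTmp (par (q k))) = s₁ at r1 r2 r3 r4 ⊢
      have r6 : s₁.reg rLow = q k := by rw [r3 _ (by norm_num)]; simp
      have r8 : s₁.reg rTmp = par (q k) := by rw [r3 _ (by norm_num)]; simp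
      have r5 : s₁.reg rPos = k := by rw [r3 _ (by norm_num)]; simp [hj]
      obtain ⟨m1, m2, m3, m4, m5⟩ := exec_mergeAll ℓ s₁ r4
      generalize exec (mergeAll ℓ) s₁ = s₂ at m1 m2 m3 m4 m5 ⊢
      rw [← m3 _ (by norm_num)] at r6 r8 r5
      have hst := exec_storeBest s₂
      rw [r8, r5] at hst
      have b1 : s₂.arr = s'.arr := m1.trans r1
      have b2 : s₂.warr = s'.warr := m2.trans r2
      rw [b1, b2] at hst
      rw [r1, r2, ← m3 8 (by norm_num), ← m3 6 (by norm_num), r6, r8] at m5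
      generalize exec storeBest s₂ = s₃ at hst ⊢
      simp only [State.setReg_arr, State.setReg_warr]
      refine ⟨?_, ?_⟩
      · refine T.step H hk (fun r j hj => ?_) (fun r j hj => ?_) (fun r hr w hw => ?_)
          (fun r hr w hw => ?_) ⟨fun z hz hf => ?_, fun x hx y hy z hz hp hc => ?_⟩
        · simp only [tableAt, State.setReg_arr]
          split_ifs with hr
          · rw [(hst r hr).2.2.1, Function.update_of_ne (by omega)]
          · rfl
        · simp only [tableAt, State.setReg_arr]
          split_ifs with hr
          · rw [(hst r hr).2.2.2, Function.update_of_ne (by omega)]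
          · rfl
        · rw [(hst r hr).1, Function.update_of_ne hw]
        · rw [(hst r hr).2.1, Function.update_of_ne hw]
        · have hk1 := hst z hz
          simp only [tableAt, State.setReg_arr, if_pos hz, hk1, Function.update_self] at hf ⊢
          have := m5.sound z hz hf
          rwa [hℓ] at this
        · have hk1 := hst z (merge_lt hz)
          simp only [hk1, Function.update_self]
          exact m5.complete x hx y hy z (by rw [hℓ]; exact hz) hp hc
      · intro j hj z hz
        rw [(hst z hz).2.2.1, (hst z hz).2.2.2]
        by_cases hjk : j = k
        · subst hjk
          simpa using m4 z hz
        · rw [Function.update_of_ne hjk, Function.update_of_ne hjk]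
          exact hlt j (by omega) z hz)
  exact ⟨s', t, hr, ht, h1, h2⟩

/-- Select the state `z` for the whole graph if it is feasible and better than the best state found
so far. -/
def selectStep (z : ℕ) : Program :=
  ite (.and (.eq (read (100 + z) (reg rVerts)) (const 1))
      (.not (.and (.eq (reg rTmp) (const 1)) (.wle (.reg 0) (.read (100 + z) (reg rVerts))))))
    (seqList [setReg rTmp (const 1), setWReg 0 (.read (100 + z) (reg rVerts)),
      setArr 2 (reg rVerts) (const z)])
    skip

/-- Select the best state for the whole graph. -/
def selectBest : Program :=
  .seq (setReg rTmp (const 0)) (seqList ((List.range 27).map selectStep))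

/-- Everything is merged into the artificial node `n`, so its column describes the whole graph. The
best state is stored in array `2` at position `n`, outside the range that is read as output, where
the tracing starts. -/
theorem exec_selectBest {s : State} {n : ℕ} (hn : s.reg rVerts = n)
    (hex : ∃ z < 27, s.arr (100 + z) n = 1) :
    (∀ a, a ≠ 2 → (exec selectBest s).arr a = s.arr a) ∧
      (exec selectBest s).warr = s.warr ∧
      (∀ x, x ≠ rTmp → (exec selectBest s).reg x = s.reg x) ∧
      (exec selectBest s).arr 2 n < 27 ∧ s.arr (100 + (exec selectBest s).arr 2 n) n = 1 ∧
      (exec selectBest s).wreg 0 = s.warr (100 + (exec selectBest s).arr 2 n) n ∧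
      ∀ z < 27, s.arr (100 + z) n = 1 → (exec selectBest s).wreg 0 ≤ s.warr (100 + z) n := by
  have := exec_map selectStep
    (fun l s' => (∀ a, a ≠ 2 → s'.arr a = s.arr a) ∧ s'.warr = s.warr ∧
      (∀ x, x ≠ rTmp → s'.reg x = s.reg x) ∧
      (s'.reg rTmp = 1 → s'.arr 2 n < 27 ∧ s.arr (100 + s'.arr 2 n) n = 1 ∧
        s'.wreg 0 = s.warr (100 + s'.arr 2 n) n) ∧
      ∀ z ∈ l, s.arr (100 + z) n = 1 → s'.reg rTmp = 1 ∧ s'.wreg 0 ≤ s.warr (100 + z) n)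
    (List.range 27) (by
      rintro z l s' hz ⟨h1, h2, h3, h4, h5⟩
      have hz := List.mem_range.1 hz
      have e1 : s'.arr (100 + z) = s.arr (100 + z) := h1 _ (by omega)
      have e0 : s'.reg rVerts = n := (h3 _ (by norm_num)).trans hn
      by_cases hc : s.arr (100 + z) n = 1 ∧ ¬ (s'.reg rTmp = 1 ∧ s'.wreg 0 ≤ s.warr (100 + z) n)
      · have he : exec (selectStep z) s' = ((s'.setReg rTmp 1).setWReg 0
            (s.warr (100 + z) n)).setArr 2 n z := by
          simp only [selectStep, exec, Test.holds, NatExpr.eval, WeightExpr.eval, e0, e1, h2,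
            seqList]
          rw [if_pos hc]
          simp [e0, h2]
        rw [he]
        refine ⟨fun a ha => ?_, h2, fun x hx => ?_, fun _ => ?_, fun y hy hf => ?_⟩
        · simp [ha, h1 a ha]
        · simp [hx, h3 x hx]
        · simp [hz, hc.1]
        · refine ⟨by simp, ?_⟩
          simp only [State.setArr_wreg, State.setWReg_wreg, if_true]
          rcases List.mem_append.1 hy with hy | hy
          · obtain ⟨k1, k2⟩ := h5 y hy hf
            have := not_and.1 hc.2 k1
            exact (le_of_lt (not_le.1 this)).trans k2
          · rw [List.mem_singleton.1 hy]
      · have he : exec (selectStep z) s' = s' := by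
          simp only [selectStep, exec, Test.holds, NatExpr.eval, WeightExpr.eval, e0, e1, h2,
            seqList]
          rw [if_neg hc]
        rw [he]
        refine ⟨h1, h2, h3, h4, fun y hy hf => ?_⟩
        rcases List.mem_append.1 hy with hy | hy
        · exact h5 y hy hf
        · rw [List.mem_singleton] at hy
          subst hy
          by_contra hcon
          exact hc ⟨hf, hcon⟩)
    [] (s.setReg rTmp 0) ⟨fun _ _ => rfl, rfl, fun x hx => by simp [hx], by simp, by simp⟩
  rw [List.nil_append] at this
  have e : exec selectBest s = exec (seqList ((List.range 27).map selectStep)) (s.setReg rTmp 0) :=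
    rfl
  rw [← e] at this
  generalize exec selectBest s = s' at this ⊢
  obtain ⟨h1, h2, h3, h4, h5⟩ := this
  obtain ⟨z, hz, hz'⟩ := hex
  obtain ⟨k1, k2, k3⟩ := h4 (h5 z (List.mem_range.2 hz) hz').1
  exact ⟨h1, h2, h3, k1, k2, k3, fun z hz hf => (h5 z (List.mem_range.2 hz) hf).2⟩

/-- Trace back the current entry of the queue if its parent has the state `z`. -/
def traceStep (z : ℕ) : Program :=
  ite (.eq (reg rLab) (const z))
    (seqList [setArr 2 (reg rLow) (read (300 + z) (reg rPos)),
      setArr 2 (reg rTmp) (read (200 + z) (reg rPos))]) skip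

/-- Trace back one entry of the queue. -/
def traceBody : Program := .seq (seqList
  [setReg rPos (pred (reg rPos)), setReg rLow (read aQueue (reg rPos)),
   setReg rTmp (read aPar (reg rLow)), setReg rLab (read 2 (reg rTmp))])
  (seqList ((List.range 27).map traceStep))

/-- Array names are part of the syntax and cannot be computed, so the lookup by the state `r` is
unrolled into `27` tests. The state is first saved in a register, which makes exactly one test
succeed although array `2` is overwritten. -/
theorem exec_traceBody {s : State} {h c p r : ℕ} (hh : s.reg rPos = h + 1)
    (hc : s.arr aQueue h = c) (hp : s.arr aPar c = p) (hr : s.arr 2 p = r) (hr27 : r < 27)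
    (hpc : p ≠ c) :
    (exec traceBody s).reg rPos = h ∧ (∀ a, a ≠ 2 → (exec traceBody s).arr a = s.arr a) ∧
      (exec traceBody s).wreg = s.wreg ∧
      (exec traceBody s).arr 2 p = s.arr (200 + r) h ∧
      (exec traceBody s).arr 2 c = s.arr (300 + r) h ∧
      ∀ w, w ≠ p → w ≠ c → (exec traceBody s).arr 2 w = s.arr 2 w := by
  have he : exec (seqList
      [setReg rPos (pred (reg rPos)), setReg rLow (read aQueue (reg rPos)),
       setReg rTmp (read aPar (reg rLow)), setReg rLab (read 2 (reg rTmp))]) s =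
      (((s.setReg rPos h).setReg rLow c).setReg rTmp p).setReg rLab r := by
    simp [exec, seqList, NatExpr.eval, hh, hc, hp, hr]
  set s₁ := (((s.setReg rPos h).setReg rLow c).setReg rTmp p).setReg rLab r with hs₁
  have := exec_map traceStep
    (fun l s' => s'.reg = s₁.reg ∧ (∀ a, a ≠ 2 → s'.arr a = s.arr a) ∧ s'.wreg = s.wreg ∧
      s'.arr 2 = if r ∈ l then Function.update (Function.update (s.arr 2) c (s.arr (300 + r) h)) p
        (s.arr (200 + r) h) else s.arr 2)
    (List.range 27) (by
      rintro z l s' hz ⟨h1, h2, h3, h4⟩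
      have e5 : s'.reg rPos = h := by rw [h1]; simp [hs₁]
      have e6 : s'.reg rLow = c := by rw [h1]; simp [hs₁]
      have e8 : s'.reg rTmp = p := by rw [h1]; simp [hs₁]
      have e9 : s'.reg rLab = r := by rw [h1]; simp [hs₁]
      by_cases hrz : r = z
      · subst hrz
        have he : exec (traceStep r) s' = (s'.setArr 2 c (s.arr (300 + r) h)).setArr 2 p
            (s.arr (200 + r) h) := by
          have k2 : s'.arr (200 + r) = s.arr (200 + r) := h2 _ (by omega)
          have k3 : s'.arr (300 + r) = s.arr (300 + r) := h2 _ (by omega)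
          simp [traceStep, exec, seqList, Test.holds, NatExpr.eval, e5, e6, e8, e9, k2, k3,
            show 200 + r ≠ 2 by omega]
        rw [he]
        refine ⟨h1, fun a ha => by simp [ha, h2 a ha], h3, ?_⟩
        simp only [State.setArr_arr, if_true, h4, List.mem_append, List.mem_singleton, or_true]
        split_ifs
        · funext w
          simp only [Function.update_apply]
          split_ifs <;> rfl
        · rfl
      · have he : exec (traceStep z) s' = s' := by
          simp [traceStep, exec, Test.holds, NatExpr.eval, e9, hrz]
        rw [he]
        exact ⟨h1, h2, h3, by rw [h4]; simp [hrz]⟩)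
    [] s₁ ⟨rfl, fun _ _ => rfl, rfl, by simp [hs₁]⟩
  rw [List.nil_append] at this
  have e : exec traceBody s = exec (seqList ((List.range 27).map traceStep)) s₁ := by
    rw [traceBody, exec.eq_6, he]
  rw [← e] at this
  generalize exec traceBody s = s' at this ⊢
  obtain ⟨h1, h2, h3, h4⟩ := this
  rw [if_pos (List.mem_range.2 hr27)] at h4
  refine ⟨by rw [h1]; simp [hs₁], h2, h3, by rw [h4]; simp, by rw [h4]; simp [hpc.symm],
    fun w h1 h2 => by rw [h4]; simp [h1, h2]⟩

/-- Trace back the selection from the state of the whole graph. -/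
def traceBack : Program :=
  .seq (setReg rPos (reg rLen)) (loop (.lt (const 0) (reg rPos)) traceBody)

theorem traceBody_loopFree : traceBody.loopFree = true := by
  have : (seqList ((List.range 27).map traceStep)).loopFree = true :=
    seqList_loopFree fun P hP => by
      obtain ⟨x, -, rfl⟩ := List.mem_map.1 hP
      rfl
  simp [traceBody, seqList, loopFree, this]

/-- Going backwards through the queue, the union over the active nodes of the selections described
by their current states is invariant. At the end every leaf is active and carries state `1` iff it
is selected, so array `2` has become the output. -/
theorem runs_traceBack {n m : ℕ} {s : State} {par q : ℕ → ℕ} (hm : s.reg rLen = m)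
    (hpar : s.arr aPar = par) (hq : s.arr aQueue = q) (H : NodeList n m par q)
    (hch : ∀ k < m, ∀ z < 27, s.arr (200 + z) k < 27 ∧ s.arr (300 + z) k < 27)
    (hst : s.arr 2 n < 27) :
    ∃ s' t, Runs traceBack s s' t ∧ t ≤ (traceBody.bound + 4) * m + 10 ∧ s'.wreg = s.wreg ∧
      ∀ v, (v < n ∧ s'.arr 2 v = 1) ↔
        v ∈ choiceSet n par q (tableAt s 200) (tableAt s 300) m (s.arr 2 n) n := by
  have hlf := traceBody_loopFree
  obtain ⟨h, s', t, hr, ⟨h1, h2, h3, h4, h5, h6⟩, hnb, ht⟩ := runs_loop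
    (b := .lt (const 0) (reg rPos)) (P := traceBody)
    (fun (h : ℕ) s' => s'.reg rPos = h ∧ h ≤ m ∧ (∀ a, a ≠ 2 → s'.arr a = s.arr a) ∧
      s'.wreg = s.wreg ∧ (∀ w, IsActive n m q h w → s'.arr 2 w < 27) ∧
      ∀ v, (∃ w, IsActive n m q h w ∧
          v ∈ choiceSet n par q (tableAt s 200) (tableAt s 300) h (s'.arr 2 w) w) ↔
        v ∈ choiceSet n par q (tableAt s 200) (tableAt s 300) m (s.arr 2 n) n)
    (fun h _ => (traceBody.bound + 4) * h)
    (by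
      rintro h s' ⟨h1, h2, h3, h4, h5, h6⟩ hb
      simp only [Test.holds, NatExpr.eval, h1] at hb
      obtain ⟨h, rfl⟩ : ∃ k, h = k + 1 := ⟨h - 1, by omega⟩
      have hlt : h < m := h2
      obtain ⟨t, hr, ht⟩ := runs_exec hlf s'
      have ep : s'.arr aPar = par := (h3 _ (by norm_num)).trans hpar
      have eq : s'.arr aQueue = q := (h3 _ (by norm_num)).trans hq
      have hr27 := h5 _ (H.active_parent hlt)
      obtain ⟨k1, k2, k3, k4, k5, k6⟩ := exec_traceBody (s := s') (h := h) (c := q h)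
        (p := par (q h)) (r := s'.arr 2 (par (q h))) h1 (by rw [eq]) (by rw [ep]) rfl hr27
        (H.par_ne hlt)
      rw [h3 _ (by omega)] at k4 k5
      obtain ⟨c1, c2⟩ := hch h hlt _ hr27
      refine ⟨h, _, t, hr, ⟨k1, hlt.le, fun a ha => (k2 a ha).trans (h3 a ha), k3.trans h4,
        fun w hw => ?_, fun v => ?_⟩, ?_⟩
      · by_cases hwp : w = par (q h)
        · rw [hwp, k4]; exact c1
        · by_cases hwq : w = q h
          · rw [hwq, k5]; exact c2
          · rw [k6 w hwp hwq]
            exact h5 w (((H.active_iff hlt w).1 hw).resolve_left hwq)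
      · rw [← h6 v]
        exact mem_choiceSet_step H hlt (by rw [k4, tableAt, if_pos hr27])
          (by rw [k5, tableAt, if_pos hr27]) k6 v
      · simp only [Test.cost, NatExpr.cost]
        rw [Nat.mul_succ]
        omega)
    m (s.setReg rPos m) ⟨by simp, le_rfl, fun _ _ => rfl, rfl, fun w hw => by
        rcases hw with rfl | ⟨j, h1, h2, -⟩
        · exact hst
        · omega, fun v => by
        constructor
        · rintro ⟨w, rfl | ⟨j, h1, h2, -⟩, hv⟩
          · exact hv
          · omega
        · exact fun hv => ⟨n, .inl rfl, hv⟩⟩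
  have h0 : h = 0 := by simp only [Test.holds, NatExpr.eval, h1] at hnb; omega
  subst h0
  refine ⟨s', _, .seq (.setReg _ _ _) (by simpa [NatExpr.eval, hm] using hr), ?_, h4, fun v => ?_⟩
  · simp only [Test.cost, NatExpr.cost] at ht ⊢
    omega
  · rw [← h6 v, mem_choiceSet_zero H]

/-- The dynamic program. -/
def solve : Program := seqList [initTables, mergeNodes, selectBest, traceBack]

theorem selectBest_loopFree : selectBest.loopFree = true := by
  have : (seqList ((List.range 27).map selectStep)).loopFree = true :=
    seqList_loopFree fun P hP => by
      obtain ⟨x, -, rfl⟩ := List.mem_map.1 hP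
      rfl
  simp [selectBest, loopFree, this]

/-- Soundness of the tables makes the traced selection feasible with the computed weight;
completeness bounds that weight by the one of every feasible selection. The labels are arbitrary
here, and the graph enters only through `selState`. -/
theorem runs_solve {n m : ℕ} {s : State} {par lab q : ℕ → ℕ} (hn : s.reg rVerts = n)
    (hm : s.reg rLen = m) (hpar : s.arr aPar = par) (hlab : s.arr aLab = lab)
    (hq : s.arr aQueue = q) (H : NodeList n m par q) (hf : ∀ r < 27, s.arr (100 + r) = 0)
    (hw : ∀ r < 27, s.warr (100 + r) = 0)
    (hex : ∃ R r, selState n par lab q m n R = some r) :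
    ∃ s' t, Runs solve s s' t ∧
      t ≤ (mergeBody.bound + traceBody.bound + 100) * m + selectBest.bound + 100 ∧
      (∃ r, selState n par lab q m n {v ∈ Finset.range n | s'.arr 2 v = 1} = some r) ∧
      s'.wreg 0 = ∑ v ∈ Finset.range n with s'.arr 2 v = 1, s.warr 0 v ∧
      ∀ R r, selState n par lab q m n R = some r →
        s'.wreg 0 ≤ ∑ v ∈ below n par q m n with v ∈ R, s.warr 0 v := by
  subst hpar hlab hq
  obtain ⟨wl, wr, wa, -, ww⟩ := mergeBody_writes
  have key : ∀ chA chB, ∃ s₁ t₁, Runs initTables s s₁ t₁ ∧ t₁ ≤ 50 * m + 50 ∧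
      Tables n (s.arr aPar) (s.arr aLab) (s.arr aQueue) m 0 (s.warr 0) (fun r => s₁.arr (100 + r))
        (fun r => s₁.warr (100 + r)) chA chB := fun chA chB =>
    runs_initTables hn hm H hf hw (s.arr aLab) chA chB
  obtain ⟨s₁, t₁, hr₁, ht₁, T₁⟩ := key (tableAt s 200) (tableAt s 300)
  have A₁ := hr₁.agree
  have e2 : tableAt s₁ 200 = tableAt s 200 := by
    funext r k
    simp only [tableAt]
    split_ifs with hr
    · rw [A₁.arr]
      simp [initTables, initTableBody, seqList, forTo, writesArr]; omega
    · rfl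
  have e3 : tableAt s₁ 300 = tableAt s 300 := by
    funext r k
    simp only [tableAt]
    split_ifs with hr
    · rw [A₁.arr]
      simp [initTables, initTableBody, seqList, forTo, writesArr]; omega
    · rfl
  rw [← e2, ← e3] at T₁
  obtain ⟨s₂, t₂, hr₂, ht₂, T₂, hch⟩ := runs_mergeNodes (s := s₁) (n := n) (m := m)
    ((A₁.reg _ rfl).trans hm) (A₁.arr _ rfl) (A₁.arr _ rfl) (A₁.arr _ rfl) H T₁
  have A₂ := hr₂.agree
  have n₂ : s₂.reg rVerts = n := by
    rw [A₂.reg _ (forTo_writesReg (by norm_num) (wr _ (by norm_num) (by norm_num) (by norm_num))),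
      A₁.reg _ rfl, hn]
  have m₂ : s₂.reg rLen = m := by
    rw [A₂.reg _ (forTo_writesReg (by norm_num) (wr _ (by norm_num) (by norm_num) (by norm_num))),
      A₁.reg _ rfl, hm]
  have arr₂ : ∀ a < 100, s₂.arr a = s₁.arr a := fun a ha => A₂.arr a (forTo_writesArr (wa a ha))
  have hact : IsActive n m (s.arr aQueue) 0 n := .inl rfl
  obtain ⟨R, r, hR⟩ := hex
  have hfeas : ∃ z < 27, s₂.arr (100 + z) n = 1 :=
    ⟨r, selState_lt hR, (T₂.complete n hact R r hR).1⟩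
  obtain ⟨b1, b2, b3, b4, b5, b6, b7⟩ := exec_selectBest n₂ hfeas
  obtain ⟨t₃, hr₃, ht₃⟩ := runs_exec selectBest_loopFree s₂
  generalize exec selectBest s₂ = s₃ at b1 b2 b3 b4 b5 b6 b7 hr₃
  obtain ⟨s₄, t₄, hr₄, ht₄, w₄, hv⟩ := runs_traceBack (s := s₃) (n := n) (m := m)
    ((b3 _ (by norm_num)).trans m₂)
    ((b1 _ (by norm_num)).trans ((arr₂ _ (by norm_num)).trans (A₁.arr _ rfl)))
    ((b1 _ (by norm_num)).trans ((arr₂ _ (by norm_num)).trans (A₁.arr _ rfl))) H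
    (fun k hk z hz => by rw [b1 _ (by omega), b1 _ (by omega)]; exact hch k hk z hz) b4
  have e2' : tableAt s₃ 200 = tableAt s₂ 200 := by
    funext r k; simp only [tableAt]; rw [b1 _ (by omega)]
  have e3' : tableAt s₃ 300 = tableAt s₂ 300 := by
    funext r k; simp only [tableAt]; rw [b1 _ (by omega)]
  rw [e2', e3'] at hv
  obtain ⟨c1, c2, c3⟩ := T₂.sound n hact _ b4 b5
  have hset : {v ∈ Finset.range n | s₄.arr 2 v = 1} = choiceSet n (s.arr aPar) (s.arr aQueue)
      (tableAt s₂ 200) (tableAt s₂ 300) m (s₃.arr 2 n) n := by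
    ext v
    rw [Finset.mem_filter, Finset.mem_range, hv]
  refine ⟨s₄, _, .seq hr₁ (.seq hr₂ (.seq hr₃ (.seq hr₄ (.skip _)))), ?_, ⟨s₃.arr 2 n, ?_⟩, ?_,
    fun R' r' hR' => ?_⟩
  · have e1 : (mergeBody.bound + traceBody.bound + 100) * m = mergeBody.bound * m +
      traceBody.bound * m + 100 * m := by ring
    rw [add_mul] at ht₂ ht₄
    omega
  · rw [hset]; exact c1
  · rw [hset, w₄, b6]; exact c3
  · obtain ⟨d1, d2⟩ := T₂.complete n hact R' r' hR'
    rw [w₄]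
    exact (b7 r' (selState_lt hR') d1).trans d2

end RAM


/-! ## The meaning of the states -/

section States

open Classical in
/-- The number of selected vertices of `W` with the property `p`. -/
noncomputable def selCount (W R : Finset ℕ) (p : ℕ → Prop) : ℕ :=
  (W.filter fun w => w ∈ R ∧ p w).card

open Classical in
theorem selCount_union {W₁ W₂ : Finset ℕ} (h : Disjoint W₁ W₂) (R : Finset ℕ) (p : ℕ → Prop) :
    selCount (W₁ ∪ W₂) R p = selCount W₁ R p + selCount W₂ R p := by
  unfold selCount
  rw [Finset.filter_union, Finset.card_union_of_disjoint (Finset.disjoint_filter_filter h)]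

open Classical in
theorem selCount_congr {W R : Finset ℕ} {p p' : ℕ → Prop} (h : ∀ w ∈ W, (p w ↔ p' w)) :
    selCount W R p = selCount W R p' := by
  unfold selCount
  congr 1
  exact Finset.filter_congr fun w hw => by rw [h w hw]

open Classical in
theorem selCount_eq_zero {W R : Finset ℕ} {p : ℕ → Prop} (h : ∀ w ∈ W, ¬ p w) :
    selCount W R p = 0 := by
  unfold selCount
  rw [Finset.card_eq_zero, Finset.filter_eq_empty_iff]
  exact fun w hw h' => h w hw h'.2

/-- The minimum over `u ∈ W` of the number of selected vertices of `W` in relation to `u`, capped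
at `2`. -/
noncomputable def minCount (P : ℕ → ℕ → Prop) (W R : Finset ℕ) : ℕ :=
  W.fold min 2 fun u => selCount W R (P u)

theorem minCount_le_two (P : ℕ → ℕ → Prop) (W R : Finset ℕ) : minCount P W R ≤ 2 :=
  ((Finset.le_fold_min _).1 le_rfl).1

theorem minCount_le (P : ℕ → ℕ → Prop) {W : Finset ℕ} (R : Finset ℕ) {u : ℕ} (hu : u ∈ W) :
    minCount P W R ≤ selCount W R (P u) :=
  ((Finset.le_fold_min _).1 le_rfl).2 u hu

theorem minCount_attained (P : ℕ → ℕ → Prop) (W R : Finset ℕ) :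
    minCount P W R = 2 ∨ ∃ u ∈ W, selCount W R (P u) = minCount P W R := by
  rcases (Finset.fold_min_le (minCount P W R)).1 (le_refl (minCount P W R)) with h | ⟨u, hu, h⟩
  · exact .inl (le_antisymm (minCount_le_two P W R) h)
  · exact .inr ⟨u, hu, le_antisymm h (minCount_le P R hu)⟩

theorem minCount_eq {P : ℕ → ℕ → Prop} {W R : Finset ℕ} {k : ℕ} (h2 : k ≤ 2)
    (hle : ∀ u ∈ W, k ≤ selCount W R (P u)) (hk : k = 2 ∨ ∃ u ∈ W, selCount W R (P u) = k) :
    minCount P W R = k := by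
  refine le_antisymm ?_ ((Finset.le_fold_min _).2 ⟨h2, hle⟩)
  rcases hk with rfl | ⟨u, hu, rfl⟩
  · exact minCount_le_two P W R
  · exact minCount_le P R hu

theorem minCount_empty (P : ℕ → ℕ → Prop) (R : Finset ℕ) : minCount P ∅ R = 2 := rfl

/-- Nothing on the other side is counted, so the counts are those of the two sides. -/
theorem minCount_union_of_not {P : ℕ → ℕ → Prop} {W₁ W₂ : Finset ℕ} (h : Disjoint W₁ W₂)
    (R : Finset ℕ) (h₁ : ∀ u ∈ W₁, ∀ w ∈ W₂, ¬ P u w) (h₂ : ∀ u ∈ W₂, ∀ w ∈ W₁, ¬ P u w) :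
    minCount P (W₁ ∪ W₂) R = min (minCount P W₁ R) (minCount P W₂ R) := by
  have e₁ : ∀ u ∈ W₁, selCount (W₁ ∪ W₂) R (P u) = selCount W₁ R (P u) := fun u hu => by
    rw [selCount_union h, selCount_eq_zero (h₁ u hu), add_zero]
  have e₂ : ∀ u ∈ W₂, selCount (W₁ ∪ W₂) R (P u) = selCount W₂ R (P u) := fun u hu => by
    rw [selCount_union h, selCount_eq_zero (h₂ u hu), zero_add]
  refine minCount_eq ((min_le_left _ _).trans (minCount_le_two P W₁ R)) (fun u hu => ?_) ?_
  · rcases Finset.mem_union.1 hu with hu | hu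
    · rw [e₁ u hu]; exact (min_le_left _ _).trans (minCount_le P R hu)
    · rw [e₂ u hu]; exact (min_le_right _ _).trans (minCount_le P R hu)
  · rcases le_total (minCount P W₁ R) (minCount P W₂ R) with hle | hle
    · rw [min_eq_left hle]
      exact (minCount_attained P W₁ R).imp id fun ⟨u, hu, hu'⟩ =>
        ⟨u, Finset.mem_union_left _ hu, by rw [e₁ u hu, hu']⟩
    · rw [min_eq_right hle]
      exact (minCount_attained P W₂ R).imp id fun ⟨u, hu, hu'⟩ =>
        ⟨u, Finset.mem_union_right _ hu, by rw [e₂ u hu, hu']⟩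

/-- The number of selected vertices of `W`, capped at `2`. -/
noncomputable def sizeCount (W R : Finset ℕ) : ℕ := min 2 (selCount W R fun _ => True)

/-- Every vertex additionally counts all selected vertices of the other side. Capping the summands
at `2` beforehand does not affect a sum that is itself capped at `2`. -/
theorem minCount_union_of {P : ℕ → ℕ → Prop} {W₁ W₂ : Finset ℕ} (h : Disjoint W₁ W₂)
    (R : Finset ℕ) (h₁ : ∀ u ∈ W₁, ∀ w ∈ W₂, P u w) (h₂ : ∀ u ∈ W₂, ∀ w ∈ W₁, P u w) :
    minCount P (W₁ ∪ W₂) R = min 2 (min (minCount P W₁ R + sizeCount W₂ R)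
      (minCount P W₂ R + sizeCount W₁ R)) := by
  have e₁ : ∀ u ∈ W₁, selCount (W₁ ∪ W₂) R (P u) =
      selCount W₁ R (P u) + selCount W₂ R fun _ => True := fun u hu => by
    rw [selCount_union h, selCount_congr (W := W₂) fun w hw => iff_true_intro (h₁ u hu w hw)]
  have e₂ : ∀ u ∈ W₂, selCount (W₁ ∪ W₂) R (P u) =
      selCount W₂ R (P u) + selCount W₁ R fun _ => True := fun u hu => by
    rw [selCount_union h, selCount_congr (W := W₁) fun w hw => iff_true_intro (h₂ u hu w hw),
      add_comm]
  unfold sizeCount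
  have a₁ := minCount_attained P W₁ R
  have a₂ := minCount_attained P W₂ R
  refine minCount_eq (min_le_left _ _) (fun u hu => ?_) ?_
  · rcases Finset.mem_union.1 hu with hu | hu
    · have := minCount_le P R hu
      rw [e₁ u hu]; omega
    · have := minCount_le P R hu
      rw [e₂ u hu]; omega
  · by_contra hcon
    rw [not_or] at hcon
    obtain ⟨k1, k2⟩ := hcon
    push Not at k2
    rcases le_total (minCount P W₁ R + min 2 (selCount W₂ R fun _ => True))
        (minCount P W₂ R + min 2 (selCount W₁ R fun _ => True)) with hle | hle
    · obtain ⟨u, hu, hu'⟩ := a₁.resolve_left (by omega)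
      refine k2 u (Finset.mem_union_left _ hu) ?_
      rw [e₁ u hu]; omega
    · obtain ⟨u, hu, hu'⟩ := a₂.resolve_left (by omega)
      refine k2 u (Finset.mem_union_right _ hu) ?_
      rw [e₂ u hu]; omega

theorem sizeCount_union {W₁ W₂ : Finset ℕ} (h : Disjoint W₁ W₂) (R : Finset ℕ) :
    sizeCount (W₁ ∪ W₂) R = min 2 (sizeCount W₁ R + sizeCount W₂ R) := by
  unfold sizeCount
  rw [selCount_union h]
  omega

/-- All pairs of vertices of `W` are resolved, in the sense of `Q`, by two selected vertices. -/
def ResolvedTwice (Q : ℕ → ℕ → ℕ → Prop) (W R : Finset ℕ) : Prop :=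
  ∀ u ∈ W, ∀ v ∈ W, u ≠ v → 2 ≤ selCount W R (Q u v)

/-- Pairs on one side are resolved from that side only. For a pair `u`, `v` across the sides the
count is a term in `u` plus a term in `v`; these vary independently, so all such pairs are fine iff
the sum of the two minima is at least `2`, and capped minima decide this. Series nodes, parallel
nodes and the parallel root are the instances with different `P`. -/
theorem resolvedTwice_union {Q : ℕ → ℕ → ℕ → Prop} {P : ℕ → ℕ → Prop} {W₁ W₂ : Finset ℕ}
    (h : Disjoint W₁ W₂) (R : Finset ℕ) (hsymm : ∀ u v w, Q u v w ↔ Q v u w)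
    (h₁ : ∀ u ∈ W₁, ∀ v ∈ W₁, ∀ w ∈ W₂, ¬ Q u v w) (h₂ : ∀ u ∈ W₂, ∀ v ∈ W₂, ∀ w ∈ W₁, ¬ Q u v w)
    (h₃ : ∀ u ∈ W₁, ∀ v ∈ W₂, ∀ w ∈ W₁, (Q u v w ↔ P u w))
    (h₄ : ∀ u ∈ W₁, ∀ v ∈ W₂, ∀ w ∈ W₂, (Q u v w ↔ P v w)) :
    ResolvedTwice Q (W₁ ∪ W₂) R ↔ ResolvedTwice Q W₁ R ∧ ResolvedTwice Q W₂ R ∧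
      2 ≤ minCount P W₁ R + minCount P W₂ R := by
  have e₁ : ∀ u ∈ W₁, ∀ v ∈ W₁, selCount (W₁ ∪ W₂) R (Q u v) = selCount W₁ R (Q u v) :=
    fun u hu v hv => by rw [selCount_union h, selCount_eq_zero (h₁ u hu v hv), add_zero]
  have e₂ : ∀ u ∈ W₂, ∀ v ∈ W₂, selCount (W₁ ∪ W₂) R (Q u v) = selCount W₂ R (Q u v) :=
    fun u hu v hv => by rw [selCount_union h, selCount_eq_zero (h₂ u hu v hv), zero_add]
  have e₃ : ∀ u ∈ W₁, ∀ v ∈ W₂, selCount (W₁ ∪ W₂) R (Q u v) =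
      selCount W₁ R (P u) + selCount W₂ R (P v) := fun u hu v hv => by
    rw [selCount_union h, selCount_congr (h₃ u hu v hv), selCount_congr (h₄ u hu v hv)]
  constructor
  · intro H
    refine ⟨fun u hu v hv huv => ?_, fun u hu v hv huv => ?_, ?_⟩
    · rw [← e₁ u hu v hv]
      exact H u (Finset.mem_union_left _ hu) v (Finset.mem_union_left _ hv) huv
    · rw [← e₂ u hu v hv]
      exact H u (Finset.mem_union_right _ hu) v (Finset.mem_union_right _ hv) huv
    · rcases minCount_attained P W₁ R with a₁ | ⟨u, hu, hu'⟩
      · omega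
      · rcases minCount_attained P W₂ R with a₂ | ⟨v, hv, hv'⟩
        · omega
        · have := H u (Finset.mem_union_left _ hu) v (Finset.mem_union_right _ hv)
            fun huv => Finset.disjoint_left.1 h hu (huv ▸ hv)
          rwa [e₃ u hu v hv, hu', hv'] at this
  · rintro ⟨H₁, H₂, H₃⟩ u hu v hv huv
    have key : ∀ u ∈ W₁, ∀ v ∈ W₂, 2 ≤ selCount (W₁ ∪ W₂) R (Q u v) := fun u hu v hv => by
      have := minCount_le P R hu
      have := minCount_le P R hv
      rw [e₃ u hu v hv]; omega
    rcases Finset.mem_union.1 hu with hu | hu <;> rcases Finset.mem_union.1 hv with hv | hv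
    · rw [e₁ u hu v hv]; exact H₁ u hu v hv huv
    · exact key u hu v hv
    · rw [selCount_congr fun w _ => hsymm u v w]; exact key v hv u hu
    · rw [e₂ u hu v hv]; exact H₂ u hu v hv huv

/-- The vertex `w` resolves `u` and `v` if the distances are determined by equality, adjacency `A`
and the relation `B` of lying in the same component. -/
def Resolves (A B : ℕ → ℕ → Prop) (u v w : ℕ) : Prop :=
  w = u ∨ w = v ∨ ¬ (A u w ↔ A v w) ∨ ¬ (B u w ↔ B v w)

theorem resolves_symm (A B : ℕ → ℕ → Prop) (u v w : ℕ) :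
    Resolves A B u v w ↔ Resolves A B v u w := by
  unfold Resolves; tauto

/-- Everything lies in the same component. -/
def Everywhere (_ _ : ℕ) : Prop := True

/-- The closed neighbourhood relation. -/
def ClosedAdj (A : ℕ → ℕ → Prop) (u w : ℕ) : Prop := w = u ∨ A u w

/-- The complement of adjacency. -/
def NonAdj (A : ℕ → ℕ → Prop) (u w : ℕ) : Prop := ¬ A u w

open Classical in
/-- The state of the selection `R` at a node with the leaves `W`, if all pairs of vertices in `W`
are resolved twice. -/
noncomputable def localState (A : ℕ → ℕ → Prop) (W R : Finset ℕ) : Option ℕ :=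
  if ResolvedTwice (Resolves A Everywhere) W R then
    some (encode (minCount (ClosedAdj A) W R) (minCount (NonAdj A) W R) (sizeCount W R))
  else none

open Classical in
/-- The state of the selection `R` at a parallel root, whose children merged so far have the leaves
`W`. -/
noncomputable def topState (A B : ℕ → ℕ → Prop) (W R : Finset ℕ) : Option ℕ :=
  if ResolvedTwice (Resolves A B) W R then some (encode (minCount B W R) 2 0) else none

variable {A B : ℕ → ℕ → Prop}

theorem localState_empty (R : Finset ℕ) : localState A ∅ R = some 11 := by
  rw [localState, if_pos (by simp [ResolvedTwice])]
  simp [minCount_empty, sizeCount, selCount, encode]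

theorem topState_empty (R : Finset ℕ) : topState A B ∅ R = some 11 := by
  rw [topState, if_pos (by simp [ResolvedTwice])]
  simp [minCount_empty, encode]

/-- A single vertex is in its own closed neighbourhood and is no neighbour of itself, so all three
counts are `1` or all are `0`; these triples have the codes `1` and `0`. -/
theorem localState_singleton (hirr : ∀ a, ¬ A a a) (v : ℕ) (R : Finset ℕ) :
    localState A {v} R = some (if v ∈ R then 1 else 0) := by
  have hcnt : ∀ P : ℕ → ℕ → Prop, P v v → minCount P {v} R = if v ∈ R then 1 else 0 := by
    intro P hP
    have : selCount {v} R (P v) = if v ∈ R then 1 else 0 := by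
      unfold selCount
      split_ifs with h
      · rw [Finset.card_eq_one]
        exact ⟨v, by ext w; simp; rintro rfl; exact ⟨h, hP⟩⟩
      · rw [Finset.card_eq_zero]
        ext w; simp; rintro rfl h'; exact absurd h' h
    refine minCount_eq (by split_ifs <;> norm_num) (fun u hu => ?_) (.inr ⟨v, by simp, this⟩)
    rw [Finset.mem_singleton.1 hu, this]
  have hs : sizeCount {v} R = if v ∈ R then 1 else 0 := by
    have := hcnt (fun _ _ => True) trivial
    unfold sizeCount
    have h2 : selCount {v} R (fun _ => True) = if v ∈ R then 1 else 0 := by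
      unfold selCount
      split_ifs with h
      · rw [Finset.card_eq_one]
        exact ⟨v, by ext w; simp; rintro rfl; exact h⟩
      · rw [Finset.card_eq_zero]
        ext w; simp; rintro rfl h'; exact absurd h' h
    rw [h2]; split_ifs <;> rfl
  rw [localState, if_pos, hcnt _ (.inl rfl), hcnt _ (hirr v), hs]
  · split_ifs <;> rfl
  · intro u hu w hw huw
    rw [Finset.mem_singleton] at hu hw
    exact absurd (hu.trans hw.symm) huw

/-- At a series node `v ∈ W₂` is adjacent to all of `W₁`, so `w ∈ W₁` resolves `u` and `v` iff it is
not adjacent to `u`, where `w = u` is included by irreflexivity. At a parallel node `v` is adjacent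
to nothing in `W₁`, so `w` must be in the closed neighbourhood of `u`. The relation of the resolving
condition ignores the other side in the minimum, whereas the complementary kind of count gains all
its selected vertices. -/
theorem localState_union {W₁ W₂ : Finset ℕ} (h : Disjoint W₁ W₂) (R : Finset ℕ)
    (hsymm : ∀ a b, A a b → A b a) (hirr : ∀ a, ¬ A a a) {ℓ : ℕ} (hℓ : ℓ ≠ 3)
    (hA : ∀ y ∈ W₁, ∀ y' ∈ W₂, (A y y' ↔ ℓ = 2)) :
    ((localState A W₁ R).bind fun x => (localState A W₂ R).bind fun y => merge ℓ x y) =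
      localState A (W₁ ∪ W₂) R := by
  have hA' : ∀ y ∈ W₂, ∀ y' ∈ W₁, (A y y' ↔ ℓ = 2) := fun y hy y' hy' =>
    ⟨fun h => (hA y' hy' y hy).1 (hsymm _ _ h), fun h => hsymm _ _ ((hA y' hy' y hy).2 h)⟩
  have hne : ∀ y ∈ W₁, ∀ y' ∈ W₂, y ≠ y' := fun y hy y' hy' h' =>
    Finset.disjoint_left.1 h hy (h' ▸ hy')
  have s₁ : sizeCount W₁ R ≤ 2 := min_le_left _ _
  have s₂ : sizeCount W₂ R ≤ 2 := min_le_left _ _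
  have c₁ := minCount_le_two (ClosedAdj A) W₁ R
  have c₂ := minCount_le_two (ClosedAdj A) W₂ R
  have n₁ := minCount_le_two (NonAdj A) W₁ R
  have n₂ := minCount_le_two (NonAdj A) W₂ R
  have hs := sizeCount_union h R
  by_cases h2 : ℓ = 2
  · have hok := resolvedTwice_union (Q := Resolves A Everywhere) (P := NonAdj A) h R
      (resolves_symm A _) ?_ ?_ ?_ ?_
    · have k1 := minCount_union_of (P := ClosedAdj A) h R (fun u hu w hw => .inr ((hA u hu w hw).2 h2))
        (fun u hu w hw => .inr ((hA' u hu w hw).2 h2))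
      have k2 := minCount_union_of_not (P := NonAdj A) h R (fun u hu w hw => not_not.2 ((hA u hu w hw).2 h2))
        (fun u hu w hw => not_not.2 ((hA' u hu w hw).2 h2))
      unfold localState
      by_cases o₁ : ResolvedTwice (Resolves A Everywhere) W₁ R
      · by_cases o₂ : ResolvedTwice (Resolves A Everywhere) W₂ R
        · rw [if_pos o₁, if_pos o₂]
          simp only [Option.bind_some, merge, h2, if_true, codeA_encode c₁, codeA_encode c₂,
            codeB_encode c₁ n₁, codeB_encode c₂ n₂, codeS_encode c₁ s₁, codeS_encode c₂ s₂, k1, k2,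
            hs, hok, o₁, o₂, true_and]
        · rw [if_pos o₁, if_neg o₂, if_neg (fun H => o₂ (hok.1 H).2.1)]; rfl
      · rw [if_neg o₁, if_neg (fun H => o₁ (hok.1 H).1)]; rfl
    · intro u hu v hv w hw
      have := hne u hu w hw
      have := hne v hv w hw
      simp only [Resolves, Everywhere, hA u hu w hw, hA v hv w hw]
      tauto
    · intro u hu v hv w hw
      have := hne w hw u hu
      have := hne w hw v hv
      simp only [Resolves, Everywhere, hA' u hu w hw, hA' v hv w hw]
      tauto
    · intro u hu v hv w hw
      have := hne w hw v hv
      have hu' : w = u → ¬ A u w := by rintro rfl; exact hirr w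
      simp only [Resolves, Everywhere, hA' v hv w hw, NonAdj]
      tauto
    · intro u hu v hv w hw
      have := hne u hu w hw
      have hu' : w = v → ¬ A v w := by rintro rfl; exact hirr w
      simp only [Resolves, Everywhere, hA u hu w hw, NonAdj]
      tauto
  · have hok := resolvedTwice_union (Q := Resolves A Everywhere) (P := ClosedAdj A) h R
      (resolves_symm A _) ?_ ?_ ?_ ?_
    · have k1 := minCount_union_of_not (P := ClosedAdj A) h R
        (fun u hu w hw => by
          have := hne u hu w hw
          have := hA u hu w hw
          simp only [ClosedAdj]; tauto)
        (fun u hu w hw => by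
          have := hne w hw u hu
          have := hA' u hu w hw
          simp only [ClosedAdj]; tauto)
      have k2 := minCount_union_of (P := NonAdj A) h R (fun u hu w hw h' => h2 ((hA u hu w hw).1 h'))
        (fun u hu w hw h' => h2 ((hA' u hu w hw).1 h'))
      unfold localState
      by_cases o₁ : ResolvedTwice (Resolves A Everywhere) W₁ R
      · by_cases o₂ : ResolvedTwice (Resolves A Everywhere) W₂ R
        · rw [if_pos o₁, if_pos o₂]
          simp only [Option.bind_some, merge, h2, hℓ, if_false, codeA_encode c₁, codeA_encode c₂,
            codeB_encode c₁ n₁, codeB_encode c₂ n₂, codeS_encode c₁ s₁, codeS_encode c₂ s₂, k1, k2,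
            hs, hok, o₁, o₂, true_and]
        · rw [if_pos o₁, if_neg o₂, if_neg (fun H => o₂ (hok.1 H).2.1)]; rfl
      · rw [if_neg o₁, if_neg (fun H => o₁ (hok.1 H).1)]; rfl
    · intro u hu v hv w hw
      have := hne u hu w hw
      have := hne v hv w hw
      simp only [Resolves, Everywhere, hA u hu w hw, hA v hv w hw]
      tauto
    · intro u hu v hv w hw
      have := hne w hw u hu
      have := hne w hw v hv
      simp only [Resolves, Everywhere, hA' u hu w hw, hA' v hv w hw]
      tauto
    · intro u hu v hv w hw
      have := hne w hw v hv
      simp only [Resolves, Everywhere, hA' v hv w hw, ClosedAdj]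
      tauto
    · intro u hu v hv w hw
      have := hne u hu w hw
      simp only [Resolves, Everywhere, hA u hu w hw, ClosedAdj]
      tauto

/-- At a parallel root every vertex of the component of `u` has finite distance to `u` and infinite
distance to a vertex of another component. So the number that matters for a component is its number
of selected vertices. The first slot of the state holds the least such number over the components
merged so far, and the other slots hold constants. -/
theorem topState_union {W₁ W₂ : Finset ℕ} (h : Disjoint W₁ W₂) (hW₂ : W₂.Nonempty) (R : Finset ℕ)
    (hsymm : ∀ a b, A a b → A b a)
    (hA : ∀ y ∈ W₁, ∀ y' ∈ W₂, ¬ A y y') (hB : ∀ y ∈ W₁, ∀ y' ∈ W₂, ¬ B y y' ∧ ¬ B y' y)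
    (hB₂ : ∀ y ∈ W₂, ∀ y' ∈ W₂, B y y') (hB₁ : ∀ y ∈ W₁, B y y)
    (hAB : ∀ y ∈ W₁, ∀ y' ∈ W₁, A y y' → B y y') :
    ((topState A B W₁ R).bind fun x => (localState A W₂ R).bind fun y => merge 3 x y) =
      topState A B (W₁ ∪ W₂) R := by
  have hA' : ∀ y ∈ W₂, ∀ y' ∈ W₁, ¬ A y y' := fun y hy y' hy' h => hA y' hy' y hy (hsymm _ _ h)
  have hne : ∀ y ∈ W₁, ∀ y' ∈ W₂, y ≠ y' := fun y hy y' hy' h' =>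
    Finset.disjoint_left.1 h hy (h' ▸ hy')
  have s₂ : sizeCount W₂ R ≤ 2 := min_le_left _ _
  have c₂ := minCount_le_two (ClosedAdj A) W₂ R
  have b₁ := minCount_le_two B W₁ R
  have k1 := minCount_union_of_not (P := B) h R (fun u hu w hw => (hB u hu w hw).1)
    (fun u hu w hw => (hB w hw u hu).2)
  -- All vertices of `W₂` are related by `B`, so every count is the size. Nonemptiness is needed
  -- because the minimum over the empty set is `2`.
  have k2 : minCount B W₂ R = sizeCount W₂ R := by
    have e : ∀ u ∈ W₂, selCount W₂ R (B u) = selCount W₂ R fun _ => True := fun u hu =>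
      selCount_congr fun w hw => iff_true_intro (hB₂ u hu w hw)
    unfold sizeCount
    refine minCount_eq (min_le_left _ _) (fun u hu => by rw [e u hu]; exact min_le_right _ _) ?_
    obtain ⟨u, hu⟩ := hW₂
    by_cases h2 : 2 ≤ selCount W₂ R fun _ => True
    · left; omega
    · right; exact ⟨u, hu, by rw [e u hu]; omega⟩
  have hW : ResolvedTwice (Resolves A B) W₂ R ↔ ResolvedTwice (Resolves A Everywhere) W₂ R := by
    refine forall₂_congr fun u hu => forall₂_congr fun v hv => ?_
    rw [selCount_congr (p' := Resolves A Everywhere u v)]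
    intro w hw
    have := hB₂ u hu w hw
    have := hB₂ v hv w hw
    simp only [Resolves, Everywhere]
    tauto
  have hok := resolvedTwice_union (Q := Resolves A B) (P := B) h R (resolves_symm A B) ?_ ?_ ?_ ?_
  · rw [hW] at hok
    unfold topState localState
    by_cases o₁ : ResolvedTwice (Resolves A B) W₁ R
    · by_cases o₂ : ResolvedTwice (Resolves A Everywhere) W₂ R
      · rw [if_pos o₁, if_pos o₂]
        have h3 : (3 : ℕ) ≠ 2 := by norm_num
        simp only [Option.bind_some, merge, h3, if_false, if_true, codeA_encode b₁,
          codeS_encode c₂ s₂, hok, o₁, o₂, true_and, k1, k2]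
      · rw [if_pos o₁, if_neg o₂, if_neg (fun H => o₂ (hok.1 H).2.1)]; rfl
    · rw [if_neg o₁, if_neg (fun H => o₁ (hok.1 H).1)]; rfl
  · intro u hu v hv w hw
    have := hne u hu w hw
    have := hne v hv w hw
    have := hA u hu w hw
    have := hA v hv w hw
    have := (hB u hu w hw).1
    have := (hB v hv w hw).1
    simp only [Resolves]
    tauto
  · intro u hu v hv w hw
    have := hne w hw u hu
    have := hne w hw v hv
    have := hA' u hu w hw
    have := hA' v hv w hw
    have := (hB w hw u hu).2
    have := (hB w hw v hv).2
    simp only [Resolves]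
    tauto
  · intro u hu v hv w hw
    have := hne w hw v hv
    have := hA' v hv w hw
    have := (hB w hw v hv).2
    have := hAB u hu w hw
    have hwu : w = u → B u w := by rintro rfl; exact hB₁ w hw
    simp only [Resolves]
    tauto
  · intro u hu v hv w hw
    have := (hB u hu w hw).1
    have := hB₂ v hv w hw
    simp only [Resolves]
    tauto

end States


/-! ## The states of the nodes of a cotree -/

theorem below_mono {n : ℕ} {par q : ℕ → ℕ} {h h' : ℕ} (hh : h ≤ h') (w : ℕ) :
    below n par q h w ⊆ below n par q h' w := by
  induction h', hh using Nat.le_induction with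
  | base => exact subset_rfl
  | succ h' _ ih =>
    simp only [below]
    split_ifs
    · exact ih.trans Finset.subset_union_left
    · exact ih

/-- The state of the empty set is neutral, so merging the root into the artificial node copies the
state of the root. -/
theorem merge_empty {y : ℕ} (hy : y < 27) : merge 0 11 y = some y := by
  revert y; decide

theorem exists_localState {A : ℕ → ℕ → Prop} {W R : Finset ℕ} :
    (∃ x, localState A W R = some x) ↔ ResolvedTwice (Resolves A Everywhere) W R := by
  unfold localState
  split_ifs with h <;> simp [h]

theorem exists_topState {A B : ℕ → ℕ → Prop} {W R : Finset ℕ} :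
    (∃ x, topState A B W R = some x) ↔ ResolvedTwice (Resolves A B) W R := by
  unfold topState
  split_ifs with h <;> simp [h]

/-- The relation `B` of lying in the same component, and every component has diameter at most
`2`. -/
structure IsComponentRel (A : ℕ → ℕ → Prop) (n : ℕ) (B : ℕ → ℕ → Prop) : Prop where
  refl : ∀ y < n, B y y
  step : ∀ y < n, ∀ z < n, ∀ t < n, B y z → A z t → B y t
  dist : ∀ y < n, ∀ z < n, y ≠ z → B y z → ¬ A y z → ∃ x < n, A y x ∧ A x z

/-- The list `q` consists of all nodes, and every node occurs before its parent. -/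
structure BottomUp (n N m : ℕ) (par q : ℕ → ℕ) : Prop where
  inj : ∀ j < m, ∀ j' < m, q j = q j' → j = j'
  mem : ∀ w, (∃ j < m, q j = w) ↔ w ∈ treeNodes n n N
  order : ∀ j < m, ∀ j' < m, par (q j') = q j → j' < j

namespace Cotree

variable {A : ℕ → ℕ → Prop} {n N : ℕ} {par lab nch : ℕ → ℕ} {D : ℕ → Finset ℕ} {m : ℕ}
  {q : ℕ → ℕ}

theorem ne_dummy {w : ℕ} (hw : w ∈ treeNodes n n N) : w ≠ n := by
  rcases mem_treeNodes.1 hw with h | h <;> omega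

theorem nodeList (T : Cotree A n n N par lab nch D) (Q : BottomUp n N m par q) :
    NodeList n m par q where
  inj := Q.inj
  ne j hj := ne_dummy ((Q.mem _).1 ⟨j, hj, rfl⟩)
  leaf v hv := (Q.mem v).2 (mem_treeNodes.2 (.inl hv))
  parent h hm := by
    by_cases hp : par (q h) = n
    · exact .inl hp
    · exact .inr ((Q.mem _).2 (T.par_mem ((Q.mem _).1 ⟨h, hm, rfl⟩) hp))
  order := Q.order

theorem below_sub (T : Cotree A n n N par lab nch D) (Q : BottomUp n N m par q) {h : ℕ}
    (hm : h ≤ m) {w : ℕ} (hw : w ∈ treeNodes n n N) : below n par q h w ⊆ D w := by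
  induction h generalizing w with
  | zero =>
    simp only [below]
    split_ifs with hwn
    · rw [T.leafD w hwn]
    · exact Finset.empty_subset _
  | succ h ih =>
    have hq := (Q.mem _).1 ⟨h, hm, rfl⟩
    simp only [below]
    split_ifs with hp
    · refine Finset.union_subset (ih (by omega) hw) ((ih (by omega) hq).trans ?_)
      rw [hp]
      exact T.sub _ hq (hp ▸ ne_dummy hw)
    · exact ih (by omega) hw

theorem exists_child_below (T : Cotree A n n N par lab nch D) (Q : BottomUp n N m par q) {h : ℕ}
    (hm : h ≤ m) {w : ℕ} (hw : n ≤ w) {y : ℕ} (hy : y ∈ below n par q h w) :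
    ∃ j < h, par (q j) = w ∧ y ∈ D (q j) := by
  induction h with
  | zero => simp [below, hw.not_gt] at hy
  | succ h ih =>
    have hq := (Q.mem _).1 ⟨h, hm, rfl⟩
    simp only [below] at hy
    split_ifs at hy with hp
    · rcases Finset.mem_union.1 hy with hy | hy
      · obtain ⟨j, hj, h'⟩ := ih (by omega) hy
        exact ⟨j, by omega, h'⟩
      · exact ⟨h, by omega, hp.symm, T.below_sub Q (by omega) hq hy⟩
    · obtain ⟨j, hj, h'⟩ := ih (by omega) hy
      exact ⟨j, by omega, h'⟩

/-- The children of a node precede it in the list, so all of them have been merged by the time the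
node itself is processed. -/
theorem sub_below (T : Cotree A n n N par lab nch D) (Q : BottomUp n N m par q) {h : ℕ}
    (hm : h < m) : D (q h) ⊆ below n par q h (q h) := by
  induction h using Nat.strong_induction_on with
  | _ h ih =>
    rcases mem_treeNodes.1 ((Q.mem _).1 ⟨h, hm, rfl⟩) with hw | ⟨h1, h2⟩
    · rw [T.leafD _ hw]
      refine subset_trans ?_ (below_mono (Nat.zero_le h) (q h))
      simp [below, hw]
    · intro y hy
      obtain ⟨c, hc, hp, hyc⟩ := T.cover _ h1 h2 y hy
      obtain ⟨j, hj, rfl⟩ := (Q.mem c).2 hc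
      have hjh := Q.order h hm j hj hp
      refine below_mono (show j + 1 ≤ h from hjh) (q h) ?_
      simp only [below, hp, if_true]
      exact Finset.mem_union_right _ (ih j hjh hj hyc)

theorem below_eq (T : Cotree A n n N par lab nch D) (Q : BottomUp n N m par q) {h : ℕ}
    (hm : h < m) : below n par q h (q h) = D (q h) :=
  (T.below_sub Q hm.le ((Q.mem _).1 ⟨h, hm, rfl⟩)).antisymm (T.sub_below Q hm)

theorem disjoint_merge (T : Cotree A n n N par lab nch D) (Q : BottomUp n N m par q) {h : ℕ}
    (hm : h < m) : Disjoint (below n par q h (par (q h))) (below n par q h (q h)) := by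
  have L := T.nodeList Q
  exact L.disjoint_below hm.le ((L.active_iff hm _).2 (.inr (L.active_parent hm)))
    (NodeList.active_self hm) (L.par_ne hm)

/-- The leaves collected at `w` so far come from children merged earlier, which are siblings of the
child `q h`. The label of `w` therefore decides all adjacencies between the two sides, as
`localState_union` requires, no matter in which order the children arrive. -/
theorem selState_eq_localState (T : Cotree A n n N par lab nch D) (Q : BottomUp n N m par q)
    (hsymm : ∀ a b, A a b → A b a) (hirr : ∀ a, ¬ A a a) {lab' : ℕ → ℕ} (R : Finset ℕ) {h : ℕ}
    (hm : h ≤ m) {w : ℕ} (hw : w ∈ treeNodes n n N) (htop : par w = n → lab w ≠ 1)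
    (hlab : ∀ w ∈ treeNodes n n N, (par w = n → lab w ≠ 1) → lab' w = lab w) :
    selState n par lab' q h w R = localState A (below n par q h w) R := by
  induction h generalizing w with
  | zero =>
    simp only [selState, below]
    split_ifs with hwn hR
    · rw [localState_singleton hirr, if_pos hR]
    · rw [localState_singleton hirr, if_neg hR]
    · rw [localState_empty]
  | succ h ih =>
    have hq := (Q.mem _).1 ⟨h, hm, rfl⟩
    have hdis := T.disjoint_merge Q hm
    simp only [selState, below]
    split_ifs with hp
    · have hpn : par (q h) ≠ n := hp ▸ ne_dummy hw
      obtain ⟨h1, h2⟩ := T.par_inner hq hpn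
      rw [ih (by omega) hw htop, ih (by omega) hq fun h' => absurd h' hpn, hlab w hw htop]
      refine localState_union (hp ▸ hdis) R hsymm hirr ?_ fun y hy y' hy' => ?_
      · rcases T.innerLab _ h1 h2 with h' | h' <;> (rw [hp, h']; norm_num)
      · obtain ⟨j, hj, hpj, hyj⟩ := T.exists_child_below Q (by omega) (by omega) hy
        rw [T.adj (q j) ((Q.mem _).1 ⟨j, by omega, rfl⟩) (q h) hq
          (fun h' => by have := Q.inj j (by omega) h hm h'; omega) (by omega) y hyj y'
          (T.below_sub Q (by omega) hq hy'), hpj]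
    · exact ih (by omega) hw htop

/-- The vertices `y` and `y'` lie below the same child of `r`. -/
def SameChild (n N : ℕ) (par : ℕ → ℕ) (D : ℕ → Finset ℕ) (r y y' : ℕ) : Prop :=
  ∃ c ∈ treeNodes n n N, par c = r ∧ y ∈ D c ∧ y' ∈ D c

/-- The children of a parallel root play the role of the components. A child is merged only after it
is complete, so `W₂` is the whole leaf set of that child. -/
theorem selState_eq_topState (T : Cotree A n n N par lab nch D) (Q : BottomUp n N m par q)
    (hsymm : ∀ a b, A a b → A b a) (hirr : ∀ a, ¬ A a a) {lab' : ℕ → ℕ} (R : Finset ℕ) {h : ℕ}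
    (hm : h ≤ m) {r : ℕ} (hr : r ∈ treeNodes n n N) (hl : lab r = 1) (hl' : lab' r = 3)
    (hlab : ∀ w ∈ treeNodes n n N, (par w = n → lab w ≠ 1) → lab' w = lab w) :
    selState n par lab' q h r R =
      topState A (SameChild n N par D r) (below n par q h r) R := by
  have hr' := T.inner_of hr (by omega)
  induction h with
  | zero =>
    simp only [selState, below, show ¬ r < n by omega, if_false, topState_empty]
  | succ h ih =>
    have hq := (Q.mem _).1 ⟨h, hm, rfl⟩
    have hdis := T.disjoint_merge Q hm
    simp only [selState, below]
    split_ifs with hp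
    · have hpn : par (q h) ≠ n := hp ▸ ne_dummy hr
      rw [ih (by omega), T.selState_eq_localState Q hsymm hirr R (by omega) hq
        (fun h' => absurd h' hpn) hlab, hl']
      have hD := T.below_eq Q hm
      have hch : ∀ y ∈ below n par q h r, ∃ j < h, par (q j) = r ∧ y ∈ D (q j) :=
        fun y hy => T.exists_child_below Q (by omega) (by omega) hy
      have hmem : ∀ j < h, q j ∈ treeNodes n n N := fun j hj => (Q.mem _).1 ⟨j, by omega, rfl⟩
      have hne : ∀ j < h, q j ≠ q h := fun j hj h' => by
        have := Q.inj j (by omega) h hm h'; omega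
      have hnot : ∀ y ∈ below n par q h r, ∀ y' ∈ below n par q h (q h), ∀ c ∈ treeNodes n n N,
          par c = r → y ∈ D c → y' ∈ D c → False := by
        intro y hy y' hy' c hc hpc hyc hyc'
        obtain ⟨j, hj, hpj, hyj⟩ := hch y hy
        rw [hD] at hy'
        by_cases hcj : c = q j
        · subst hcj
          exact Finset.disjoint_left.1 (T.disj _ hc _ hq (hne j hj) (by omega)) hyc' hy'
        · exact Finset.disjoint_left.1 (T.disj _ hc _ (hmem j hj) hcj (by omega)) hyc hyj
      refine topState_union (hp ▸ hdis) (hD ▸ T.nonempty _ hq) R hsymm ?_ ?_ ?_ ?_ ?_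
      · intro y hy y' hy' hA
        obtain ⟨j, hj, hpj, hyj⟩ := hch y hy
        rw [hD] at hy'
        rw [T.adj _ (hmem j hj) _ hq (hne j hj) (by omega) y hyj y' hy', hpj, hl] at hA
        omega
      · intro y hy y' hy'
        exact ⟨fun ⟨c, hc, hpc, h1, h2⟩ => hnot y hy y' hy' c hc hpc h1 h2,
          fun ⟨c, hc, hpc, h1, h2⟩ => hnot y hy y' hy' c hc hpc h2 h1⟩
      · intro y hy y' hy'
        rw [hD] at hy hy'
        exact ⟨q h, hq, hp.symm, hy, hy'⟩
      · intro y hy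
        obtain ⟨j, hj, hpj, hyj⟩ := hch y hy
        exact ⟨q j, hmem j hj, hpj, hyj, hyj⟩
      · intro y hy y' hy' hA
        obtain ⟨j, hj, hpj, hyj⟩ := hch y hy
        obtain ⟨j', hj', hpj', hyj'⟩ := hch y' hy'
        by_cases hjj : q j = q j'
        · exact ⟨q j, hmem j hj, hpj, hyj, hjj ▸ hyj'⟩
        · rw [T.adj _ (hmem j hj) _ (hmem j' hj') hjj (by omega) y hyj y' hyj', hpj, hl] at hA
          omega
    · exact ih (by omega)

/-- Only the root, at position `k`, is ever merged into `n`. Before that the state is that of the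
empty set, afterwards that of the root. -/
theorem selState_dummy (T : Cotree A n n N par lab nch D) (Q : BottomUp n N m par q)
    {lab' : ℕ → ℕ} (hl : lab' n = 0) (R : Finset ℕ) {k : ℕ} (hk : k < m) (hr : par (q k) = n)
    {h : ℕ} (hm : h ≤ m) : selState n par lab' q h n R =
      if h ≤ k then some 11 else selState n par lab' q k (q k) R := by
  induction h with
  | zero => simp [selState]
  | succ h ih =>
    simp only [selState]
    rw [ih (by omega)]
    by_cases hp : n = par (q h)
    · have : h = k := Q.inj h hm k hk
        (T.root_unique ((Q.mem _).1 ⟨h, hm, rfl⟩) ((Q.mem _).1 ⟨k, hk, rfl⟩) hp.symm hr)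
      subst this
      rw [if_pos hp, if_pos le_rfl, if_neg (by omega), Option.bind_some, hl]
      cases hx : selState n par lab' q h (q h) R with
      | none => rfl
      | some x => exact merge_empty (selState_lt hx)
    · have : h ≠ k := by rintro rfl; exact hp hr.symm
      rw [if_neg hp]
      by_cases hhk : h ≤ k
      · rw [if_pos hhk, if_pos (by omega)]
      · rw [if_neg hhk, if_neg (by omega)]

/-- Distinct non-adjacent vertices below a series node lie below the same child, and any vertex
below another child is adjacent to both. This gives diameter at most `2`. -/
theorem exists_common (T : Cotree A n n N par lab nch D) (hsymm : ∀ a b, A a b → A b a) {c : ℕ}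
    (hc : c ∈ treeNodes n n N) (hl : lab c ≠ 1) {y z : ℕ} (hy : y ∈ D c) (hz : z ∈ D c)
    (hyz : y ≠ z) (hA : ¬ A y z) : ∃ x < n, A y x ∧ A x z := by
  rcases mem_treeNodes.1 hc with h | ⟨h1, h2⟩
  · rw [T.leafD c h, Finset.mem_singleton] at hy hz
    exact absurd (hy.trans hz.symm) hyz
  · have hl2 := (T.innerLab c h1 h2).resolve_left hl
    obtain ⟨a, ha, hpa, hya⟩ := T.cover c h1 h2 y hy
    obtain ⟨b, hb, hpb, hzb⟩ := T.cover c h1 h2 z hz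
    by_cases hab : a = b
    · subst hab
      obtain ⟨d, hd, hpd, hda⟩ := T.exists_sibling h1 h2 a
      obtain ⟨x, hx⟩ := T.nonempty d hd
      refine ⟨x, Finset.mem_range.1 (T.sub_range hd hx), hsymm _ _ ?_, ?_⟩
      · exact (T.adj d hd a ha hda (by omega) x hx y hya).2 (by rw [hpd, hl2])
      · exact (T.adj d hd a ha hda (by omega) x hx z hzb).2 (by rw [hpd, hl2])
    · exact absurd ((T.adj a ha b hb hab (by omega) y hya z hzb).2 (by rw [hpa, hl2])) hA

/-- If the root is parallel, its children are leaves or series by alternation, hence of diameter at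
most `2`, and no edge runs between them, so lying below the same child is the component relation.
Otherwise the root is a leaf or series and all vertices form one component. -/
theorem exists_componentRel (T : Cotree A n n N par lab nch D) (halt : Alternating n n N par lab)
    (Q : BottomUp n N m par q) (hsymm : ∀ a b, A a b → A b a) (hirr : ∀ a, ¬ A a a) {r : ℕ}
    (hr : r ∈ treeNodes n n N) (hp : par r = n) :
    ∃ B, IsComponentRel A n B ∧ ∀ R,
      (∃ x, selState n par (if lab r = 1 then Function.update lab r 3 else lab) q m n R = some x) ↔
        ResolvedTwice (Resolves A B) (Finset.range n) R := by
  have hD := T.rootD r hr hp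
  obtain ⟨k, hk, rfl⟩ := (Q.mem r).2 hr
  have hbelow := (T.below_eq Q hk).trans hD
  have hdummy : n ≠ q k := (ne_dummy hr).symm
  have hroot : ∀ w ∈ treeNodes n n N, par w = n → w = q k := fun w hw h =>
    T.root_unique hw hr h hp
  by_cases hl : lab (q k) = 1
  · rw [if_pos hl]
    have hk' := T.inner_of hr (by omega)
    have hcov : ∀ y < n, ∃ c ∈ treeNodes n n N, par c = q k ∧ y ∈ D c := fun y hy =>
      T.cover _ hk'.1 hk'.2 y (hD ▸ Finset.mem_range.2 hy)
    refine ⟨SameChild n N par D (q k), ⟨?_, ?_, ?_⟩, fun R => ?_⟩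
    · intro y hy
      obtain ⟨c, hc, hpc, hyc⟩ := hcov y hy
      exact ⟨c, hc, hpc, hyc, hyc⟩
    · rintro y hy z hz t ht ⟨c, hc, hpc, hyc, hzc⟩ hA
      obtain ⟨d, hd, hpd, htd⟩ := hcov t ht
      by_cases hcd : c = d
      · exact ⟨c, hc, hpc, hyc, hcd ▸ htd⟩
      · rw [T.adj c hc d hd hcd (by omega) z hzc t htd, hpc, hl] at hA
        omega
    · rintro y hy z hz hyz ⟨c, hc, hpc, hyc, hzc⟩ hA
      refine T.exists_common hsymm hc ?_ hyc hzc hyz hA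
      have := halt c hc (by omega)
      rwa [hpc, hl] at this
    · rw [T.selState_dummy Q (by rw [Function.update_of_ne hdummy, T.lab_root]) R hk hp le_rfl,
        if_neg (by omega), T.selState_eq_topState Q hsymm hirr R hk.le hr hl
        (Function.update_self ..), hbelow, exists_topState]
      intro w hw htop
      refine Function.update_of_ne ?_ _ _
      rintro rfl
      exact htop hp hl
  · rw [if_neg hl]
    refine ⟨Everywhere, ⟨fun _ _ => trivial, fun _ _ _ _ _ _ _ _ => trivial, ?_⟩, fun R => ?_⟩
    · intro y hy z hz hyz _ hA
      exact T.exists_common hsymm hr hl (hD ▸ Finset.mem_range.2 hy) (hD ▸ Finset.mem_range.2 hz)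
        hyz hA
    · rw [T.selState_dummy Q T.lab_root R hk hp le_rfl, if_neg (by omega),
        T.selState_eq_localState Q hsymm hirr R hk.le hr (fun _ => hl) fun _ _ _ => rfl, hbelow,
        exists_localState]

end Cotree


/-! ## Cographs and distances -/

/-- A path stays in one part of a disjoint union. The complement of a path `a b c d` is the path `c
a d b`, so the property passes to complements; the cases `a = c` and `b = d` arise because equal
vertices are non-adjacent in the complement too. -/
theorem IsCograph.p4Free {V : Type} {G : SimpleGraph V} (h : IsCograph G) :
    ∀ a b c d, G.Adj a b → G.Adj b c → G.Adj c d → ¬ G.Adj a c → ¬ G.Adj b d → G.Adj a d := by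
  induction h with
  | single => simp
  | union _ _ ih₁ ih₂ =>
    rintro (a | a) (b | b) (c | c) (d | d) <;> simp
    · exact ih₁ a b c d
    · exact ih₂ a b c d
  | @compl V G _ ih =>
    intro a b c d
    simp only [SimpleGraph.compl_adj]
    rintro ⟨hab, hab'⟩ ⟨hbc, hbc'⟩ ⟨hcd, hcd'⟩ hac hbd
    by_cases h1 : a = c
    · subst h1; exact ⟨hcd, hcd'⟩
    by_cases h2 : b = d
    · subst h2; exact ⟨hab, hab'⟩
    have hac' : G.Adj a c := by tauto
    have hbd' : G.Adj b d := by tauto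
    refine ⟨fun h => hcd' (h ▸ hac'.symm), fun h => hbc' ?_⟩
    exact (ih c a d b hac'.symm h hbd'.symm hcd' hab').symm
  | ofIso e _ ih =>
    intro a b c d
    simpa only [SimpleGraph.Iso.map_adj_iff] using ih (e.symm a) (e.symm b) (e.symm c) (e.symm d)

/-- There is a first vertex to start the cotree with, and additive constants in the running time can
be absorbed into the number of vertices. -/
theorem IsCograph.nonempty {V : Type} {G : SimpleGraph V} (h : IsCograph G) : Nonempty V := by
  induction h with
  | single => exact ⟨()⟩
  | union _ _ ih _ => exact ih.map Sum.inl
  | compl _ ih => exact ih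
  | ofIso e _ ih => exact ih.map e

/-- Deleting a resolving vertex leaves another one, which is a second resolving vertex. Conversely,
one of two different vertices survives any deletion. -/
theorem isFaultTolerantResolvingSet_iff {V : Type} [DecidableEq V] {G : SimpleGraph V}
    {R : Finset V} : IsFaultTolerantResolvingSet G R ↔
      ∀ u v, u ≠ v → ∃ w ∈ R, ∃ w' ∈ R, w ≠ w' ∧ G.edist u w ≠ G.edist v w ∧
        G.edist u w' ≠ G.edist v w' := by
  constructor
  · rintro ⟨h₁, h₂⟩ u v huv
    obtain ⟨w, hw, hd⟩ := h₁ u v huv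
    obtain ⟨w', hw', hd'⟩ := h₂ w hw u v huv
    rw [Finset.mem_erase] at hw'
    exact ⟨w, hw, w', hw'.2, hw'.1.symm, hd, hd'⟩
  · refine fun h => ⟨fun u v huv => ?_, fun r _ u v huv => ?_⟩
    · obtain ⟨w, hw, -, -, -, hd, -⟩ := h u v huv
      exact ⟨w, hw, hd⟩
    · obtain ⟨w, hw, w', hw', hne, hd, hd'⟩ := h u v huv
      by_cases hr : w = r
      · exact ⟨w', Finset.mem_erase.2 ⟨fun h => hne (hr.trans h.symm), hw'⟩, hd'⟩
      · exact ⟨w, Finset.mem_erase.2 ⟨hr, hw⟩, hd⟩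

/-- Two vertices resolve themselves. This supplies the feasible selection without which the tables
could be empty. -/
theorem isFaultTolerantResolvingSet_univ {V : Type} [DecidableEq V] [Fintype V]
    (G : SimpleGraph V) : IsFaultTolerantResolvingSet G Finset.univ := by
  refine isFaultTolerantResolvingSet_iff.2 fun u v huv =>
    ⟨u, Finset.mem_univ _, v, Finset.mem_univ _, huv, ?_, ?_⟩
  · rw [SimpleGraph.edist_self]
    exact (SimpleGraph.edist_pos_of_ne huv.symm).ne
  · rw [SimpleGraph.edist_self]
    exact (SimpleGraph.edist_pos_of_ne huv).ne'

section FinGraph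

variable {n : ℕ} {G : SimpleGraph (Fin n)}

/-- Adjacency as a relation on numbers. -/
def NatAdj (G : SimpleGraph (Fin n)) (y z : ℕ) : Prop := ∃ hy hz, G.Adj ⟨y, hy⟩ ⟨z, hz⟩

theorem natAdj_iff {u v : Fin n} : NatAdj G u v ↔ G.Adj u v :=
  ⟨fun ⟨_, _, h⟩ => h, fun h => ⟨u.2, v.2, h⟩⟩

theorem natAdj_symm (a b : ℕ) : NatAdj G a b → NatAdj G b a := fun ⟨ha, hb, h⟩ => ⟨hb, ha, h.symm⟩

theorem natAdj_irrefl (a : ℕ) : ¬ NatAdj G a a := fun ⟨_, _, h⟩ => G.loopless.irrefl _ h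

theorem p4Free_natAdj (h : IsCograph G) : P4Free (NatAdj G) := by
  rintro a b c d ⟨ha, hb, hab⟩ ⟨_, hc, hbc⟩ ⟨_, hd, hcd⟩ hac hbd
  exact ⟨ha, hd, h.p4Free _ _ _ _ hab hbc hcd (fun h => hac ⟨_, _, h⟩) fun h => hbd ⟨_, _, h⟩⟩

variable {B : ℕ → ℕ → Prop}

theorem IsComponentRel.reachable (H : IsComponentRel (NatAdj G) n B) {u v : Fin n}
    (h : G.Reachable u v) : B u v := by
  rw [SimpleGraph.reachable_iff_reflTransGen] at h
  induction h with
  | refl => exact H.refl _ u.2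
  | tail _ h ih => exact H.step _ u.2 _ (Fin.is_lt _) _ (Fin.is_lt _) ih (natAdj_iff.2 h)

open Classical in
-- Related non-adjacent vertices have a common neighbour, and unrelated vertices are unreachable
-- because the relation is closed under edges.
theorem IsComponentRel.edist_eq (H : IsComponentRel (NatAdj G) n B) (u v : Fin n) :
    G.edist u v = if u = v then 0 else if G.Adj u v then 1 else if B u v then 2 else ⊤ := by
  split_ifs with h1 h2 h3
  · exact SimpleGraph.edist_eq_zero_iff.2 h1
  · exact SimpleGraph.edist_eq_one_iff_adj.2 h2
  · obtain ⟨x, hx, ⟨_, _, hux⟩, ⟨_, _, hxv⟩⟩ := H.dist u u.2 v v.2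
      (fun h => h1 (Fin.ext h)) h3 (fun h => h2 (natAdj_iff.1 h))
    exact SimpleGraph.edist_eq_two_iff.2 ⟨h1, h2, ⟨x, hx⟩, hux, hxv.symm⟩
  · exact SimpleGraph.edist_eq_top_of_not_reachable fun h => h3 (H.reachable h)

/-- The four possible distances are told apart by equality, adjacency and `B`, each implying the
later ones or excluding them. Hence distances differ iff one of these relations to `w` differs. -/
theorem IsComponentRel.resolves_iff (H : IsComponentRel (NatAdj G) n B) {u v : Fin n} (w : Fin n)
    (huv : u ≠ v) : Resolves (NatAdj G) B u v w ↔ G.edist u w ≠ G.edist v w := by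
  have key : ∀ u : Fin n, (u = w → B u w ∧ ¬ G.Adj u w) ∧ (G.Adj u w → B u w) := fun u =>
    ⟨fun h => h ▸ ⟨H.refl _ u.2, G.loopless.irrefl u⟩, fun h => H.reachable h.reachable⟩
  have ku := key u
  have kv := key v
  have hw : u = w → v ≠ w := fun h h' => huv (h.trans h'.symm)
  rw [H.edist_eq, H.edist_eq]
  simp only [Resolves, natAdj_iff, Fin.val_inj, eq_comm (a := w)]
  split_ifs <;> simp_all

open Classical in
theorem selCount_map {R : Finset (Fin n)} {p : ℕ → Prop} :
    2 ≤ selCount (Finset.range n) (R.map Fin.valEmbedding) p ↔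
      ∃ w ∈ R, ∃ w' ∈ R, w ≠ w' ∧ p w ∧ p w' := by
  unfold selCount
  rw [Nat.succ_le_iff, Finset.one_lt_card]
  constructor
  · rintro ⟨a, ha, b, hb, hab⟩
    simp only [Finset.mem_filter, Finset.mem_map, Fin.valEmbedding_apply] at ha hb
    obtain ⟨-, ⟨a, haR, rfl⟩, hpa⟩ := ha
    obtain ⟨-, ⟨b, hbR, rfl⟩, hpb⟩ := hb
    exact ⟨a, haR, b, hbR, fun h => hab (by rw [h]), hpa, hpb⟩
  · rintro ⟨a, ha, b, hb, hab, hpa, hpb⟩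
    refine ⟨a, ?_, b, ?_, fun h => hab (Fin.ext h)⟩
    · exact Finset.mem_filter.2 ⟨Finset.mem_range.2 a.2, Finset.mem_map.2 ⟨a, ha, rfl⟩, hpa⟩
    · exact Finset.mem_filter.2 ⟨Finset.mem_range.2 b.2, Finset.mem_map.2 ⟨b, hb, rfl⟩, hpb⟩

theorem IsComponentRel.resolvedTwice_iff (H : IsComponentRel (NatAdj G) n B)
    (R : Finset (Fin n)) :
    ResolvedTwice (Resolves (NatAdj G) B) (Finset.range n) (R.map Fin.valEmbedding) ↔
      IsFaultTolerantResolvingSet G R := by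
  rw [isFaultTolerantResolvingSet_iff]
  constructor
  · intro h u v huv
    have := h u (Finset.mem_range.2 u.2) v (Finset.mem_range.2 v.2) fun h => huv (Fin.ext h)
    obtain ⟨w, hw, w', hw', hne, h1, h2⟩ := selCount_map.1 this
    exact ⟨w, hw, w', hw', hne, (H.resolves_iff w huv).1 h1, (H.resolves_iff w' huv).1 h2⟩
  · intro h u hu v hv huv
    lift u to Fin n using Finset.mem_range.1 hu
    lift v to Fin n using Finset.mem_range.1 hv
    have huv' : u ≠ v := fun h => huv (by rw [h])
    obtain ⟨w, hw, w', hw', hne, h1, h2⟩ := h u v huv'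
    exact selCount_map.2
      ⟨w, hw, w', hw', hne, (H.resolves_iff w huv').2 h1, (H.resolves_iff w' huv').2 h2⟩

end FinGraph

/-! ## Reading the input -/

namespace RAM

variable {n : ℕ} {adj : Fin n → List (Fin n)} {c : Fin n → NNReal}

theorem initial_inputState : Initial n (inputState adj c) where
  verts := by simp [inputState]
  arr a ha := by
    funext i
    simp [inputState, show a ≠ 0 by omega, show a ≠ 1 by omega]

/-- The list of the neighbours of the vertex number `i`. -/
def neighborList (adj : Fin n → List (Fin n)) (i : ℕ) : List ℕ :=
  if h : i < n then (adj ⟨i, h⟩).map Fin.val else []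

theorem hasNeighbors_inputState {G : SimpleGraph (Fin n)} (hadj : IsAdjacencyList G adj) {i : ℕ}
    (hi : i < n) : HasNeighbors (inputState adj c) i (neighborList adj i) := by
  have hd : (List.ofFn adj).drop i = adj ⟨i, hi⟩ :: (List.ofFn adj).drop (i + 1) := by
    rw [List.drop_eq_getElem_cons (by simpa using hi)]
    simp
  have hsplit : (List.ofFn adj).flatten = ((List.ofFn adj).take i).flatten ++
      (adj ⟨i, hi⟩ ++ ((List.ofFn adj).drop (i + 1)).flatten) := by
    rw [← List.flatten_cons, ← hd, ← List.flatten_append, List.take_append_drop]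
  simp only [neighborList, hi, dif_pos]
  refine ⟨(hadj _).1.map Fin.val_injective, ?_, fun k hk => ?_⟩
  · simp only [inputState, if_true, show i + 1 ≤ n from hi, hi.le]
    rw [List.take_add_one]
    simp [hi]
  · simp only [inputState, if_true, hi.le, one_ne_zero, if_false]
    rw [List.length_map] at hk
    rw [hsplit, List.getD_eq_getElem?_getD, List.getElem?_map,
      List.getElem?_append_right (Nat.le_add_right _ _), Nat.add_sub_cancel_left,
      List.getElem?_append_left hk]
    simp [hk]

theorem mem_neighborList {G : SimpleGraph (Fin n)} (hadj : IsAdjacencyList G adj) {i : ℕ}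
    (hi : i < n) (y : ℕ) : y ∈ neighborList adj i ↔ NatAdj G i y := by
  simp only [neighborList, hi, dif_pos, List.mem_map, (hadj _).2]
  constructor
  · rintro ⟨w, hw, rfl⟩
    exact ⟨hi, w.2, hw⟩
  · rintro ⟨_, hy, h⟩
    exact ⟨⟨y, hy⟩, h, rfl⟩

/-- The handshake lemma. It turns the sum of the insertion costs into a bound linear in the number
of edges. -/
theorem sum_length_neighborList {G : SimpleGraph (Fin n)} (hadj : IsAdjacencyList G adj) :
    ∑ i ∈ Finset.range n, (neighborList adj i).length = 2 * G.edgeSet.ncard := by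
  classical
  rw [← SimpleGraph.coe_edgeFinset, Set.ncard_coe_finset, ← SimpleGraph.sum_degrees_eq_twice_card_edges,
    Finset.sum_range]
  refine Finset.sum_congr rfl fun v _ => ?_
  simp only [neighborList, v.2, dif_pos, List.length_map]
  rw [← SimpleGraph.card_neighborFinset_eq_degree, ← List.toFinset_card_of_nodup (hadj v).1]
  congr 1
  ext w
  simp [(hadj v).2]

end RAM

/-! ### Assembly of the algorithm -/

theorem mainTheorem1 :
    ∃ (P : RAM.Program) (C : ℕ),
      ∀ (n : ℕ) (G : SimpleGraph (Fin n)) (c : Fin n → NNReal) (adj : Fin n → List (Fin n)),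
        IsCograph G → IsAdjacencyList G adj →
          ∃ (s : RAM.State) (t : ℕ),
            RAM.Runs P (inputState adj c) s t ∧
            t ≤ C * (n + G.edgeSet.ncard) ∧
            IsMinWeightFaultTolerantResolvingSet G c (outputSet n s) ∧
            IsWeightedFaultTolerantMetricDim G c (outputWeight s) := by
  -- The bounds of the unrolled programs are hidden behind variables, so that they are treated as
  -- unknown constants and never evaluated.
  obtain ⟨K₁, hK₁⟩ : ∃ K, K = RAM.mergeBody.bound + RAM.traceBody.bound + 100 := ⟨_, rfl⟩
  obtain ⟨K₂, hK₂⟩ : ∃ K, K = RAM.selectBest.bound + 100 := ⟨_, rfl⟩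
  refine ⟨.seq RAM.buildTree RAM.solve, 1420 + 1300 + 2 * K₁ + K₂, fun n G c adj hG hadj => ?_⟩
  have hn : 0 < n := by
    obtain ⟨v⟩ := hG.nonempty
    exact v.pos
  have hsymm := natAdj_symm (G := G)
  obtain ⟨s₁, t₁, N, lab, nch, D, r, m, hr₁, L, ht₁⟩ := RAM.runs_buildTree (A := NatAdj G)
    (nb := RAM.neighborList adj) hn (RAM.initial_inputState (c := c)) hsymm (p4Free_natAdj hG)
    (fun i hi => RAM.hasNeighbors_inputState hadj hi) fun i hi y => RAM.mem_neighborList hadj hi y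
  rw [RAM.sum_length_neighborList hadj] at ht₁
  have agr := hr₁.agree
  have hwrites : ∀ r < 27, RAM.buildTree.writesArr (100 + r) = false := by decide
  have Q : BottomUp n N m (s₁.arr aPar) (s₁.arr aQueue) := ⟨L.inj, L.mem, L.order⟩
  obtain ⟨B, hB, hsel⟩ := L.tree.exists_componentRel L.alt Q hsymm natAdj_irrefl L.root L.par_root
  rw [← L.lab] at hsel
  have hfeas := fun R => (hsel _).trans (hB.resolvedTwice_iff R)
  have harr : ∀ a, RAM.buildTree.writesArr a = false → 2 ≤ a → s₁.arr a = 0 := fun a ha ha2 => by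
    rw [agr.arr a ha]
    exact RAM.initial_inputState.arr a ha2
  have hwarr : ∀ a, s₁.warr a = (inputState adj c).warr a := fun a => agr.warr a (by rfl)
  obtain ⟨s₂, t₂, hr₂, ht₂, hout, hwt, hmin⟩ := RAM.runs_solve L.verts L.len rfl rfl rfl
    (L.tree.nodeList Q)
    (fun r hr => harr _ (hwrites r hr) (by omega))
    (fun r _ => by rw [hwarr]; funext i; simp [inputState])
    ⟨_, (hfeas Finset.univ).2 (isFaultTolerantResolvingSet_univ G)⟩
  have hset : ({v ∈ Finset.range n | s₂.arr 2 v = 1} : Finset ℕ) =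
      (outputSet n s₂).map Fin.valEmbedding := by
    ext v
    simp only [outputSet, Finset.mem_filter, Finset.mem_range, Finset.mem_map, Finset.mem_univ,
      true_and, Fin.valEmbedding_apply]
    exact ⟨fun ⟨h, h'⟩ => ⟨⟨v, h⟩, h', rfl⟩, by rintro ⟨v, h, rfl⟩; exact ⟨v.2, h⟩⟩
  have hweight : ∀ R : Finset (Fin n),
      ∑ v ∈ R.map Fin.valEmbedding, s₁.warr 0 v = setWeight c R := fun R => by
    rw [Finset.sum_map, setWeight, hwarr]
    exact Finset.sum_congr rfl fun v _ => by simp [inputState]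
  rw [hset] at hout hwt
  rw [hweight] at hwt
  have hout' := (hfeas _).1 hout
  have hopt : ∀ R, IsFaultTolerantResolvingSet G R → s₂.wreg 0 ≤ setWeight c R := fun R hR => by
    obtain ⟨x, hx⟩ := (hfeas R).2 hR
    refine (hmin _ x hx).trans ?_
    rw [← hweight]
    -- The dynamic program bounds the weight by that of the part of `R` below the artificial node.
    -- This part is contained in `R`, and weights are non-negative.
    exact Finset.sum_le_sum_of_subset fun v hv => (Finset.mem_filter.1 hv).2
  refine ⟨s₂, t₁ + t₂, .seq hr₁ hr₂, ?_, ⟨hout', fun R hR => ?_⟩, ⟨_, hout', hwt.symm⟩, ?_⟩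
  · rw [add_assoc, ← hK₁, ← hK₂] at ht₂
    clear hK₁ hK₂
    -- The tree has at most `2 * n` nodes. In the constants, `1420` is twice `710` because the list
    -- lengths sum to `2 * |E|`, and `1300` covers the linear and the constant term of building the
    -- tree; constants become multiples of `n` since `n` is positive.
    have h₁ : K₁ * m ≤ K₁ * (2 * n) := Nat.mul_le_mul_left _ L.len_le
    have h₂ := Nat.le_mul_of_pos_right K₂ hn
    calc t₁ + t₂ ≤ 2720 * n + 1420 * G.edgeSet.ncard + K₁ * (2 * n) + K₂ * n := by omega
      _ ≤ (1420 + 1300 + 2 * K₁ + K₂) * n + (1420 + 1300 + 2 * K₁ + K₂) * G.edgeSet.ncard := by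
        have := Nat.mul_le_mul_right G.edgeSet.ncard
          (show 1420 ≤ 1420 + 1300 + 2 * K₁ + K₂ by omega)
        have e : (1420 + 1300 + 2 * K₁ + K₂) * n = 2720 * n + K₁ * (2 * n) + K₂ * n := by ring
        omega
      _ = _ := (mul_add ..).symm
  · rw [← hwt]
    exact not_lt.2 (hopt R hR)
  · rintro _ ⟨R, hR, rfl⟩
    exact hopt R hR
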